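/- Let $G$ be a profinite group. **Witt vectors with coefficients.** Let $H\le G$ be an open subgroup. Choose a set $\underline S_H$ of representatives of the $H$-conjugacy classes of open subgroups $V\le H$ and, for each open $V$, coset representatives of $G/V$. For a commutative ring $R$ and an $R$-module $M$, and open $U\le V$, let $f_{G/V}:M^{\otimes_R G/V\times V/U}\cong M^{\otimes_R G/U}$ be the isomorphism induced by $(gV,sU)\mapsto gsU$ ($g$ the chosen representative), let $g\cdot(-):M^{\otimes_R G/U}\to M^{\otimes_R G/gUg^{-1}}$ be induced by $aU\mapsto ag^{-1}(gUg^{-1})$, and put $U^h=h^{-1}Uh$. Tensor powers are discrete and products carry the product topology. The ghost map $w:\prod_{V\in\underline S_H}M^{\otimes_R G/V}\to\big(\prod_{U\le_o H}M^{\otimes_R G/U}\big)^H$ is $$w_U(n)=\sum_{V\in\underline S_H}\ \sum_{hV\in(H/V)^U}h\cdot f_{G/V}\big(n_V^{\otimes V/U^h}\big).$$ If $Q$ is a free module over a free commutative ring $T$ (a polynomial ring over $\mathbb Z$), the image of $w$ is a subgroup and one puts $W_{H\le G}(T;Q)=\operatorname{im}(w)$. In general, let $P(R;M)=(\mathbb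 Z[R];\mathbb Z[R]^{(M)})$ be the polynomial ring on the underlying set of $R$ with the free module on the underlying set of $M$ over it, and $\varepsilon:P(R;M)\to(R;M)$ the canonical map; $W_{H\le G}(R;M)$ is the coequaliser, in Hausdorff topological abelian groups, of the maps $W_{H\le G}(PP(R;M))\rightrightarrows W_{H\le G}(P(R;M))$ induced by $\varepsilon_{P(R;M)}$ and $P(\varepsilon_{(R;M)})$. It is functorial in $(R;M)$ and has a natural additive ghost map, also written $w$, to $\prod_{U\le_o H}M^{\otimes_R G/U}$. Write $W_G=W_{G\le G}$, $\underline S=\underline S_G$. The following natural transformations exist and are uniquely determined by the stated property. (All are natural in the coefficients, and homomorphisms of topological groups except for (1), which is a continuous map of sets, and (2), which is biadditive.) 1. $q:\prod_{V\in\underline S_H}M^{\otimes_R G/V}\to W_{H\le G}(R;M)$ through which the ghost map of the product factors, $w\circ q=w$. 2. The external product $\star:W_{H\le G}(R;M)\times W_{H\le G}(R';M')\to W_{H\le G}(R\otimes_{\mathbb Z}R';M\otimes_{\mathbb Z}M')$ that lifts the maps $M^{\otimes_R G/U}\otimes_{\mathbb Z} M'^{\otimes_{R'}G/U}\cong (M\otimes_{\mathbb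 Z} M')^{\otimes_{R\otimes R'}G/U}$ on ghost components. 3. The Frobenius $F_H^G:W_G(R;M)\to W_{H\le G}(R;M)$ that lifts the projection onto the components $U\le H$, and the Verschiebung $V_H^G:W_{H\le G}(R;M)\to W_G(R;M)$ that lifts $a\mapsto\big(\sum_{gH\in(G/H)^U}g\cdot a_{U^g}\big)_U$. 4. For each choice of coset representatives of $G/H$, an isomorphism $\Theta:W_{H}(R;M^{\otimes_R G/H})\cong W_{H\le G}(R;M)$ of topological groups that lifts the isomorphisms $M^{\otimes_R G/H\times H/U}\cong M^{\otimes_R G/U}$ (here $W_H=W_{H\le H}$). Equip $W_{H\le G}(R;R)$ with the product $W_{H\le G}(R;R)\times W_{H\le G}(R;R)\xrightarrow{\star}W_{H\le G}(R\otimes R;R\otimes R)\to W_{H\le G}(R;R)$, the second map being induced by the multiplication of $R$, and with the unit $q(u)$, where $u_H=1$ and $u_V=0$ for $V\ne H$. **Dress–Siebeneicher Witt vectors.** There is a unique functor $R\mapsto W_G(R)$ from commutative rings to commutative rings whose underlying set is $\prod_{V\in\underline S}R$ (ring maps acting componentwise) and for which all the ghost components $$\varphi_U(a)=\sum_{V\in\underline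 S}\#(G/V)^U\,a_V^{\,[G:U]/[G:V]}\qquad(U\le_o G)$$ are ring homomorphisms (if $(G/V)^U\neq\emptyset$ then $[G:V]$ divides $[G:U]$; the other terms are $0$). For $H\le_o G$ there are unique natural maps $f_H:W_G(R)\to W_H(R)$ with $\varphi_U(f_H(a))=\varphi_U(a)$ for $U\le_o H$, and $v_H:W_H(R)\to W_G(R)$ with $\varphi_U(v_H(b))=\sum_{gH\in(G/H)^U}\varphi_{U^g}(b)$ for $U\le_o G$. **Proposition.** Let $e_G:W_G(R)\to W_G(R;R)$ be the composite $\prod_{V\in\underline S}R\cong\prod_{V\in\underline S}R^{\otimes_R G/V}\xrightarrow{q}W_G(R;R)$, $a\mapsto q\big((a_V\cdot 1\otimes\cdots\otimes 1)_V\big)$. (a) For every commutative ring $R$, $e_G$ is bijective and an isomorphism of commutative rings $W_G(R)\cong W_G(R;R)$. (b) $e_G$ respects Frobenius and Verschiebung: let $H\le G$ be open and let $\delta^{-1}$ be the composite $W_H(R;R)\cong W_H(R;R^{\otimes_R G/H})\xrightarrow{\Theta}W_{H\le G}(R;R)$, the first map being induced by $R\cong R^{\otimes_R G/H}$, $r\mapsto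 r\cdot 1\otimes\cdots\otimes1$, for any choice of coset representatives of $G/H$. Then $\delta^{-1}$ is bijective, and $$F_H^G\circ e_G=\delta^{-1}\circ e_H\circ f_H,\qquad V_H^G\circ\delta^{-1}\circ e_H=e_G\circ v_H .$$ (c) For every open subgroup $H\le G$ there is a ring isomorphism $\hat\Omega(H)\cong W_{H\le G}(\mathbb Z;\mathbb Z)$, where $\hat\Omega(H)$ is the completed Burnside ring of $H$, i.e. the Grothendieck ring (under disjoint union and cartesian product) of those discrete $H$-sets $X$ for which $X^U$ is finite for all open $U\le H$. It sends $[X]$ to the element whose ghost component at each open $U\le H$ is $\#X^U\cdot(1\otimes\cdots\otimes1)$. -/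

import Mathlib

open scoped TensorProduct

universe u v

/-- The tensor power `M^{⊗_R X}`, regarded as a discrete topological abelian group. -/
def TPow (R M X : Type*) [CommRing R] [AddCommGroup M] [Module R M] : Type _ :=
  PiTensorProduct R (fun _ : X => M)

namespace TPow

section Basic

variable (R : Type*) {M : Type*} {X Y : Type*} [CommRing R] [AddCommGroup M] [Module R M]

noncomputable instance : AddCommGroup (TPow R M X) :=
  inferInstanceAs (AddCommGroup (PiTensorProduct R (fun _ : X => M)))

noncomputable instance : Module R (TPow R M X) :=
  inferInstanceAs (Module R (PiTensorProduct R (fun _ : X => M)))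

instance : TopologicalSpace (TPow R M X) := ⊥

instance : DiscreteTopology (TPow R M X) := ⟨rfl⟩

/-- The pure tensor `⨂_x m_x`. -/
noncomputable def tprod (m : X → M) : TPow R M X :=
  PiTensorProduct.tprod R m

variable {R} in
theorem induction {P : TPow R M X → Prop}
    (h : ∀ (r : R) (m : X → M), P (r • tprod R m))
    (hadd : ∀ s t, P s → P t → P (s + t)) (t : TPow R M X) : P t :=
  PiTensorProduct.induction_on t (fun r m => h r m) (fun s t => hadd s t)

/-- The isomorphism `M^{⊗ X} ≅ M^{⊗ Y}` induced by a bijection `X ≃ Y`. -/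
noncomputable def reindex (e : X ≃ Y) : TPow R M X ≃ₗ[R] TPow R M Y :=
  PiTensorProduct.reindex R (fun _ : X => M) e

theorem reindex_tprod (e : X ≃ Y) (m : X → M) :
    reindex R e (tprod R m) = tprod R (fun y => m (e.symm y)) :=
  PiTensorProduct.reindex_tprod _ _

/-- Universal property of the tensor power, for maps that are multilinear along a ring
homomorphism `α`. -/
noncomputable def lift {S N : Type*} [CommRing S] [AddCommGroup N] [Module S N] (α : R →+* S)
    (φ : (X → M) → N)
    (hadd : ∀ [DecidableEq X] (m : X → M) (x : X) (a b : M),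
      φ (Function.update m x (a + b)) = φ (Function.update m x a) + φ (Function.update m x b))
    (hsmul : ∀ [DecidableEq X] (m : X → M) (x : X) (r : R) (a : M),
      φ (Function.update m x (r • a)) = α r • φ (Function.update m x a)) :
    TPow R M X →ₛₗ[α] N :=
  letI : Module R N := Module.compHom N α
  let L : PiTensorProduct R (fun _ : X => M) →ₗ[R] N := PiTensorProduct.lift
    { toFun := φ, map_update_add' := hadd, map_update_smul' := hsmul }
  { toFun := fun t => L t
    map_add' := fun s t => L.map_add s t
    map_smul' := fun r t => L.map_smul r t }

theorem lift_tprod {S N : Type*} [CommRing S] [AddCommGroup N] [Module S N] (α : R →+* S)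
    (φ : (X → M) → N) (hadd) (hsmul) (m : X → M) :
    lift R α φ hadd hsmul (tprod R m) = φ m := by
  let _ : Module R N := Module.compHom N α
  exact PiTensorProduct.lift.tprod
    (φ := ({ toFun := φ, map_update_add' := hadd, map_update_smul' := hsmul } :
      MultilinearMap R (fun _ : X => M) N)) m

end Basic

section Map

variable {R R' M M' X Y : Type*} [CommRing R] [CommRing R'] [AddCommGroup M] [AddCommGroup M']
  [Module R M] [Module R' M']

/-- The map of tensor powers induced by a family of semilinear maps, one for each tensor factor. -/
noncomputable def mapFam (α : R →+* R') (f : X → (M →ₛₗ[α] M')) :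
    TPow R M X →ₛₗ[α] TPow R' M' X :=
  lift R α (fun m => tprod R' (fun x => f x (m x)))
    (fun {_} m x a b => by
      have key : ∀ c : M, (fun y => f y (Function.update m x c y))
          = Function.update (fun y => f y (m y)) x (f x c) := fun c => by
        funext y; rcases eq_or_ne y x with rfl | h <;> simp [*]
      simp only [key, map_add]
      exact (PiTensorProduct.tprod R').map_update_add _ _ _ _)
    (fun {_} m x r a => by
      have key : ∀ c : M, (fun y => f y (Function.update m x c y))
          = Function.update (fun y => f y (m y)) x (f x c) := fun c => by
        funext y; rcases eq_or_ne y x with rfl | h <;> simp [*]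
      simp only [key, map_smulₛₗ]
      exact (PiTensorProduct.tprod R').map_update_smul _ _ _ _)

theorem mapFam_tprod (α : R →+* R') (f : X → (M →ₛₗ[α] M')) (m : X → M) :
    mapFam α f (tprod R m) = tprod R' (fun x => f x (m x)) :=
  lift_tprod R α _ _ _ m

/-- Functoriality of `(R; M) ↦ M^{⊗_R X}` on the category of all modules. -/
noncomputable def map (α : R →+* R') (f : M →ₛₗ[α] M') (X : Type*) :
    TPow R M X →ₛₗ[α] TPow R' M' X :=
  mapFam α (fun _ => f)

theorem map_tprod (α : R →+* R') (f : M →ₛₗ[α] M') (m : X → M) :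
    map α f X (tprod R m) = tprod R' (fun x => f (m x)) :=
  mapFam_tprod _ _ _

theorem map_comm {R₁ R₂ R₃ M₁ M₂ M₃ : Type*} [CommRing R₁] [CommRing R₂] [CommRing R₃]
    [AddCommGroup M₁] [AddCommGroup M₂] [AddCommGroup M₃] [Module R₁ M₁] [Module R₂ M₂]
    [Module R₃ M₃] {α₁ : R →+* R₁} {β₁ : R₁ →+* R₃} {α₂ : R →+* R₂} {β₂ : R₂ →+* R₃}
    {f₁ : M →ₛₗ[α₁] M₁} {g₁ : M₁ →ₛₗ[β₁] M₃} {f₂ : M →ₛₗ[α₂] M₂} {g₂ : M₂ →ₛₗ[β₂] M₃}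
    (hr : ∀ r, β₁ (α₁ r) = β₂ (α₂ r)) (hm : ∀ m, g₁ (f₁ m) = g₂ (f₂ m)) (t : TPow R M X) :
    map β₁ g₁ X (map α₁ f₁ X t) = map β₂ g₂ X (map α₂ f₂ X t) := by
  induction t using TPow.induction with
  | h r m => simp only [map_smulₛₗ, map_tprod, hr, hm]
  | hadd s t hs ht => simp only [map_add, hs, ht]

theorem map_reindex (α : R →+* R') (f : M →ₛₗ[α] M') (e : X ≃ Y) (t : TPow R M X) :
    map α f Y (reindex R e t) = reindex R' e (map α f X t) := by
  induction t using TPow.induction with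
  | h r m => simp only [map_smulₛₗ, map_tprod, reindex_tprod, RingHom.id_apply]
  | hadd s t hs ht => simp only [map_add, hs, ht]

end Map

section Nest

variable {R : Type*} {M : Type*} {X Y : Type*} [CommRing R] [AddCommGroup M] [Module R M]

/-- Concatenation of tensors, `M^{⊗ X} ⊗ M^{⊗ Y} ≅ M^{⊗ (X ⊔ Y)}`. -/
noncomputable def sumEquiv (X Y : Type*) :
    TPow R M X ⊗[R] TPow R M Y ≃ₗ[R] TPow R M (X ⊕ Y) :=
  PiTensorProduct.tmulEquiv R M

theorem sumEquiv_tprod (a : X → M) (b : Y → M) :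
    sumEquiv X Y (tprod R a ⊗ₜ[R] tprod R b) = tprod R (Sum.elim a b) :=
  PiTensorProduct.tmulEquiv_apply R M a b

/-- There is a linear map `(M^{⊗ X})^{⊗ Y} → M^{⊗ X × Y}` removing brackets from pure tensors. -/
theorem exists_nest (Y : Type*) [Finite Y] :
    ∃ Φ : TPow R (TPow R M X) Y →ₗ[R] TPow R M (X × Y),
      ∀ m : Y → X → M, Φ (tprod R fun y => tprod R (m y)) = tprod R fun p => m p.2 p.1 := by
  classical
  induction Y using Finite.induction_empty_option with
  | of_equiv e ih =>
    obtain ⟨Φ, hΦ⟩ := ih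
    refine ⟨(reindex R (Equiv.prodCongr (Equiv.refl X) e)).toLinearMap ∘ₗ Φ ∘ₗ
      (reindex R e.symm).toLinearMap, fun m => ?_⟩
    simp only [LinearMap.comp_apply, LinearEquiv.coe_coe, reindex_tprod, Equiv.symm_symm, hΦ]
    congr 1
    funext p
    simp [Equiv.prodCongr]
  | h_empty =>
    refine ⟨lift R (RingHom.id R) (fun _ => tprod R fun p => p.2.elim)
      (fun {_} m x => x.elim) (fun {_} m x => x.elim), fun m => ?_⟩
    rw [lift_tprod]
    congr 1
    funext p
    exact p.2.elim
  | @h_option Y _ ih =>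
    obtain ⟨Φ, hΦ⟩ := ih
    let s : TPow R (TPow R M X) Unit →ₗ[R] TPow R M X :=
      lift R (RingHom.id R) (fun m => m ()) (fun {_} m x a b => by simp)
        (fun {_} m x r a => by simp)
    have hs : ∀ m, s (tprod R m) = m () := fun m => lift_tprod R _ _ _ _ m
    let o : Option Y ≃ Y ⊕ Unit := Equiv.optionEquivSumPUnit Y
    let e : (X × Y) ⊕ X ≃ X × Option Y :=
      (Equiv.sumCongr (Equiv.refl _) (Equiv.prodUnique X Unit).symm).trans
      ((Equiv.prodSumDistrib X Y Unit).symm.trans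
        (Equiv.prodCongr (Equiv.refl X) o.symm))
    refine ⟨(reindex R e).toLinearMap ∘ₗ (sumEquiv (X × Y) X).toLinearMap ∘ₗ
      TensorProduct.map Φ s ∘ₗ (sumEquiv Y Unit).symm.toLinearMap ∘ₗ
      (reindex R o).toLinearMap, fun m => ?_⟩
    have h1 : reindex R o (tprod R fun y => tprod R (m y)) =
        sumEquiv Y Unit ((tprod R fun y => tprod R (m (some y))) ⊗ₜ[R]
          (tprod R fun _ => tprod R (m none))) := by
      rw [sumEquiv_tprod, reindex_tprod]
      congr 1
      funext y
      rcases y with y | y <;> simp [o]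
    simp only [LinearMap.comp_apply, LinearEquiv.coe_coe]
    rw [h1, LinearEquiv.symm_apply_apply]
    simp only [TensorProduct.map_tmul, hΦ, hs, sumEquiv_tprod, reindex_tprod]
    congr 1
    funext ⟨x, y⟩
    cases y <;> simp [e, o, Equiv.prodCongr, Equiv.sumCongr, Equiv.prodSumDistrib]

open Classical in
/-- The canonical map `(M^{⊗_R X})^{⊗_R Y} → M^{⊗_R X × Y}`, for `Y` finite. -/
noncomputable def nest (R M X Y : Type*) [CommRing R] [AddCommGroup M] [Module R M] :
    TPow R (TPow R M X) Y →ₗ[R] TPow R M (X × Y) :=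
  if _h : Finite Y then (exists_nest (R := R) (M := M) (X := X) Y).choose else 0

theorem nest_tprod [hY : Finite Y] (m : Y → X → M) :
    nest R M X Y (tprod R fun y => tprod R (m y)) = tprod R fun p => m p.2 p.1 := by
  rw [nest, dif_pos hY]
  exact (exists_nest (R := R) (M := M) (X := X) Y).choose_spec m

/-- The tensor power map `n ↦ n^{⊗ Y}`, from `M^{⊗ X}` to `M^{⊗ X × Y}`. -/
noncomputable def power (Y : Type*) (n : TPow R M X) : TPow R M (X × Y) :=
  nest R M X Y (tprod R fun _ => n)

theorem map_nest {R' M' : Type*} [CommRing R'] [AddCommGroup M'] [Module R' M']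
    (α : R →+* R') (f : M →ₛₗ[α] M') (n : Y → TPow R M X) :
    map α f (X × Y) (nest R M X Y (tprod R n)) =
      nest R' M' X Y (tprod R' fun y => map α f X (n y)) := by
  by_cases hY : Finite Y
  · let _ : Module R (TPow R' M' (X × Y)) := Module.compHom _ α
    let A : TPow R (TPow R M X) Y →ₗ[R] TPow R' M' (X × Y) :=
      { toFun := fun t => map α f (X × Y) (nest R M X Y t)
        map_add' := fun s t => by rw [map_add, map_add]
        map_smul' := fun r t => by rw [map_smul, map_smulₛₗ]; rfl }
    let B : TPow R (TPow R M X) Y →ₗ[R] TPow R' M' (X × Y) :=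
      { toFun := fun t => nest R' M' X Y (map α (map α f X) Y t)
        map_add' := fun s t => by rw [map_add, map_add]
        map_smul' := fun r t => by rw [map_smulₛₗ, map_smul]; rfl }
    have hAB : A = B := by
      refine PiTensorProduct.ext_of_span_eq_top (R := R) (ι := Y) (M := fun _ => TPow R M X)
        (γ := fun _ => X → M) (g := fun {_} m => tprod R m)
        (fun _ => PiTensorProduct.span_tprod_eq_top) (fun m => ?_)
      change map α f (X × Y) (nest R M X Y (tprod R fun y => tprod R (m y))) =
        nest R' M' X Y (map α (map α f X) Y (tprod R fun y => tprod R (m y)))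
      simp only [nest_tprod, map_tprod]
    have h := LinearMap.congr_fun hAB (tprod R n)
    change map α f (X × Y) (nest R M X Y (tprod R n)) =
        nest R' M' X Y (map α (map α f X) Y (tprod R n)) at h
    rw [h, map_tprod]
  · simp [nest, hY]

theorem map_power {R' M' : Type*} [CommRing R'] [AddCommGroup M'] [Module R' M']
    (α : R →+* R') (f : M →ₛₗ[α] M') (n : TPow R M X) :
    map α f (X × Y) (power Y n) = power Y (map α f X n) :=
  map_nest α f _

end Nest
end TPow

section Cosets

variable {G : Type*} [Group G]

/-- The conjugate `g U g⁻¹`. -/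
def conjSubgroup (g : G) (U : Subgroup G) : Subgroup G :=
  U.comap (MulAut.conj g⁻¹).toMonoidHom

theorem mem_conjSubgroup {g x : G} {U : Subgroup G} : x ∈ conjSubgroup g U ↔ g⁻¹ * x * g ∈ U := by
  simp [conjSubgroup]

/-- For `B = g A g⁻¹`, the bijection `G/A ≃ G/B`, `a A ↦ a g⁻¹ B`. -/
def cosetTwist (g : G) {A B : Subgroup G} (h : ∀ x, x ∈ B ↔ g⁻¹ * x * g ∈ A) : G ⧸ A ≃ G ⧸ B where
  toFun := Quotient.map' (fun a => a * g⁻¹) fun a b hab => by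
    rw [QuotientGroup.leftRel_apply] at hab ⊢
    rw [h]
    simpa [mul_assoc] using hab
  invFun := Quotient.map' (fun a => a * g) fun a b hab => by
    rw [QuotientGroup.leftRel_apply, h] at hab
    rw [QuotientGroup.leftRel_apply]
    simpa [mul_assoc] using hab
  left_inv := by
    rintro ⟨a⟩
    exact congrArg (QuotientGroup.mk : G → G ⧸ A) (inv_mul_cancel_right a g)
  right_inv := by
    rintro ⟨a⟩
    exact congrArg (QuotientGroup.mk : G → G ⧸ B) (mul_inv_cancel_right a g)

/-- The fixed points `(H/V)^U`, as a set of cosets in `G/V`. -/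
def fixedCosets (H U V : Subgroup G) : Set (G ⧸ V) :=
  {x | (∃ h ∈ H, (h : G ⧸ V) = x) ∧ ∀ u ∈ U, u • x = x}

theorem mem_conjSubgroup_inv {g x : G} {U : Subgroup G} :
    x ∈ conjSubgroup g⁻¹ U ↔ g * x * g⁻¹ ∈ U := by
  rw [mem_conjSubgroup, inv_inv]

theorem conj_le_of_fixed {U V : Subgroup G} {x : G ⧸ V} (hx : ∀ u ∈ U, u • x = x) :
    conjSubgroup x.out⁻¹ U ≤ V := by
  intro y hy
  have h := hx _ (mem_conjSubgroup_inv.1 hy)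
  conv at h => rw [← QuotientGroup.out_eq' x]
  rw [MulAction.Quotient.smul_mk, QuotientGroup.eq] at h
  rw [← V.inv_mem_iff]
  simpa [mul_assoc] using h

theorem mem_iff_conj_mem (g : G) (U : Subgroup G) (x : G) :
    x ∈ U ↔ g⁻¹ * x * g ∈ conjSubgroup g⁻¹ U := by
  rw [mem_conjSubgroup_inv]
  simp [mul_assoc]

end Cosets

/-- A choice of one representative for each `H`-conjugacy class of open subgroups of `H`. -/
structure ClassReps {G : Type*} [Group G] [TopologicalSpace G] (H : Subgroup G) where
  /-- the distinguished subgroups -/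
  reps : Set (Subgroup G)
  isOpen : ∀ V ∈ reps, IsOpen (V : Set G)
  le : ∀ V ∈ reps, V ≤ H
  existsUnique : ∀ U : Subgroup G, IsOpen (U : Set G) → U ≤ H →
    ∃! V, V ∈ reps ∧ ∃ h ∈ H, U = conjSubgroup h V

/-- The choices made in the construction of the Witt vectors: representatives for the
`H`-conjugacy classes of open subgroups of `H`, and coset representatives for each `G/V`. -/
structure WittChoice {G : Type*} [Group G] [TopologicalSpace G] (H : Subgroup G) extends
    ClassReps H where
  /-- `sec V (gV)` is the chosen representative of the coset `gV` -/
  sec : ∀ V : Subgroup G, G ⧸ V → G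
  sec_spec : ∀ V, Function.RightInverse (sec V) (QuotientGroup.mk : G → G ⧸ V)

/-- The open subgroups of `G` that are contained in `H`. -/
abbrev OpenSub {G : Type*} [Group G] [TopologicalSpace G] (H : Subgroup G) : Type _ :=
  {U : Subgroup G // IsOpen (U : Set G) ∧ U ≤ H}

section Operations

variable {G : Type*} [Group G] {R M : Type*} [CommRing R] [AddCommGroup M] [Module R M]

/-- The map `g · (-) : M^{⊗ G/A} → M^{⊗ G/B}`, where `B = g A g⁻¹`. -/
noncomputable def TPow.twist (g : G) {A B : Subgroup G} (h : ∀ x, x ∈ B ↔ g⁻¹ * x * g ∈ A) :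
    TPow R M (G ⧸ A) ≃ₗ[R] TPow R M (G ⧸ B) :=
  TPow.reindex R (cosetTwist g h)

/-- The isomorphism `f_{G/V} : M^{⊗ G/V × V/U} ≅ M^{⊗ G/U}` induced by `(g_i V, sU) ↦ g_i s U`,
for a choice `σ` of representatives `g_i` of the cosets of `V`. -/
noncomputable def TPow.cosetIso {U V : Subgroup G} (hUV : U ≤ V) (σ : G ⧸ V → G)
    (hσ : Function.RightInverse σ QuotientGroup.mk) :
    TPow R M ((G ⧸ V) × (V ⧸ U.subgroupOf V)) ≃ₗ[R] TPow R M (G ⧸ U) :=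
  TPow.reindex R (Subgroup.quotientEquivProdOfLE' hUV σ hσ).symm

end Operations

section Ghost

variable {G : Type*} [Group G] [TopologicalSpace G] {H : Subgroup G}

/-- The product `∏_{U ≤_o H} M^{⊗_R G/U}`, which contains the ghost group as its subgroup of
`H`-fixed points. -/
abbrev GhostProd (H : Subgroup G) (R M : Type*) [CommRing R] [AddCommGroup M] [Module R M] :
    Type _ :=
  ∀ U : OpenSub H, TPow R M (G ⧸ U.1)

/-- Functoriality of the product of tensor powers. -/
noncomputable def GhostProd.map (H : Subgroup G) {R M R' M' : Type*} [CommRing R]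
    [AddCommGroup M] [Module R M] [CommRing R'] [AddCommGroup M'] [Module R' M'] (α : R →+* R')
    (f : M →ₛₗ[α] M') : GhostProd H R M →+ GhostProd H R' M' where
  toFun a U := TPow.map α f _ (a U)
  map_zero' := by funext U; exact map_zero _
  map_add' a b := by funext U; exact map_add _ _ _

theorem GhostProd.continuous_map {R M R' M' : Type*} [CommRing R]
    [AddCommGroup M] [Module R M] [CommRing R'] [AddCommGroup M'] [Module R' M'] (α : R →+* R')
    (f : M →ₛₗ[α] M') : Continuous (GhostProd.map H α f) :=
  continuous_pi fun U => (continuous_of_discreteTopology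
    (f := fun t : TPow R M (G ⧸ U.1) => TPow.map α f _ t)).comp (continuous_apply U)

/-- The pairs `(V, hV)` with `V` a distinguished subgroup and `hV ∈ (H/V)^U`; these index the sum
that defines the `U`-component of the ghost map. -/
abbrev GhostIndex (c : WittChoice H) (U : Subgroup G) : Type _ :=
  Σ V : c.reps, fixedCosets H U V.1

/-- The summand `h · f_{G/V}(n_V^{⊗ V/U^h})` of the ghost map, where `U^h = h⁻¹ U h`. -/
noncomputable def ghostTerm (c : WittChoice H) (R M : Type*) [CommRing R] [AddCommGroup M]
    [Module R M] (U : Subgroup G) (n : ∀ V : c.reps, TPow R M (G ⧸ V.1)) (i : GhostIndex c U) :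
    TPow R M (G ⧸ U) :=
  TPow.twist i.2.1.out (mem_iff_conj_mem i.2.1.out U)
    (TPow.cosetIso (conj_le_of_fixed i.2.2.2) (c.sec i.1.1) (c.sec_spec i.1.1)
      (TPow.power _ (n i.1)))

open Classical in
/-- The ghost map `w : ∏_{V ∈ S̲} M^{⊗ G/V} → ∏_U M^{⊗ G/U}`,
`w_U(n) = ∑_V ∑_{hV ∈ (H/V)^U} h · f_{G/V}(n_V^{⊗ V/U^h})`. It takes values in the `H`-fixed
points. For `G` profinite the index set of the sum is finite. -/
noncomputable def ghostMap (c : WittChoice H) (R M : Type*) [CommRing R] [AddCommGroup M]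
    [Module R M] (n : ∀ V : c.reps, TPow R M (G ⧸ V.1)) : GhostProd H R M :=
  fun U =>
    if _h : Finite (GhostIndex c U.1) then
      letI := Fintype.ofFinite (GhostIndex c U.1)
      ∑ i, ghostTerm c R M U.1 n i
    else 0

theorem map_ghostMap (c : WittChoice H) {R M R' M' : Type*} [CommRing R]
    [AddCommGroup M] [Module R M] [CommRing R'] [AddCommGroup M'] [Module R' M'] (α : R →+* R')
    (f : M →ₛₗ[α] M') (n : ∀ V : c.reps, TPow R M (G ⧸ V.1)) :
    GhostProd.map H α f (ghostMap c R M n) =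
      ghostMap c R' M' (fun V => TPow.map α f _ (n V)) := by
  funext U
  change TPow.map α f _ (ghostMap c R M n U) = _
  unfold ghostMap
  split_ifs with h
  · rw [map_sum]
    refine Finset.sum_congr rfl fun i _ => ?_
    simp only [ghostTerm, TPow.twist, TPow.cosetIso, TPow.map_reindex, TPow.map_power]
  · exact map_zero _

end Ghost

section FreeResolution

/-- The semilinear map `T(Y) → M` out of the free `T`-module on `Y` that extends `φ : Y → M`. -/
noncomputable def freeLift {T R M Y : Type*} [CommRing T] [CommRing R] [AddCommGroup M]
    [Module R M] (α : T →+* R) (φ : Y → M) : (Y →₀ T) →ₛₗ[α] M where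
  toFun a := a.sum fun y t => α t • φ y
  map_add' a b := Finsupp.sum_add_index' (fun y => by simp) (fun y s t => by rw [map_add, add_smul])
  map_smul' r a := by
    rw [Finsupp.sum_smul_index' (fun y => by simp), Finsupp.smul_sum]
    simp [mul_smul]

theorem freeLift_single {T R M Y : Type*} [CommRing T] [CommRing R] [AddCommGroup M]
    [Module R M] (α : T →+* R) (φ : Y → M) (y : Y) (t : T) :
    freeLift α φ (Finsupp.single y t) = α t • φ y :=
  Finsupp.sum_single_index (h := fun y t => α t • φ y) (by rw [map_zero, zero_smul])

theorem freeLift_comp {T R M Y S N : Type*} [CommRing T] [CommRing R] [AddCommGroup M]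
    [Module R M] [CommRing S] [AddCommGroup N] [Module S N] (α : T →+* R) (φ : Y → M)
    (β : R →+* S) (f : M →ₛₗ[β] N) (γ : T →+* S) (ψ : Y → N) (h : ∀ t, β (α t) = γ t)
    (h' : ∀ y, f (φ y) = ψ y) (a : Y →₀ T) : f (freeLift α φ a) = freeLift γ ψ a := by
  induction a using Finsupp.induction_linear with
  | zero => simp
  | add a b ha hb => simp only [map_add, ha, hb]
  | single y t => rw [freeLift_single, freeLift_single, map_smulₛₗ, h, h']

/-- The free commutative ring `ℤ[R]` on the underlying set of `R`. -/
abbrev FreeR (R : Type*) : Type _ := MvPolynomial R ℤ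

/-- The free `ℤ[R]`-module on the underlying set of `M`. The pair `(FreeR R; FreeM R M)` is the
free module over a free ring on the underlying sets of `(R; M)`. -/
abbrev FreeM (R M : Type*) : Type _ := M →₀ FreeR R

/-- Functoriality of `FreeR`. -/
noncomputable def freeRMap {R R' : Type*} (α : R → R') : FreeR R →+* FreeR R' :=
  (MvPolynomial.rename α : FreeR R →ₐ[ℤ] FreeR R').toRingHom

/-- Functoriality of `FreeM`. -/
noncomputable def freeMMap {R R' M M' : Type*} (α : R → R') (f : M → M') :
    FreeM R M →ₛₗ[freeRMap α] FreeM R' M' :=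
  freeLift (freeRMap α) (fun m => Finsupp.single (f m) 1)

/-- The counit `ℤ[R] → R`. -/
noncomputable def counitR (R : Type*) [CommRing R] : FreeR R →+* R :=
  (MvPolynomial.aeval (R := ℤ) (id : R → R)).toRingHom

/-- The counit on modules. -/
noncomputable def counitM (R M : Type*) [CommRing R] [AddCommGroup M] [Module R M] :
    FreeM R M →ₛₗ[counitR R] M :=
  freeLift (counitR R) id

section
variable {R R' M M' : Type*} [CommRing R] [CommRing R'] [AddCommGroup M] [AddCommGroup M']
  [Module R M] [Module R' M']

theorem counitR_map (α : R →+* R') (t : FreeR R) :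
    counitR R' (freeRMap α t) = α (counitR R t) := by
  have : (counitR R').comp (freeRMap α) = α.comp (counitR R) := by
    apply MvPolynomial.ringHom_ext <;> simp [counitR, freeRMap]
  exact RingHom.congr_fun this t

theorem counitM_map (α : R →+* R') (f : M →ₛₗ[α] M') (t : FreeM R M) :
    counitM R' M' (freeMMap α f t) = f (counitM R M t) := by
  unfold freeMMap
  rw [freeLift_comp (freeRMap α) _ (counitR R') (counitM R' M') (α.comp (counitR R)) (fun m => f m)
    (fun t => counitR_map α t) (fun y => by simp [counitM, freeLift_single])]
  exact (freeLift_comp (counitR R) id α f (α.comp (counitR R)) (fun m => f m) (fun _ => rfl)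
    (fun _ => rfl) t).symm

end

theorem freeRMap_comp {A B C : Type*} (α : A → B) (β : B → C) (γ : A → C) (h : ∀ a, β (α a) = γ a)
    (t : FreeR A) : freeRMap β (freeRMap α t) = freeRMap γ t := by
  obtain rfl : γ = β ∘ α := funext fun a => (h a).symm
  exact MvPolynomial.rename_rename _ _ _

theorem freeMMap_comp {A B C M N P : Type*} (α : A → B) (β : B → C) (γ : A → C)
    (h : ∀ a, β (α a) = γ a) (f : M → N) (g : N → P) (k : M → P) (h' : ∀ m, g (f m) = k m)
    (t : FreeM A M) : freeMMap β g (freeMMap α f t) = freeMMap γ k t := by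
  unfold freeMMap
  exact freeLift_comp _ _ _ _ _ _ (freeRMap_comp α β γ h)
    (fun y => by rw [freeLift_single]; simp [h']) t

end FreeResolution

section Witt

variable {G : Type*} [Group G] [TopologicalSpace G] {H : Subgroup G}

theorem GhostProd.map_comm {R R₁ R₂ R₃ M M₁ M₂ M₃ : Type*} [CommRing R] [CommRing R₁]
    [CommRing R₂] [CommRing R₃] [AddCommGroup M] [AddCommGroup M₁] [AddCommGroup M₂]
    [AddCommGroup M₃] [Module R M] [Module R₁ M₁] [Module R₂ M₂] [Module R₃ M₃] {α₁ : R →+* R₁}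
    {β₁ : R₁ →+* R₃} {α₂ : R →+* R₂} {β₂ : R₂ →+* R₃} {f₁ : M →ₛₗ[α₁] M₁} {g₁ : M₁ →ₛₗ[β₁] M₃}
    {f₂ : M →ₛₗ[α₂] M₂} {g₂ : M₂ →ₛₗ[β₂] M₃} (hr : ∀ r, β₁ (α₁ r) = β₂ (α₂ r))
    (hm : ∀ m, g₁ (f₁ m) = g₂ (f₂ m)) (a : GhostProd H R M) :
    GhostProd.map H β₁ g₁ (GhostProd.map H α₁ f₁ a) =
      GhostProd.map H β₂ g₂ (GhostProd.map H α₂ f₂ a) :=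
  funext fun U => TPow.map_comm hr hm (a U)

/-- The subgroup generated by the image of the ghost map. When `M` is a free module over a free
ring the image is itself a subgroup, so this is the image. -/
noncomputable def ghostImage (c : WittChoice H) (R M : Type*) [CommRing R] [AddCommGroup M]
    [Module R M] : AddSubgroup (GhostProd H R M) :=
  AddSubgroup.closure (Set.range (ghostMap c R M))

section
variable (c : WittChoice H) {R R' M M' : Type*} [CommRing R] [CommRing R'] [AddCommGroup M]
  [AddCommGroup M'] [Module R M] [Module R' M']

/-- Functoriality of the image of the ghost map. -/
noncomputable def ghostImageMap (α : R →+* R') (f : M →ₛₗ[α] M') :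
    ghostImage c R M →+ ghostImage c R' M' :=
  ((GhostProd.map H α f).comp (ghostImage c R M).subtype).codRestrict (ghostImage c R' M') (by
    rintro ⟨a, ha⟩
    change GhostProd.map H α f a ∈ _
    induction ha using AddSubgroup.closure_induction with
    | mem x hx =>
      obtain ⟨n, rfl⟩ := hx
      rw [map_ghostMap]
      exact AddSubgroup.subset_closure ⟨_, rfl⟩
    | zero => rw [map_zero]; exact zero_mem _
    | add x y _ _ hx hy => rw [map_add]; exact add_mem hx hy
    | neg x _ hx => rw [map_neg]; exact neg_mem hx)

theorem coe_ghostImageMap (α : R →+* R') (f : M →ₛₗ[α] M') (a : ghostImage c R M) :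
    (ghostImageMap c α f a : GhostProd H R' M') = GhostProd.map H α f a := rfl

theorem continuous_ghostImageMap (α : R →+* R') (f : M →ₛₗ[α] M') :
    Continuous (ghostImageMap c α f) :=
  ((GhostProd.continuous_map α f).comp continuous_subtype_val).subtype_mk _

end

variable (c : WittChoice H) (R M : Type*) [CommRing R] [AddCommGroup M] [Module R M]

/-- The difference of the two maps `W(FUFU(R; M)) ⇉ W(FU(R; M))` on Witt vectors with free
coefficients that are induced by the canonical free resolution
`FUFU(R; M) ⇉ FU(R; M) → (R; M)`. -/
noncomputable def resolutionDiff :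
    ghostImage c (FreeR (FreeR R)) (FreeM (FreeR R) (FreeM R M)) →+
      ghostImage c (FreeR R) (FreeM R M) :=
  ghostImageMap c (counitR (FreeR R)) (counitM (FreeR R) (FreeM R M)) -
    ghostImageMap c (freeRMap (counitR R)) (freeMMap (counitR R) (counitM R M))

/-- The Hausdorff topological abelian group `W_{H ≤ G}(R; M)` of (untruncated) `G`-typical Witt
vectors with coefficients: the coequaliser, in Hausdorff topological abelian groups, of
`W(FUFU(R; M)) ⇉ W(FU(R; M))`. This is the value at `(R; M)` of the reflexive-coequaliser
preserving extension of the functor `(T; Q) ↦ im(w)` on free modules over free rings. -/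
def Witt : Type _ :=
  ghostImage c (FreeR R) (FreeM R M) ⧸ (resolutionDiff c R M).range.topologicalClosure

noncomputable instance : AddCommGroup (Witt c R M) :=
  inferInstanceAs (AddCommGroup
    (ghostImage c (FreeR R) (FreeM R M) ⧸ (resolutionDiff c R M).range.topologicalClosure))

noncomputable instance : TopologicalSpace (Witt c R M) :=
  inferInstanceAs (TopologicalSpace
    (ghostImage c (FreeR R) (FreeM R M) ⧸ (resolutionDiff c R M).range.topologicalClosure))

namespace Witt

/-- The ghost map `W_{H ≤ G}(R; M) → ∏_{U ≤_o H} M^{⊗_R G/U}`, with values in the `H`-fixed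
points. -/
noncomputable def ghost : Witt c R M →+ GhostProd H R M :=
  QuotientAddGroup.lift _
    ((GhostProd.map H (counitR R) (counitM R M)).comp
      (ghostImage c (FreeR R) (FreeM R M)).subtype) (by
    refine AddSubgroup.topologicalClosure_minimal (t := AddMonoidHom.ker _) _ ?_ ?_
    · rintro _ ⟨a, rfl⟩
      rw [AddMonoidHom.mem_ker, resolutionDiff, AddMonoidHom.sub_apply, map_sub, sub_eq_zero]
      change GhostProd.map H _ _ (GhostProd.map H _ _ _) =
        GhostProd.map H _ _ (GhostProd.map H _ _ _)
      exact GhostProd.map_comm (fun r => (counitR_map (counitR R) r).symm)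
        (fun m => (counitM_map (counitR R) (counitM R M) m).symm) _
    · exact isClosed_singleton.preimage
        ((GhostProd.continuous_map _ _).comp continuous_subtype_val))

variable {R M} {R' M' : Type*} [CommRing R'] [AddCommGroup M'] [Module R' M']

/-- Functoriality of the Witt vectors on the category of all modules. -/
noncomputable def map (α : R →+* R') (f : M →ₛₗ[α] M') : Witt c R M →+ Witt c R' M' :=
  QuotientAddGroup.map _ _ (ghostImageMap c (freeRMap α) (freeMMap α f)) (by
    refine AddSubgroup.topologicalClosure_minimal _ ?_ ?_
    · rintro _ ⟨a, rfl⟩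
      refine AddSubgroup.le_topologicalClosure _
        ⟨ghostImageMap c (freeRMap (freeRMap α)) (freeMMap (freeRMap α) (freeMMap α f)) a, ?_⟩
      simp only [resolutionDiff, AddMonoidHom.sub_apply, map_sub]
      congr 1 <;> apply Subtype.ext <;> simp only [coe_ghostImageMap]
      · exact GhostProd.map_comm (fun r => counitR_map (freeRMap α) r)
          (fun m => counitM_map (freeRMap α) (freeMMap α f) m) _
      · refine GhostProd.map_comm (fun r => ?_) (fun m => ?_) _
        · exact (freeRMap_comp (freeRMap α) (counitR R') _ (fun _ => rfl) r).trans
            (freeRMap_comp (counitR R) α _ (fun t => (counitR_map α t).symm) r).symm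
        · exact (freeMMap_comp (freeRMap α) (counitR R') _ (fun _ => rfl) (freeMMap α f)
            (counitM R' M') _ (fun _ => rfl) m).trans
            (freeMMap_comp (counitR R) α _ (fun t => (counitR_map α t).symm) (counitM R M) f _
              (fun t => (counitM_map α f t).symm) m).symm
    · exact (AddSubgroup.isClosed_topologicalClosure _).preimage (continuous_ghostImageMap c _ _))

end Witt

end Witt

section ExternalTensor

/-- The underlying group `M ⊗_ℤ M'` of the object `(R ⊗_ℤ R'; M ⊗_ℤ M')`. -/
def ExtTensor (R M R' M' : Type*) [CommRing R] [AddCommGroup M] [Module R M] [CommRing R']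
    [AddCommGroup M'] [Module R' M'] : Type _ :=
  M ⊗[ℤ] M'

variable {R M R' M' : Type*} [CommRing R] [AddCommGroup M] [Module R M] [CommRing R']
  [AddCommGroup M'] [Module R' M']

noncomputable instance : AddCommGroup (ExtTensor R M R' M') :=
  inferInstanceAs (AddCommGroup (M ⊗[ℤ] M'))

variable (R M R' M') in
/-- The action of `R ⊗_ℤ R'` on `M ⊗_ℤ M'`, with `(r ⊗ r') (m ⊗ m') = r m ⊗ r' m'`. -/
noncomputable def ExtTensor.action : R ⊗[ℤ] R' →+* Module.End ℤ (M ⊗[ℤ] M') :=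
  ((Module.endTensorEndAlgHom (R := ℤ) (S := ℤ) (A := ℤ) (M := M) (N := M')).comp
    (Algebra.TensorProduct.map (Algebra.lsmul ℤ ℤ M : R →ₐ[ℤ] Module.End ℤ M)
      (Algebra.lsmul ℤ ℤ M' : R' →ₐ[ℤ] Module.End ℤ M'))).toRingHom

noncomputable instance : Module (R ⊗[ℤ] R') (ExtTensor R M R' M') :=
  Module.compHom (M ⊗[ℤ] M') (ExtTensor.action R M R' M')

namespace ExtTensor

variable (R R') in
/-- The pure tensor `m ⊗ m'`. -/
noncomputable def mk (m : M) (m' : M') : ExtTensor R M R' M' := m ⊗ₜ[ℤ] m'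

theorem mk_add_left (a b : M) (m' : M') : mk R R' (a + b) m' = mk R R' a m' + mk R R' b m' :=
  TensorProduct.add_tmul _ _ _

theorem mk_add_right (m : M) (a b : M') : mk R R' m (a + b) = mk R R' m a + mk R R' m b :=
  TensorProduct.tmul_add _ _ _

theorem action_tmul (r : R) (r' : R') (m : M) (m' : M') :
    ExtTensor.action R M R' M' (r ⊗ₜ[ℤ] r') (m ⊗ₜ[ℤ] m') = (r • m) ⊗ₜ[ℤ] (r' • m') := rfl

theorem tmul_smul_mk (r : R) (r' : R') (m : M) (m' : M') :
    (r ⊗ₜ[ℤ] r') • mk R R' m m' = mk R R' (r • m) (r' • m') := rfl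

/-- An additive map out of `M ⊗ M'` that is compatible with scalars on pure tensors. -/
theorem semilinear_aux {A N : Type*} [CommRing A] [AddCommGroup N] [Module A N]
    (γ : R ⊗[ℤ] R' →+* A) (F : M ⊗[ℤ] M' →+ N)
    (h : ∀ r r' m m', F ((r • m) ⊗ₜ[ℤ] (r' • m')) = γ (r ⊗ₜ[ℤ] r') • F (m ⊗ₜ[ℤ] m'))
    (x : R ⊗[ℤ] R') (t : M ⊗[ℤ] M') :
    F (ExtTensor.action R M R' M' x t) = γ x • F t := by
  induction x using TensorProduct.induction_on with
  | zero => simp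
  | add x y hx hy => simp only [map_add, LinearMap.add_apply, hx, hy, add_smul]
  | tmul r r' =>
    induction t using TensorProduct.induction_on with
    | zero => simp
    | add x y hx hy => simp only [map_add, hx, hy, smul_add]
    | tmul m m' => rw [action_tmul, h]

/-- The map `m ⊗ m' ↦ f m ⊗ g m'`. -/
noncomputable def mapAux {S N S' N' : Type*} [CommRing S] [AddCommGroup N] [Module S N]
    [CommRing S'] [AddCommGroup N'] [Module S' N'] {α : R →+* S} (f : M →ₛₗ[α] N)
    {β : R' →+* S'} (g : M' →ₛₗ[β] N') : M ⊗[ℤ] M' →+ N ⊗[ℤ] N' :=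
  (TensorProduct.map f.toAddMonoidHom.toIntLinearMap
    g.toAddMonoidHom.toIntLinearMap).toAddMonoidHom

/-- Functoriality of the tensor product on the category of all modules. -/
noncomputable def map {S N S' N' : Type*} [CommRing S] [AddCommGroup N] [Module S N]
    [CommRing S'] [AddCommGroup N'] [Module S' N'] (α : R →+* S) (f : M →ₛₗ[α] N)
    (β : R' →+* S') (g : M' →ₛₗ[β] N') :
    ExtTensor R M R' M' →ₛₗ[(Algebra.TensorProduct.map α.toIntAlgHom β.toIntAlgHom).toRingHom]
      ExtTensor S N S' N' where
  toFun := mapAux f g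
  map_add' s t := (mapAux f g).map_add s t
  map_smul' r t := semilinear_aux (N := ExtTensor S N S' N')
    (Algebra.TensorProduct.map α.toIntAlgHom β.toIntAlgHom).toRingHom
    (mapAux f g) (fun r r' m m' => by
      change mk S S' (f (r • m)) (g (r' • m')) = (α r ⊗ₜ[ℤ] β r') • mk S S' (f m) (g m')
      rw [tmul_smul_mk, map_smulₛₗ, map_smulₛₗ]) r t

/-- The ring multiplication as a morphism `(R ⊗ R; R ⊗ R) → (R; R)`. -/
noncomputable def mul' (R : Type*) [CommRing R] :
    ExtTensor R R R R →ₛₗ[(Algebra.TensorProduct.lmul' (S := R) ℤ).toRingHom] R where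
  toFun := LinearMap.mul' ℤ R
  map_add' s t := LinearMap.map_add _ s t
  map_smul' r t := semilinear_aux (Algebra.TensorProduct.lmul' (S := R) ℤ).toRingHom
    (LinearMap.mul' ℤ R).toAddMonoidHom (fun r r' m m' => by
      change (r * m) * (r' * m') = (r * r') * (m * m')
      ring) r t

variable (R R') in
/-- The morphism `m ↦ m ⊗ m'`. -/
noncomputable def mkLeft (m' : M') :
    M →ₛₗ[(Algebra.TensorProduct.includeLeftRingHom : R →+* R ⊗[ℤ] R')] ExtTensor R M R' M' where
  toFun m := mk R R' m m'
  map_add' a b := mk_add_left a b _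
  map_smul' r m := by
    change _ = (r ⊗ₜ[ℤ] (1 : R')) • mk R R' m m'
    rw [tmul_smul_mk, one_smul]

end ExtTensor

/-- The map `t ↦ t ⊗ ⨂_x m'_x` into `(M ⊗ M')^{⊗ X}`. -/
noncomputable def TPow.shuffleAux {X : Type*} (m' : X → M') :
    TPow R M X →+ TPow (R ⊗[ℤ] R') (ExtTensor R M R' M') X :=
  (TPow.mapFam (Algebra.TensorProduct.includeLeftRingHom : R →+* R ⊗[ℤ] R')
    (fun x => ExtTensor.mkLeft R R' (m' x))).toAddMonoidHom

theorem TPow.shuffleAux_smul_tprod {X : Type*} (m' : X → M') (r : R) (m : X → M) :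
    TPow.shuffleAux (R := R) (R' := R') m' (r • TPow.tprod R m) =
      (r ⊗ₜ[ℤ] (1 : R')) • TPow.tprod _ (fun x => ExtTensor.mk R R' (m x) (m' x)) := by
  change TPow.mapFam _ _ (r • TPow.tprod R m) = _
  rw [map_smulₛₗ, TPow.mapFam_tprod]
  rfl

/-- The shuffle `M^{⊗_R X} ⊗_ℤ M'^{⊗_{R'} X} → (M ⊗_ℤ M')^{⊗_{R ⊗ R'} X}`,
`(⨂ m_x) ⊗ (⨂ m'_x) ↦ ⨂ (m_x ⊗ m'_x)`, as a biadditive map with the second tensor first. -/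
noncomputable def TPow.shuffle (R M R' M' X : Type*) [CommRing R] [AddCommGroup M] [Module R M]
    [CommRing R'] [AddCommGroup M'] [Module R' M'] :
    TPow R' M' X →+ TPow R M X →+ TPow (R ⊗[ℤ] R') (ExtTensor R M R' M') X :=
  (TPow.lift R' (Algebra.TensorProduct.includeRight : R' →ₐ[ℤ] R ⊗[ℤ] R').toRingHom
    (fun m' => TPow.shuffleAux m')
    (fun {_} m' x a b => by
      have key : ∀ (m : X → M) (c : M'), (fun y => ExtTensor.mk R R' (m y)
          (Function.update m' x c y)) = Function.update (fun y => ExtTensor.mk R R' (m y) (m' y)) x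
            (ExtTensor.mk R R' (m x) c) := fun m c => by
        funext y; rcases eq_or_ne y x with rfl | h <;> simp [*]
      ext t
      induction t using TPow.induction with
      | h r m =>
        rw [AddMonoidHom.add_apply]
        simp only [TPow.shuffleAux_smul_tprod, key, ExtTensor.mk_add_right, ← smul_add]
        exact congrArg _ ((PiTensorProduct.tprod _).map_update_add _ _ _ _)
      | hadd s t hs ht => rw [map_add, hs, ht, map_add])
    (fun {_} m' x r' a => by
      have key : ∀ (m : X → M) (c : M'), (fun y => ExtTensor.mk R R' (m y)
          (Function.update m' x c y)) = Function.update (fun y => ExtTensor.mk R R' (m y) (m' y)) x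
            (ExtTensor.mk R R' (m x) c) := fun m c => by
        funext y; rcases eq_or_ne y x with rfl | h <;> simp [*]
      have key' : ∀ m : M, ExtTensor.mk R R' m (r' • a) =
          ((1 : R) ⊗ₜ[ℤ] r') • ExtTensor.mk R R' m a := fun m => by
        rw [ExtTensor.tmul_smul_mk, one_smul]
      ext t
      induction t using TPow.induction with
      | h r m =>
        change _ = ((1 : R) ⊗ₜ[ℤ] r') • (TPow.shuffleAux (Function.update m' x a)
          (r • TPow.tprod R m))
        simp only [TPow.shuffleAux_smul_tprod, key, key']
        rw [smul_comm]
        exact congrArg _ ((PiTensorProduct.tprod _).map_update_smul _ _ _ _)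
      | hadd s t hs ht => rw [map_add, hs, ht, map_add])).toAddMonoidHom

end ExternalTensor

section Operators

variable {G : Type v} [Group G] [TopologicalSpace G]

theorem isOpen_conjSubgroup [IsTopologicalGroup G] (g : G) {U : Subgroup G}
    (hU : IsOpen (U : Set G)) : IsOpen (conjSubgroup g U : Set G) := by
  have h : (conjSubgroup g U : Set G) = (fun x => g⁻¹ * x * g) ⁻¹' U := by
    ext x
    exact mem_conjSubgroup
  rw [h]
  exact hU.preimage (by fun_prop)

/-- For `K ≤ H` and `xK ∈ (H/K)^W`, the open subgroup `W^x = x⁻¹ W x` of `K`. -/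
noncomputable def OpenSub.conj [IsTopologicalGroup G] {H K : Subgroup G} (W : OpenSub H)
    (x : fixedCosets H W.1 K) : OpenSub K :=
  ⟨conjSubgroup x.1.out⁻¹ W.1, isOpen_conjSubgroup _ W.2.1, conj_le_of_fixed x.2.2⟩

/-- The open subgroup `U` of `G` with `U ≤ H`, as an open subgroup of the group `H`. -/
def OpenSub.inside {H : Subgroup G} (U : OpenSub H) : OpenSub (⊤ : Subgroup ↥H) :=
  ⟨U.1.subgroupOf H, U.2.1.preimage continuous_subtype_val, le_top⟩

/-- The quotient map `q : ∏_{V ∈ S̲} M^{⊗ G/V} → W_{H ≤ G}(R; M)`: the natural continuous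
transformation through which the ghost map `w` factors. -/
structure QuotMap {H : Subgroup G} (c : WittChoice H) where
  toFun : ∀ (R M : Type u) [CommRing R] [AddCommGroup M] [Module R M],
    (∀ V : c.reps, TPow R M (G ⧸ V.1)) → Witt c R M
  continuous : ∀ (R M : Type u) [CommRing R] [AddCommGroup M] [Module R M],
    Continuous (toFun R M)
  natural : ∀ {R M R' M' : Type u} [CommRing R] [AddCommGroup M] [Module R M] [CommRing R']
    [AddCommGroup M'] [Module R' M'] (α : R →+* R') (f : M →ₛₗ[α] M')
    (n : ∀ V : c.reps, TPow R M (G ⧸ V.1)),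
    Witt.map c α f (toFun R M n) = toFun R' M' (fun V => TPow.map α f _ (n V))
  ghost : ∀ {R M : Type u} [CommRing R] [AddCommGroup M] [Module R M]
    (n : ∀ V : c.reps, TPow R M (G ⧸ V.1)),
    Witt.ghost c R M (toFun R M n) = ghostMap c R M n

/-- The external product
`W_{H ≤ G}(R; M) ⊗ W_{H ≤ G}(R'; M') → W_{H ≤ G}(R ⊗ R'; M ⊗ M')`: the natural biadditive map
that is given on ghost components by the shuffle
`M^{⊗ G/U} ⊗ M'^{⊗ G/U} → (M ⊗ M')^{⊗ G/U}`. -/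
structure ExternalProduct {H : Subgroup G} (c : WittChoice H) where
  toFun : ∀ (R M R' M' : Type u) [CommRing R] [AddCommGroup M] [Module R M] [CommRing R']
    [AddCommGroup M'] [Module R' M'],
    Witt c R M →+ Witt c R' M' →+ Witt c (R ⊗[ℤ] R') (ExtTensor R M R' M')
  natural : ∀ {R M R' M' S N S' N' : Type u} [CommRing R] [AddCommGroup M] [Module R M]
    [CommRing R'] [AddCommGroup M'] [Module R' M'] [CommRing S] [AddCommGroup N] [Module S N]
    [CommRing S'] [AddCommGroup N'] [Module S' N'] (α : R →+* S) (f : M →ₛₗ[α] N)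
    (β : R' →+* S') (g : M' →ₛₗ[β] N') (x : Witt c R M) (y : Witt c R' M'),
    Witt.map c _ (ExtTensor.map α f β g) (toFun R M R' M' x y) =
      toFun S N S' N' (Witt.map c α f x) (Witt.map c β g y)
  ghost : ∀ {R M R' M' : Type u} [CommRing R] [AddCommGroup M] [Module R M] [CommRing R']
    [AddCommGroup M'] [Module R' M'] (x : Witt c R M) (y : Witt c R' M') (U : OpenSub H),
    Witt.ghost c _ _ (toFun R M R' M' x y) U =
      TPow.shuffle R M R' M' _ (Witt.ghost c R' M' y U) (Witt.ghost c R M x U)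

/-- The Frobenius `F_K^H : W_{H ≤ G}(R; M) → W_{K ≤ G}(R; M)`: the natural transformation of
topological groups that is the projection onto the components `U ≤ K` on ghosts. -/
structure Frobenius {H K : Subgroup G} (hKH : K ≤ H) (c : WittChoice H) (c' : WittChoice K) where
  toFun : ∀ (R M : Type u) [CommRing R] [AddCommGroup M] [Module R M],
    Witt c R M →ₜ+ Witt c' R M
  natural : ∀ {R M R' M' : Type u} [CommRing R] [AddCommGroup M] [Module R M] [CommRing R']
    [AddCommGroup M'] [Module R' M'] (α : R →+* R') (f : M →ₛₗ[α] M') (x : Witt c R M),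
    Witt.map c' α f (toFun R M x) = toFun R' M' (Witt.map c α f x)
  ghost : ∀ {R M : Type u} [CommRing R] [AddCommGroup M] [Module R M] (x : Witt c R M)
    (U : OpenSub K),
    Witt.ghost c' R M (toFun R M x) U = Witt.ghost c R M x ⟨U.1, U.2.1, U.2.2.trans hKH⟩

/-- The Verschiebung `V_K^H : W_{K ≤ G}(R; M) → W_{H ≤ G}(R; M)`: the natural transformation of
topological groups given on ghosts by `a ↦ (∑_{hK ∈ (H/K)^W} h · a_{W^h})_W`. -/
structure Verschiebung [IsTopologicalGroup G] {H K : Subgroup G} (c : WittChoice H)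
    (c' : WittChoice K) where
  toFun : ∀ (R M : Type u) [CommRing R] [AddCommGroup M] [Module R M],
    Witt c' R M →ₜ+ Witt c R M
  natural : ∀ {R M R' M' : Type u} [CommRing R] [AddCommGroup M] [Module R M] [CommRing R']
    [AddCommGroup M'] [Module R' M'] (α : R →+* R') (f : M →ₛₗ[α] M') (x : Witt c' R M),
    Witt.map c α f (toFun R M x) = toFun R' M' (Witt.map c' α f x)
  ghost : ∀ {R M : Type u} [CommRing R] [AddCommGroup M] [Module R M] (x : Witt c' R M)
    (W : OpenSub H),
    Witt.ghost c R M (toFun R M x) W =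
      ∑ᶠ i : fixedCosets H W.1 K, TPow.twist i.1.out (mem_iff_conj_mem i.1.out W.1)
        (Witt.ghost c' R M x (W.conj i))

/-- The isomorphism `Θ : W_{H ≤ H}(R; M^{⊗ G/H}) ≅ W_{H ≤ G}(R; M)` determined by a choice `σ` of
coset representatives for `G/H`: the natural transformation given on ghosts by
`M^{⊗ G/H × H/U} ≅ M^{⊗ G/U}`. -/
structure Theta {H : Subgroup G} (σ : G ⧸ H → G) (hσ : Function.RightInverse σ QuotientGroup.mk)
    (c : WittChoice H) (c' : WittChoice (⊤ : Subgroup ↥H)) where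
  toFun : ∀ (R M : Type u) [CommRing R] [AddCommGroup M] [Module R M],
    Witt c' R (TPow R M (G ⧸ H)) ≃ₜ+ Witt c R M
  natural : ∀ {R M R' M' : Type u} [CommRing R] [AddCommGroup M] [Module R M] [CommRing R']
    [AddCommGroup M'] [Module R' M'] (α : R →+* R') (f : M →ₛₗ[α] M')
    (x : Witt c' R (TPow R M (G ⧸ H))),
    Witt.map c α f (toFun R M x) = toFun R' M' (Witt.map c' α (TPow.map α f _) x)
  ghost : ∀ {R M : Type u} [CommRing R] [AddCommGroup M] [Module R M]
    (x : Witt c' R (TPow R M (G ⧸ H))) (U : OpenSub H),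
    Witt.ghost c R M (toFun R M x) U =
      TPow.cosetIso U.2.2 σ hσ (TPow.nest R M _ _ (Witt.ghost c' R _ x U.inside))

end Operators

section RingStructure

variable {G : Type v} [Group G] [TopologicalSpace G] {H : Subgroup G} {c : WittChoice H}

/-- The Witt vectors `W_{H ≤ G}(R; R)` with multiplication
`W(R; R) ⊗ W(R; R) → W(R ⊗ R; R ⊗ R) → W(R; R)` and unit `τ_{G/H}(1)`. -/
def WittRing (_q : QuotMap.{u} c) (_s : ExternalProduct.{u} c) (R : Type u) [CommRing R] : Type _ :=
  Witt c R R

variable (q : QuotMap.{u} c) (s : ExternalProduct.{u} c) (R : Type u) [CommRing R]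

noncomputable instance : AddCommGroup (WittRing q s R) :=
  inferInstanceAs (AddCommGroup (Witt c R R))

noncomputable instance : Mul (WittRing q s R) where
  mul x y := Witt.map c (Algebra.TensorProduct.lmul' (S := R) ℤ).toRingHom (ExtTensor.mul' R)
    (s.toFun R R R R x y)

open Classical in
noncomputable instance : One (WittRing q s R) where
  one := q.toFun R R (fun V => if V.1 = H then TPow.tprod R (fun _ => 1) else 0)

/-- The map `∏_{V ∈ S̲} R ≅ ∏_{V ∈ S̲} R^{⊗ G/V} → W_{H ≤ G}(R; R)`. -/
noncomputable def QuotMap.ringMap (a : c.reps → R) : Witt c R R :=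
  q.toFun R R (fun V => a V • TPow.tprod R (fun _ => 1))

end RingStructure

section Delta

variable {G : Type v} [Group G] [TopologicalSpace G] {H : Subgroup G}

/-- The isomorphism `W_H(R; R) ≅ W_H(R; R^{⊗ G/H}) ≅ W_{H ≤ G}(R; R)`, where the first map is
induced by `R ≅ R^{⊗ G/H}`, `r ↦ r (1 ⊗ ⋯ ⊗ 1)`, and the second one is `Θ`. -/
noncomputable def Theta.deltaInv {σ : G ⧸ H → G} {hσ : Function.RightInverse σ QuotientGroup.mk}
    {c : WittChoice H} {c' : WittChoice (⊤ : Subgroup ↥H)} (Θ : Theta.{u} σ hσ c c') (R : Type u)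
    [CommRing R] (x : Witt c' R R) : Witt c R R :=
  Θ.toFun R R (Witt.map c' (RingHom.id R)
    (LinearMap.toSpanSingleton R (TPow R R (G ⧸ H)) (TPow.tprod R (fun _ => 1))) x)

end Delta

section DressSiebeneicher

variable {G : Type v} [Group G] [TopologicalSpace G]

/-- The underlying set `∏_{V ∈ S̲} R` of the `G`-typical Witt vectors `W_G(R)`. -/
def DSWitt (S : ClassReps (⊤ : Subgroup G)) (R : Type*) : Type _ := S.reps → R

/-- The map induced on `G`-typical Witt vectors by a map of coefficients. -/
def DSWitt.map (S : ClassReps (⊤ : Subgroup G)) {R R' : Type*} (α : R → R') (a : DSWitt S R) :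
    DSWitt S R' :=
  fun V => α (a V)

/-- The ghost component
`φ_U(a) = ∑_V #(G/V)^U a_V^{(V : U)}`, where `(V : U) = [G : U] / [G : V]`. -/
noncomputable def DSWitt.ghost (S : ClassReps (⊤ : Subgroup G)) {R : Type*} [CommRing R]
    (U : Subgroup G) (a : DSWitt S R) : R :=
  ∑ᶠ V : S.reps, (Nat.card (fixedCosets ⊤ U V.1) : R) * a V ^ (U.index / V.1.index)

/-- The ring structures on the sets `W_G(R) = ∏_{V ∈ S̲} R`, for all commutative rings `R`, such
that `W_G` is a functor to rings and the ghost components are ring homomorphisms. -/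
structure DressSiebeneicher (S : ClassReps (⊤ : Subgroup G)) where
  ring : ∀ (R : Type u) [CommRing R], CommRing (DSWitt S R)
  map_ring : ∀ {R R' : Type u} [CommRing R] [CommRing R'] (α : R →+* R'),
    letI := ring R
    letI := ring R'
    ∃ F : DSWitt S R →+* DSWitt S R', ∀ a, F a = DSWitt.map S α a
  ghost_ring : ∀ (R : Type u) [CommRing R] (U : Subgroup G), IsOpen (U : Set G) →
    letI := ring R
    ∃ φ : DSWitt S R →+* R, ∀ a, φ a = DSWitt.ghost S U a

/-- The Frobenius `f_H : W_G(R) → W_H(R)`: the natural map that corresponds on ghosts to the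
restriction to the open subgroups of `H`. -/
structure DSFrobenius (H : Subgroup G) (S : ClassReps (⊤ : Subgroup G))
    (S' : ClassReps (⊤ : Subgroup ↥H)) where
  toFun : ∀ (R : Type u) [CommRing R], DSWitt S R → DSWitt S' R
  natural : ∀ {R R' : Type u} [CommRing R] [CommRing R'] (α : R →+* R') (a : DSWitt S R),
    DSWitt.map S' α (toFun R a) = toFun R' (DSWitt.map S α a)
  ghost : ∀ {R : Type u} [CommRing R] (a : DSWitt S R) (U : OpenSub H),
    DSWitt.ghost S' U.inside.1 (toFun R a) = DSWitt.ghost S U.1 a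

/-- The Verschiebung `v_H : W_H(R) → W_G(R)`: the natural map given on ghosts by
`φ_W(v_H b) = ∑_{gH ∈ (G/H)^W} φ_{W^g}(b)`. -/
structure DSVerschiebung [IsTopologicalGroup G] (H : Subgroup G)
    (S : ClassReps (⊤ : Subgroup G)) (S' : ClassReps (⊤ : Subgroup ↥H)) where
  toFun : ∀ (R : Type u) [CommRing R], DSWitt S' R → DSWitt S R
  natural : ∀ {R R' : Type u} [CommRing R] [CommRing R'] (α : R →+* R') (b : DSWitt S' R),
    DSWitt.map S α (toFun R b) = toFun R' (DSWitt.map S' α b)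
  ghost : ∀ {R : Type u} [CommRing R] (b : DSWitt S' R) (W : OpenSub (⊤ : Subgroup G)),
    DSWitt.ghost S W.1 (toFun R b) =
      ∑ᶠ i : fixedCosets ⊤ W.1 H, DSWitt.ghost S' (W.conj i).inside.1 b

end DressSiebeneicher

section Burnside

/-- Almost finite `Γ`-sets: discrete `Γ`-sets in which every open subgroup has finitely many fixed
points. -/
structure AFSet (Γ : Type v) [Group Γ] [TopologicalSpace Γ] where
  carrier : Type v
  [action : MulAction Γ carrier]
  isOpen_stabilizer : ∀ x : carrier, IsOpen (MulAction.stabilizer Γ x : Set Γ)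
  finite_fixed : ∀ U : Subgroup Γ, IsOpen (U : Set Γ) →
    {x : carrier | ∀ g ∈ U, g • x = x}.Finite

namespace AFSet

attribute [instance] AFSet.action

variable {Γ : Type v} [Group Γ] [TopologicalSpace Γ]

/-- The fixed points `X^U`. -/
def fixed (X : AFSet Γ) (U : Subgroup Γ) : Set X.carrier := {x | ∀ g ∈ U, g • x = x}

/-- Isomorphism of `Γ`-sets. -/
instance setoid (Γ : Type v) [Group Γ] [TopologicalSpace Γ] : Setoid (AFSet Γ) where
  r X Y := ∃ e : X.carrier ≃ Y.carrier, ∀ (g : Γ) x, e (g • x) = g • e x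
  iseqv :=
    { refl := fun _ => ⟨Equiv.refl _, fun _ _ => rfl⟩
      symm := fun ⟨e, he⟩ => ⟨e.symm, fun g y => e.injective (by simp [he])⟩
      trans := fun ⟨e, he⟩ ⟨f, hf⟩ => ⟨e.trans f, fun g x => by simp [he, hf]⟩ }

/-- Disjoint union. -/
def sum (X Y : AFSet Γ) : AFSet Γ where
  carrier := X.carrier ⊕ Y.carrier
  isOpen_stabilizer := by
    rintro (x | y)
    · convert X.isOpen_stabilizer x using 1
      ext g
      simp
    · convert Y.isOpen_stabilizer y using 1
      ext g
      simp
  finite_fixed U hU := by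
    refine (((X.finite_fixed U hU).image Sum.inl).union
      ((Y.finite_fixed U hU).image Sum.inr)).subset ?_
    rintro (x | y) h
    · exact Or.inl ⟨x, fun g hg => Sum.inl_injective (h g hg), rfl⟩
    · exact Or.inr ⟨y, fun g hg => Sum.inr_injective (h g hg), rfl⟩

/-- Cartesian product, with the diagonal action. -/
def prod (X Y : AFSet Γ) : AFSet Γ where
  carrier := X.carrier × Y.carrier
  isOpen_stabilizer := by
    rintro ⟨x, y⟩
    convert (X.isOpen_stabilizer x).inter (Y.isOpen_stabilizer y) using 1
    ext g
    simp
  finite_fixed U hU := by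
    refine ((X.finite_fixed U hU).prod (Y.finite_fixed U hU)).subset ?_
    rintro ⟨x, y⟩ h
    exact ⟨fun g hg => congrArg Prod.fst (h g hg), fun g hg => congrArg Prod.snd (h g hg)⟩

/-- The one-point `Γ`-set. -/
def point (Γ : Type v) [Group Γ] [TopologicalSpace Γ] : AFSet Γ where
  carrier := PUnit
  isOpen_stabilizer x := by
    convert isOpen_univ
    ext g
    simp
  finite_fixed _ _ := Set.toFinite _

end AFSet

/-- Isomorphism classes of almost finite `Γ`-sets. -/
def AFClass (Γ : Type v) [Group Γ] [TopologicalSpace Γ] : Type (v + 1) :=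
  Quotient (AFSet.setoid Γ)

namespace AFClass

variable {Γ : Type v} [Group Γ] [TopologicalSpace Γ]

/-- The isomorphism class of an almost finite `Γ`-set. -/
def mk (X : AFSet Γ) : AFClass Γ := Quotient.mk _ X

instance : Add (AFClass Γ) where
  add := Quotient.map₂ AFSet.sum fun _ _ ⟨e, he⟩ _ _ ⟨f, hf⟩ =>
    ⟨Equiv.sumCongr e f, fun g x => by
      rcases x with x | y
      · exact congrArg Sum.inl (he g x)
      · exact congrArg Sum.inr (hf g y)⟩

instance : Mul (AFClass Γ) where
  mul := Quotient.map₂ AFSet.prod fun _ _ ⟨e, he⟩ _ _ ⟨f, hf⟩ =>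
    ⟨Equiv.prodCongr e f, fun g x => Prod.ext (he g x.1) (hf g x.2)⟩

instance : One (AFClass Γ) := ⟨mk (AFSet.point Γ)⟩

instance : CommMonoid (AFClass Γ) where
  mul_assoc := by
    rintro ⟨X⟩ ⟨Y⟩ ⟨Z⟩
    exact Quotient.sound ⟨Equiv.prodAssoc _ _ _, fun _ _ => rfl⟩
  mul_comm := by
    rintro ⟨X⟩ ⟨Y⟩
    exact Quotient.sound ⟨Equiv.prodComm _ _, fun _ _ => rfl⟩
  one_mul := by
    rintro ⟨X⟩
    exact Quotient.sound ⟨Equiv.punitProd _, fun _ _ => rfl⟩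
  mul_one := by
    rintro ⟨X⟩
    exact Quotient.sound ⟨Equiv.prodPUnit _, fun _ _ => rfl⟩

end AFClass

/-- The completed Burnside ring `Ω̂(Γ)`: the Grothendieck ring of almost finite `Γ`-sets, with sum
and product induced by disjoint union and cartesian product. -/
abbrev BurnsideRing (Γ : Type v) [Group Γ] [TopologicalSpace Γ] : Type (v + 1) :=
  FreeAbelianGroup (AFClass Γ) ⧸ Ideal.span
    {x : FreeAbelianGroup (AFClass Γ) | ∃ a b : AFClass Γ, x =
      FreeAbelianGroup.of (a + b) - FreeAbelianGroup.of a - FreeAbelianGroup.of b}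

/-- The class of an almost finite `Γ`-set in the completed Burnside ring. -/
def BurnsideRing.of {Γ : Type v} [Group Γ] [TopologicalSpace Γ] (X : AFSet Γ) : BurnsideRing Γ :=
  Ideal.Quotient.mk _ (FreeAbelianGroup.of (AFClass.mk X))

end Burnside

/-! The proof first describes the image of the ghost map for coefficients (ℤ; ℤ^(B)). There the
tensor power over G/U is the free abelian group `LabelGroup B U` on the maps G/U → B, and the image
turns out to be the subgroup `congruences`: families invariant under conjugation by H such that, for
U ≤ D ≤ H, the sum over x in N_D(U)/U of the restrictions of a at ⟨U, x⟩ lies in the image of the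
transfer of N_D(U)/U.

Ghost vectors satisfy these congruences for a combinatorial reason. The labelled fixed points of an
H-set satisfy them by a labelled Cauchy–Frobenius count (`labelSum_mem_congruences`). The ghost
vector of a sum of basis tensors is of this kind, for the coinduced sets `CosetFun`. Arbitrary
integer coefficients are congruent modulo every N to nonnegative ones, and the congruences can be
tested modulo all N (`mem_congruences_of_nsmul`). Conversely the ghost map is triangular with the
transfer on the diagonal, so a family satisfying the congruences is solved for by recursion on the
index, as in Dwork's lemma (`exists_eq_of_triangular`). The result is `range_ghostMap_int`; pushing
forward along ℤ^(M) → M gives `range_ghostMap` for all coefficients. In particular the image is a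
subgroup independent of the choices, and it is stable under projections, transfers, shuffles and Θ.

Next come the resolutions. If (T; Q) has a `ResolutionSection`, the defining coequaliser splits and
W(T; Q) is the ghost image. This holds for free modules over polynomial rings and for tensor
products of such pairs. The natural transformations are therefore defined on ghost images and
descended, and they are unique because ghosts are injective on canonical free pairs, whose Witt
vectors surject onto all others. For Θ it is also needed that tensor powers turn the canonical
resolution into a presentation (`TPow.exists_counit_pair`) and that W respects presentations
(`Witt.Presentation.map_eq_zero`).

In rank one a tensor power R^{⊗ X} is R, and ghost components become the polynomials φ_U. The map
`Witt.scalar` is bijective: surjective by reduction to polynomial rings, injective by a density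
argument using finitely many ghost components. The ring W_G(R) is obtained by transport along it.
Compatibility with Frobenius and Verschiebung is an identity of ghost components over polynomial
rings, pushed forward along the counit. Finally, for ℤ both the Burnside ring and W(ℤ; ℤ) embed in
the product of copies of ℤ over the open subgroups, and both have as range the integer families
satisfying `congruences` with B a point. -/

set_option linter.unusedSectionVars false

/-! ### Tensor powers: brackets, power maps and bases -/

namespace TPow

section Tensor

variable {R : Type*} {M : Type*} {X Y Z : Type*} [CommRing R] [AddCommGroup M] [Module R M]

/-- The universal multilinear map into the tensor power. -/
noncomputable def tprodMulti (R M X : Type*) [CommRing R] [AddCommGroup M] [Module R M] :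
    MultilinearMap R (fun _ : X => M) (TPow R M X) :=
  PiTensorProduct.tprod R

theorem reindex_reindex (e : X ≃ Y) (e' : Y ≃ Z) (t : TPow R M X) :
    reindex R e' (reindex R e t) = reindex R (e.trans e') t := by
  induction t using TPow.induction with
  | h r m => simp only [map_smul, reindex_tprod]; rfl
  | hadd s t hs ht => simp only [map_add, hs, ht]

theorem reindex_of_eq (e : X ≃ X) (he : ∀ x, e x = x) (t : TPow R M X) :
    reindex R e t = t := by
  obtain rfl : e = Equiv.refl X := Equiv.ext he
  induction t using TPow.induction with
  | h r m => simp only [map_smul, reindex_tprod]; rfl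
  | hadd s t hs ht => simp only [map_add, hs, ht]

/-- Linear maps out of a tensor power agree if they agree on pure tensors. -/
theorem linear_ext {N : Type*} [AddCommGroup N] [Module R N] {Φ Ψ : TPow R M X →ₗ[R] N}
    (h : ∀ m, Φ (tprod R m) = Ψ (tprod R m)) : Φ = Ψ := by
  ext t
  induction t using TPow.induction with
  | h r m => simp only [map_smul, h]
  | hadd s t hs ht => simp only [map_add, hs, ht]

theorem nest_ext {N : Type*} [AddCommGroup N] [Module R N]
    {Φ Ψ : TPow R (TPow R M X) Y →ₗ[R] N} [Finite Y]
    (h : ∀ m : Y → X → M, Φ (tprod R fun y => tprod R (m y)) = Ψ (tprod R fun y => tprod R (m y))) :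
    Φ = Ψ :=
  PiTensorProduct.ext_of_span_eq_top (R := R) (ι := Y) (M := fun _ => TPow R M X)
    (γ := fun _ => X → M) (g := fun {_} m => tprod R m)
    (fun _ => PiTensorProduct.span_tprod_eq_top) (fun m => h m)

theorem nest_reindex [Finite Y] (θ : Y ≃ Z) (n : Y → TPow R M X) :
    reindex R (Equiv.prodCongr (Equiv.refl X) θ) (nest R M X Y (tprod R n)) =
      nest R M X Z (tprod R fun z => n (θ.symm z)) := by
  have : Finite Z := Finite.of_equiv _ θ
  have h : (reindex R (Equiv.prodCongr (Equiv.refl X) θ)).toLinearMap ∘ₗ nest R M X Y =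
      nest R M X Z ∘ₗ (reindex R θ).toLinearMap := nest_ext fun m => by
    simp only [LinearMap.comp_apply, LinearEquiv.coe_coe, nest_tprod, reindex_tprod]
    rfl
  have := LinearMap.congr_fun h (tprod R n)
  simpa only [LinearMap.comp_apply, LinearEquiv.coe_coe, reindex_tprod] using this

/-- All copies of `n` in the power are equal, so permuting them by θ changes nothing. Comparisons of
norm maps below are reduced to this statement and a check on coset representatives. -/
theorem reindex_power_congr [Finite Y] {W : Type*} (n : TPow R M X) (θ : Y ≃ Z) (e : X × Y ≃ W)
    (e' : X × Z ≃ W) (h : ∀ x y, e (x, y) = e' (x, θ y)) :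
    reindex R e (power Y n) = reindex R e' (power Z n) := by
  have h1 := nest_reindex θ (fun _ => n)
  rw [power, power, ← h1, reindex_reindex]
  congr 2
  ext ⟨x, y⟩
  exact h x y

theorem reindex_power_unique [Unique Y] (n : TPow R M X) (e : X × Y ≃ X)
    (he : ∀ x y, e (x, y) = x) : reindex R e (power Y n) = n := by
  let Ψ : TPow R (TPow R M X) Y →ₗ[R] TPow R M X :=
    lift R (RingHom.id R) (fun m => m default)
      (fun {_} m y a b => by obtain rfl := Subsingleton.elim y default; simp)
      (fun {_} m y r a => by obtain rfl := Subsingleton.elim y default; simp)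
  have hΨ : ∀ m, Ψ (tprod R m) = m default := fun m => lift_tprod R _ _ _ _ m
  have h : (reindex R e).toLinearMap ∘ₗ nest R M X Y = Ψ := nest_ext fun m => by
    simp only [LinearMap.comp_apply, LinearEquiv.coe_coe, nest_tprod, reindex_tprod, hΨ]
    congr 1
    funext x
    have hx : e.symm x = (x, default) := by rw [Equiv.symm_apply_eq, he]
    rw [hx]
  exact (LinearMap.congr_fun h (tprod R fun _ => n)).trans (hΨ _)

/-- Multilinear expansion of the power of a sum. The choice functions κ will reappear as points of a
coinduced set. -/
theorem power_sum [Finite Y] {I : Type*} [Fintype I] (n : I → TPow R M X)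
    [Fintype (Y → I)] :
    power Y (∑ i, n i) = ∑ κ : Y → I, nest R M X Y (tprod R fun y => n (κ y)) := by
  classical
  let _ := Fintype.ofFinite Y
  have h := (PiTensorProduct.tprod R (s := fun _ : Y => TPow R M X)).map_sum (fun _ i => n i)
  rw [power, ← map_sum]
  congr 1
  refine h.trans (Finset.sum_congr ?_ fun _ _ => rfl)
  ext
  simp

/-- The power map is not additive, but it is well defined modulo N. This is what allows integer
coefficients to be replaced by nonnegative ones in ghost vectors. -/
theorem exists_power_add_nsmul [Finite Y] (N : ℕ) (n m : TPow R M X) :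
    ∃ z, power Y (n + N • m) = power Y n + N • z := by
  classical
  let _ := Fintype.ofFinite Y
  let f := tprodMulti R (TPow R M X) Y
  -- The slots in `s` already hold `n + N • m`. Filling one more slot changes the tensor by a
  -- multiple of N.
  have key : ∀ s : Finset Y, ∃ z, f (s.piecewise (fun _ => n + N • m) fun _ => n) =
      f (fun _ => n) + N • z := by
    intro s
    induction s using Finset.induction_on with
    | empty => exact ⟨0, by simp⟩
    | insert y s hy ih =>
      obtain ⟨z, hz⟩ := ih
      refine ⟨z + f (Function.update (s.piecewise (fun _ => n + N • m) fun _ => n) y m), ?_⟩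
      have hsm : f (Function.update (s.piecewise (fun _ => n + N • m) fun _ => n) y (N • m)) =
          N • f (Function.update (s.piecewise (fun _ => n + N • m) fun _ => n) y m) := by
        have := f.map_update_smul (s.piecewise (fun _ => n + N • m) fun _ => n) y (N : R) m
        rwa [Nat.cast_smul_eq_nsmul, Nat.cast_smul_eq_nsmul] at this
      rw [Finset.piecewise_insert, f.map_update_add, hsm]
      have : Function.update (s.piecewise (fun _ => n + N • m) fun _ => n) y n =
          s.piecewise (fun _ => n + N • m) fun _ => n := by
        rw [Function.update_eq_self_iff, Finset.piecewise_eq_of_notMem _ _ _ hy]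
      rw [this, hz, smul_add, add_assoc]
  obtain ⟨z, hz⟩ := key Finset.univ
  refine ⟨nest R M X Y z, ?_⟩
  rw [Finset.piecewise_univ] at hz
  rw [power, power, ← map_nsmul, ← map_add]
  exact congrArg _ hz

/-- Changing one entry of an array changes one row only, in one place; this is the multilinearity
behind `unnest`. -/
theorem update_prodMk [DecidableEq (X × Y)] [DecidableEq X] [DecidableEq Y] (m : X × Y → M)
    (p : X × Y) (c : M) : (fun y => tprod R fun x => Function.update m p c (x, y)) =
      Function.update (fun y => tprod R fun x => m (x, y)) p.2
        (tprod R (Function.update (fun x => m (x, p.2)) p.1 c)) := by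
  funext y
  by_cases h : y = p.2
  · subst h
    simp only [Function.update_self]
    congr 1
    funext x
    simp [Function.update_apply, Prod.ext_iff]
  · rw [Function.update_of_ne h]
    congr 1
    funext x
    simp [Prod.ext_iff, h]

/-- The inverse of `TPow.nest`. -/
noncomputable def unnest (R M X Y : Type*) [CommRing R] [AddCommGroup M] [Module R M] :
    TPow R M (X × Y) →ₗ[R] TPow R (TPow R M X) Y :=
  lift R (RingHom.id R) (fun m => tprod R fun y => tprod R fun x => m (x, y))
    (fun {_} m p a b => by
      classical
      have e1 : tprod R (Function.update (fun x => m (x, p.2)) p.1 (a + b)) = _ :=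
        (PiTensorProduct.tprod R).map_update_add _ _ _ _
      rw [update_prodMk, update_prodMk, update_prodMk, e1]
      exact (PiTensorProduct.tprod R).map_update_add _ _ _ _)
    (fun {_} m p r a => by
      classical
      have e1 : tprod R (Function.update (fun x => m (x, p.2)) p.1 (r • a)) = _ :=
        (PiTensorProduct.tprod R).map_update_smul _ _ _ _
      rw [update_prodMk, update_prodMk, e1]
      exact (PiTensorProduct.tprod R).map_update_smul _ _ _ _)

theorem unnest_tprod (m : X × Y → M) :
    unnest R M X Y (tprod R m) = tprod R fun y => tprod R fun x => m (x, y) :=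
  lift_tprod R _ _ _ _ m

theorem unnest_nest [Finite Y] (t : TPow R (TPow R M X) Y) :
    unnest R M X Y (nest R M X Y t) = t :=
  LinearMap.congr_fun (nest_ext (Φ := unnest R M X Y ∘ₗ nest R M X Y) (Ψ := LinearMap.id)
    fun m => by simp only [LinearMap.comp_apply, nest_tprod, unnest_tprod, LinearMap.id_apply]) t

theorem nest_unnest [Finite Y] (t : TPow R M (X × Y)) :
    nest R M X Y (unnest R M X Y t) = t :=
  LinearMap.congr_fun (linear_ext (Φ := nest R M X Y ∘ₗ unnest R M X Y) (Ψ := LinearMap.id)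
    fun m => by simp only [LinearMap.comp_apply, nest_tprod, unnest_tprod, LinearMap.id_apply]) t

/-- A scalar can be absorbed into any one factor. Nonemptiness of the index set is essential, since
the empty power is R itself. -/
theorem smul_tprod [Nonempty X] (r : R) (m : X → M) :
    ∃ m' : X → M, tprod R m' = r • tprod R m := by
  classical
  obtain ⟨x⟩ := ‹Nonempty X›
  refine ⟨Function.update m x (r • m x), ?_⟩
  refine ((PiTensorProduct.tprod R).map_update_smul m x r (m x)).trans ?_
  rw [Function.update_eq_self]
  rfl

/-- Pure tensors generate a nonempty tensor power additively. -/
theorem add_induction [Nonempty X] {P : TPow R M X → Prop} (h : ∀ m : X → M, P (tprod R m))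
    (hadd : ∀ s t, P s → P t → P (s + t)) (t : TPow R M X) : P t := by
  induction t using TPow.induction with
  | h r m =>
    obtain ⟨m', hm'⟩ := smul_tprod r m
    exact hm' ▸ h m'
  | hadd s t hs ht => exact hadd s t hs ht

open Classical in
/-- The basis of pure tensors of a tensor power of a free module. -/
noncomputable def finsuppEquiv (R B X : Type*) [CommRing R] [Finite X] :
    TPow R (B →₀ R) X ≃ₗ[R] ((X → B) →₀ R) :=
  letI := Fintype.ofFinite X
  PiTensorProduct.ofFinsuppEquiv'

theorem finsuppEquiv_tprod {B : Type*} [Finite X] (b : X → B) :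
    finsuppEquiv R B X (tprod R fun x => Finsupp.single (b x) 1) = Finsupp.single b 1 := by
  classical
  let _ := Fintype.ofFinite X
  refine (PiTensorProduct.ofFinsuppEquiv'_tprod_single (R := R) b (fun _ => (1 : R))).trans ?_
  simp

theorem finsuppEquiv_symm_single {B : Type*} [Finite X] (b : X → B) :
    (finsuppEquiv R B X).symm (Finsupp.single b 1) = tprod R fun x => Finsupp.single (b x) 1 := by
  rw [← finsuppEquiv_tprod, LinearEquiv.symm_apply_apply]

end Tensor

section Map

variable {R R' M M' X Y : Type*} [CommRing R] [CommRing R'] [AddCommGroup M] [AddCommGroup M']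
  [Module R M] [Module R' M']

theorem map_of_eq (α : R →+* R) (f : M →ₛₗ[α] M) (hα : ∀ r, α r = r) (hf : ∀ m, f m = m)
    (t : TPow R M X) : map α f X t = t := by
  induction t using TPow.induction with
  | h r m => simp only [map_smulₛₗ, map_tprod, hα, hf]
  | hadd s t hs ht => simp only [map_add, hs, ht]

theorem map_map {R'' M'' : Type*} [CommRing R''] [AddCommGroup M''] [Module R'' M'']
    {α : R →+* R'} {f : M →ₛₗ[α] M'} {β : R' →+* R''} {g : M' →ₛₗ[β] M''} {γ : R →+* R''}
    {k : M →ₛₗ[γ] M''} (hr : ∀ r, β (α r) = γ r) (hm : ∀ m, g (f m) = k m) (t : TPow R M X) :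
    map β g X (map α f X t) = map γ k X t := by
  induction t using TPow.induction with
  | h r m => simp only [map_smulₛₗ, map_tprod, hr, hm]
  | hadd s t hs ht => simp only [map_add, hs, ht]

theorem map_surjective [Nonempty X] (α : R →+* R') (f : M →ₛₗ[α] M')
    (hf : Function.Surjective f) : Function.Surjective (map α f X) := by
  intro t
  induction t using add_induction with
  | h m =>
    refine ⟨tprod R fun x => Function.surjInv hf (m x), ?_⟩
    rw [map_tprod]
    congr 1
    funext x
    exact Function.surjInv_eq hf _
  | hadd s t hs ht =>
    obtain ⟨a, rfl⟩ := hs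
    obtain ⟨b, rfl⟩ := ht
    exact ⟨a + b, map_add _ _ _⟩

end Map

/-! ### Tensor powers of the ring itself -/

section RankOne

variable {R R' X Y : Type*} [CommRing R] [CommRing R']

/-- The isomorphism `R ≅ R^{⊗ X}` for `X` finite. -/
noncomputable def oneEquiv (R X : Type*) [CommRing R] [Finite X] : R ≃ₗ[R] TPow R R X :=
  letI := Fintype.ofFinite X
  (PiTensorProduct.constantBaseRingEquiv X R).toLinearEquiv.symm

theorem oneEquiv_apply [Finite X] (r : R) :
    oneEquiv R X r = r • tprod R (fun _ : X => (1 : R)) := by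
  let _ := Fintype.ofFinite X
  have h : (oneEquiv R X).symm (tprod R fun _ => (1 : R)) =
      ∏ _x : X, (1 : R) := PiTensorProduct.constantBaseRingEquiv_tprod _
  rw [← LinearEquiv.eq_symm_apply, map_smul, h]
  simp

theorem smul_one_injective [Finite X] {r r' : R}
    (h : r • tprod R (fun _ : X => (1 : R)) = r' • tprod R (fun _ : X => (1 : R))) : r = r' := by
  rw [← oneEquiv_apply, ← oneEquiv_apply] at h
  exact (oneEquiv R X).injective h

theorem exists_smul_one [Finite X] (t : TPow R R X) :
    ∃ r : R, t = r • tprod R (fun _ : X => (1 : R)) :=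
  ⟨(oneEquiv R X).symm t, by rw [← oneEquiv_apply, LinearEquiv.apply_symm_apply]⟩

theorem reindex_smul_one (e : X ≃ Y) (r : R) :
    reindex R e (r • tprod R fun _ => (1 : R)) = r • tprod R fun _ => (1 : R) := by
  rw [map_smul, reindex_tprod]

theorem nest_smul_one [Finite Y] (r : R) :
    nest R R X Y (tprod R fun _ => r • tprod R fun _ => (1 : R)) =
      r ^ Nat.card Y • tprod R fun _ => (1 : R) := by
  let _ := Fintype.ofFinite Y
  have h := (PiTensorProduct.tprod R (s := fun _ : Y => TPow R R X)).map_smul_univ (fun _ => r)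
    (fun _ => tprod R fun _ => (1 : R))
  have h' : tprod R (fun _ : Y => r • tprod R fun _ : X => (1 : R)) =
      (∏ _y : Y, r) • tprod R (fun _ : Y => tprod R fun _ : X => (1 : R)) := h
  rw [h', map_smul, nest_tprod, Finset.prod_const, Finset.card_univ, Nat.card_eq_fintype_card]

theorem map_smul_one (α : R →+* R') (r : R) (f : R →ₛₗ[α] R') (hf : f 1 = 1) :
    map α f X (r • tprod R fun _ => (1 : R)) = α r • tprod R' fun _ => (1 : R') := by
  rw [map_smulₛₗ, map_tprod, hf]

end RankOne

/-! ### The canonical free resolution and its tensor powers -/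

section Resolution

variable {R M X : Type*} [CommRing R] [AddCommGroup M] [Module R M]

theorem counitR_X (r : R) : counitR R (MvPolynomial.X r) = r := by simp [counitR]

theorem freeRMap_X {A B : Type*} (α : A → B) (a : A) :
    freeRMap α (MvPolynomial.X a) = MvPolynomial.X (α a) := by simp [freeRMap]

theorem counitM_single (m : M) : counitM R M (Finsupp.single m 1) = m := by
  simp [counitM, freeLift_single]

theorem freeMMap_single {A B N P : Type*} (α : A → B) (f : N → P) (n : N) :
    freeMMap α f (Finsupp.single n 1) = Finsupp.single (f n) 1 := by
  simp [freeMMap, freeLift_single]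

theorem counitR_surjective : Function.Surjective (counitR R) := fun r => ⟨_, counitR_X r⟩

theorem counitM_surjective : Function.Surjective (counitM R M) := fun m => ⟨_, counitM_single m⟩

theorem counitR_freeRMap_X {σ : Type*} (t : FreeR σ) :
    counitR (FreeR σ) (freeRMap (MvPolynomial.X : σ → FreeR σ) t) = t := by
  have : (counitR (FreeR σ)).comp (freeRMap MvPolynomial.X) = RingHom.id _ := by
    apply MvPolynomial.ringHom_ext
    · intro z; simp
    · intro z; simp [freeRMap_X, counitR_X]
  exact RingHom.congr_fun this t

theorem counitM_freeMMap_single {σ B : Type*} (t : FreeM σ B) :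
    counitM (FreeR σ) (FreeM σ B) (freeMMap (MvPolynomial.X : σ → FreeR σ)
      (fun b => Finsupp.single b 1) t) = t := by
  induction t using Finsupp.induction_linear with
  | zero => simp
  | add a b ha hb => simp only [map_add, ha, hb]
  | single b t =>
    rw [freeMMap, freeLift_single, map_smulₛₗ, counitR_freeRMap_X, counitM_single]
    simp

/-- With `counitR_freeRMap_X` this shows that one map, induced by the inclusion of generators,
splits both maps of the resolution: the pair is reflexive. -/
theorem freeRMap_counitR_freeRMap_X (t : FreeR R) :
    freeRMap (counitR R) (freeRMap (MvPolynomial.X : R → FreeR R) t) = t := by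
  rw [freeRMap_comp _ _ id (fun a => counitR_X a)]
  exact MvPolynomial.rename_id_apply _

theorem freeMMap_id {A N : Type*} (t : FreeM A N) : freeMMap id id t = t := by
  induction t using Finsupp.induction_linear with
  | zero => simp
  | add a b ha hb => simp only [map_add, ha, hb]
  | single b t =>
    rw [freeMMap, freeLift_single]
    have : freeRMap id t = t := MvPolynomial.rename_id_apply _
    simp [this]

theorem freeMMap_counitM_freeMMap_single (t : FreeM R M) :
    freeMMap (counitR R) (counitM R M) (freeMMap (MvPolynomial.X : R → FreeR R)
      (fun m => Finsupp.single m 1) t) = t := by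
  rw [freeMMap_comp _ _ id (fun a => counitR_X a) _ _ id (fun m => counitM_single m), freeMMap_id]

theorem exists_counitR_pair (t t' : FreeR R) (h : counitR R t = counitR R t') :
    ∃ z : FreeR (FreeR R), counitR (FreeR R) z = t ∧ freeRMap (counitR R) z = t' := by
  -- The difference of generators maps to t − t' and, since t and t' have the same image, to 0.
  -- Adding the value at t' of the common section moves both results by t'.
  refine ⟨MvPolynomial.X t - MvPolynomial.X t' + freeRMap MvPolynomial.X t', ?_, ?_⟩
  · simp [counitR_X, counitR_freeRMap_X]
  · simp [freeRMap_X, freeRMap_counitR_freeRMap_X, h]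

/-- Tensor powers preserve the reflexive coequaliser given by the canonical free resolution. -/
theorem exists_counit_pair (t t' : TPow (FreeR R) (FreeM R M) X)
    (h : map (counitR R) (counitM R M) X t = map (counitR R) (counitM R M) X t') :
    ∃ z : TPow (FreeR (FreeR R)) (FreeM (FreeR R) (FreeM R M)) X,
      map (counitR (FreeR R)) (counitM (FreeR R) (FreeM R M)) X z = t ∧
      map (freeRMap (counitR R)) (freeMMap (counitR R) (counitM R M)) X z = t' := by
  let d₀ := map (counitR (FreeR R)) (counitM (FreeR R) (FreeM R M)) X
  let d₁ := map (freeRMap (counitR R)) (freeMMap (counitR R) (counitM R M)) X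
  let s := map (freeRMap (MvPolynomial.X : R → FreeR R))
    (freeMMap (MvPolynomial.X : R → FreeR R) (fun m : M => (Finsupp.single m 1 : FreeM R M))) X
  have hd₀s : ∀ t, d₀ (s t) = t := fun t => by
    refine (map_map (γ := RingHom.id _) (k := LinearMap.id) (fun r => counitR_freeRMap_X r)
      (fun m => counitM_freeMMap_single m) t).trans (map_of_eq _ _ (fun _ => rfl) (fun _ => rfl) t)
  have hd₁s : ∀ t, d₁ (s t) = t := fun t => by
    refine (map_map (γ := RingHom.id _) (k := LinearMap.id)
      (fun r => freeRMap_counitR_freeRMap_X r)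
      (fun m => freeMMap_counitM_freeMMap_single m) t).trans
        (map_of_eq _ _ (fun _ => rfl) (fun _ => rfl) t)
  -- The image of d₀ − d₁. It is closed under scalars because these lift along the common section of
  -- the two ring maps.
  let I : Submodule (FreeR R) (TPow (FreeR R) (FreeM R M) X) :=
    { carrier := {t | ∃ x, t = d₀ x - d₁ x}
      add_mem' := by
        rintro _ _ ⟨x, rfl⟩ ⟨y, rfl⟩
        exact ⟨x + y, by rw [map_add, map_add]; abel⟩
      zero_mem' := ⟨0, by simp⟩
      smul_mem' := by
        rintro r _ ⟨x, rfl⟩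
        refine ⟨freeRMap (MvPolynomial.X : R → FreeR R) r • x, ?_⟩
        simp only [d₀, d₁, map_smulₛₗ]
        rw [counitR_freeRMap_X, freeRMap_counitR_freeRMap_X, smul_sub] }
  have hI : ∀ x, I.mkQ (d₀ x) = I.mkQ (d₁ x) := fun x => by
    rw [← sub_eq_zero, ← map_sub, Submodule.mkQ_apply, Submodule.Quotient.mk_eq_zero]
    exact ⟨x, rfl⟩
  -- Modulo I, a scalar acts through its image in R. Hence the kernel J of the counit acts as zero
  -- and the quotient is a module over the quotient ring, which is R.
  have hX : ∀ r (q : TPow (FreeR R) (FreeM R M) X),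
      I.mkQ (r • q) = I.mkQ (MvPolynomial.X (counitR R r) • q) := fun r q => by
    have := hI ((MvPolynomial.X r : FreeR (FreeR R)) • s q)
    rwa [map_smulₛₗ d₀, map_smulₛₗ d₁, counitR_X, freeRMap_X, hd₀s, hd₁s] at this
  let J := RingHom.ker (counitR R)
  have hJ : Module.IsTorsionBySet (FreeR R) (TPow (FreeR R) (FreeM R M) X ⧸ I) J := by
    rintro x ⟨r, hr⟩
    obtain ⟨q, rfl⟩ := I.mkQ_surjective x
    change r • I.mkQ q = 0
    rw [← map_smul, hX, (hr : counitR R r = 0), ← map_zero (counitR R), ← hX, zero_smul, map_zero]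
  let _ : Module (FreeR R ⧸ J) (TPow (FreeR R) (FreeM R M) X ⧸ I) := hJ.module
  let α : R ≃+* FreeR R ⧸ J :=
    (RingHom.quotientKerEquivOfSurjective (counitR_surjective (R := R))).symm
  have hα : ∀ r, α (counitR R r) = Ideal.Quotient.mk J r := fun r => by
    rw [RingEquiv.symm_apply_eq]
    rfl
  have hαs : ∀ r q, α (counitR R r) • I.mkQ q = I.mkQ (r • q) := fun r q => by
    rw [hα]
    exact Module.IsTorsionBySet.mk_smul hJ r (I.mkQ q)
  have key : ∀ [DecidableEq X] (m : X → M) (x : X) (c : M),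
      (fun y => Finsupp.single (Function.update m x c y) (1 : FreeR R)) =
        Function.update (fun y => Finsupp.single (m y) 1) x (Finsupp.single c 1) := by
    intro _ m x c
    funext y
    rcases eq_or_ne y x with rfl | h <;> simp [*]
  have hL : ∀ q : X → FreeM R M, I.mkQ (tprod _ q) =
      I.mkQ (tprod _ fun x => Finsupp.single (counitM R M (q x)) 1) := fun q => by
    have := hI (tprod _ fun x => Finsupp.single (q x) 1)
    simpa only [d₀, d₁, map_tprod, counitM_single, freeMMap_single] using this
  -- This left inverse of the map induced on the quotient by I sends a pure tensor to the tensor of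
  -- the corresponding generators. It is multilinear because, by `hL`, a pure tensor modulo I
  -- depends only on the images of its entries in M.
  let L : TPow R M X →ₛₗ[α.toRingHom] TPow (FreeR R) (FreeM R M) X ⧸ I :=
    lift R α.toRingHom
      (fun m => I.mkQ (tprod _ fun x => Finsupp.single (m x) 1))
      (fun {_} m x a b => by
        have h1 := hL (Function.update (fun y => Finsupp.single (m y) 1) x
          (Finsupp.single a 1 + Finsupp.single b 1))
        have h2 : (fun y => Finsupp.single (counitM R M (Function.update
            (fun y => Finsupp.single (m y) (1 : FreeR R)) x
              (Finsupp.single a 1 + Finsupp.single b 1) y)) (1 : FreeR R)) =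
            fun y => Finsupp.single (Function.update m x (a + b) y) 1 := by
          funext y
          rcases eq_or_ne y x with rfl | h <;> simp [counitM_single, *]
        rw [h2] at h1
        rw [← h1, key, key, ← map_add]
        exact congrArg _ ((PiTensorProduct.tprod _).map_update_add _ _ _ _))
      (fun {_} m x r a => by
        have h1 := hL (Function.update (fun y => Finsupp.single (m y) 1) x
          ((MvPolynomial.X r : FreeR R) • Finsupp.single a 1))
        have h2 : (fun y => Finsupp.single (counitM R M (Function.update
            (fun y => Finsupp.single (m y) (1 : FreeR R)) x
              ((MvPolynomial.X r : FreeR R) • Finsupp.single a 1) y)) (1 : FreeR R)) =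
            fun y => Finsupp.single (Function.update m x (r • a) y) 1 := by
          funext y
          rcases eq_or_ne y x with rfl | h
          · simp only [Function.update_self, map_smulₛₗ, counitM_single, counitR_X]
          · simp [counitM_single, h]
        rw [h2] at h1
        have h3 : α.toRingHom r = α (counitR R (MvPolynomial.X r)) := by rw [counitR_X]; rfl
        rw [← h1, h3, hαs, key]
        exact congrArg _ ((PiTensorProduct.tprod _).map_update_smul _ _ _ _))
  have hLε : ∀ t, L (map (counitR R) (counitM R M) X t) = I.mkQ t := by
    intro t
    induction t using TPow.induction with
    | h r q =>
      have h3 : L (tprod R fun x => counitM R M (q x)) = _ := lift_tprod R _ _ _ _ _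
      rw [map_smulₛₗ, map_tprod, map_smulₛₗ, h3, ← hL]
      exact hαs _ _
    | hadd s t hs ht => simp only [map_add, hs, ht]
  have h4 : I.mkQ t = I.mkQ t' := by rw [← hLε, ← hLε, h]
  rw [← sub_eq_zero, ← map_sub, Submodule.mkQ_apply, Submodule.Quotient.mk_eq_zero] at h4
  obtain ⟨x, hx⟩ := h4
  -- Here d₀ x − d₁ x = t − t'. Both maps send the correction to t' − d₁ x, which moves the two ends
  -- to t and t'.
  refine ⟨x + s (t' - d₁ x), ?_, ?_⟩
  · change d₀ _ = _
    rw [map_add, hd₀s, add_sub_left_comm, ← hx]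
    abel
  · change d₁ _ = _
    rw [map_add, hd₁s]
    abel

end Resolution

/-! ### The shuffle on pure tensors -/

section Shuffle

variable {R R' M M' X Y : Type*} [CommRing R] [CommRing R'] [AddCommGroup M] [AddCommGroup M']
  [Module R M] [Module R' M']

theorem shuffle_smul_left (r' : R') (t' : TPow R' M' X) (t : TPow R M X) :
    shuffle R M R' M' X (r' • t') t = ((1 : R) ⊗ₜ[ℤ] r') • shuffle R M R' M' X t' t := by
  unfold shuffle
  rw [LinearMap.toAddMonoidHom_coe, map_smulₛₗ]
  rfl

theorem shuffle_tprod (m' : X → M') (r : R) (m : X → M) (r' : R') :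
    shuffle R M R' M' X (r' • tprod R' m') (r • tprod R m) =
      (r ⊗ₜ[ℤ] r') • tprod _ (fun x => ExtTensor.mk R R' (m x) (m' x)) := by
  have h1 : shuffle R M R' M' X (tprod R' m') = shuffleAux m' := lift_tprod _ _ _ _ _ _
  rw [shuffle_smul_left, h1, shuffleAux_smul_tprod, smul_smul]
  simp

theorem map_shuffle {S S' N N' : Type*} [CommRing S] [CommRing S'] [AddCommGroup N]
    [AddCommGroup N'] [Module S N] [Module S' N'] (α : R →+* S) (f : M →ₛₗ[α] N)
    (β : R' →+* S') (g : M' →ₛₗ[β] N') (t' : TPow R' M' X) (t : TPow R M X) :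
    map _ (ExtTensor.map α f β g) X (shuffle R M R' M' X t' t) =
      shuffle S N S' N' X (map β g X t') (map α f X t) := by
  induction t' using TPow.induction with
  | h r' m' =>
    induction t using TPow.induction with
    | h r m =>
      rw [shuffle_tprod, map_smulₛₗ, map_tprod, map_smulₛₗ (map β g X), map_smulₛₗ (map α f X),
        map_tprod, map_tprod, shuffle_tprod]
      rfl
    | hadd s t hs ht => simp only [map_add, hs, ht]
  | hadd s t hs ht => simp only [map_add, AddMonoidHom.add_apply, hs, ht]

end Shuffle

end TPow

/-! ### Subconjugate subgroups and maps of coset spaces -/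

section ConjLE

variable {G : Type*} [Group G]

/-- The subgroup `U` is contained in `g V g⁻¹`. -/
def ConjLE (g : G) (U V : Subgroup G) : Prop := ∀ u ∈ U, g⁻¹ * u * g ∈ V

variable {g g' : G} {U V W H : Subgroup G}

theorem ConjLE.one (h : U ≤ V) : ConjLE 1 U V := fun u hu => by simpa using h hu

theorem ConjLE.mul (h : ConjLE g U V) (h' : ConjLE g' V W) : ConjLE (g * g') U W := fun u hu => by
  simpa [mul_assoc] using h' _ (h u hu)

theorem ConjLE.of_iff (h : ∀ x, x ∈ U ↔ g⁻¹ * x * g ∈ V) : ConjLE g U V := fun u hu => (h u).1 hu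

theorem ConjLE.le_conj (h : ConjLE g U V) : U ≤ conjSubgroup g V :=
  fun u hu => mem_conjSubgroup.2 (h u hu)

theorem ConjLE.conj_le (h : ConjLE g U V) : conjSubgroup g⁻¹ U ≤ V := fun u hu => by
  simpa [mul_assoc] using h _ (mem_conjSubgroup_inv.1 hu)

theorem conjLE_out {x : G ⧸ V} (hx : ∀ u ∈ U, u • x = x) : ConjLE x.out U V := fun u hu =>
  conj_le_of_fixed hx (by rw [mem_conjSubgroup_inv]; simpa [mul_assoc] using hu)

theorem ConjLE.smul_mk (h : ConjLE g U V) {u : G} (hu : u ∈ U) :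
    u • (QuotientGroup.mk g : G ⧸ V) = QuotientGroup.mk g := by
  rw [MulAction.Quotient.smul_mk, eq_comm, QuotientGroup.eq]
  simpa [mul_assoc] using h u hu

theorem mk_mem_fixedCosets (hg : g ∈ H) (h : ConjLE g U V) :
    (QuotientGroup.mk g : G ⧸ V) ∈ fixedCosets H U V :=
  ⟨⟨g, hg, rfl⟩, fun _ hu => h.smul_mk hu⟩

theorem out_mem_of_mem_fixedCosets (hV : V ≤ H) {x : G ⧸ V} (hx : x ∈ fixedCosets H U V) :
    x.out ∈ H := by
  obtain ⟨h, hh, rfl⟩ := hx.1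
  obtain ⟨v, hv⟩ := QuotientGroup.mk_out_eq_mul V h
  rw [hv]
  exact H.mul_mem hh (hV v.2)

theorem out_eq_mul {x : G ⧸ V} (h : (QuotientGroup.mk g : G ⧸ V) = x) :
    ∃ v ∈ V, x.out = g * v := by
  obtain ⟨v, hv⟩ := QuotientGroup.mk_out_eq_mul V g
  exact ⟨v, v.2, by rw [← h, hv]⟩

theorem index_conjSubgroup (g : G) (V : Subgroup G) : (conjSubgroup g V).index = V.index :=
  Subgroup.index_comap_of_surjective _ (MulAut.conj g⁻¹).surjective

theorem ConjLE.index_dvd (h : ConjLE g U V) : V.index ∣ U.index := by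
  rw [← index_conjSubgroup g V]
  exact Subgroup.index_dvd_of_le h.le_conj

theorem Subgroup.eq_of_le_of_index_eq (h : U ≤ V) (hi : V.index = U.index) (h0 : U.index ≠ 0) :
    U = V := by
  refine le_antisymm h ?_
  rw [← Subgroup.relIndex_eq_one]
  have := Subgroup.relIndex_mul_index h
  rw [hi] at this
  exact Nat.eq_of_mul_eq_mul_right (Nat.pos_of_ne_zero h0) (by rw [this, one_mul])

/-- Finite index turns subconjugation between subgroups of equal index into conjugation. -/
theorem ConjLE.iff_of_index_eq (h : ConjLE g U V) (hi : V.index = U.index) (h0 : U.index ≠ 0)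
    (x : G) : x ∈ U ↔ g⁻¹ * x * g ∈ V := by
  have := Subgroup.eq_of_le_of_index_eq h.le_conj (by rw [index_conjSubgroup, hi]) h0
  rw [this, mem_conjSubgroup]

/-- The map `G/U → G/V`, `yU ↦ y g V`, for `U ≤ g V g⁻¹`. -/
def cosetMap (g : G) (h : ConjLE g U V) : G ⧸ U → G ⧸ V :=
  Quotient.map' (fun y => y * g) fun a b hab => by
    rw [QuotientGroup.leftRel_apply] at hab ⊢
    simpa [mul_assoc] using h _ hab

theorem cosetMap_mk (h : ConjLE g U V) (y : G) :
    cosetMap g h (QuotientGroup.mk y) = QuotientGroup.mk (y * g) := rfl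

theorem cosetMap_cosetMap (h : ConjLE g U V) (h' : ConjLE g' V W) (x : G ⧸ U) :
    cosetMap g' h' (cosetMap g h x) = cosetMap (g * g') (h.mul h') x := by
  induction x using QuotientGroup.induction_on with
  | H y => simp only [cosetMap_mk, mul_assoc]

theorem cosetMap_of_mem (h : ConjLE g U U) (hg : g ∈ U) (x : G ⧸ U) : cosetMap g h x = x := by
  induction x using QuotientGroup.induction_on with
  | H y => rw [cosetMap_mk, QuotientGroup.mk_mul_of_mem _ hg]

end ConjLE

/-! ### Label groups: tensor powers of ℤ^(B) in coordinates -/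

section Labels

variable {G : Type*} [Group G]

/-- The free abelian group on the maps `G/U → B`. -/
abbrev LabelGroup (B : Type*) (U : Subgroup G) : Type _ := (G ⧸ U → B) →₀ ℤ

namespace LabelGroup

variable {B : Type*} {U V W : Subgroup G} {g g' : G}

/-- The restriction map `A(V) → A(U)` along `G/U → G/V`, `yU ↦ y g V`. -/
noncomputable def res (g : G) (h : ConjLE g U V) : LabelGroup B V →+ LabelGroup B U :=
  Finsupp.mapDomain.addMonoidHom (fun b => b ∘ cosetMap g h)

theorem res_single (h : ConjLE g U V) (b : G ⧸ V → B) (k : ℤ) :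
    res g h (Finsupp.single b k) = Finsupp.single (b ∘ cosetMap g h) k :=
  Finsupp.mapDomain_single

theorem res_res (h : ConjLE g U V) (h' : ConjLE g' V W) (x : LabelGroup B W) :
    res g h (res g' h' x) = res (g * g') (h.mul h') x := by
  refine (Finsupp.mapDomain_comp).symm.trans ?_
  congr 1
  funext b
  funext y
  simp only [Function.comp_apply, cosetMap_cosetMap]

theorem res_of_mem (h : ConjLE g U U) (hg : g ∈ U) (x : LabelGroup B U) : res g h x = x := by
  have : (fun b : G ⧸ U → B => b ∘ cosetMap g h) = id := by
    funext b y
    simp only [Function.comp_apply, cosetMap_of_mem h hg, id]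
  change Finsupp.mapDomain _ _ = _
  rw [this, Finsupp.mapDomain_id]

theorem res_congr (h : ConjLE g U V) (h' : ConjLE g' U V) (hg : g = g') (x : LabelGroup B V) :
    res g h x = res g' h' x := by
  subst hg
  rfl

end LabelGroup

end Labels

/-! ### The Burnside congruences -/

section Congruences

variable {G : Type*} [Group G] [TopologicalSpace G] {H : Subgroup G}

theorem OpenSub.finite_quotient [IsTopologicalGroup G] [CompactSpace G] (U : OpenSub H) :
    Finite (G ⧸ U.1) :=
  Subgroup.quotient_finite_of_isOpen U.1 U.2.1

theorem OpenSub.index_ne_zero [IsTopologicalGroup G] [CompactSpace G] (U : OpenSub H) :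
    U.1.index ≠ 0 := by
  have := U.finite_quotient
  exact Subgroup.index_ne_zero_of_finite

attribute [local instance] OpenSub.finite_quotient Fintype.ofFinite

/-- The open subgroup generated by `U` and `g`, intersected with `H`. -/
def OpenSub.adjoin [IsTopologicalGroup G] (U : OpenSub H) (g : G) : OpenSub H :=
  ⟨(U.1 ⊔ Subgroup.zpowers g) ⊓ H,
    Subgroup.isOpen_mono (le_inf le_sup_left U.2.2) U.2.1, inf_le_right⟩

variable [IsTopologicalGroup G]

theorem OpenSub.le_adjoin (U : OpenSub H) (g : G) : U.1 ≤ (U.adjoin g).1 :=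
  le_inf le_sup_left U.2.2

theorem OpenSub.mem_adjoin (U : OpenSub H) {g : G} (hg : g ∈ H) : g ∈ (U.adjoin g).1 :=
  ⟨Subgroup.mem_sup_right (Subgroup.mem_zpowers g), hg⟩

theorem OpenSub.adjoin_le (U : OpenSub H) {g : G} {K : Subgroup G} (hU : U.1 ≤ K) (hg : g ∈ K) :
    (U.adjoin g).1 ≤ K :=
  inf_le_left.trans (sup_le hU (Subgroup.zpowers_le.2 hg))

variable [CompactSpace G] {B : Type*}

/-- The transfer `y ↦ ∑_{x ∈ N_D(U)/U} x · y`. -/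
noncomputable def LabelGroup.tr (D : Subgroup G) (U : OpenSub H) :
    LabelGroup B U.1 →+ LabelGroup B U.1 :=
  ∑ x : fixedCosets D U.1 U.1, LabelGroup.res x.1.out (conjLE_out x.2.2)

theorem LabelGroup.tr_apply (D : Subgroup G) (U : OpenSub H) (y : LabelGroup B U.1) :
    LabelGroup.tr D U y = ∑ x : fixedCosets D U.1 U.1, LabelGroup.res x.1.out (conjLE_out x.2.2) y :=
  by rw [LabelGroup.tr, AddMonoidHom.finsetSum_apply]

/-- The invariant families of labels that satisfy the Burnside congruences. -/
noncomputable def congruences (H : Subgroup G) (B : Type*) :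
    AddSubgroup (∀ U : OpenSub H, LabelGroup B U.1) where
  carrier := {a |
    (∀ (U V : OpenSub H) (g : G) (_ : g ∈ H) (h : ∀ x, x ∈ U.1 ↔ g⁻¹ * x * g ∈ V.1),
      LabelGroup.res g (ConjLE.of_iff h) (a V) = a U) ∧
    -- The fixed cosets (D/U)^U are N_D(U)/U. Solving for a ghost vector only uses D = H; allowing
    -- every D makes the condition inherited by the smaller group K in `restrict_mem_congruences`.
    ∀ (U : OpenSub H) (D : Subgroup G), U.1 ≤ D → D ≤ H → ∃ y,
      ∑ x : fixedCosets D U.1 U.1, LabelGroup.res 1 (ConjLE.one (U.le_adjoin x.1.out))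
        (a (U.adjoin x.1.out)) = LabelGroup.tr D U y}
  zero_mem' := ⟨fun _ _ _ _ _ => by simp, fun _ _ _ _ => ⟨0, by simp⟩⟩
  add_mem' := by
    rintro a b ⟨ha, ha'⟩ ⟨hb, hb'⟩
    refine ⟨fun U V g hg h => by simp only [Pi.add_apply, map_add, ha U V g hg h, hb U V g hg h],
      fun U D hU hD => ?_⟩
    obtain ⟨y, hy⟩ := ha' U D hU hD
    obtain ⟨z, hz⟩ := hb' U D hU hD
    exact ⟨y + z, by simp only [Pi.add_apply, map_add, Finset.sum_add_distrib, hy, hz]⟩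
  neg_mem' := by
    rintro a ⟨ha, ha'⟩
    refine ⟨fun U V g hg h => by simp only [Pi.neg_apply, map_neg, ha U V g hg h],
      fun U D hU hD => ?_⟩
    obtain ⟨y, hy⟩ := ha' U D hU hD
    exact ⟨-y, by simp only [Pi.neg_apply, map_neg, Finset.sum_neg_distrib, hy]⟩

/-- A fixed coset only gives that a conjugate of U lies in U; finite index makes it an equality, so
representatives normalise U. -/
theorem out_normalizes (U : OpenSub H) {D : Subgroup G} (x : fixedCosets D U.1 U.1) (y : G) :
    y ∈ U.1 ↔ x.1.out⁻¹ * y * x.1.out ∈ U.1 :=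
  (conjLE_out x.2.2).iff_of_index_eq rfl U.index_ne_zero y

/-- Right multiplication by `h⁻¹` on `N_D(U)/U`, for `h ∈ N_D(U)`. -/
def fixedCosetsMulRight {D U : Subgroup G} (h : G) (hD : h ∈ D)
    (hU : ∀ y, y ∈ U ↔ h⁻¹ * y * h ∈ U) : fixedCosets D U U ≃ fixedCosets D U U :=
  (cosetTwist h hU).subtypeEquiv fun c => by
    have hU' : ∀ y, y ∈ U ↔ h * y * h⁻¹ ∈ U := fun y => by rw [hU (h * y * h⁻¹)]; simp [mul_assoc]
    induction c using QuotientGroup.induction_on with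
    | H a =>
      change _ ↔ (QuotientGroup.mk (a * h⁻¹) : G ⧸ U) ∈ _
      refine and_congr ⟨?_, ?_⟩ (forall₂_congr fun u _ => ?_)
      · rintro ⟨d, hd, hda⟩
        refine ⟨d * h⁻¹, D.mul_mem hd (D.inv_mem hD), ?_⟩
        rw [QuotientGroup.eq] at hda ⊢
        simpa [mul_assoc] using (hU' _).1 hda
      · rintro ⟨d, hd, hda⟩
        refine ⟨d * h, D.mul_mem hd hD, ?_⟩
        rw [QuotientGroup.eq] at hda ⊢
        simpa [mul_assoc] using (hU _).1 hda
      · rw [MulAction.Quotient.smul_mk, MulAction.Quotient.smul_mk, QuotientGroup.eq,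
          QuotientGroup.eq, hU']
        simp [mul_assoc]

end Congruences

/-! ### Labelled fixed points of H-sets -/

section EquivariantLabels

attribute [local instance] OpenSub.finite_quotient Fintype.ofFinite

variable {G : Type*} [Group G] [TopologicalSpace G] {H : Subgroup G} [IsTopologicalGroup G]
  [CompactSpace G] {B : Type*}

/-- The points of the `H`-set `X` that are fixed by the elements of `U`. -/
def fixedPts (H : Subgroup G) (X : Type*) [MulAction H X] (U : Subgroup G) : Set X :=
  {p | ∀ h : H, (h : G) ∈ U → h • p = p}

variable {X : Type*} [MulAction H X] (lam : X → G → B)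

open Classical in
/-- The family of labelled fixed points of an `H`-set with labels in the maps `G → B`. -/
noncomputable def labelSum (U : OpenSub H) : LabelGroup B U.1 :=
  if _h : Finite (fixedPts H X U.1) then
    ∑ p : fixedPts H X U.1, Finsupp.single (fun q : G ⧸ U.1 => lam p q.out) 1
  else 0

variable {lam}

/-- The label of a point fixed by U is constant on cosets of U, so the arbitrary representatives
used in `labelSum` do not matter. -/
theorem label_mul_mem (hl : ∀ (h : H) p y, lam (h • p) y = lam p (y * h)) {U : OpenSub H} {p : X}
    (hp : p ∈ fixedPts H X U.1) (y u : G) (hu : u ∈ U.1) : lam p (y * u) = lam p y := by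
  rw [← hl ⟨u, U.2.2 hu⟩ p y, hp _ hu]

theorem res_label (hl : ∀ (h : H) p y, lam (h • p) y = lam p (y * h)) {U V : OpenSub H} {p : X}
    (hp : p ∈ fixedPts H X V.1) (h : H) (hg : ConjLE (h : G) U.1 V.1) :
    LabelGroup.res (h : G) hg (Finsupp.single (fun q : G ⧸ V.1 => lam p q.out) 1) =
      Finsupp.single (fun q : G ⧸ U.1 => lam (h • p) q.out) 1 := by
  rw [LabelGroup.res_single]
  congr 1
  funext q
  have h1 : (QuotientGroup.mk (q.out * h) : G ⧸ V.1) = cosetMap (h : G) hg q := by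
    rw [← cosetMap_mk hg, QuotientGroup.out_eq']
  obtain ⟨v, hv, hq⟩ := out_eq_mul h1
  rw [Function.comp_apply, hq, label_mul_mem hl hp _ _ hv, hl]

theorem smul_mem_fixedPts {U V : OpenSub H} {p : X} (hp : p ∈ fixedPts H X V.1) (h : H)
    (hg : ConjLE (h : G) U.1 V.1) : h • p ∈ fixedPts H X U.1 := fun k hk => by
  have := hp (h⁻¹ * k * h) (by simpa using hg _ hk)
  rw [mul_smul, mul_smul, inv_smul_eq_iff] at this
  exact this

/-- A labelled Cauchy–Frobenius formula. The group N_D(U)/U acts on X^U, and the points fixed by ⟨U,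
x⟩ are the points of X^U fixed by x. Counting pairs (x, p) with xp = p, weighted by the label of p,
gives the transfer of a sum of labels of orbit representatives. -/
theorem labelSum_mem_congruences (hl : ∀ (h : H) p y, lam (h • p) y = lam p (y * h))
    (hfin : ∀ U : OpenSub H, Finite (fixedPts H X U.1)) :
    labelSum lam ∈ congruences H B := by
  have hs : ∀ U : OpenSub H, labelSum lam U =
      ∑ p : fixedPts H X U.1, Finsupp.single (fun q : G ⧸ U.1 => lam p q.out) 1 :=
    fun U => dif_pos (hfin U)
  refine ⟨fun U V g hg h => ?_, fun U D hU hD => ?_⟩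
  · have h' : ∀ x, x ∈ V.1 ↔ g⁻¹⁻¹ * x * g⁻¹ ∈ U.1 := fun x => by
      rw [h]; simp [mul_assoc]
    let g' : H := ⟨g, hg⟩
    let e : fixedPts H X V.1 ≃ fixedPts H X U.1 :=
      { toFun := fun p => ⟨g' • p.1, smul_mem_fixedPts p.2 g' (ConjLE.of_iff h)⟩
        invFun := fun p => ⟨g'⁻¹ • p.1, smul_mem_fixedPts p.2 g'⁻¹ (ConjLE.of_iff h')⟩
        left_inv := fun p => Subtype.ext (inv_smul_smul _ _)
        right_inv := fun p => Subtype.ext (smul_inv_smul _ _) }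
    rw [hs, hs, map_sum]
    refine Fintype.sum_equiv e _ _ fun p => ?_
    exact res_label hl p.2 g' (ConjLE.of_iff h)
  · let N := fixedCosets D U.1 U.1
    let Y := fixedPts H X U.1
    let _ : DecidableEq Y := Classical.decEq Y
    let l : Y → LabelGroup B U.1 := fun p => Finsupp.single (fun q : G ⧸ U.1 => lam p q.out) 1
    have hND : ∀ c : N, c.1.out ∈ D := fun c => out_mem_of_mem_fixedCosets hU c.2
    let nH : N → H := fun c => ⟨c.1.out, hD (hND c)⟩
    let act : N → Y → Y := fun c p =>
      ⟨nH c • p.1, smul_mem_fixedPts p.2 (nH c) (conjLE_out c.2.2)⟩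
    have hact : ∀ (c : N) (h : H) (p : Y), (QuotientGroup.mk (h : G) : G ⧸ U.1) = c.1 →
        nH c • p.1 = h • p.1 := fun c h p hc => by
      obtain ⟨v, hv, hcv⟩ := out_eq_mul hc
      have : nH c = h * ⟨v, U.2.2 hv⟩ := Subtype.ext hcv
      rw [this, mul_smul, p.2 ⟨v, U.2.2 hv⟩ hv]
    -- The fixed points of the subgroup generated by U and a representative of c are rewritten as an
    -- indicator sum over X^U.
    have hleft : ∀ c : N, LabelGroup.res 1 (ConjLE.one (U.le_adjoin c.1.out))
        (labelSum lam (U.adjoin c.1.out)) = ∑ p : Y, if act c p = p then l p else 0 := by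
      intro c
      have hY : ∀ p : X, p ∈ fixedPts H X (U.adjoin c.1.out).1 ↔
          p ∈ Y ∧ nH c • p = p := by
        intro p
        constructor
        · intro hp
          exact ⟨fun h hh => hp h (U.le_adjoin _ hh), hp _ (U.mem_adjoin (nH c).2)⟩
        · rintro ⟨hp, hc⟩ h hh
          have : (U.adjoin c.1.out).1 ≤ (MulAction.stabilizer H p).map H.subtype := by
            refine U.adjoin_le (fun u hu => ?_) ?_
            · exact ⟨⟨u, U.2.2 hu⟩, hp _ hu, rfl⟩
            · exact ⟨nH c, hc, rfl⟩
          obtain ⟨k, hk, hkh⟩ := this hh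
          rw [← Subtype.ext hkh]
          exact hk
      rw [hs, map_sum, ← Finset.sum_filter, ← Finset.sum_subtype_eq_sum_filter]
      let e : fixedPts H X (U.adjoin c.1.out).1 ≃ {p : Y // act c p = p} :=
        { toFun := fun p => ⟨⟨p.1, ((hY _).1 p.2).1⟩, Subtype.ext ((hY _).1 p.2).2⟩
          invFun := fun p => ⟨p.1.1, (hY _).2 ⟨p.1.2, congrArg Subtype.val p.2⟩⟩
          left_inv := fun _ => rfl
          right_inv := fun _ => rfl }
      have : (Finset.subtype (fun p => act c p = p) (Finset.univ : Finset Y)) = Finset.univ := by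
        ext; simp
      rw [this]
      refine Fintype.sum_equiv e _ _ fun p => ?_
      refine (res_label hl p.2 1 (ConjLE.one (U.le_adjoin c.1.out))).trans ?_
      rw [one_smul]
      rfl
    let s : Setoid Y :=
      { r := fun p p' => ∃ h : H, (h : G) ∈ D ∧ (∀ y, y ∈ U.1 ↔ (h : G)⁻¹ * y * h ∈ U.1) ∧
          h • p.1 = p'.1
        iseqv :=
          { refl := fun p => ⟨1, D.one_mem, fun y => by simp, one_smul _ _⟩
            symm := by
              rintro p p' ⟨h, h1, h2, h3⟩
              refine ⟨h⁻¹, D.inv_mem h1, fun y => ?_, by rw [← h3, inv_smul_smul]⟩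
              rw [h2 (_ * _ * _)]
              simp [mul_assoc]
            trans := by
              rintro p p' p'' ⟨h, h1, h2, h3⟩ ⟨k, k1, k2, k3⟩
              refine ⟨k * h, D.mul_mem k1 h1, fun y => ?_, by rw [mul_smul, h3, k3]⟩
              rw [k2, h2]
              simp [mul_assoc] } }
    -- One label for each N_D(U)-orbit on X^U.
    refine ⟨∑ q : Quotient s, l q.out, ?_⟩
    have hright : ∀ c : N, LabelGroup.res c.1.out (conjLE_out c.2.2) (∑ q : Quotient s, l q.out) =
        ∑ p : Y, ∑ q : Quotient s, if act c q.out = p then l p else 0 := by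
      intro c
      rw [map_sum, Finset.sum_comm]
      refine Finset.sum_congr rfl fun q _ => ?_
      rw [Finset.sum_ite_eq, if_pos (Finset.mem_univ _)]
      exact res_label hl q.out.2 (nH c) (conjLE_out c.2.2)
    rw [LabelGroup.tr_apply, Finset.sum_congr rfl fun c _ => hleft c,
      Finset.sum_congr rfl fun c _ => hright c]
    refine Finset.sum_comm.trans (Eq.trans (Finset.sum_congr rfl fun p _ => ?_) Finset.sum_comm)
    refine Eq.trans ?_ Finset.sum_comm
    -- For a fixed p only its own orbit contributes. It remains to compare the stabiliser of p with
    -- the set of elements carrying the orbit representative to p.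
    refine Eq.symm ((Finset.sum_eq_single (Quotient.mk s p) ?_ ?_).trans ?_)
    rotate_left 2
    -- If h carries the representative to p, then right multiplication by h⁻¹ maps the transporter
    -- bijectively onto the stabiliser of p.
    · obtain ⟨h, h1, h2, h3⟩ := Quotient.mk_out (s := s) p
      let e : N ≃ N := fixedCosetsMulRight (h : G) h1 h2
      refine Fintype.sum_equiv e
        (fun c => if act c (Quotient.mk s p).out = p then l p else 0)
        (fun c => if act c p = p then l p else 0) fun c => ?_
      have h4 : (QuotientGroup.mk ((nH c * h⁻¹ : H) : G) : G ⧸ U.1) = (e c).1 := by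
        have : (QuotientGroup.mk (c.1.out) : G ⧸ U.1) = c.1 := QuotientGroup.out_eq' _
        change _ = cosetTwist (h : G) h2 c.1
        rw [← this]
        exact congrArg QuotientGroup.mk (by simp [nH])
      have h5 : act (e c) p = act c (Quotient.mk s p).out := Subtype.ext <| by
        change nH (e c) • p.1 = nH c • _
        rw [hact _ _ p h4, mul_smul, ← h3, inv_smul_smul]
      rw [h5]
    · intro q _ hq
      refine Finset.sum_eq_zero fun c _ => if_neg fun hc => hq ?_
      rw [← Quotient.out_eq q]
      refine Quotient.sound ⟨nH c, hND c, out_normalizes U c, congrArg Subtype.val hc⟩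
    · intro h
      exact absurd (Finset.mem_univ _) h

end EquivariantLabels

/-! ### Approximation modulo N and the triangular (Dwork) argument -/

section Dwork

attribute [local instance] OpenSub.finite_quotient Fintype.ofFinite

variable {G : Type*} [Group G] [TopologicalSpace G] {H : Subgroup G} [IsTopologicalGroup G]
  [CompactSpace G] {B : Type*}

theorem LabelGroup.nsmul_cancel {U : Subgroup G} {N : ℕ} (hN : N ≠ 0) {x y : LabelGroup B U}
    (h : N • x = N • y) : x = y := by
  ext b
  have := DFunLike.congr_fun h b
  simpa [hN] using this

theorem LabelGroup.eq_zero_of_forall_nsmul {U : Subgroup G} {x : LabelGroup B U}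
    (h : ∀ N : ℕ, N ≠ 0 → ∃ y : LabelGroup B U, x = N • y) : x = 0 := by
  ext b
  obtain ⟨y, hy⟩ := h ((x b).natAbs + 1) (Nat.succ_ne_zero _)
  refine Int.eq_zero_of_abs_lt_dvd (m := ((x b).natAbs + 1 : ℕ)) ⟨y b, ?_⟩ (by push_cast; simp)
  conv_lhs => rw [hy]
  simp

/-- Conjugation by an element of `N_D(U)` on `N_D(U)/U`. -/
theorem exists_conj_fixedCosets {U : OpenSub H} {D : Subgroup G} (hU : U.1 ≤ D)
    (c : fixedCosets D U.1 U.1) : ∃ e : fixedCosets D U.1 U.1 ≃ fixedCosets D U.1 U.1,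
      ∀ x, (QuotientGroup.mk (c.1.out * x.1.out * c.1.out⁻¹) : G ⧸ U.1) = (e x).1 := by
  have hc := out_mem_of_mem_fixedCosets hU c.2
  have hn := out_normalizes U c
  let f : fixedCosets D U.1 U.1 → fixedCosets D U.1 U.1 := fun x =>
    ⟨QuotientGroup.mk (c.1.out * x.1.out * c.1.out⁻¹), mk_mem_fixedCosets
      (D.mul_mem (D.mul_mem hc (out_mem_of_mem_fixedCosets hU x.2)) (D.inv_mem hc))
      (((conjLE_out c.2.2).mul (conjLE_out x.2.2)).mul
        (ConjLE.of_iff fun y => by rw [hn (_ * _ * _)]; simp [mul_assoc]))⟩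
  have hf : Function.Injective f := by
    intro x x' h
    have h1 := congrArg Subtype.val h
    change (QuotientGroup.mk _ : G ⧸ U.1) = QuotientGroup.mk _ at h1
    rw [QuotientGroup.eq, hn] at h1
    have h2 : x.1.out⁻¹ * x'.1.out ∈ U.1 := by
      simpa [mul_assoc] using h1
    apply Subtype.ext
    rw [← QuotientGroup.out_eq' x.1, ← QuotientGroup.out_eq' x'.1]
    exact QuotientGroup.eq.2 h2
  exact ⟨Equiv.ofBijective f (Finite.injective_iff_bijective.1 hf), fun x => rfl⟩

/-- Invariance is an equation in a free abelian group, so it may be checked modulo every N. A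
congruence for (U, D) needs only N = #N_D(U)/U, because for an invariant element w the multiple N w
is already the transfer of w. -/
theorem mem_congruences_of_nsmul {a : ∀ U : OpenSub H, LabelGroup B U.1}
    (h : ∀ N : ℕ, N ≠ 0 → ∃ a' ∈ congruences H B, ∃ y, a = a' + N • y) :
    a ∈ congruences H B := by
  have hinv : ∀ (U V : OpenSub H) (g : G) (_ : g ∈ H) (h : ∀ x, x ∈ U.1 ↔ g⁻¹ * x * g ∈ V.1),
      LabelGroup.res g (ConjLE.of_iff h) (a V) = a U := by
    intro U V g hg hgV
    rw [← sub_eq_zero]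
    refine LabelGroup.eq_zero_of_forall_nsmul fun N hN => ?_
    obtain ⟨a', ha', y, rfl⟩ := h N hN
    refine ⟨LabelGroup.res g (ConjLE.of_iff hgV) (y V) - y U, ?_⟩
    simp only [Pi.add_apply, Pi.smul_apply, map_add, map_nsmul, ha'.1 U V g hg hgV, smul_sub]
    abel
  refine ⟨hinv, fun U D hU hD => ?_⟩
  have hN : Fintype.card (fixedCosets D U.1 U.1) ≠ 0 := by
    have : Nonempty (fixedCosets D U.1 U.1) :=
      ⟨⟨QuotientGroup.mk 1, mk_mem_fixedCosets D.one_mem (ConjLE.one le_rfl)⟩⟩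
    exact Fintype.card_ne_zero
  obtain ⟨a', ha', y, rfl⟩ := h _ hN
  -- Since a and a' are invariant, so is N y; label groups are torsion-free, hence y is invariant
  -- too.
  have hy : ∀ (U V : OpenSub H) (g : G) (_ : g ∈ H) (h : ∀ x, x ∈ U.1 ↔ g⁻¹ * x * g ∈ V.1),
      LabelGroup.res g (ConjLE.of_iff h) (y V) = y U := by
    intro U V g hg hgV
    have := hinv U V g hg hgV
    simp only [Pi.add_apply, Pi.smul_apply, map_add, map_nsmul, ha'.1 U V g hg hgV] at this
    exact LabelGroup.nsmul_cancel hN (add_left_cancel this)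
  obtain ⟨z, hz⟩ := ha'.2 U D hU hD
  let w := ∑ x : fixedCosets D U.1 U.1, LabelGroup.res 1 (ConjLE.one (U.le_adjoin x.1.out))
        (y (U.adjoin x.1.out))
  -- Conjugation by c sends ⟨U, x⟩ to ⟨U, cxc⁻¹⟩ and so permutes the summands of w.
  have hw : ∀ c : fixedCosets D U.1 U.1, LabelGroup.res c.1.out (conjLE_out c.2.2) w = w := by
    intro c
    obtain ⟨e, he⟩ := exists_conj_fixedCosets hU c
    rw [map_sum]
    refine Fintype.sum_equiv e _ _ fun x => ?_
    have hcH : c.1.out ∈ H := hD (out_mem_of_mem_fixedCosets hU c.2)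
    have hxH : x.1.out ∈ H := hD (out_mem_of_mem_fixedCosets hU x.2)
    have heH : (e x).1.out ∈ H := hD (out_mem_of_mem_fixedCosets hU (e x).2)
    obtain ⟨v, hv, hev⟩ := out_eq_mul (he x)
    have hn := out_normalizes U c
    have hn' : ∀ y, y ∈ U.1 ↔ c.1.out * y * c.1.out⁻¹ ∈ U.1 := fun y => by
      rw [hn (c.1.out * y * c.1.out⁻¹)]; simp [mul_assoc]
    have hconj : ∀ t, t ∈ (U.adjoin (e x).1.out).1 ↔
        c.1.out⁻¹ * t * c.1.out ∈ (U.adjoin x.1.out).1 := by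
      have h1 : (U.adjoin (e x).1.out).1 ≤ conjSubgroup c.1.out (U.adjoin x.1.out).1 := by
        refine U.adjoin_le (fun u hu => mem_conjSubgroup.2 (U.le_adjoin _ ((hn u).1 hu))) ?_
        rw [mem_conjSubgroup, hev]
        have : c.1.out⁻¹ * (c.1.out * x.1.out * c.1.out⁻¹ * v) * c.1.out =
          x.1.out * (c.1.out⁻¹ * v * c.1.out) := by group
        rw [this]
        exact Subgroup.mul_mem _ (U.mem_adjoin hxH) (U.le_adjoin _ ((hn v).1 hv))
      have h2 : (U.adjoin x.1.out).1 ≤ conjSubgroup c.1.out⁻¹ (U.adjoin (e x).1.out).1 := by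
        refine U.adjoin_le (fun u hu => mem_conjSubgroup_inv.2 (U.le_adjoin _ ((hn' u).1 hu))) ?_
        rw [mem_conjSubgroup_inv, ← mul_inv_cancel_right (c.1.out * x.1.out * c.1.out⁻¹) v, ← hev]
        exact Subgroup.mul_mem _ (U.mem_adjoin heH) (U.le_adjoin _ (U.1.inv_mem hv))
      intro t
      refine ⟨fun ht => mem_conjSubgroup.1 (h1 ht), fun ht => ?_⟩
      have := mem_conjSubgroup_inv.1 (h2 ht)
      simpa [mul_assoc] using this
    rw [LabelGroup.res_res, ← hy _ _ _ hcH hconj, LabelGroup.res_res]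
    exact LabelGroup.res_congr _ _ (by simp) _
  -- z accounts for a', and w for N y, since its transfer is N w.
  refine ⟨z + w, ?_⟩
  have h1 : LabelGroup.tr D U w = Fintype.card (fixedCosets D U.1 U.1) • w := by
    rw [LabelGroup.tr_apply, Finset.sum_congr rfl fun c _ => hw c, Finset.sum_const,
      Finset.card_univ]
  rw [map_add, ← hz, h1]
  simp only [Pi.add_apply, Pi.smul_apply, map_add, map_nsmul, Finset.sum_add_distrib, w,
    Finset.smul_sum]

/-- The distinguished subgroups, as open subgroups of `H`. -/
abbrev ClassReps.openSub (S : ClassReps H) (V : S.reps) : OpenSub H :=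
  ⟨V.1, S.isOpen _ V.2, S.le _ V.2⟩

theorem ClassReps.exists_conj (S : ClassReps H) (U : OpenSub H) :
    ∃ V : S.reps, ∃ h ∈ H, ∀ x, x ∈ U.1 ↔ h⁻¹ * x * h ∈ V.1 := by
  obtain ⟨V, ⟨hV, h, hh, hU⟩, -⟩ := S.existsUnique U.1 U.2.1 U.2.2
  exact ⟨⟨V, hV⟩, h, hh, fun x => by rw [hU, mem_conjSubgroup]⟩

theorem index_eq_of_conj {U V : Subgroup G} {g : G} (h : ∀ x, x ∈ U ↔ g⁻¹ * x * g ∈ V) :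
    U.index = V.index := by
  have : U = conjSubgroup g V := by ext x; rw [h, mem_conjSubgroup]
  rw [this, index_conjSubgroup]

/-- Elements satisfying the congruences can be expanded along a triangular map. -/
theorem exists_eq_of_triangular (S : ClassReps H)
    (ω : (∀ V : S.reps, LabelGroup B V.1) → ∀ U : OpenSub H, LabelGroup B U.1)
    (hω : ∀ n, ω n ∈ congruences H B)
    (htri : ∀ n n' (U : S.reps), (∀ V : S.reps, V.1.index < U.1.index → n V = n' V) →
      ω n (S.openSub U) - ω n' (S.openSub U) = LabelGroup.tr H (S.openSub U) (n U - n' U))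
    {a : ∀ U : OpenSub H, LabelGroup B U.1} (ha : a ∈ congruences H B) : ∃ n, ω n = a := by
  classical
  -- The congruence for the difference b with D = H: a nontrivial x makes ⟨U, x⟩ of smaller index
  -- than U, where b already vanishes. Only the trivial coset survives, so b at U is itself a
  -- transfer.
  have key : ∀ n (U : S.reps), (∀ V : S.reps, V.1.index < U.1.index →
      ω n (S.openSub V) = a (S.openSub V)) → ∃ y, a (S.openSub U) - ω n (S.openSub U) =
        LabelGroup.tr H (S.openSub U) y := by
    intro n U hn
    have hb := sub_mem ha (hω n)
    have h0 : ∀ W : OpenSub H, W.1.index < U.1.index → (a - ω n) W = 0 := by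
      intro W hW
      obtain ⟨V, h, hh, hV⟩ := S.exists_conj W
      rw [← hb.1 W (S.openSub V) h hh hV, Pi.sub_apply,
        hn V (by rwa [← index_eq_of_conj hV]), sub_self, map_zero]
    obtain ⟨y, hy⟩ := hb.2 (S.openSub U) H (S.openSub U).2.2 le_rfl
    refine ⟨y, hy ▸ ?_⟩
    have hUU : ∀ g ∈ U.1, ((S.openSub U).adjoin g) = S.openSub U := fun g hg =>
      Subtype.ext (le_antisymm (OpenSub.adjoin_le _ le_rfl hg) (OpenSub.le_adjoin _ _))
    have h1 : (QuotientGroup.mk (1 : G) : G ⧸ U.1).out ∈ U.1 := by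
      have := QuotientGroup.out_eq' (QuotientGroup.mk (1 : G) : G ⧸ U.1)
      rw [eq_comm, QuotientGroup.eq] at this
      simpa using this
    have hres : ∀ (W : OpenSub H) (hW : W = S.openSub U) (h : (S.openSub U).1 ≤ W.1),
        LabelGroup.res 1 (ConjLE.one h) ((a - ω n) W) = (a - ω n) (S.openSub U) := by
      rintro _ rfl h
      exact LabelGroup.res_of_mem _ (one_mem _) _
    rw [Finset.sum_eq_single ⟨QuotientGroup.mk (1 : G),
      mk_mem_fixedCosets H.one_mem (ConjLE.one le_rfl)⟩, hres _ (hUU _ h1) (OpenSub.le_adjoin _ _), Pi.sub_apply]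
    · intro x _ hx
      rw [h0, map_zero]
      refine lt_of_le_of_ne (Nat.le_of_dvd (Nat.pos_of_ne_zero (S.openSub U).index_ne_zero)
        (Subgroup.index_dvd_of_le (OpenSub.le_adjoin (S.openSub U) _))) fun hi => hx ?_
      have h2 := Subgroup.eq_of_le_of_index_eq (OpenSub.le_adjoin (S.openSub U) x.1.out) hi
        (S.openSub U).index_ne_zero
      have h3 : x.1.out ∈ U.1 := by
        refine le_of_eq h2.symm ?_
        exact OpenSub.mem_adjoin _ (out_mem_of_mem_fixedCosets (S.openSub U).2.2 x.2)
      apply Subtype.ext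
      rw [← QuotientGroup.out_eq' x.1, eq_comm, QuotientGroup.eq]
      simpa using h3
    · intro h
      simp at h
  let step : (∀ V : S.reps, LabelGroup B V.1) → ∀ U : S.reps, LabelGroup B U.1 := fun n U =>
    if h : ∃ y, a (S.openSub U) - ω n (S.openSub U) = LabelGroup.tr H (S.openSub U) y
    then h.choose else 0
  -- The recursion knows only coordinates of smaller index. The others are set to 0, so that ω can
  -- be evaluated on a partial solution.
  let trunc : (U : S.reps) → (∀ V : S.reps, V.1.index < U.1.index → LabelGroup B V.1) →
      ∀ V : S.reps, LabelGroup B V.1 := fun U F V =>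
    if h : V.1.index < U.1.index then F V h else 0
  have wf : WellFounded (fun V U : S.reps => V.1.index < U.1.index) :=
    (measure fun V : S.reps => V.1.index).wf
  let F : ∀ U : S.reps, LabelGroup B U.1 := wf.fix fun U rec => step (trunc U rec) U
  have hF : ∀ U, F U = step (trunc U fun V _ => F V) U := fun U => wf.fix_eq _ U
  have ht : ∀ U V : S.reps, V.1.index < U.1.index → trunc U (fun V _ => F V) V = F V :=
    fun U V h => dif_pos h
  have hmain : ∀ U : S.reps, ω F (S.openSub U) = a (S.openSub U) := by
    intro U
    induction U using wf.induction with
    | _ U ih =>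
      obtain ⟨y, hy⟩ := key (trunc U fun V _ => F V) U fun V hV => by
        rw [← ih V hV, ← sub_eq_zero, htri _ F V fun W hW => ht U W (hW.trans hV), ht U V hV,
          sub_self, map_zero]
      have hst : a (S.openSub U) - ω (trunc U fun V _ => F V) (S.openSub U) =
          LabelGroup.tr H (S.openSub U) (F U) := by
        rw [hF]
        have h : ∃ y, a (S.openSub U) - ω (trunc U fun V _ => F V) (S.openSub U) =
          LabelGroup.tr H (S.openSub U) y := ⟨y, hy⟩
        have h' : step (trunc U fun V _ => F V) U = h.choose := dif_pos h
        rw [h']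
        exact h.choose_spec
      have h2 := htri F (trunc U fun V _ => F V) U fun V hV => (ht U V hV).symm
      -- The truncated family vanishes at U itself, so triangularity changes the ghost component by
      -- exactly the transfer of F U.
      have h3 : trunc U (fun V _ => F V) U = 0 := dif_neg (lt_irrefl _)
      rw [h3, sub_zero, ← hst] at h2
      exact sub_left_injective h2
  refine ⟨F, funext fun U => ?_⟩
  obtain ⟨V, h, hh, hV⟩ := S.exists_conj U
  rw [← ha.1 U (S.openSub V) h hh hV, ← (hω F).1 U (S.openSub V) h hh hV, hmain]

end Dwork

/-! ### The norm maps occurring in the ghost map -/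

section Norm

variable {G : Type*} [Group G] {R M : Type*} [CommRing R] [AddCommGroup M] [Module R M]
  {U U' V : Subgroup G} {σ : G ⧸ V → G} (hσ : Function.RightInverse σ QuotientGroup.mk)

/-- The bijection `G/V × V/U^g ≃ G/U`, `(xV, s U^g) ↦ σ(xV) s g⁻¹ U`. -/
def normEquiv (g : G) (h : ConjLE g U V) :
    (G ⧸ V) × (V ⧸ (conjSubgroup g⁻¹ U).subgroupOf V) ≃ G ⧸ U :=
  (Subgroup.quotientEquivProdOfLE' h.conj_le σ hσ).symm.trans (cosetTwist g (mem_iff_conj_mem g U))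

theorem normEquiv_mk (g : G) (h : ConjLE g U V) (x : G ⧸ V) (s : V) :
    normEquiv hσ g h (x, QuotientGroup.mk s) = QuotientGroup.mk (σ x * s * g⁻¹) := rfl

theorem finite_normFiber [Finite (G ⧸ U)] (g : G) (h : ConjLE g U V) :
    Finite (V ⧸ (conjSubgroup g⁻¹ U).subgroupOf V) :=
  Finite.of_injective (fun y => normEquiv (σ := Quotient.out) QuotientGroup.out_eq' g h
    (QuotientGroup.mk 1, y)) fun _ _ hy => (Prod.ext_iff.1 ((normEquiv _ g h).injective hy)).2

/-- The term `g · f_{G/V}(n^{⊗ V/U^g})` of the ghost map. -/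
noncomputable def tensorNorm (g : G) (h : ConjLE g U V) (n : TPow R M (G ⧸ V)) : TPow R M (G ⧸ U) :=
  TPow.twist g (mem_iff_conj_mem g U) (TPow.cosetIso h.conj_le σ hσ (TPow.power _ n))

theorem norm_eq_reindex (g : G) (h : ConjLE g U V) (n : TPow R M (G ⧸ V)) :
    tensorNorm hσ g h n = TPow.reindex R (normEquiv hσ g h) (TPow.power _ n) :=
  TPow.reindex_reindex _ _ _

theorem map_norm {R' M' : Type*} [CommRing R'] [AddCommGroup M'] [Module R' M'] (α : R →+* R')
    (f : M →ₛₗ[α] M') (g : G) (h : ConjLE g U V) (n : TPow R M (G ⧸ V)) :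
    TPow.map α f _ (tensorNorm hσ g h n) = tensorNorm hσ g h (TPow.map α f _ n) := by
  simp only [norm_eq_reindex, TPow.map_reindex, TPow.map_power]

/-- The norm depends on g only through its coset modulo V, compatibly with twisting. The element v =
(kg)⁻¹g' of V gives the bijection between the two fibres V/U^g and V/U'^{g'} along which the equal
copies of `n` are permuted. -/
theorem twist_norm [Finite (G ⧸ U)] {g g' k : G} (h : ConjLE g U V) (h' : ConjLE g' U' V)
    (hk : ∀ x, x ∈ U' ↔ k⁻¹ * x * k ∈ U)
    (hg : (QuotientGroup.mk (k * g) : G ⧸ V) = QuotientGroup.mk g') (n : TPow R M (G ⧸ V)) :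
    TPow.twist k hk (tensorNorm hσ g h n) = tensorNorm hσ g' h' n := by
  have := finite_normFiber g h
  rw [QuotientGroup.eq] at hg
  let v : V := ⟨_, hg⟩
  let θ : V ⧸ (conjSubgroup g⁻¹ U).subgroupOf V ≃ V ⧸ (conjSubgroup g'⁻¹ U').subgroupOf V :=
    cosetTwist v⁻¹ fun x => by
      rw [Subgroup.mem_subgroupOf, Subgroup.mem_subgroupOf, mem_conjSubgroup_inv,
        mem_conjSubgroup_inv, hk]
      simp [v, mul_assoc]
  rw [norm_eq_reindex, norm_eq_reindex, TPow.twist, TPow.reindex_reindex]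
  refine TPow.reindex_power_congr n θ _ _ fun x y => ?_
  induction y using QuotientGroup.induction_on with
  | H s =>
    change QuotientGroup.mk (σ x * s * g⁻¹ * k⁻¹) = QuotientGroup.mk (σ x * (s * v⁻¹⁻¹ : V) * g'⁻¹)
    congr 1
    simp [v, mul_assoc]

theorem norm_congr [Finite (G ⧸ U)] {g g' : G} (h : ConjLE g U V) (h' : ConjLE g' U V)
    (hg : (QuotientGroup.mk g : G ⧸ V) = QuotientGroup.mk g') (n : TPow R M (G ⧸ V)) :
    tensorNorm hσ g h n = tensorNorm hσ g' h' n := by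
  have h1 := twist_norm hσ (k := 1) h h' (fun x => by simp) (by simpa using hg) n
  rw [← h1, TPow.twist, TPow.reindex_of_eq]
  intro x
  induction x using QuotientGroup.induction_on with
  | H y =>
    change QuotientGroup.mk (y * 1⁻¹) = _
    simp

/-- The fibre V/V^g is a single point, so no power is taken. This identifies the diagonal of the
ghost map with the transfer. -/
theorem norm_self {g : G} (h : ConjLE g V V) (hg : ∀ x, x ∈ V ↔ g⁻¹ * x * g ∈ V)
    (n : TPow R M (G ⧸ V)) : tensorNorm hσ g h n = TPow.twist g hg n := by
  have hV : (conjSubgroup g⁻¹ V).subgroupOf V = ⊤ := by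
    rw [eq_top_iff]
    intro x _
    rw [Subgroup.mem_subgroupOf, mem_conjSubgroup_inv, hg]
    simp [mul_assoc]
  have : Subsingleton (V ⧸ (conjSubgroup g⁻¹ V).subgroupOf V) := by
    rw [hV]
    exact QuotientGroup.subsingleton_quotient_top
  let _ : Unique (V ⧸ (conjSubgroup g⁻¹ V).subgroupOf V) := uniqueOfSubsingleton
    (QuotientGroup.mk 1)
  have key := TPow.reindex_power_unique n ((normEquiv hσ g h).trans (cosetTwist g hg).symm)
    fun x y => by
      induction y using QuotientGroup.induction_on with
      | H s =>
        change QuotientGroup.mk (σ x * s * g⁻¹ * g) = x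
        rw [inv_mul_cancel_right, QuotientGroup.mk_mul_of_mem _ s.2]
        exact hσ x
  rw [norm_eq_reindex, TPow.twist]
  conv_rhs => rw [← key]
  rw [TPow.reindex_reindex]
  congr 2
  ext p
  simp

theorem exists_norm_add_nsmul [Finite (G ⧸ U)] {g : G} (h : ConjLE g U V) (N : ℕ)
    (n m : TPow R M (G ⧸ V)) : ∃ z, tensorNorm hσ g h (n + N • m) = tensorNorm hσ g h n + N • z := by
  have := finite_normFiber g h
  obtain ⟨z, hz⟩ := TPow.exists_power_add_nsmul
    (Y := V ⧸ (conjSubgroup g⁻¹ U).subgroupOf V) N n m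
  refine ⟨TPow.reindex R (normEquiv hσ g h) z, ?_⟩
  rw [norm_eq_reindex, hz, map_add, map_nsmul, norm_eq_reindex]

end Norm

/-! ### The coinduced H-sets and their fixed points -/

section CoinducedSet

/-- The `H`-set of `I`-valued functions on the cosets of `V` in `H`. -/
def CosetFun {G : Type*} [Group G] (H V : Subgroup G) (I : Type*) [Inhabited I] : Type _ :=
  {p : (G ⧸ V) × (G → I) // (∃ h ∈ H, (QuotientGroup.mk h : G ⧸ V) = p.1) ∧
    -- A point is a coset together with a function on that coset. Prescribing the values elsewhere
    -- avoids a dependent type and keeps equality of points pointwise.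
    ∀ g : G, (QuotientGroup.mk g : G ⧸ V) ≠ p.1 → p.2 g = default}

namespace CosetFun

variable {G : Type*} [Group G] {H V : Subgroup G} {I : Type*} [Inhabited I]

instance : MulAction H (CosetFun H V I) where
  smul h p := ⟨((h : G) • p.1.1, fun g => p.1.2 ((h : G)⁻¹ * g)), by
    obtain ⟨⟨k, hk, hp⟩, hs⟩ := p.2
    refine ⟨⟨h * k, H.mul_mem h.2 hk, by rw [← hp]; rfl⟩, fun g hg => hs _ fun h' => hg ?_⟩
    rw [← h', MulAction.Quotient.smul_mk, smul_eq_mul, mul_inv_cancel_left]⟩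
  one_smul p := Subtype.ext <| Prod.ext (one_smul G p.1.1) <| funext fun g =>
    congrArg p.1.2 (by simp)
  mul_smul h k p := Subtype.ext <| Prod.ext (mul_smul (h : G) (k : G) p.1.1) <| funext fun g =>
    congrArg p.1.2 (by simp [mul_assoc])

theorem smul_fst (h : H) (p : CosetFun H V I) : (h • p).1.1 = (h : G) • p.1.1 := rfl

theorem smul_snd (h : H) (p : CosetFun H V I) (g : G) :
    (h • p).1.2 g = p.1.2 ((h : G)⁻¹ * g) := rfl

/-- The labels of the points of `CosetFun` that are given by a family of functions on `G/V`. -/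
def label {B : Type*} (σ : G ⧸ V → G) (b : I → G ⧸ V → B) (p : CosetFun H V I) (y : G) : B :=
  b (p.1.2 (y⁻¹ * σ (y • p.1.1))) (y • p.1.1)

/-- If x is the coset of p, then y⁻¹σ(yx) lies in x, so the label reads a meaningful value of the
function of p. Both this element and yx are unchanged when (hp, y) is replaced by (p, yh). -/
theorem label_smul {B : Type*} (σ : G ⧸ V → G) (b : I → G ⧸ V → B) (h : H) (p : CosetFun H V I)
    (y : G) : label σ b (h • p) y = label σ b p (y * h) := by
  simp only [label, smul_fst, smul_snd, mul_inv_rev, mul_assoc, mul_smul]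

theorem inv_mul_out_mem {x : G ⧸ V} {g : G}
    (hg : (QuotientGroup.mk g : G ⧸ V) = x) : g⁻¹ * x.out ∈ V := by
  rw [← QuotientGroup.eq, hg, QuotientGroup.out_eq']

open Classical in
/-- The fixed points of `U` on `CosetFun` in terms of functions on `V/U^x`. -/
noncomputable def ofFixed {U : Subgroup G} (p : Σ x : fixedCosets H U V,
      (V ⧸ (conjSubgroup x.1.out⁻¹ U).subgroupOf V → I)) : CosetFun H V I :=
  ⟨(p.1.1, fun g => if h : (QuotientGroup.mk g : G ⧸ V) = p.1.1 then
      p.2 (QuotientGroup.mk ⟨g⁻¹ * p.1.1.out, inv_mul_out_mem h⟩) else default),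
    p.1.2.1, fun _ hg => dif_neg hg⟩

theorem ofFixed_snd_of_ne {U : Subgroup G} (x : fixedCosets H U V)
    (κ : V ⧸ (conjSubgroup x.1.out⁻¹ U).subgroupOf V → I) {g : G}
    (hg : (QuotientGroup.mk g : G ⧸ V) ≠ x.1) : (ofFixed ⟨x, κ⟩).1.2 g = default :=
  dif_neg hg

/-- The map s ↦ x s⁻¹ turns the functions on the coset xV that are invariant under left
multiplication by U into functions on V/U^x; this is why the inverse of s appears. -/
theorem ofFixed_snd {U : Subgroup G} (x : fixedCosets H U V)
    (κ : V ⧸ (conjSubgroup x.1.out⁻¹ U).subgroupOf V → I) (u : G) (hu : u ∈ U) (s : V) :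
    (ofFixed ⟨x, κ⟩).1.2 (u * x.1.out * (s : G)⁻¹) = κ (QuotientGroup.mk s) := by
  have h : (QuotientGroup.mk (u * x.1.out * (s : G)⁻¹) : G ⧸ V) = x.1 := by
    rw [QuotientGroup.mk_mul_of_mem _ (V.inv_mem s.2)]
    change u • (QuotientGroup.mk x.1.out : G ⧸ V) = _
    rw [QuotientGroup.out_eq', x.2.2 u hu]
  refine (dif_pos h).trans (congrArg κ ?_)
  rw [QuotientGroup.eq, Subgroup.mem_subgroupOf, mem_conjSubgroup_inv]
  simpa [mul_assoc] using hu

theorem ofFixed_mem {U : Subgroup G} (p : Σ x : fixedCosets H U V,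
      (V ⧸ (conjSubgroup x.1.out⁻¹ U).subgroupOf V → I)) : ofFixed p ∈ fixedPts H _ U := by
  obtain ⟨x, κ⟩ := p
  intro h hh
  refine Subtype.ext (Prod.ext (x.2.2 h hh) (funext fun g => ?_))
  rw [smul_snd]
  by_cases hg : (QuotientGroup.mk g : G ⧸ V) = x.1
  · let s : V := ⟨g⁻¹ * x.1.out, inv_mul_out_mem hg⟩
    have h1 : g = 1 * x.1.out * (s : G)⁻¹ := by simp [s]
    have h2 : (h : G)⁻¹ * g = (h : G)⁻¹ * x.1.out * (s : G)⁻¹ := by simp [s, mul_assoc]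
    rw [h2, ofFixed_snd _ _ _ (U.inv_mem hh)]
    conv_rhs => rw [h1, ofFixed_snd _ _ _ U.one_mem]
  · refine Eq.trans (ofFixed_snd_of_ne _ _ fun h' => hg ?_) (ofFixed_snd_of_ne _ _ hg).symm
    rw [← x.2.2 h hh, ← h', MulAction.Quotient.smul_mk, smul_eq_mul, mul_inv_cancel_left]

theorem mem_fixedPts_iff {U : Subgroup G} (hU : U ≤ H) (p : CosetFun H V I) :
    p ∈ fixedPts H _ U ↔ ∀ u ∈ U, u • p.1.1 = p.1.1 ∧ ∀ g, p.1.2 (u * g) = p.1.2 g := by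
  refine ⟨fun hp u hu => ⟨?_, fun g => ?_⟩, fun hp h hh => ?_⟩
  · exact congrArg (fun q => q.1.1) (hp ⟨u, hU hu⟩ hu)
  · have := congrArg (fun q => q.1.2 (u * g)) (hp ⟨u, hU hu⟩ hu)
    rw [← this, smul_snd, inv_mul_cancel_left]
  · refine Subtype.ext (Prod.ext (hp h hh).1 (funext fun g => ?_))
    exact (hp _ (U.inv_mem hh)).2 g

/-- The parametrization of the fixed points of `U` on `CosetFun`. -/
noncomputable def fixedEquiv {U : Subgroup G} (hU : U ≤ H) : (Σ x : fixedCosets H U V,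
      (V ⧸ (conjSubgroup x.1.out⁻¹ U).subgroupOf V → I)) ≃ fixedPts H (CosetFun H V I) U :=
  Equiv.ofBijective (fun p => ⟨ofFixed p, ofFixed_mem p⟩) (by
    constructor
    · rintro ⟨x, κ⟩ ⟨x', κ'⟩ h
      have h0 : ofFixed ⟨x, κ⟩ = ofFixed ⟨x', κ'⟩ := congrArg Subtype.val h
      obtain rfl : x = x' := Subtype.ext (congrArg (fun p => p.1.1) h0)
      congr 1
      funext s
      induction s using QuotientGroup.induction_on with
      | H s => rw [← ofFixed_snd x κ 1 U.one_mem, ← ofFixed_snd x κ' 1 U.one_mem, h0]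
    · rintro ⟨p, hp⟩
      have hp' := (mem_fixedPts_iff hU p).1 hp
      let x : fixedCosets H U V := ⟨p.1.1, p.2.1, fun u hu => (hp' u hu).1⟩
      -- Invariance of the function of p under U makes this independent of the representative s.
      let κ : V ⧸ (conjSubgroup x.1.out⁻¹ U).subgroupOf V → I :=
        Quotient.lift (fun s : V => p.1.2 (x.1.out * (s : G)⁻¹)) fun s s' h => by
          replace h := QuotientGroup.leftRel_apply.1 h
          rw [Subgroup.mem_subgroupOf, mem_conjSubgroup_inv] at h
          rw [← (hp' _ h).2 (x.1.out * (s' : G)⁻¹)]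
          simp [mul_assoc]
      have hκ : ∀ s : V, κ (QuotientGroup.mk s) = p.1.2 (x.1.out * (s : G)⁻¹) := fun _ => rfl
      refine ⟨⟨x, κ⟩, Subtype.ext (Subtype.ext (Prod.ext rfl (funext fun g => ?_)))⟩
      by_cases hg : (QuotientGroup.mk g : G ⧸ V) = x.1
      · have h1 : g = 1 * x.1.out * ((⟨g⁻¹ * x.1.out, inv_mul_out_mem hg⟩ : V) : G)⁻¹ := by simp
        conv_lhs => rw [h1]
        refine (ofFixed_snd _ _ _ U.one_mem _).trans ((hκ _).trans ?_)
        simp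
      · exact (ofFixed_snd_of_ne _ _ hg).trans (p.2.2 g hg).symm)

end CosetFun

end CoinducedSet

/-! ### Finiteness of the sums in the ghost map -/

section Finiteness

variable {G : Type v} [Group G] [TopologicalSpace G] {H : Subgroup G} [IsTopologicalGroup G]
  [CompactSpace G]

theorem Subgroup.finite_setOf_le {N : Subgroup G} [Finite (G ⧸ N)] :
    Finite {V : Subgroup G // N ≤ V} := by
  refine Finite.of_injective (β := Set (G ⧸ N)) (fun V => {x | ∃ g ∈ V.1, QuotientGroup.mk g = x})
    fun V V' h => Subtype.ext ?_
  have key : ∀ W : {V : Subgroup G // N ≤ V}, ∀ g : G,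
      (QuotientGroup.mk g : G ⧸ N) ∈ {x | ∃ g ∈ W.1, (QuotientGroup.mk g : G ⧸ N) = x} ↔
        g ∈ W.1 := by
    refine fun W g => ⟨?_, fun hg => ⟨g, hg, rfl⟩⟩
    rintro ⟨k, hk, hkg⟩
    have := W.1.mul_mem hk (W.2 (QuotientGroup.eq.1 hkg))
    rwa [mul_inv_cancel_left] at this
  ext g
  rw [← key V, ← key V']
  exact iff_of_eq (congrArg (fun s : Set (G ⧸ N) => (QuotientGroup.mk g : G ⧸ N) ∈ s) h)

theorem ConjLE.normalCore_le {g : G} {U V : Subgroup G} (h : ConjLE g U V) :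
    U.normalCore ≤ V := fun x hx => by
  have := h _ (hx g)
  simpa [mul_assoc] using this

theorem finite_normalCore_quotient (U : OpenSub H) : Finite (G ⧸ U.1.normalCore) := by
  have : Finite (G ⧸ U.1) := U.finite_quotient
  have : U.1.FiniteIndex := Subgroup.finiteIndex_of_finite_quotient
  exact Subgroup.finite_quotient_of_finiteIndex

/-- If U fixes a coset of V, then V contains the normal core of U. That core has finite index, so
only finitely many V occur, each with finitely many cosets. -/
theorem finite_ghostIndex (c : WittChoice H) (U : OpenSub H) : Finite (GhostIndex c U.1) := by
  have := finite_normalCore_quotient U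
  have := Subgroup.finite_setOf_le (N := U.1.normalCore)
  have : ∀ V : {V : Subgroup G // U.1.normalCore ≤ V}, Finite (G ⧸ V.1) := fun V => by
    have : V.1.FiniteIndex := by
      have : U.1.normalCore.FiniteIndex := Subgroup.finiteIndex_of_finite_quotient
      exact Subgroup.finiteIndex_of_le V.2
    exact Subgroup.finite_quotient_of_finiteIndex
  refine Finite.of_injective (β := Σ V : {V : Subgroup G // U.1.normalCore ≤ V}, G ⧸ V.1)
    (fun i => ⟨⟨i.1.1, (conjLE_out i.2.2.2).normalCore_le⟩, i.2.1⟩) ?_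
  rintro ⟨⟨V, hV⟩, x⟩ ⟨⟨V', hV'⟩, x'⟩ h
  obtain rfl : V = V' := congrArg (fun p => p.1.1) h
  congr 1
  exact Subtype.ext (eq_of_heq (Sigma.mk.inj h).2)

end Finiteness

/-! ### Ghost vectors of families of subgroups, and the image over ℤ -/

section FamilySum

attribute [local instance] OpenSub.finite_quotient Fintype.ofFinite

variable {G : Type v} [Group G] [TopologicalSpace G] {H : Subgroup G} [IsTopologicalGroup G]
  [CompactSpace G]

section
variable {R M : Type*} [CommRing R] [AddCommGroup M] [Module R M]

/-- The sum of the norms of a family of tensors. -/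
noncomputable def familySum {ι : Type v} (V : ι → OpenSub H) {σ : ∀ i, G ⧸ (V i).1 → G}
    (hσ : ∀ i, Function.RightInverse (σ i) QuotientGroup.mk)
    (n : ∀ i, TPow R M (G ⧸ (V i).1)) : GhostProd H R M :=
  fun U => ∑ᶠ p : Σ i, fixedCosets H U.1 (V i).1,
    tensorNorm (hσ p.1) p.2.1.out (conjLE_out p.2.2.2) (n p.1)

theorem familySum_apply {ι : Type v} (V : ι → OpenSub H) {σ : ∀ i, G ⧸ (V i).1 → G}
    (hσ : ∀ i, Function.RightInverse (σ i) QuotientGroup.mk)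
    (n : ∀ i, TPow R M (G ⧸ (V i).1)) (U : OpenSub H)
    [Fintype (Σ i, fixedCosets H U.1 (V i).1)] : familySum V hσ n U =
      ∑ p : Σ i, fixedCosets H U.1 (V i).1,
        tensorNorm (hσ p.1) p.2.1.out (conjLE_out p.2.2.2) (n p.1) :=
  finsum_eq_sum_of_fintype _

theorem ghostMap_apply (c : WittChoice H) (n : ∀ V : c.reps, TPow R M (G ⧸ V.1)) (U : OpenSub H)
    [Fintype (GhostIndex c U.1)] : ghostMap c R M n U = ∑ i, ghostTerm c R M U.1 n i := by
  rw [ghostMap, dif_pos (finite_ghostIndex c U)]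
  congr!

theorem ghostMap_eq_familySum (c : WittChoice H) (n : ∀ V : c.reps, TPow R M (G ⧸ V.1)) :
    ghostMap c R M n = familySum c.openSub (fun V => c.sec_spec V.1) n := by
  funext U
  have : Finite (Σ V : c.reps, fixedCosets H U.1 (c.openSub V).1) := finite_ghostIndex c U
  have : Finite (GhostIndex c U.1) := this
  rw [familySum_apply, ghostMap_apply]
  rfl

theorem map_familySum {R' M' : Type*} [CommRing R'] [AddCommGroup M'] [Module R' M']
    (α : R →+* R') (f : M →ₛₗ[α] M') {ι : Type v} (V : ι → OpenSub H)
    {σ : ∀ i, G ⧸ (V i).1 → G} (hσ : ∀ i, Function.RightInverse (σ i) QuotientGroup.mk)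
    (hfin : ∀ U : OpenSub H, Finite (Σ i, fixedCosets H U.1 (V i).1))
    (n : ∀ i, TPow R M (G ⧸ (V i).1)) :
    GhostProd.map H α f (familySum V hσ n) = familySum V hσ fun i => TPow.map α f _ (n i) := by
  funext U
  have := hfin U
  change TPow.map α f _ (familySum V hσ n U) = _
  rw [familySum_apply, familySum_apply, map_sum]
  exact Finset.sum_congr rfl fun p _ => map_norm _ _ _ _ _ _

end

variable {B : Type*}

/-- For free coefficients over `ℤ`, tensor powers are groups of labels. -/
noncomputable def GhostProd.labels (H : Subgroup G) (B : Type*) :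
    GhostProd H ℤ (B →₀ ℤ) ≃+ ∀ U : OpenSub H, LabelGroup B U.1 :=
  AddEquiv.piCongrRight fun U => (TPow.finsuppEquiv ℤ B (G ⧸ U.1)).toAddEquiv

theorem GhostProd.labels_apply (a : GhostProd H ℤ (B →₀ ℤ)) (U : OpenSub H) :
    GhostProd.labels H B a U = TPow.finsuppEquiv ℤ B (G ⧸ U.1) (a U) := rfl

/-- In coordinates, the norm of a sum of basis tensors is again a sum of basis elements, one for
each choice function on the fibre. -/
theorem finsuppEquiv_norm {U V : OpenSub H} {σ : G ⧸ V.1 → G}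
    (hσ : Function.RightInverse σ QuotientGroup.mk) (g : G) (h : ConjLE g U.1 V.1)
    {I : Type*} [Fintype I] (b : I → G ⧸ V.1 → B)
    [Fintype (V.1 ⧸ (conjSubgroup g⁻¹ U.1).subgroupOf V.1 → I)] :
    TPow.finsuppEquiv ℤ B (G ⧸ U.1) (tensorNorm hσ g h
      (∑ i, TPow.tprod ℤ fun x => Finsupp.single (b i x) 1)) =
    ∑ κ : V.1 ⧸ (conjSubgroup g⁻¹ U.1).subgroupOf V.1 → I, Finsupp.single
      (fun q => b (κ ((normEquiv hσ g h).symm q).2) ((normEquiv hσ g h).symm q).1) 1 := by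
  have := finite_normFiber g h
  rw [norm_eq_reindex, TPow.power_sum, map_sum, map_sum]
  refine Finset.sum_congr rfl fun κ _ => ?_
  rw [TPow.nest_tprod fun y x => Finsupp.single (b (κ y) x) (1 : ℤ), TPow.reindex_tprod]
  exact TPow.finsuppEquiv_tprod _

/-- This matches the label of the fixed point (x, κ) of the coinduced set with the summand κ in
`finsuppEquiv_norm`. -/
theorem CosetFun.label_ofFixed {I : Type*} [Inhabited I] {U V : OpenSub H} {σ : G ⧸ V.1 → G}
    (hσ : Function.RightInverse σ QuotientGroup.mk) (b : I → G ⧸ V.1 → B)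
    (x : fixedCosets H U.1 V.1) (κ : V.1 ⧸ (conjSubgroup x.1.out⁻¹ U.1).subgroupOf V.1 → I)
    (q : G ⧸ U.1) : label σ b (ofFixed ⟨x, κ⟩) q.out =
      b (κ ((normEquiv hσ x.1.out (conjLE_out x.2.2)).symm q).2)
        ((normEquiv hσ x.1.out (conjLE_out x.2.2)).symm q).1 := by
  obtain ⟨⟨x', s⟩, rfl⟩ := (normEquiv hσ x.1.out (conjLE_out x.2.2)).surjective q
  rw [Equiv.symm_apply_apply]
  induction s using QuotientGroup.induction_on with
  | H s =>
    obtain ⟨u, hu, hq⟩ := out_eq_mul (normEquiv_mk hσ x.1.out (conjLE_out x.2.2) x' s).symm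
    have h1 : (normEquiv hσ x.1.out (conjLE_out x.2.2) (x', QuotientGroup.mk s)).out • x.1 = x' := by
      rw [hq, mul_smul, x.2.2 u hu]
      refine (congrArg _ (QuotientGroup.out_eq' x.1).symm).trans ?_
      rw [MulAction.Quotient.smul_mk, smul_eq_mul, inv_mul_cancel_right,
        QuotientGroup.mk_mul_of_mem _ s.2]
      exact hσ x'
    rw [label]
    have h2 : (ofFixed (H := H) ⟨x, κ⟩).1.1 = x.1 := rfl
    rw [h2, h1, hq]
    have h3 : (σ x' * s * x.1.out⁻¹ * u)⁻¹ * σ x' = u⁻¹ * x.1.out * (s : G)⁻¹ := by group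
    rw [h3, ofFixed_snd _ _ _ (U.1.inv_mem hu)]

theorem exists_sum_single_add_nsmul {X : Type*} [Nonempty X] {N : ℕ} (hN : N ≠ 0) (f : X →₀ ℤ) :
    ∃ (I : Type) (_ : Fintype I) (_ : Nonempty I) (b : I → X) (z : X →₀ ℤ),
      f = ∑ i, Finsupp.single (b i) 1 + N • z := by
  have hs : ∀ (b : X) (k : ℤ), ∃ (I : Type) (_ : Fintype I) (_ : Nonempty I) (c : I → X)
      (z : X →₀ ℤ), Finsupp.single b k = ∑ i, Finsupp.single (c i) 1 + N • z := by
    intro b k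
    -- The residue of k is raised by N so that the index type is nonempty; the coinduced sets need a
    -- default element.
    refine ⟨Fin ((k % N).toNat + N), inferInstance, ⟨⟨0, by omega⟩⟩, fun _ => b,
      Finsupp.single b (k / N - 1), ?_⟩
    have h0 : 0 ≤ k % N := Int.emod_nonneg k (by exact_mod_cast hN)
    rw [Finset.sum_const, Finset.card_univ, Fintype.card_fin, Finsupp.smul_single,
      Finsupp.smul_single, ← Finsupp.single_add]
    congr 1
    simp only [nsmul_eq_mul, mul_one, Nat.cast_add, Int.toNat_of_nonneg h0]
    have := Int.emod_add_mul_ediv k N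
    linarith
  induction f using Finsupp.induction_linear with
  | zero =>
    obtain ⟨b⟩ := ‹Nonempty X›
    simpa using hs b 0
  | add f g hf hg =>
    obtain ⟨I, _, _, b, z, rfl⟩ := hf
    obtain ⟨J, _, _, c, z', rfl⟩ := hg
    refine ⟨I ⊕ J, inferInstance, inferInstance, Sum.elim b c, z + z', ?_⟩
    rw [Fintype.sum_sum_type, smul_add]
    simp only [Sum.elim_inl, Sum.elim_inr]
    abel
  | single b k => exact hs b k

theorem exists_tprod_add_nsmul {X : Type*} [Finite X] [Nonempty B] {N : ℕ} (hN : N ≠ 0)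
    (n : TPow ℤ (B →₀ ℤ) X) :
    ∃ (I : Type) (_ : Fintype I) (_ : Nonempty I) (b : I → X → B) (z : TPow ℤ (B →₀ ℤ) X),
      n = ∑ i, (TPow.tprod ℤ fun x => Finsupp.single (b i x) 1) + N • z := by
  obtain ⟨I, hI, hI', b, z, h⟩ := exists_sum_single_add_nsmul hN (TPow.finsuppEquiv ℤ B X n)
  refine ⟨I, hI, hI', b, (TPow.finsuppEquiv ℤ B X).symm z, (TPow.finsuppEquiv ℤ B X).injective ?_⟩
  rw [h, map_add, map_sum, map_nsmul, LinearEquiv.apply_symm_apply]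
  simp only [TPow.finsuppEquiv_tprod]

/-- The fixed points of a disjoint union. -/
def sigmaFixedPts {ι : Type*} {X : ι → Type*} [∀ i, MulAction H (X i)] (U : Subgroup G) :
    (Σ i, fixedPts H (X i) U) ≃ fixedPts H (Σ i, X i) U where
  toFun p := ⟨⟨p.1, p.2.1⟩, fun h hh => Sigma.ext rfl (heq_of_eq (p.2.2 h hh))⟩
  invFun p := ⟨p.1.1, p.1.2, fun h hh => eq_of_heq (Sigma.mk.inj (p.2 h hh)).2⟩
  left_inv _ := rfl
  right_inv _ := rfl

/-- Each coefficient is a sum of basis tensors modulo N, and norms respect congruence modulo N. The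
norm of a sum of basis tensors counts fixed points of a coinduced set, so the whole vector is,
modulo N, that of their disjoint union. -/
theorem exists_labelSum_add_nsmul [Nonempty B] {ι : Type v} (V : ι → OpenSub H)
    {σ : ∀ i, G ⧸ (V i).1 → G} (hσ : ∀ i, Function.RightInverse (σ i) QuotientGroup.mk)
    (hfin : ∀ U : OpenSub H, Finite (Σ i, fixedCosets H U.1 (V i).1))
    (n : ∀ i, TPow ℤ (B →₀ ℤ) (G ⧸ (V i).1)) {N : ℕ} (hN : N ≠ 0) :
    ∃ (X : Type v) (_ : MulAction H X) (lam : X → G → B),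
      (∀ (h : H) p y, lam (h • p) y = lam p (y * h)) ∧
      (∀ U : OpenSub H, Finite (fixedPts H X U.1)) ∧
      ∃ y, GhostProd.labels H B (familySum V hσ n) = labelSum lam + N • y := by
  choose I hI hI' b z hz using fun i => exists_tprod_add_nsmul hN (n i)
  let _ : ∀ i, Inhabited (I i) := fun i => ⟨(hI' i).some⟩
  let lam : (Σ i, CosetFun H (V i).1 (I i)) → G → B := fun p =>
    CosetFun.label (σ p.1) (b p.1) p.2
  have hf : ∀ (U : OpenSub H) i (x : fixedCosets H U.1 (V i).1),
    Finite ((V i).1 ⧸ (conjSubgroup x.1.out⁻¹ U.1).subgroupOf (V i).1) :=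
      fun U i x => finite_normFiber x.1.out (conjLE_out x.2.2)
  let E : ∀ U : OpenSub H, (Σ p : (Σ i, fixedCosets H U.1 (V i).1),
      ((V p.1).1 ⧸ (conjSubgroup p.2.1.out⁻¹ U.1).subgroupOf (V p.1).1 → I p.1)) ≃
      fixedPts H (Σ i, CosetFun H (V i).1 (I i)) U.1 := fun U =>
    ((Equiv.sigmaAssoc fun i (x : fixedCosets H U.1 (V i).1) =>
      ((V i).1 ⧸ (conjSubgroup x.1.out⁻¹ U.1).subgroupOf (V i).1 → I i)).trans
      (Equiv.sigmaCongrRight fun i => CosetFun.fixedEquiv U.2.2)).trans (sigmaFixedPts U.1)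
  have hX : ∀ U : OpenSub H, Finite (fixedPts H (Σ i, CosetFun H (V i).1 (I i)) U.1) := fun U =>
    have := hfin U
    Finite.of_equiv _ (E U)
  have hloc : ∀ U : OpenSub H, ∃ y, GhostProd.labels H B (familySum V hσ n) U =
      labelSum lam U + N • y := by
    intro U
    have := hfin U
    choose w hw using fun p : (Σ i, fixedCosets H U.1 (V i).1) =>
      exists_norm_add_nsmul (hσ p.1) (conjLE_out p.2.2.2) N
        (∑ i, TPow.tprod ℤ fun x => Finsupp.single (b p.1 i x) 1) (z p.1)
    refine ⟨∑ p, TPow.finsuppEquiv ℤ B _ (w p), ?_⟩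
    rw [GhostProd.labels_apply, familySum_apply, map_sum, labelSum, dif_pos (hX U),
      Finset.smul_sum]
    have hterm : ∀ p : (Σ i, fixedCosets H U.1 (V i).1), TPow.finsuppEquiv ℤ B (G ⧸ U.1)
        (tensorNorm (hσ p.1) p.2.1.out (conjLE_out p.2.2.2) (n p.1)) =
        ∑ κ, Finsupp.single (fun q : G ⧸ U.1 => lam (E U ⟨p, κ⟩).1 q.out) 1 +
          N • TPow.finsuppEquiv ℤ B _ (w p) := by
      intro p
      conv_lhs => rw [hz p.1]
      rw [hw p, map_add, map_nsmul, finsuppEquiv_norm]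
      congr 1
      refine Finset.sum_congr rfl fun κ _ => ?_
      congr 1
      funext q
      exact (CosetFun.label_ofFixed (H := H) (hσ p.1) (b p.1) p.2 κ q).symm
    rw [Finset.sum_congr rfl fun p _ => hterm p, Finset.sum_add_distrib, Finset.sum_sigma']
    congr 1
    exact Fintype.sum_equiv (E U) _ (fun p => Finsupp.single (fun q : G ⧸ U.1 => lam p.1 q.out) 1)
      fun _ => rfl
  choose y hy using hloc
  exact ⟨_, inferInstance, lam, fun h p y => CosetFun.label_smul _ _ h p.2 y, hX, y, funext hy⟩

theorem labelGroup_eq_zero_of_isEmpty [IsEmpty B] (a : ∀ U : OpenSub H, LabelGroup B U.1) :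
    a = 0 := by
  funext U
  ext b
  exact isEmptyElim (b (QuotientGroup.mk 1))

theorem labels_familySum_mem {ι : Type v} (V : ι → OpenSub H)
    {σ : ∀ i, G ⧸ (V i).1 → G} (hσ : ∀ i, Function.RightInverse (σ i) QuotientGroup.mk)
    (hfin : ∀ U : OpenSub H, Finite (Σ i, fixedCosets H U.1 (V i).1))
    (n : ∀ i, TPow ℤ (B →₀ ℤ) (G ⧸ (V i).1)) :
    GhostProd.labels H B (familySum V hσ n) ∈ congruences H B := by
  rcases isEmpty_or_nonempty B with hB | hB
  · rw [labelGroup_eq_zero_of_isEmpty (GhostProd.labels H B (familySum V hσ n))]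
    exact zero_mem _
  · refine mem_congruences_of_nsmul fun N hN => ?_
    obtain ⟨X, _, lam, hl, hX, y, hy⟩ := exists_labelSum_add_nsmul V hσ hfin n hN
    exact ⟨_, labelSum_mem_congruences hl hX, y, hy⟩

theorem finsuppEquiv_twist {U V : OpenSub H} {g : G} (hg : ∀ x, x ∈ U.1 ↔ g⁻¹ * x * g ∈ V.1)
    (t : TPow ℤ (B →₀ ℤ) (G ⧸ V.1)) :
    TPow.finsuppEquiv ℤ B (G ⧸ U.1) (TPow.twist g hg t) =
      LabelGroup.res g (ConjLE.of_iff hg) (TPow.finsuppEquiv ℤ B (G ⧸ V.1) t) := by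
  obtain ⟨f, rfl⟩ := (TPow.finsuppEquiv ℤ B (G ⧸ V.1)).symm.surjective t
  rw [LinearEquiv.apply_symm_apply]
  induction f using Finsupp.induction_linear with
  | zero => simp
  | add f f' hf hf' => simp only [map_add, hf, hf']
  | single b k =>
    have : (Finsupp.single b k : (G ⧸ V.1 → B) →₀ ℤ) = k • Finsupp.single b 1 := by simp
    rw [this, map_smul, map_smul, map_smul, map_zsmul, TPow.finsuppEquiv_symm_single, TPow.twist,
      TPow.reindex_tprod, LabelGroup.res_single, TPow.finsuppEquiv_tprod fun y =>
        b ((cosetTwist g hg).symm y)]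
    rfl

/-- U is conjugate in H to a subgroup of V. Equal indices would make the two representatives
conjugate in H, hence equal. -/
theorem GhostIndex.index_lt (c : WittChoice H) {U V : c.reps} (x : fixedCosets H U.1 V.1)
    (hVU : V ≠ U) : V.1.index < U.1.index := by
  have hle := conjLE_out x.2.2
  have h0 : U.1.index ≠ 0 := (c.openSub U).index_ne_zero
  refine lt_of_le_of_ne (Nat.le_of_dvd (Nat.pos_of_ne_zero h0) hle.index_dvd) fun he => hVU ?_
  have hx := out_mem_of_mem_fixedCosets (c.le _ V.2) x.2
  refine Subtype.ext ((c.existsUnique U.1 (c.isOpen _ U.2) (c.le _ U.2)).unique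
    ⟨V.2, x.1.out, hx, ?_⟩ ⟨U.2, 1, H.one_mem, ?_⟩)
  · ext y
    rw [mem_conjSubgroup]
    exact hle.iff_of_index_eq he h0 y
  · ext y
    rw [mem_conjSubgroup]
    simp

/-- In the component at U, the terms for V ≠ U have smaller index and cancel; those for V = U are
twists and hence additive. Agreement is required only at the V that actually occur, which limits how
many ghost components are needed in `scalar_eq_of_ghost_eq`. -/
theorem ghostMap_sub_of_agree {R M : Type*} [CommRing R] [AddCommGroup M] [Module R M]
    (c : WittChoice H) (n n' : ∀ V : c.reps, TPow R M (G ⧸ V.1)) (U : c.reps)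
    (h : ∀ V : c.reps, V.1.index < U.1.index → Nonempty (fixedCosets H U.1 V.1) → n V = n' V) :
    ghostMap c R M n (c.openSub U) - ghostMap c R M n' (c.openSub U) =
      ∑ x : fixedCosets H (c.openSub U).1 (c.openSub U).1, TPow.twist x.1.out (out_normalizes (c.openSub U) x)
        (n U - n' U) := by
  have : Finite (GhostIndex c (c.openSub U).1) := finite_ghostIndex c _
  have : Finite (G ⧸ U.1) := (c.openSub U).finite_quotient
  rw [ghostMap_apply, ghostMap_apply, ← Finset.sum_sub_distrib]
  refine (Fintype.sum_of_injective (fun x : fixedCosets H U.1 U.1 =>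
    (⟨U, x⟩ : GhostIndex c (c.openSub U).1)) (fun x x' hx => eq_of_heq (Sigma.mk.inj hx).2) _ _
    (fun i hi => ?_) fun x => ?_).symm
  · obtain ⟨V, x⟩ := i
    rw [sub_eq_zero]
    have hlt : V.1.index < U.1.index := GhostIndex.index_lt c x fun hVU => hi ?_
    · simp only [ghostTerm, h V hlt ⟨x⟩]
    · subst hVU
      exact ⟨x, rfl⟩
  · rw [map_sub]
    congr 1 <;> exact (norm_self (c.sec_spec U.1) (conjLE_out x.2.2) _ _).symm

/-- One inclusion is the count of labelled fixed points, the other the triangular argument; the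
diagonal of the ghost map in label coordinates is exactly the transfer. -/
theorem range_ghostMap_int (c : WittChoice H) (B : Type*) :
    Set.range (ghostMap c ℤ (B →₀ ℤ)) = {a | GhostProd.labels H B a ∈ congruences H B} := by
  have hmem : ∀ n, GhostProd.labels H B (ghostMap c ℤ (B →₀ ℤ) n) ∈ congruences H B := fun n => by
    rw [ghostMap_eq_familySum]
    exact labels_familySum_mem c.openSub (fun V => c.sec_spec V.1) (finite_ghostIndex c) n
  ext a
  refine ⟨?_, fun ha => ?_⟩
  · rintro ⟨n, rfl⟩
    exact hmem n
  · let L : ∀ V : c.reps, LabelGroup B V.1 → TPow ℤ (B →₀ ℤ) (G ⧸ V.1) := fun V =>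
      have := (c.openSub V).finite_quotient
      (TPow.finsuppEquiv ℤ B (G ⧸ V.1)).symm
    let ω : (∀ V : c.reps, LabelGroup B V.1) → ∀ U : OpenSub H, LabelGroup B U.1 := fun n =>
      GhostProd.labels H B (ghostMap c ℤ (B →₀ ℤ) fun V => L V (n V))
    have htri : ∀ n n' (U : c.reps), (∀ V : c.reps, V.1.index < U.1.index → n V = n' V) →
        ω n (c.openSub U) - ω n' (c.openSub U) =
          LabelGroup.tr H (c.openSub U) (n U - n' U) := by
      intro n n' U hnn
      have hfin : Finite (G ⧸ U.1) := (c.openSub U).finite_quotient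
      have h1 := congrArg (TPow.finsuppEquiv ℤ B (G ⧸ (c.openSub U).1))
        (ghostMap_sub_of_agree c (fun V => L V (n V)) (fun V => L V (n' V)) U
          fun V hV _ => by rw [hnn V hV])
      rw [map_sub, map_sum] at h1
      refine h1.trans ?_
      rw [LabelGroup.tr_apply]
      refine Finset.sum_congr rfl fun x _ => ?_
      refine (finsuppEquiv_twist (U := c.openSub U) (V := c.openSub U) _ _).trans ?_
      congr 1
      change TPow.finsuppEquiv ℤ B (G ⧸ U.1) ((TPow.finsuppEquiv ℤ B (G ⧸ U.1)).symm _ -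
        (TPow.finsuppEquiv ℤ B (G ⧸ U.1)).symm _) = _
      rw [← map_sub, LinearEquiv.apply_symm_apply]
    obtain ⟨n, hn⟩ := exists_eq_of_triangular c.toClassReps ω (fun n => hmem _) htri ha
    exact ⟨_, (GhostProd.labels H B).injective hn⟩

end FamilySum

/-! ### The image of the ghost map for general coefficients -/

section GhostImage

attribute [local instance] OpenSub.finite_quotient Fintype.ofFinite

variable {G : Type v} [Group G] [TopologicalSpace G] {H : Subgroup G} [IsTopologicalGroup G]
  [CompactSpace G] {R M : Type*} [CommRing R] [AddCommGroup M] [Module R M]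

/-- The canonical map `(ℤ; ℤ^{(M)}) → (R; M)`. -/
noncomputable def intCounit (R M : Type*) [CommRing R] [AddCommGroup M] [Module R M] :
    (M →₀ ℤ) →ₛₗ[Int.castRingHom R] M :=
  freeLift (Int.castRingHom R) id

theorem intCounit_single (m : M) : intCounit R M (Finsupp.single m 1) = m := by
  simp [intCounit, freeLift_single]

theorem intCounit_surjective : Function.Surjective (intCounit R M) :=
  fun m => ⟨_, intCounit_single m⟩

/-- The family of tensors described by a family of labels. -/
noncomputable def GhostProd.ofLabels (H : Subgroup G) (R M : Type*) [CommRing R] [AddCommGroup M]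
    [Module R M] : (∀ U : OpenSub H, LabelGroup M U.1) →+ GhostProd H R M :=
  (GhostProd.map H (Int.castRingHom R) (intCounit R M)).comp
    (GhostProd.labels H M).symm.toAddMonoidHom

theorem GhostProd.ofLabels_labels (a : GhostProd H ℤ (M →₀ ℤ)) :
    GhostProd.ofLabels H R M (GhostProd.labels H M a) =
      GhostProd.map H (Int.castRingHom R) (intCounit R M) a :=
  congrArg (GhostProd.map H (Int.castRingHom R) (intCounit R M))
    ((GhostProd.labels H M).symm_apply_apply a)

/-- Tensor powers of ℤ^(M) surject onto those of M, so every ghost vector lifts to ℤ. The right-hand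
side is a subgroup and does not involve `c`: the image is additive and independent of all choices.
-/
theorem range_ghostMap (c : WittChoice H) (R M : Type*) [CommRing R] [AddCommGroup M]
    [Module R M] : Set.range (ghostMap c R M) =
      ((congruences H M).map (GhostProd.ofLabels H R M) : Set (GhostProd H R M)) := by
  ext a
  constructor
  · rintro ⟨n, rfl⟩
    choose n' hn' using fun V : c.reps => TPow.map_surjective (X := G ⧸ V.1) _ (intCounit R M)
      intCounit_surjective (n V)
    have hmem : ghostMap c ℤ (M →₀ ℤ) n' ∈ {a | GhostProd.labels H M a ∈ congruences H M} := by
      rw [← range_ghostMap_int c]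
      exact ⟨_, rfl⟩
    refine ⟨_, hmem, ?_⟩
    rw [GhostProd.ofLabels_labels, map_ghostMap]
    simp only [hn']
  · rintro ⟨l, hl, rfl⟩
    have hmem : (GhostProd.labels H M).symm l ∈ Set.range (ghostMap c ℤ (M →₀ ℤ)) := by
      rw [range_ghostMap_int c, Set.mem_ofPred_eq, AddEquiv.apply_symm_apply]
      exact hl
    obtain ⟨n, hn⟩ := hmem
    refine ⟨fun V => TPow.map (Int.castRingHom R) (intCounit R M) _ (n V), ?_⟩
    rw [← map_ghostMap, hn]
    rfl

theorem ghostImage_eq (c : WittChoice H) (R M : Type*) [CommRing R] [AddCommGroup M]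
    [Module R M] : ghostImage c R M = (congruences H M).map (GhostProd.ofLabels H R M) := by
  rw [ghostImage, range_ghostMap, AddSubgroup.closure_eq]

theorem mem_ghostImage (c : WittChoice H) {a : GhostProd H R M} :
    a ∈ ghostImage c R M ↔ ∃ n, ghostMap c R M n = a := by
  rw [ghostImage_eq, ← SetLike.mem_coe, ← range_ghostMap c]
  rfl

theorem ghostMap_mem (c : WittChoice H) (n : ∀ V : c.reps, TPow R M (G ⧸ V.1)) :
    ghostMap c R M n ∈ ghostImage c R M :=
  (mem_ghostImage c).2 ⟨n, rfl⟩

theorem ghostImageMap_surjective (c : WittChoice H) {R' M' : Type*} [CommRing R']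
    [AddCommGroup M'] [Module R' M'] (α : R →+* R') (f : M →ₛₗ[α] M')
    (hf : Function.Surjective f) : Function.Surjective (ghostImageMap c α f) := by
  rintro ⟨a, ha⟩
  obtain ⟨n, rfl⟩ := (mem_ghostImage c).1 ha
  choose n' hn' using fun V : c.reps => TPow.map_surjective (X := G ⧸ V.1) _ f hf (n V)
  refine ⟨⟨_, ghostMap_mem c n'⟩, Subtype.ext ?_⟩
  rw [coe_ghostImageMap, map_ghostMap]
  simp only [hn']

theorem map_mem_ghostImage (c : WittChoice H) {R' M' : Type*} [CommRing R']
    [AddCommGroup M'] [Module R' M'] (α : R →+* R') (f : M →ₛₗ[α] M') {a : GhostProd H R M}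
    (ha : a ∈ ghostImage c R M) : GhostProd.map H α f a ∈ ghostImage c R' M' :=
  (ghostImageMap c α f ⟨a, ha⟩).2

/-- The subgroups may be repeated or conjugate and the sections arbitrary, because the congruences
over ℤ were proved in that generality. Transfer and Θ produce families of this kind. -/
theorem familySum_mem_ghostImage (c : WittChoice H) {ι : Type v} (V : ι → OpenSub H)
    {σ : ∀ i, G ⧸ (V i).1 → G} (hσ : ∀ i, Function.RightInverse (σ i) QuotientGroup.mk)
    (hfin : ∀ U : OpenSub H, Finite (Σ i, fixedCosets H U.1 (V i).1))
    (n : ∀ i, TPow R M (G ⧸ (V i).1)) : familySum V hσ n ∈ ghostImage c R M := by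
  choose n' hn' using fun i => TPow.map_surjective (X := G ⧸ (V i).1) _ (intCounit R M)
    intCounit_surjective (n i)
  have h : familySum V hσ n' ∈ ghostImage c ℤ (M →₀ ℤ) := by
    rw [mem_ghostImage]
    change _ ∈ Set.range _
    rw [range_ghostMap_int]
    exact labels_familySum_mem V hσ hfin n'
  have := map_mem_ghostImage c _ (intCounit R M) h
  rw [map_familySum _ _ V hσ hfin] at this
  simpa only [hn'] using this

end GhostImage

/-! ### Restriction and transfer of ghost components -/

section GhostOperators

attribute [local instance] OpenSub.finite_quotient Fintype.ofFinite

variable {G : Type v} [Group G] [TopologicalSpace G] {H K : Subgroup G} [IsTopologicalGroup G]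
  [CompactSpace G] {R M : Type*} [CommRing R] [AddCommGroup M] [Module R M]

/-- An open subgroup of `K` as an open subgroup of `H`. -/
abbrev OpenSub.incl (hKH : K ≤ H) (U : OpenSub K) : OpenSub H := ⟨U.1, U.2.1, U.2.2.trans hKH⟩

/-- The projection onto the components `U ≤ K`. -/
def GhostProd.restrict (hKH : K ≤ H) (R M : Type*) [CommRing R] [AddCommGroup M] [Module R M] :
    GhostProd H R M →+ GhostProd K R M where
  toFun a U := a (U.incl hKH)
  map_zero' := rfl
  map_add' _ _ := rfl

theorem GhostProd.continuous_restrict (hKH : K ≤ H) :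
    Continuous (GhostProd.restrict hKH R M) :=
  continuous_pi fun U => continuous_apply (U.incl hKH)

/-- For D ≤ K the representatives of N_D(U)/U lie in K, so adjoining one of them to U gives the same
subgroup inside K as inside H. The congruences for K are thus among those for H. -/
theorem restrict_mem_congruences {B : Type*} (hKH : K ≤ H) {a : ∀ U : OpenSub H, LabelGroup B U.1}
    (ha : a ∈ congruences H B) :
    (fun U : OpenSub K => (a (U.incl hKH) : LabelGroup B U.1)) ∈ congruences K B := by
  refine ⟨fun U V g hg h => ha.1 (U.incl hKH) (V.incl hKH) g (hKH hg) h, fun U D hU hD => ?_⟩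
  obtain ⟨y, hy⟩ := ha.2 (U.incl hKH) D hU (hD.trans hKH)
  refine ⟨y, Eq.trans (Finset.sum_congr rfl fun x _ => ?_) hy⟩
  have hx : x.1.out ∈ K := hD (out_mem_of_mem_fixedCosets hU x.2)
  have key : ∀ (W W' : OpenSub H) (e : W = W') (h : U.1 ≤ W.1) (h' : U.1 ≤ W'.1),
      LabelGroup.res 1 (ConjLE.one h) (a W) = LabelGroup.res 1 (ConjLE.one h') (a W') := by
    rintro W _ rfl h h'
    rfl
  refine key ((U.adjoin x.1.out).incl hKH) ((U.incl hKH).adjoin x.1.out) (Subtype.ext ?_)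
    (U.le_adjoin _) ((U.incl hKH).le_adjoin _)
  have hle : U.1 ⊔ Subgroup.zpowers x.1.out ≤ K :=
    sup_le U.2.2 (Subgroup.zpowers_le.2 hx)
  exact (inf_eq_left.2 hle).trans (inf_eq_left.2 (hle.trans hKH)).symm

theorem GhostProd.restrict_mem (hKH : K ≤ H) (c : WittChoice H) (c' : WittChoice K)
    {a : GhostProd H R M} (ha : a ∈ ghostImage c R M) :
    GhostProd.restrict hKH R M a ∈ ghostImage c' R M := by
  rw [ghostImage_eq] at ha ⊢
  obtain ⟨l, hl, rfl⟩ := ha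
  exact ⟨_, restrict_mem_congruences hKH hl, rfl⟩

theorem finite_fixedCosets (hK : IsOpen (K : Set G)) (W : Subgroup G) :
    Finite (fixedCosets H W K) := by
  have : Finite (G ⧸ K) := Subgroup.quotient_finite_of_isOpen K hK
  infer_instance

theorem OpenSub.mem_conj (W : OpenSub H) (i : fixedCosets H W.1 K) (x : G) :
    x ∈ W.1 ↔ i.1.out⁻¹ * x * i.1.out ∈ (W.conj i).1 :=
  mem_iff_conj_mem i.1.out W.1 x

/-- The map `a ↦ (∑_{hK ∈ (H/K)^W} h · a_{W^h})_W`. -/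
noncomputable def GhostProd.transfer (H : Subgroup G) (hK : IsOpen (K : Set G)) (R M : Type*)
    [CommRing R] [AddCommGroup M] [Module R M] : GhostProd K R M →+ GhostProd H R M where
  toFun a W := ∑ᶠ i : fixedCosets H W.1 K, TPow.twist i.1.out (W.mem_conj i)
    (a (W.conj i))
  map_zero' := by
    funext W
    simp
  map_add' a b := by
    funext W
    have := finite_fixedCosets (H := H) hK W.1
    simp only [Pi.add_apply, map_add]
    exact finsum_add_distrib (Set.toFinite _) (Set.toFinite _)

theorem GhostProd.transfer_apply (hK : IsOpen (K : Set G)) (a : GhostProd K R M) (W : OpenSub H)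
    [Fintype (fixedCosets H W.1 K)] : GhostProd.transfer H hK R M a W =
      ∑ i : fixedCosets H W.1 K, TPow.twist i.1.out (W.mem_conj i)
        (a (W.conj i)) :=
  finsum_eq_sum_of_fintype _

theorem GhostProd.continuous_transfer (hK : IsOpen (K : Set G)) :
    Continuous (GhostProd.transfer H hK R M) := by
  refine continuous_pi fun W => ?_
  have := finite_fixedCosets (H := H) hK W.1
  simp only [GhostProd.transfer_apply]
  exact continuous_finsetSum _ fun i _ => (continuous_of_discreteTopology (f := fun t =>
    TPow.twist (R := R) (M := M) i.1.out (W.mem_conj i) t)).comp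
      (continuous_apply (W.conj i))

theorem GhostProd.map_transfer {R' M' : Type*} [CommRing R'] [AddCommGroup M'] [Module R' M']
    (hK : IsOpen (K : Set G)) (α : R →+* R') (f : M →ₛₗ[α] M') (a : GhostProd K R M) :
    GhostProd.map H α f (GhostProd.transfer H hK R M a) =
      GhostProd.transfer H hK R' M' (GhostProd.map K α f a) := by
  funext W
  have := finite_fixedCosets (H := H) hK W.1
  change TPow.map α f _ _ = _
  rw [GhostProd.transfer_apply, GhostProd.transfer_apply, map_sum]
  exact Finset.sum_congr rfl fun i _ => TPow.map_reindex _ _ _ _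

/-- The fixed points of `W` on `H/V` lie over the fixed points of `W` on `H/K`. -/
noncomputable def fixedCosetsSigma (hKH : K ≤ H) (W : OpenSub H) (V : OpenSub K) :
    (Σ i : fixedCosets H W.1 K, fixedCosets K (W.conj i).1 V.1) ≃ fixedCosets H W.1 V.1 :=
  Equiv.ofBijective (fun p => ⟨QuotientGroup.mk (p.1.1.out * p.2.1.out), mk_mem_fixedCosets
      (H.mul_mem (out_mem_of_mem_fixedCosets hKH p.1.2)
        (hKH (out_mem_of_mem_fixedCosets V.2.2 p.2.2)))
      ((ConjLE.of_iff (W.mem_conj p.1)).mul (conjLE_out p.2.2.2))⟩) (by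
    constructor
    · rintro ⟨i, x⟩ ⟨i', x'⟩ h
      have h1 := QuotientGroup.eq.1 (congrArg Subtype.val h)
      have hx := out_mem_of_mem_fixedCosets V.2.2 x.2
      have hx' := out_mem_of_mem_fixedCosets V.2.2 x'.2
      obtain rfl : i = i' := by
        apply Subtype.ext
        rw [← QuotientGroup.out_eq' i.1, ← QuotientGroup.out_eq' i'.1]
        refine QuotientGroup.eq.2 ?_
        have := K.mul_mem (K.mul_mem hx (V.2.2 h1)) (K.inv_mem hx')
        simpa [mul_assoc] using this
      congr 1
      apply Subtype.ext
      rw [← QuotientGroup.out_eq' x.1, ← QuotientGroup.out_eq' x'.1]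
      refine QuotientGroup.eq.2 ?_
      simpa [mul_assoc] using h1
    · rintro ⟨y, hy⟩
      have hyH := out_mem_of_mem_fixedCosets (V.2.2.trans hKH) hy
      let i : fixedCosets H W.1 K := ⟨QuotientGroup.mk y.out, mk_mem_fixedCosets hyH
        fun u hu => V.2.2 (conjLE_out hy.2 u hu)⟩
      have hi : i.1.out⁻¹ * y.out ∈ K := by
        rw [← QuotientGroup.eq, QuotientGroup.out_eq']
      let x : fixedCosets K (W.conj i).1 V.1 := ⟨QuotientGroup.mk (i.1.out⁻¹ * y.out),
        mk_mem_fixedCosets hi fun u hu => by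
          have := conjLE_out hy.2 _ (mem_conjSubgroup_inv.1 hu)
          simpa [mul_assoc] using this⟩
      refine ⟨⟨i, x⟩, Subtype.ext ?_⟩
      obtain ⟨v, hv, hx⟩ := out_eq_mul (rfl : _ = x.1)
      change QuotientGroup.mk (i.1.out * x.1.out) = y
      rw [hx, ← mul_assoc, QuotientGroup.mk_mul_of_mem _ hv, mul_inv_cancel_left,
        QuotientGroup.out_eq'])

/-- Since (H/V)^W is fibred over (H/K)^W, the transfer of the ghost vector of `n` is the sum of
norms of the same `n`, with each V ≤ K regarded as a subgroup of H. Distinct V may become conjugate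
in H, hence the general `familySum`. -/
theorem GhostProd.transfer_mem (hKH : K ≤ H) (hK : IsOpen (K : Set G)) (c : WittChoice H)
    (c' : WittChoice K) {a : GhostProd K R M} (ha : a ∈ ghostImage c' R M) :
    GhostProd.transfer H hK R M a ∈ ghostImage c R M := by
  obtain ⟨n, rfl⟩ := (mem_ghostImage c').1 ha
  let E : ∀ W : OpenSub H, (Σ i : fixedCosets H W.1 K, GhostIndex c' (W.conj i).1) ≃
      Σ V : c'.reps, fixedCosets H W.1 ((c'.openSub V).incl hKH).1 := fun W =>
    Equiv.trans
      { toFun := fun p => ⟨p.2.1, p.1, p.2.2⟩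
        invFun := fun p => ⟨p.2.1, p.1, p.2.2⟩
        left_inv := fun _ => rfl
        right_inv := fun _ => rfl }
      (Equiv.sigmaCongrRight fun V => fixedCosetsSigma hKH W (c'.openSub V))
  have hfin : ∀ W : OpenSub H, Finite (Σ i : fixedCosets H W.1 K, GhostIndex c' (W.conj i).1) :=
    fun W => by
      have := finite_fixedCosets (H := H) hK W.1
      have := fun i : fixedCosets H W.1 K => finite_ghostIndex c' (W.conj i)
      infer_instance
  have hfin' : ∀ W : OpenSub H,
      Finite (Σ V : c'.reps, fixedCosets H W.1 ((c'.openSub V).incl hKH).1) := fun W =>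
    have := hfin W
    Finite.of_equiv _ (E W)
  convert familySum_mem_ghostImage c (fun V => (c'.openSub V).incl hKH)
    (fun V => c'.sec_spec V.1) hfin' n using 1
  funext W
  have := finite_fixedCosets (H := H) hK W.1
  have h2 := fun i : fixedCosets H W.1 K => finite_ghostIndex c' (W.conj i)
  have := hfin W
  have := hfin' W
  rw [GhostProd.transfer_apply, familySum_apply]
  refine Eq.trans ?_ (Fintype.sum_equiv (E W) (fun p => TPow.twist p.1.1.out
    (W.mem_conj p.1) (ghostTerm c' R M (W.conj p.1).1 n p.2)) _ fun p => ?_)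
  · rw [Fintype.sum_sigma]
    refine Finset.sum_congr rfl fun i _ => ?_
    rw [ghostMap_apply, map_sum]
  · have : Finite (G ⧸ (W.conj p.1).1) := (W.conj p.1).finite_quotient
    refine twist_norm (c'.sec_spec p.2.1.1) (conjLE_out p.2.2.2.2) _ _ ?_ (n p.2.1)
    exact (QuotientGroup.out_eq' (E W p).2.1).symm

end GhostOperators

/-! ### Products of labelled sets and the shuffle -/

namespace LabelGroup

variable {G : Type*} [Group G] {B B' : Type*} {U : Subgroup G}

/-- The pairing of labels. -/
noncomputable def pair : LabelGroup B U →+ LabelGroup B' U →+ LabelGroup (B × B') U :=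
  Finsupp.liftAddHom fun b => AddMonoidHom.mk' (fun k => Finsupp.liftAddHom fun b' =>
    (Finsupp.singleAddHom fun q => (b q, b' q)).comp (AddMonoidHom.mulLeft k)) fun k l => by
      ext b' x
      simp

theorem pair_single (b : G ⧸ U → B) (b' : G ⧸ U → B') (k l : ℤ) :
    pair (Finsupp.single b k) (Finsupp.single b' l) =
      Finsupp.single (fun q => (b q, b' q)) (k * l) := by
  simp [pair]

end LabelGroup

section GhostPairing

attribute [local instance] OpenSub.finite_quotient Fintype.ofFinite

variable {G : Type v} [Group G] [TopologicalSpace G] {H : Subgroup G} [IsTopologicalGroup G]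
  [CompactSpace G] {B B' : Type*}

/-- The converse use of `range_ghostMap_int`: modulo any N, a family satisfying the congruences
comes from an actual labelled H-set. -/
theorem exists_labelSum_of_mem_congruences [Nonempty B] (c : WittChoice H)
    {a : ∀ U : OpenSub H, LabelGroup B U.1} (ha : a ∈ congruences H B) {N : ℕ} (hN : N ≠ 0) :
    ∃ (X : Type v) (_ : MulAction H X) (lam : X → G → B),
      (∀ (h : H) p y, lam (h • p) y = lam p (y * h)) ∧
      (∀ U : OpenSub H, Finite (fixedPts H X U.1)) ∧ ∃ y, a = labelSum lam + N • y := by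
  obtain ⟨a, rfl⟩ := (GhostProd.labels H B).surjective a
  have h1 : a ∈ Set.range (ghostMap c ℤ (B →₀ ℤ)) := by
    rw [range_ghostMap_int c]
    exact ha
  obtain ⟨n, rfl⟩ := h1
  rw [ghostMap_eq_familySum]
  exact exists_labelSum_add_nsmul c.openSub (fun V => c.sec_spec V.1) (finite_ghostIndex c) n hN

theorem pair_labelSum {X X' : Type v} [MulAction H X] [MulAction H X'] (lam : X → G → B)
    (lam' : X' → G → B') (U : OpenSub H) [hX : Finite (fixedPts H X U.1)]
    [hX' : Finite (fixedPts H X' U.1)] :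
    Finite (fixedPts H (X × X') U.1) ∧ LabelGroup.pair (labelSum lam U) (labelSum lam' U) =
      labelSum (fun (p : X × X') y => (lam p.1 y, lam' p.2 y)) U := by
  let E : fixedPts H X U.1 × fixedPts H X' U.1 ≃ fixedPts H (X × X') U.1 :=
    { toFun := fun p => ⟨(p.1.1, p.2.1), fun h hh => Prod.ext (p.1.2 h hh) (p.2.2 h hh)⟩
      invFun := fun p => (⟨p.1.1, fun h hh => congrArg Prod.fst (p.2 h hh)⟩,
        ⟨p.1.2, fun h hh => congrArg Prod.snd (p.2 h hh)⟩)
      left_inv := fun _ => rfl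
      right_inv := fun _ => rfl }
  have h : Finite (fixedPts H (X × X') U.1) := Finite.of_equiv _ E
  refine ⟨h, ?_⟩
  rw [labelSum, labelSum, labelSum, dif_pos hX, dif_pos hX', dif_pos h]
  simp only [map_sum, AddMonoidHom.finsetSum_apply, LabelGroup.pair_single, mul_one]
  rw [Finset.sum_comm, ← Fintype.sum_prod_type' (fun (p : fixedPts H X U.1) (p' : fixedPts H X' U.1) =>
    (Finsupp.single (fun q : G ⧸ U.1 => (lam p.1 q.out, lam' p'.1 q.out)) 1 :
      LabelGroup (B × B') U.1))]
  exact Fintype.sum_equiv E _ _ fun _ => rfl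

/-- For families coming from labelled sets, the pairing corresponds to the cartesian product of
H-sets. The general case follows modulo every N, since all cross terms are divisible by N. -/
theorem pair_mem_congruences (c : WittChoice H) {a : ∀ U : OpenSub H, LabelGroup B U.1}
    {a' : ∀ U : OpenSub H, LabelGroup B' U.1} (ha : a ∈ congruences H B)
    (ha' : a' ∈ congruences H B') :
    (fun U => LabelGroup.pair (a U) (a' U)) ∈ congruences H (B × B') := by
  rcases isEmpty_or_nonempty B with hB | hB
  · rw [labelGroup_eq_zero_of_isEmpty fun U => LabelGroup.pair (a U) (a' U)]
    exact zero_mem _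
  rcases isEmpty_or_nonempty B' with hB' | hB'
  · rw [labelGroup_eq_zero_of_isEmpty fun U => LabelGroup.pair (a U) (a' U)]
    exact zero_mem _
  refine mem_congruences_of_nsmul fun N hN => ?_
  obtain ⟨X, _, lam, hl, hX, y, rfl⟩ := exists_labelSum_of_mem_congruences c ha hN
  obtain ⟨X', _, lam', hl', hX', y', rfl⟩ := exists_labelSum_of_mem_congruences c ha' hN
  refine ⟨_, labelSum_mem_congruences (lam := fun (p : X × X') y => (lam p.1 y, lam' p.2 y))
    (fun h p y => Prod.ext (hl h p.1 y) (hl' h p.2 y)) fun U => (pair_labelSum lam lam' U).1,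
    fun U => LabelGroup.pair (labelSum lam U) (y' U) + LabelGroup.pair (y U) (labelSum lam' U) +
      N • LabelGroup.pair (y U) (y' U), ?_⟩
  funext U
  simp only [Pi.add_apply, Pi.smul_apply, ← (pair_labelSum lam lam' U).2, map_add,
    AddMonoidHom.add_apply, map_nsmul, AddMonoidHom.nsmul_apply, smul_add]
  abel

section
variable {R M R' M' : Type*} [CommRing R] [AddCommGroup M] [Module R M] [CommRing R']
  [AddCommGroup M'] [Module R' M']

/-- The tensor given by a combination of labels and a map from labels to `M`. -/
noncomputable def LabelGroup.eval (R : Type*) {M : Type*} [CommRing R] [AddCommGroup M]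
    [Module R M] (φ : B → M) (U : OpenSub H) : LabelGroup B U.1 →+ TPow R M (G ⧸ U.1) :=
  (TPow.map (Int.castRingHom R) (freeLift (Int.castRingHom R) φ) _).toAddMonoidHom.comp
    (TPow.finsuppEquiv ℤ B (G ⧸ U.1)).symm.toLinearMap.toAddMonoidHom

theorem LabelGroup.eval_single (φ : B → M) (U : OpenSub H) (b : G ⧸ U.1 → B) :
    LabelGroup.eval R φ U (Finsupp.single b 1) = TPow.tprod R fun q => φ (b q) := by
  change TPow.map _ _ _ ((TPow.finsuppEquiv ℤ B (G ⧸ U.1)).symm _) = _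
  rw [TPow.finsuppEquiv_symm_single, TPow.map_tprod]
  simp [freeLift_single]

theorem eval_mem_ghostImage (c : WittChoice H) (φ : B → M) {a : ∀ U : OpenSub H, LabelGroup B U.1}
    (ha : a ∈ congruences H B) : (fun U => LabelGroup.eval R φ U (a U)) ∈ ghostImage c R M := by
  have h : (GhostProd.labels H B).symm a ∈ ghostImage c ℤ (B →₀ ℤ) := by
    rw [mem_ghostImage]
    change _ ∈ Set.range _
    rw [range_ghostMap_int c, Set.mem_ofPred_eq, AddEquiv.apply_symm_apply]
    exact ha
  exact map_mem_ghostImage c (Int.castRingHom R) (freeLift (Int.castRingHom R) φ) h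

/-- Both sides are biadditive, so it suffices to compare basis labels, where both are the pure
tensor of the m ⊗ m'. -/
theorem shuffle_eval (U : OpenSub H) (a : LabelGroup M U.1) (a' : LabelGroup M' U.1) :
    TPow.shuffle R M R' M' _ (LabelGroup.eval R' id U a') (LabelGroup.eval R id U a) =
      LabelGroup.eval (R ⊗[ℤ] R') (fun p : M × M' => ExtTensor.mk R R' p.1 p.2) U
        (LabelGroup.pair a a') := by
  induction a using Finsupp.induction_linear with
  | zero => simp
  | add f g hf hg => simp only [map_add, AddMonoidHom.add_apply, hf, hg]
  | single b k =>
    induction a' using Finsupp.induction_linear with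
    | zero => simp
    | add f g hf hg => simp only [map_add, AddMonoidHom.add_apply, hf, hg]
    | single b' l =>
      rw [← Finsupp.smul_single_one b k, ← Finsupp.smul_single_one b' l]
      simp only [map_zsmul, AddMonoidHom.zsmul_apply, LabelGroup.eval_single,
        LabelGroup.pair_single, mul_one]
      have := TPow.shuffle_tprod (R := R) (R' := R') b' 1 b 1
      rw [one_smul, one_smul, ← Algebra.TensorProduct.one_def, one_smul] at this
      simp only [id, this, smul_comm k l]

/-- The external product on ghost components. -/
noncomputable def GhostProd.shuffle (H : Subgroup G) (R M R' M' : Type*) [CommRing R]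
    [AddCommGroup M] [Module R M] [CommRing R'] [AddCommGroup M'] [Module R' M'] :
    GhostProd H R M →+ GhostProd H R' M' →+ GhostProd H (R ⊗[ℤ] R') (ExtTensor R M R' M') :=
  AddMonoidHom.mk' (fun a => AddMonoidHom.mk'
    (fun b U => TPow.shuffle R M R' M' _ (b U) (a U)) fun b b' => by
      funext U
      simp) fun a a' => by
    ext b U
    simp

theorem GhostProd.continuous_shuffle :
    Continuous fun p : GhostProd H R M × GhostProd H R' M' =>
      GhostProd.shuffle H R M R' M' p.1 p.2 :=
  continuous_pi fun U =>
    have h : Continuous fun t : TPow R M (G ⧸ U.1) × TPow R' M' (G ⧸ U.1) =>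
      TPow.shuffle R M R' M' _ t.2 t.1 := continuous_of_discreteTopology
    h.comp (f := fun p : GhostProd H R M × GhostProd H R' M' => (p.1 U, p.2 U))
      (((continuous_apply U).comp continuous_fst).prodMk
      ((continuous_apply U).comp continuous_snd))

theorem GhostProd.shuffle_mem (c : WittChoice H) {a : GhostProd H R M} {b : GhostProd H R' M'}
    (ha : a ∈ ghostImage c R M) (hb : b ∈ ghostImage c R' M') :
    GhostProd.shuffle H R M R' M' a b ∈ ghostImage c (R ⊗[ℤ] R') (ExtTensor R M R' M') := by
  rw [ghostImage_eq] at ha hb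
  obtain ⟨l, hl, rfl⟩ := ha
  obtain ⟨l', hl', rfl⟩ := hb
  have := eval_mem_ghostImage (R := R ⊗[ℤ] R') c
    (fun p : M × M' => ExtTensor.mk R R' p.1 p.2) (pair_mem_congruences c hl hl')
  convert this using 1
  funext U
  exact shuffle_eval U (l U) (l' U)

theorem GhostProd.map_shuffle {S N S' N' : Type*} [CommRing S] [AddCommGroup N] [Module S N]
    [CommRing S'] [AddCommGroup N'] [Module S' N'] (α : R →+* S) (f : M →ₛₗ[α] N)
    (β : R' →+* S') (g : M' →ₛₗ[β] N') (a : GhostProd H R M) (b : GhostProd H R' M') :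
    GhostProd.map H _ (ExtTensor.map α f β g) (GhostProd.shuffle H R M R' M' a b) =
      GhostProd.shuffle H S N S' N' (GhostProd.map H α f a) (GhostProd.map H β g b) :=
  funext fun _ => TPow.map_shuffle _ _ _ _ _ _

end

end GhostPairing

/-! ### Iterated tensor powers and Θ on ghost components -/

namespace TPow

variable {R M X Y Z W : Type*} [CommRing R] [AddCommGroup M] [Module R M]

theorem nest_reindex_apply [Finite Y] (e : Y ≃ Z) (t : TPow R (TPow R M X) Y) :
    nest R M X Z (reindex R e t) =
      reindex R (Equiv.prodCongr (Equiv.refl X) e) (nest R M X Y t) := by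
  have : Finite Z := Finite.of_equiv _ e
  refine LinearMap.congr_fun (linear_ext (Φ := nest R M X Z ∘ₗ (reindex R e).toLinearMap)
    (Ψ := (reindex R (Equiv.prodCongr (Equiv.refl X) e)).toLinearMap ∘ₗ nest R M X Y) fun n => ?_) t
  simp only [LinearMap.comp_apply, LinearEquiv.coe_coe, reindex_tprod, nest_reindex]

theorem power_reindex [Finite Z] (e : X ≃ Y) (n : TPow R M X) :
    power Z (reindex R e n) = reindex R (Equiv.prodCongr e (Equiv.refl Z)) (power Z n) := by
  have h := LinearMap.congr_fun (nest_ext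
    (Φ := (reindex R (Equiv.prodCongr e (Equiv.refl Z))).toLinearMap ∘ₗ nest R M X Z)
    (Ψ := nest R M Y Z ∘ₗ map (RingHom.id R) (reindex R e).toLinearMap Z) fun m => by
      simp only [LinearMap.comp_apply, LinearEquiv.coe_coe, nest_tprod, map_tprod, reindex_tprod,
        nest_tprod fun z y => m z (e.symm y)]
      rfl) (tprod R fun _ => n)
  simp only [LinearMap.comp_apply, LinearEquiv.coe_coe, map_tprod] at h
  exact h.symm

theorem nest_power [Finite W] [Finite Y] (n : TPow R (TPow R M X) W) :
    nest R M X (W × Y) (power Y n) =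
      reindex R (Equiv.prodAssoc X W Y) (power Y (nest R M X W n)) := by
  have h := LinearMap.congr_fun (nest_ext
    (Φ := nest R M X (W × Y))
    (Ψ := (reindex R (Equiv.prodAssoc X W Y)).toLinearMap ∘ₗ nest R M (X × W) Y ∘ₗ
      map (RingHom.id R) (nest R M X W) Y ∘ₗ unnest R (TPow R M X) W Y) fun m => by
      simp only [LinearMap.comp_apply, LinearEquiv.coe_coe, nest_tprod, unnest_tprod, map_tprod,
        reindex_tprod]
      rfl) (power Y n)
  rw [h]
  simp only [LinearMap.comp_apply, LinearEquiv.coe_coe, power, unnest_nest, map_tprod]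

end TPow

section Theta

variable {G : Type v} [Group G] [TopologicalSpace G] {H : Subgroup G}

/-- An open subgroup of the group `H` as an open subgroup of `G` that is contained in `H`. -/
def OpenSub.outside (hH : IsOpen (H : Set G)) (U : OpenSub (⊤ : Subgroup ↥H)) : OpenSub H :=
  ⟨U.1.map H.subtype, by
    rw [Subgroup.coe_map]
    exact hH.isOpenMap_subtype_val _ U.2.1, Subgroup.map_subtype_le _⟩

theorem OpenSub.inside_outside (hH : IsOpen (H : Set G)) (U : OpenSub (⊤ : Subgroup ↥H)) :
    (U.outside hH).inside = U :=
  Subtype.ext (Subgroup.comap_map_eq_self_of_injective H.subtype_injective U.1)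

/-- The open subgroups of `G` that are contained in `H` are the open subgroups of `H`. -/
def OpenSub.insideEquiv (hH : IsOpen (H : Set G)) : OpenSub H ≃ OpenSub (⊤ : Subgroup ↥H) where
  toFun U := U.inside
  invFun U := U.outside hH
  left_inv U := Subtype.ext ((Subgroup.subgroupOf_map_subtype U.1 H).trans (inf_eq_left.2 U.2.2))
  right_inv U := U.inside_outside hH

variable {R M : Type*} [CommRing R] [AddCommGroup M] [Module R M]

/-- The composite of coset representatives for `G/H` and for `H/V`. -/
noncomputable def compSection {V : Subgroup G} (hV : V ≤ H) (σ : G ⧸ H → G)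
    (hσ : Function.RightInverse σ QuotientGroup.mk) (τ : ↥H ⧸ V.subgroupOf H → ↥H) (y : G ⧸ V) :
    G :=
  σ (Subgroup.quotientEquivProdOfLE' hV σ hσ y).1 *
    (τ (Subgroup.quotientEquivProdOfLE' hV σ hσ y).2 : G)

theorem mk_compSection {V : Subgroup G} (hV : V ≤ H) (σ : G ⧸ H → G)
    (hσ : Function.RightInverse σ QuotientGroup.mk) (τ : ↥H ⧸ V.subgroupOf H → ↥H)
    (hτ : Function.RightInverse τ QuotientGroup.mk) :
    Function.RightInverse (compSection hV σ hσ τ) QuotientGroup.mk := fun y => by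
  have h : (Subgroup.quotientEquivProdOfLE' hV σ hσ).symm
      ((Subgroup.quotientEquivProdOfLE' hV σ hσ y).1, QuotientGroup.mk
        (τ (Subgroup.quotientEquivProdOfLE' hV σ hσ y).2)) =
      QuotientGroup.mk (compSection hV σ hσ τ y) := rfl
  rw [← h, hτ]
  exact Equiv.symm_apply_apply _ y

theorem compSection_symm_apply {V : Subgroup G} (hV : V ≤ H) (σ : G ⧸ H → G)
    (hσ : Function.RightInverse σ QuotientGroup.mk) (τ : ↥H ⧸ V.subgroupOf H → ↥H)
    (p : (G ⧸ H) × (↥H ⧸ V.subgroupOf H)) :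
    compSection hV σ hσ τ ((Subgroup.quotientEquivProdOfLE' hV σ hσ).symm p) =
      σ p.1 * (τ p.2 : G) := by
  rw [compSection, Equiv.apply_symm_apply]

theorem ConjLE.inside {U V : Subgroup G} {h : ↥H} (hh : ConjLE (h : G) U V) :
    ConjLE h (U.subgroupOf H) (V.subgroupOf H) :=
  fun u hu => hh u hu

/-- The isomorphism `(M^{⊗ X})^{⊗ Y} ≅ M^{⊗ X × Y}`. -/
noncomputable def TPow.nestEquiv (R M X Y : Type*) [CommRing R] [AddCommGroup M] [Module R M]
    [Finite Y] : TPow R (TPow R M X) Y ≃ₗ[R] TPow R M (X × Y) :=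
  { TPow.nest R M X Y with
    invFun := TPow.unnest R M X Y
    left_inv := TPow.unnest_nest
    right_inv := TPow.nest_unnest }

/-- The isomorphism `(M^{⊗ G/H})^{⊗ H/U} ≅ M^{⊗ G/U}`. -/
noncomputable def nestCoset {U : Subgroup G} (hU : U ≤ H) (σ : G ⧸ H → G)
    (hσ : Function.RightInverse σ QuotientGroup.mk) [Finite (↥H ⧸ U.subgroupOf H)] :
    TPow R (TPow R M (G ⧸ H)) (↥H ⧸ U.subgroupOf H) ≃ₗ[R] TPow R M (G ⧸ U) :=
  (TPow.nestEquiv R M _ _).trans (TPow.cosetIso hU σ hσ)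

theorem nestCoset_apply {U : Subgroup G} (hU : U ≤ H) (σ : G ⧸ H → G)
    (hσ : Function.RightInverse σ QuotientGroup.mk) [Finite (↥H ⧸ U.subgroupOf H)]
    (t : TPow R (TPow R M (G ⧸ H)) (↥H ⧸ U.subgroupOf H)) :
    nestCoset hU σ hσ t = TPow.cosetIso hU σ hσ (TPow.nest R M _ _ t) := rfl

/-- Both sides distribute the same copies of the nested tensor over G/U. With the composite section
for G/V the positions are σ(x)τ(s)yh⁻¹ on either side, so the two reindexings agree exactly. -/
theorem nestCoset_tensorNorm {U V : Subgroup G} (hU : U ≤ H) (hV : V ≤ H) (σ : G ⧸ H → G)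
    (hσ : Function.RightInverse σ QuotientGroup.mk) [Finite (↥H ⧸ U.subgroupOf H)]
    [Finite (↥H ⧸ V.subgroupOf H)] (τ : ↥H ⧸ V.subgroupOf H → ↥H)
    (hτ : Function.RightInverse τ QuotientGroup.mk) (h : ↥H) (hh : ConjLE (h : G) U V)
    (n : TPow R (TPow R M (G ⧸ H)) (↥H ⧸ V.subgroupOf H)) :
    nestCoset hU σ hσ (tensorNorm hτ h hh.inside n) =
      tensorNorm (mk_compSection hV σ hσ τ hτ) (h : G) hh (nestCoset hV σ hσ n) := by
  have hfin := finite_normFiber h hh.inside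
  let θ : (V.subgroupOf H) ⧸ (conjSubgroup h⁻¹ (U.subgroupOf H)).subgroupOf (V.subgroupOf H) ≃
      V ⧸ (conjSubgroup (h : G)⁻¹ U).subgroupOf V :=
    Quotient.congr (Subgroup.subgroupOfEquivOfLe hV).toEquiv fun a b => by
      rw [QuotientGroup.leftRel_apply, QuotientGroup.leftRel_apply]
      rfl
  have hfin' := Finite.of_equiv _ θ
  rw [nestCoset_apply, nestCoset_apply, norm_eq_reindex, norm_eq_reindex,
    TPow.nest_reindex_apply, TPow.nest_power, TPow.cosetIso, TPow.cosetIso, TPow.power_reindex]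
  simp only [TPow.reindex_reindex]
  refine TPow.reindex_power_congr _ θ _ _ fun x y => ?_
  obtain ⟨x, s⟩ := x
  induction y using QuotientGroup.induction_on with
  | H y =>
    induction s using QuotientGroup.induction_on with
    | H s =>
      have h0 := compSection_symm_apply hV σ hσ τ (x, QuotientGroup.mk s)
      change QuotientGroup.mk (σ x * ((τ (QuotientGroup.mk s) * y * h⁻¹ : ↥H) : G)) =
        QuotientGroup.mk (compSection hV σ hσ τ ((Subgroup.quotientEquivProdOfLE' hV σ hσ).symm
          (x, QuotientGroup.mk s)) * ((y : ↥H) : G) * (h : G)⁻¹)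
      rw [h0]
      simp [mul_assoc]

end Theta

section GhostTheta

variable {G : Type v} [Group G] [TopologicalSpace G] {H : Subgroup G} [IsTopologicalGroup G]
  [CompactSpace G] {R M : Type*} [CommRing R] [AddCommGroup M] [Module R M]

theorem compactSpace_of_isOpen (hH : IsOpen (H : Set G)) : CompactSpace ↥H :=
  isCompact_iff_compactSpace.1 (H.isClosed_of_isOpen hH).isCompact

/-- The fixed points of `U` on `H/V`, computed in `H` and in `G`. -/
noncomputable def insideFixed (U V : OpenSub H) :
    fixedCosets (⊤ : Subgroup ↥H) U.inside.1 V.inside.1 ≃ fixedCosets H U.1 V.1 :=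
  Equiv.ofBijective (fun x => ⟨QuotientGroup.mk (x.1.out : G), mk_mem_fixedCosets x.1.out.2
      fun u hu => conjLE_out x.2.2 (⟨u, U.2.2 hu⟩ : ↥H) hu⟩) (by
    constructor
    · intro x x' h
      have h1 := QuotientGroup.eq.1 (congrArg Subtype.val h)
      apply Subtype.ext
      rw [← QuotientGroup.out_eq' x.1, ← QuotientGroup.out_eq' x'.1]
      exact QuotientGroup.eq.2 h1
    · rintro ⟨y, hy⟩
      let h : ↥H := ⟨y.out, out_mem_of_mem_fixedCosets V.2.2 hy⟩
      let x : fixedCosets (⊤ : Subgroup ↥H) U.inside.1 V.inside.1 := ⟨QuotientGroup.mk h,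
        mk_mem_fixedCosets trivial fun u hu => conjLE_out hy.2 (u : G) hu⟩
      refine ⟨x, Subtype.ext ?_⟩
      obtain ⟨v, hv, hx⟩ := out_eq_mul (rfl : QuotientGroup.mk h = x.1)
      change QuotientGroup.mk ((x.1.out : ↥H) : G) = y
      rw [hx]
      exact (QuotientGroup.mk_mul_of_mem (h : G) (show (v : G) ∈ V.1 from hv)).trans
        (QuotientGroup.out_eq' y))

/-- The isomorphism `Θ` on ghost components. -/
noncomputable def GhostProd.theta (hH : IsOpen (H : Set G)) (σ : G ⧸ H → G)
    (hσ : Function.RightInverse σ QuotientGroup.mk) (R M : Type*) [CommRing R] [AddCommGroup M]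
    [Module R M] :
    GhostProd (⊤ : Subgroup ↥H) R (TPow R M (G ⧸ H)) ≃ₜ+ GhostProd H R M :=
  have _ := compactSpace_of_isOpen hH
  have _ : ∀ U : OpenSub H, Finite (↥H ⧸ U.1.subgroupOf H) := fun U =>
    OpenSub.finite_quotient U.inside
  { (Homeomorph.piCongrLeft (Y := fun U : OpenSub (⊤ : Subgroup ↥H) =>
      TPow R (TPow R M (G ⧸ H)) (↥H ⧸ U.1)) (OpenSub.insideEquiv hH)).symm.trans
      (Homeomorph.piCongrRight fun U : OpenSub H =>
        { (nestCoset U.2.2 σ hσ).toEquiv with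
          continuous_toFun := continuous_of_discreteTopology
          continuous_invFun := continuous_of_discreteTopology }) with
    map_add' := fun _ _ => funext fun U => map_add (nestCoset U.2.2 σ hσ) _ _ }

theorem GhostProd.map_theta {R' M' : Type*} [CommRing R'] [AddCommGroup M'] [Module R' M']
    (hH : IsOpen (H : Set G)) (σ : G ⧸ H → G)
    (hσ : Function.RightInverse σ QuotientGroup.mk) (α : R →+* R') (f : M →ₛₗ[α] M')
    (a : GhostProd (⊤ : Subgroup ↥H) R (TPow R M (G ⧸ H))) :
    GhostProd.map H α f (GhostProd.theta hH σ hσ R M a) =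
      GhostProd.theta hH σ hσ R' M' (GhostProd.map ⊤ α (TPow.map α f _) a) := by
  funext U
  have hc := compactSpace_of_isOpen hH
  have : Finite (↥H ⧸ U.1.subgroupOf H) := OpenSub.finite_quotient U.inside
  have key : ∀ t : TPow R (TPow R M (G ⧸ H)) (↥H ⧸ U.1.subgroupOf H),
      TPow.map α f _ (TPow.cosetIso U.2.2 σ hσ (TPow.nest R M _ _ t)) =
        TPow.cosetIso U.2.2 σ hσ (TPow.nest R' M' _ _ (TPow.map α (TPow.map α f _) _ t)) := by
    intro t
    induction t using TPow.induction with
    | h r m =>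
      rw [map_smul, map_smul, map_smulₛₗ, map_smulₛₗ, map_smul, map_smul, TPow.map_tprod,
        TPow.cosetIso, TPow.map_reindex, TPow.map_nest]
      rfl
    | hadd s t hs ht => simp only [map_add, hs, ht]
  exact key (a U.inside)

theorem theta_familySum (hH : IsOpen (H : Set G)) (σ : G ⧸ H → G)
    (hσ : Function.RightInverse σ QuotientGroup.mk) {ι : Type v} (V : ι → OpenSub H)
    [∀ i, Finite (↥H ⧸ (V i).1.subgroupOf H)]
    {τ : ∀ i, ↥H ⧸ (V i).inside.1 → ↥H} (hτ : ∀ i, Function.RightInverse (τ i) QuotientGroup.mk)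
    (hfin : ∀ U : OpenSub H, Finite (Σ i, fixedCosets H U.1 (V i).1))
    (n : ∀ i, TPow R (TPow R M (G ⧸ H)) (↥H ⧸ (V i).inside.1)) :
    GhostProd.theta hH σ hσ R M (familySum (fun i => (V i).inside) hτ n) =
      familySum V (fun i => mk_compSection (V i).2.2 σ hσ (τ i) (hτ i))
        fun i => nestCoset (V i).2.2 σ hσ (n i) := by
  funext U
  have hc := compactSpace_of_isOpen hH
  have : Finite (↥H ⧸ U.1.subgroupOf H) := OpenSub.finite_quotient U.inside
  have := OpenSub.finite_quotient U
  have := hfin U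
  let E : (Σ i, fixedCosets (⊤ : Subgroup ↥H) U.inside.1 (V i).inside.1) ≃
      Σ i, fixedCosets H U.1 (V i).1 := Equiv.sigmaCongrRight fun i => insideFixed U (V i)
  have := Finite.of_equiv _ E.symm
  let _ := Fintype.ofFinite (Σ i, fixedCosets H U.1 (V i).1)
  let _ := Fintype.ofFinite (Σ i, fixedCosets (⊤ : Subgroup ↥H) U.inside.1 (V i).inside.1)
  have h1 : GhostProd.theta hH σ hσ R M (familySum (fun i => (V i).inside) hτ n) U =
      nestCoset U.2.2 σ hσ (familySum (fun i => (V i).inside) hτ n U.inside) := rfl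
  rw [h1, familySum_apply, familySum_apply]
  refine (map_sum (nestCoset U.2.2 σ hσ) _ _).trans ?_
  refine Fintype.sum_equiv E _ _ fun p => ?_
  have hh : ConjLE (p.2.1.out : G) U.1 (V p.1).1 := fun u hu =>
    conjLE_out p.2.2.2 (⟨u, U.2.2 hu⟩ : ↥H) hu
  refine (nestCoset_tensorNorm U.2.2 (V p.1).2.2 σ hσ (τ p.1) (hτ p.1) p.2.1.out hh (n p.1)).trans ?_
  refine norm_congr _ _ _ ?_ _
  exact (QuotientGroup.out_eq' (E p).2.1).symm

theorem exists_familySum (c : WittChoice H) {σ : ∀ V : c.reps, G ⧸ V.1 → G}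
    (hσ : ∀ V, Function.RightInverse (σ V) QuotientGroup.mk) {a : GhostProd H R M}
    (ha : a ∈ ghostImage c R M) : ∃ n, familySum c.openSub hσ n = a := by
  classical
  -- Only the coset representatives are changed. By `ghostImage_eq` the image is the same, so `a` is
  -- a ghost vector for the prescribed sections too.
  let c₂ : WittChoice H :=
    { c.toClassReps with
      sec := fun V => if h : V ∈ c.reps then σ ⟨V, h⟩ else Quotient.out
      sec_spec := fun V => by
        by_cases h : V ∈ c.reps
        · rw [dif_pos h]
          exact hσ _
        · rw [dif_neg h]
          exact QuotientGroup.out_eq' }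
  rw [ghostImage_eq, ← ghostImage_eq c₂] at ha
  obtain ⟨n, rfl⟩ := (mem_ghostImage c₂).1 ha
  have key : ∀ (σ' : ∀ V : c.reps, G ⧸ V.1 → G)
      (hσ' : ∀ V, Function.RightInverse (σ' V) QuotientGroup.mk) (_ : σ' = σ),
      familySum c.openSub hσ n = familySum c.openSub hσ' n := by
    rintro _ _ rfl
    rfl
  refine ⟨n, (key (fun V => c₂.sec V.1) (fun V => c₂.sec_spec V.1) ?_).trans
    (ghostMap_eq_familySum c₂ n).symm⟩
  exact funext fun V => dif_pos V.2

theorem finite_inside (hH : IsOpen (H : Set G)) {ι : Type v} (V : ι → OpenSub H)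
    (hfin : ∀ U : OpenSub H, Finite (Σ i, fixedCosets H U.1 (V i).1))
    (U : OpenSub (⊤ : Subgroup ↥H)) :
    Finite (Σ i, fixedCosets (⊤ : Subgroup ↥H) U.1 (V i).inside.1) := by
  obtain ⟨U, rfl⟩ := (OpenSub.insideEquiv hH).surjective U
  have := hfin U
  exact Finite.of_equiv _ (Equiv.sigmaCongrRight fun i => insideFixed U (V i)).symm

theorem theta_familySum_mem (hH : IsOpen (H : Set G)) (σ : G ⧸ H → G)
    (hσ : Function.RightInverse σ QuotientGroup.mk) (c : WittChoice H) {ι : Type v}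
    (V : ι → OpenSub (⊤ : Subgroup ↥H)) {τ : ∀ i, ↥H ⧸ (V i).1 → ↥H}
    (hτ : ∀ i, Function.RightInverse (τ i) QuotientGroup.mk)
    (hfin : ∀ U : OpenSub (⊤ : Subgroup ↥H), Finite (Σ i, fixedCosets ⊤ U.1 (V i).1))
    (n : ∀ i, TPow R (TPow R M (G ⧸ H)) (↥H ⧸ (V i).1)) :
    GhostProd.theta hH σ hσ R M (familySum V hτ n) ∈ ghostImage c R M := by
  have hc := compactSpace_of_isOpen hH
  obtain ⟨V', rfl⟩ : ∃ V' : ι → OpenSub H, V = fun i => (V' i).inside :=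
    ⟨fun i => (V i).outside hH, funext fun i => ((V i).inside_outside hH).symm⟩
  have : ∀ i, Finite (↥H ⧸ (V' i).1.subgroupOf H) := fun i =>
    OpenSub.finite_quotient (V' i).inside
  have hfin' : ∀ U : OpenSub H, Finite (Σ i, fixedCosets H U.1 (V' i).1) := fun U =>
    have := hfin U.inside
    Finite.of_equiv _ (Equiv.sigmaCongrRight fun i => insideFixed U (V' i))
  rw [theta_familySum hH σ hσ V' hτ hfin']
  exact familySum_mem_ghostImage c V' _ hfin' _

/-- Θ takes sums of norms to sums of norms with composite sections. For the nontrivial converse, the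
given vector is written with those sections, its coefficients are pulled back through the
isomorphisms `nestCoset`, and injectivity of Θ on ghosts concludes. -/
theorem theta_mem_iff (hH : IsOpen (H : Set G)) (σ : G ⧸ H → G)
    (hσ : Function.RightInverse σ QuotientGroup.mk) (c : WittChoice H)
    (c' : WittChoice (⊤ : Subgroup ↥H))
    {a : GhostProd (⊤ : Subgroup ↥H) R (TPow R M (G ⧸ H))} :
    GhostProd.theta hH σ hσ R M a ∈ ghostImage c R M ↔
      a ∈ ghostImage c' R (TPow R M (G ⧸ H)) := by
  have hc := compactSpace_of_isOpen hH
  refine ⟨fun h => ?_, fun h => ?_⟩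
  · have : ∀ V : c.reps, Finite (↥H ⧸ (c.openSub V).1.subgroupOf H) := fun V =>
      OpenSub.finite_quotient (c.openSub V).inside
    have hτ : ∀ V : c.reps, Function.RightInverse
        (Quotient.out : ↥H ⧸ (c.openSub V).inside.1 → ↥H) QuotientGroup.mk :=
      fun V => QuotientGroup.out_eq'
    obtain ⟨m, hm⟩ := exists_familySum c
      (fun V => mk_compSection (c.openSub V).2.2 σ hσ _ (hτ V)) h
    choose n hn using fun V => (nestCoset (c.openSub V).2.2 σ hσ).surjective (m V)
    have h1 := theta_familySum hH σ hσ c.openSub hτ (finite_ghostIndex c) n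
    obtain rfl : (fun V => nestCoset (c.openSub V).2.2 σ hσ (n V)) = m := funext hn
    rw [hm] at h1
    rw [← (GhostProd.theta hH σ hσ R M).injective h1]
    exact familySum_mem_ghostImage c' _ hτ (finite_inside hH _ (finite_ghostIndex c)) n
  · obtain ⟨n, rfl⟩ := (mem_ghostImage c').1 h
    rw [ghostMap_eq_familySum]
    exact theta_familySum_mem hH σ hσ c c'.openSub (fun V => c'.sec_spec V.1)
      (finite_ghostIndex c') n

end GhostTheta

/-! ### Functoriality of the Witt vectors -/

namespace Witt

variable {G : Type*} [Group G] [TopologicalSpace G] {H : Subgroup G} (c : WittChoice H)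
  {R M R' M' R'' M'' : Type*} [CommRing R] [AddCommGroup M] [Module R M] [CommRing R']
  [AddCommGroup M'] [Module R' M'] [CommRing R''] [AddCommGroup M''] [Module R'' M'']

/-- The quotient map that defines the Witt vectors. -/
noncomputable def mk (R M : Type*) [CommRing R] [AddCommGroup M] [Module R M] :
    ghostImage c (FreeR R) (FreeM R M) →+ Witt c R M :=
  QuotientAddGroup.mk' _

noncomputable instance : IsTopologicalAddGroup (Witt c R M) :=
  inferInstanceAs (IsTopologicalAddGroup
    (ghostImage c (FreeR R) (FreeM R M) ⧸ (resolutionDiff c R M).range.topologicalClosure))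

instance : T2Space (Witt c R M) :=
  have : IsClosed ((resolutionDiff c R M).range.topologicalClosure :
    Set (ghostImage c (FreeR R) (FreeM R M))) := AddSubgroup.isClosed_topologicalClosure _
  inferInstanceAs (T2Space
    (ghostImage c (FreeR R) (FreeM R M) ⧸ (resolutionDiff c R M).range.topologicalClosure))

theorem mk_surjective : Function.Surjective (mk c R M) := QuotientAddGroup.mk'_surjective _

theorem isQuotientMap_mk : Topology.IsQuotientMap (mk c R M) := isQuotientMap_quot_mk

theorem mk_eq_zero {a : ghostImage c (FreeR R) (FreeM R M)} :
    mk c R M a = 0 ↔ a ∈ (resolutionDiff c R M).range.topologicalClosure :=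
  QuotientAddGroup.eq_zero_iff a

theorem mk_resolutionDiff (z : ghostImage c (FreeR (FreeR R)) (FreeM (FreeR R) (FreeM R M))) :
    mk c R M (ghostImageMap c (counitR (FreeR R)) (counitM (FreeR R) (FreeM R M)) z) =
      mk c R M (ghostImageMap c (freeRMap (counitR R)) (freeMMap (counitR R) (counitM R M)) z) := by
  rw [← sub_eq_zero, ← map_sub, mk_eq_zero]
  exact AddSubgroup.le_topologicalClosure _ ⟨z, rfl⟩

theorem ghost_mk (a : ghostImage c (FreeR R) (FreeM R M)) :
    ghost c R M (mk c R M a) = GhostProd.map H (counitR R) (counitM R M) a := rfl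

theorem map_mk (α : R →+* R') (f : M →ₛₗ[α] M') (a : ghostImage c (FreeR R) (FreeM R M)) :
    map c α f (mk c R M a) = mk c R' M' (ghostImageMap c (freeRMap α) (freeMMap α f) a) := rfl

theorem continuous_of_mk {Y : Type*} [TopologicalSpace Y] {f : Witt c R M → Y}
    (h : Continuous fun a => f (mk c R M a)) : Continuous f :=
  (isQuotientMap_mk c).continuous_iff.2 h

theorem continuous_ghost : Continuous (ghost c R M) :=
  continuous_of_mk c ((GhostProd.continuous_map _ _).comp continuous_subtype_val)

theorem continuous_map (α : R →+* R') (f : M →ₛₗ[α] M') : Continuous (map c α f) :=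
  continuous_of_mk c ((isQuotientMap_mk c).continuous.comp (continuous_ghostImageMap c _ _))

theorem ghost_map (α : R →+* R') (f : M →ₛₗ[α] M') (x : Witt c R M) :
    ghost c R' M' (map c α f x) = GhostProd.map H α f (ghost c R M x) := by
  obtain ⟨a, rfl⟩ := mk_surjective c x
  rw [map_mk, ghost_mk, ghost_mk, coe_ghostImageMap]
  exact GhostProd.map_comm (fun r => counitR_map α r) (fun m => counitM_map α f m) _

theorem map_map {α : R →+* R'} {f : M →ₛₗ[α] M'} {β : R' →+* R''} {g : M' →ₛₗ[β] M''}
    {γ : R →+* R''} {k : M →ₛₗ[γ] M''} (hr : ∀ r, β (α r) = γ r) (hm : ∀ m, g (f m) = k m)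
    (x : Witt c R M) : map c β g (map c α f x) = map c γ k x := by
  obtain ⟨a, rfl⟩ := mk_surjective c x
  rw [map_mk, map_mk, map_mk]
  congr 1
  refine Subtype.ext (funext fun U => ?_)
  exact TPow.map_map (fun r => freeRMap_comp _ _ _ hr r)
    (fun m => freeMMap_comp _ _ _ hr _ _ _ hm m) _

theorem map_comm {R₃ M₃ : Type*} [CommRing R₃] [AddCommGroup M₃] [Module R₃ M₃]
    {α₁ : R →+* R'} {β₁ : R' →+* R₃} {α₂ : R →+* R''} {β₂ : R'' →+* R₃}
    {f₁ : M →ₛₗ[α₁] M'} {g₁ : M' →ₛₗ[β₁] M₃} {f₂ : M →ₛₗ[α₂] M''} {g₂ : M'' →ₛₗ[β₂] M₃}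
    (hr : ∀ r, β₁ (α₁ r) = β₂ (α₂ r)) (hm : ∀ m, g₁ (f₁ m) = g₂ (f₂ m)) (x : Witt c R M) :
    map c β₁ g₁ (map c α₁ f₁ x) = map c β₂ g₂ (map c α₂ f₂ x) := by
  obtain ⟨a, rfl⟩ := mk_surjective c x
  simp only [map_mk]
  congr 1
  refine Subtype.ext (GhostProd.map_comm (fun r => ?_) (fun m => ?_) _)
  · rw [freeRMap_comp _ _ _ hr, freeRMap_comp _ _ _ (fun _ => rfl)]
  · rw [freeMMap_comp _ _ _ hr _ _ _ hm, freeMMap_comp _ _ _ (fun _ => rfl) _ _ _ (fun _ => rfl)]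

theorem map_of_eq (α : R →+* R) (f : M →ₛₗ[α] M) (hα : ∀ r, α r = r) (hf : ∀ m, f m = m)
    (x : Witt c R M) : map c α f x = x := by
  obtain ⟨a, rfl⟩ := mk_surjective c x
  rw [map_mk]
  congr 1
  refine Subtype.ext (funext fun U => ?_)
  have h1 : ∀ r, freeRMap α r = r := fun r => by
    rw [show (α : R → R) = id from funext hα]
    exact MvPolynomial.rename_id_apply r
  refine TPow.map_of_eq _ _ h1 (fun m => ?_) _
  induction m using Finsupp.induction_linear with
  | zero => simp
  | add a b ha hb => simp only [_root_.map_add, ha, hb]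
  | single m t => rw [freeMMap, freeLift_single, h1, hf, Finsupp.smul_single, smul_eq_mul, mul_one]

end Witt

/-! ### Split resolutions: Witt vectors as ghost images -/

/-- A section of the canonical resolution of `(T; Q)`. -/
structure ResolutionSection (T Q : Type*) [CommRing T] [AddCommGroup Q] [Module T Q] where
  /-- the section on rings -/
  ring : T →+* FreeR T
  /-- the section on modules -/
  module : Q →ₛₗ[ring] FreeM T Q
  counitR_ring : ∀ t, counitR T (ring t) = t
  counitM_module : ∀ q, counitM T Q (module q) = q

namespace ResolutionSection

variable {G : Type*} [Group G] [TopologicalSpace G] {H : Subgroup G} (c : WittChoice H)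
  {T Q : Type*} [CommRing T] [AddCommGroup Q] [Module T Q]

/-- A section splits the coequaliser. Apply s to the underlying sets to lift `a` to the second stage
of the resolution: one map returns `a`, while the other returns s of the ghost of `a`, which is
zero. -/
theorem ghost_injective (s : ResolutionSection T Q) :
    Function.Injective (Witt.ghost c T Q) := by
  rw [injective_iff_map_eq_zero]
  intro x hx
  obtain ⟨a, rfl⟩ := Witt.mk_surjective c x
  have h := Witt.mk_resolutionDiff c (ghostImageMap c (freeRMap s.ring) (freeMMap s.ring s.module) a)
  rw [Witt.ghost_mk] at hx
  have h1 : ghostImageMap c (freeRMap (counitR T)) (freeMMap (counitR T) (counitM T Q))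
      (ghostImageMap c (freeRMap s.ring) (freeMMap s.ring s.module) a) = a := by
    refine Subtype.ext (funext fun U => ?_)
    refine (TPow.map_map (γ := freeRMap id) (k := freeMMap id id) (fun r => ?_) (fun m => ?_) _).trans
      (TPow.map_of_eq _ _ ?_ ?_ _)
    · exact freeRMap_comp _ _ _ s.counitR_ring r
    · exact freeMMap_comp _ _ _ s.counitR_ring _ _ _ s.counitM_module m
    · exact fun r => MvPolynomial.rename_id_apply r
    · exact TPow.freeMMap_id
  have h2 : ghostImageMap c (counitR (FreeR T)) (counitM (FreeR T) (FreeM T Q))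
      (ghostImageMap c (freeRMap s.ring) (freeMMap s.ring s.module) a) = 0 := by
    refine Subtype.ext ?_
    rw [coe_ghostImageMap, coe_ghostImageMap,
      GhostProd.map_comm (fun r => counitR_map s.ring r) (fun m => counitM_map s.ring s.module m),
      hx, map_zero]
    rfl
  rw [h1, h2, map_zero] at h
  exact h.symm

/-- The Witt vectors of a free module are the image of the ghost map. -/
noncomputable def ofGhost (s : ResolutionSection T Q) : ghostImage c T Q →+ Witt c T Q :=
  (Witt.mk c T Q).comp (ghostImageMap c s.ring s.module)

theorem continuous_ofGhost (s : ResolutionSection T Q) : Continuous (s.ofGhost c) :=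
  (Witt.isQuotientMap_mk c).continuous.comp (continuous_ghostImageMap c _ _)

theorem ghost_ofGhost (s : ResolutionSection T Q) (a : ghostImage c T Q) :
    Witt.ghost c T Q (s.ofGhost c a) = a := by
  refine (Witt.ghost_mk c _).trans (funext fun U => ?_)
  exact (TPow.map_map (γ := RingHom.id T) (k := LinearMap.id) s.counitR_ring s.counitM_module
    _).trans (TPow.map_of_eq _ _ (fun _ => rfl) (fun _ => rfl) _)

theorem ghost_mem (x : Witt c T Q) : Witt.ghost c T Q x ∈ ghostImage c T Q := by
  obtain ⟨a, rfl⟩ := Witt.mk_surjective c x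
  exact (ghostImageMap c (counitR T) (counitM T Q) a).2

/-- The Witt vectors of a free module are the image of the ghost map. -/
noncomputable def ghostEquiv (s : ResolutionSection T Q) : Witt c T Q ≃ₜ+ ghostImage c T Q where
  toFun x := ⟨Witt.ghost c T Q x, ghost_mem c x⟩
  invFun := s.ofGhost c
  left_inv _ := s.ghost_injective c (s.ghost_ofGhost c _)
  right_inv a := Subtype.ext (s.ghost_ofGhost c a)
  map_add' _ _ := Subtype.ext (map_add _ _ _)
  continuous_toFun := (Witt.continuous_ghost c).subtype_mk _
  continuous_invFun := s.continuous_ofGhost c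

theorem map_ofGhost {T' Q' : Type*} [CommRing T'] [AddCommGroup Q'] [Module T' Q']
    (s : ResolutionSection T Q) (s' : ResolutionSection T' Q') (α : T →+* T') (f : Q →ₛₗ[α] Q')
    (a : ghostImage c T Q) :
    Witt.map c α f (s.ofGhost c a) = s'.ofGhost c (ghostImageMap c α f a) := by
  apply s'.ghost_injective c
  rw [Witt.ghost_map, ghost_ofGhost, ghost_ofGhost, coe_ghostImageMap]

/-- A free module has a section of its resolution if its ring has one. -/
noncomputable def ofBasis {B : Type*} (ρ : T →+* FreeR T) (hρ : ∀ t, counitR T (ρ t) = t)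
    (b : Module.Basis B T Q) : ResolutionSection T Q where
  ring := ρ
  module := (freeLift ρ fun i => Finsupp.single (b i) 1).comp b.repr.toLinearMap
  counitR_ring := hρ
  counitM_module q := by
    have h := freeLift_comp ρ (fun i => Finsupp.single (b i) 1) (counitR T) (counitM T Q)
      (RingHom.id T) b hρ (fun i => TPow.counitM_single _) (b.repr q)
    refine h.trans ?_
    conv_rhs => rw [← b.linearCombination_repr q]
    rfl

/-- Free modules over polynomial rings. -/
noncomputable def free {B : Type*} (σ : Type*) {Q : Type*} [AddCommGroup Q] [Module (FreeR σ) Q]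
    (b : Module.Basis B (FreeR σ) Q) : ResolutionSection (FreeR σ) Q :=
  ofBasis (freeRMap MvPolynomial.X) TPow.counitR_freeRMap_X b

/-- The integers. -/
noncomputable def int : ResolutionSection ℤ ℤ :=
  ofBasis (B := Unit) (Int.castRingHom _) (fun t => by simp) (Module.Basis.singleton Unit ℤ)

section Tensor

variable {T' Q' : Type*} [CommRing T'] [AddCommGroup Q'] [Module T' Q']

/-- The product of polynomials in elements of `T` and of `T'`, as a polynomial in elements of
`T ⊗ T'`. -/
noncomputable def tensorCoeff (T T' : Type*) [CommRing T] [CommRing T'] (p : FreeR T)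
    (p' : FreeR T') : FreeR (T ⊗[ℤ] T') :=
  freeRMap (fun t => t ⊗ₜ[ℤ] (1 : T')) p * freeRMap (fun t' => (1 : T) ⊗ₜ[ℤ] t') p'

theorem counitR_tensorCoeff (p : FreeR T) (p' : FreeR T') :
    counitR _ (tensorCoeff T T' p p') = counitR T p ⊗ₜ[ℤ] counitR T' p' := by
  rw [tensorCoeff, map_mul]
  have h := counitR_map (Algebra.TensorProduct.includeLeftRingHom : T →+* T ⊗[ℤ] T') p
  have h' := counitR_map
    (Algebra.TensorProduct.includeRight : T' →ₐ[ℤ] T ⊗[ℤ] T').toRingHom p'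
  refine (congrArg₂ _ h h').trans ?_
  change (_ ⊗ₜ[ℤ] _) * (_ ⊗ₜ[ℤ] _) = _
  rw [Algebra.TensorProduct.tmul_mul_tmul, mul_one, one_mul]

/-- The ring part of the section for a tensor product. -/
noncomputable def tensorRing (s : ResolutionSection T Q) (s' : ResolutionSection T' Q') :
    T ⊗[ℤ] T' →+* FreeR (T ⊗[ℤ] T') :=
  (Algebra.TensorProduct.productMap
    ((freeRMap fun t => t ⊗ₜ[ℤ] (1 : T')).comp s.ring).toIntAlgHom
    ((freeRMap fun t' => (1 : T) ⊗ₜ[ℤ] t').comp s'.ring).toIntAlgHom).toRingHom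

theorem tensorRing_tmul (s : ResolutionSection T Q) (s' : ResolutionSection T' Q') (t : T)
    (t' : T') : tensorRing s s' (t ⊗ₜ[ℤ] t') = tensorCoeff T T' (s.ring t) (s'.ring t') :=
  Algebra.TensorProduct.productMap_apply_tmul _ _ _ _

/-- The biadditive map `FreeM T Q × FreeM T' Q' → FreeM (T ⊗ T') (Q ⊗ Q')`. -/
noncomputable def tensorBilin (T Q T' Q' : Type*) [CommRing T] [AddCommGroup Q] [Module T Q]
    [CommRing T'] [AddCommGroup Q'] [Module T' Q'] :
    FreeM T Q →+ FreeM T' Q' →+ FreeM (T ⊗[ℤ] T') (ExtTensor T Q T' Q') :=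
  AddMonoidHom.mk' (fun m => AddMonoidHom.mk' (fun m' => m.sum fun q p => m'.sum fun q' p' =>
      Finsupp.single (ExtTensor.mk T T' q q') (tensorCoeff T T' p p')) fun m' n' => by
    rw [← Finsupp.sum_add]
    congr 1
    funext q p
    refine Finsupp.sum_add_index' (fun q' => ?_) fun q' p' r' => ?_
    · rw [tensorCoeff, map_zero, mul_zero, Finsupp.single_zero]
    · rw [tensorCoeff, map_add, mul_add, Finsupp.single_add]
      rfl) fun m n => by
    refine AddMonoidHom.ext fun m' => ?_
    refine Finsupp.sum_add_index' (h := fun q p => m'.sum fun q' p' =>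
      Finsupp.single (ExtTensor.mk T T' q q') (tensorCoeff T T' p p')) (fun q => ?_) fun q p r => ?_
    · refine Finset.sum_eq_zero (f := fun q' => Finsupp.single (ExtTensor.mk T T' q q')
        (tensorCoeff T T' 0 (m' q'))) fun q' _ => ?_
      rw [tensorCoeff, map_zero, zero_mul, Finsupp.single_zero]
    · rw [← Finsupp.sum_add]
      congr 1
      funext q' p'
      rw [tensorCoeff, map_add, add_mul, Finsupp.single_add]
      rfl

theorem tensorBilin_single (q : Q) (p : FreeR T) (q' : Q') (p' : FreeR T') :
    tensorBilin T Q T' Q' (Finsupp.single q p) (Finsupp.single q' p') =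
      Finsupp.single (ExtTensor.mk T T' q q') (tensorCoeff T T' p p') := by
  change Finsupp.sum (Finsupp.single q p) (fun q p => Finsupp.sum (Finsupp.single q' p')
    fun q' p' => Finsupp.single (ExtTensor.mk T T' q q') (tensorCoeff T T' p p')) = _
  rw [Finsupp.sum_single_index, Finsupp.sum_single_index]
  · rw [tensorCoeff, map_zero, mul_zero, Finsupp.single_zero]
  · refine Finset.sum_eq_zero (f := fun r' => Finsupp.single (ExtTensor.mk T T' q r')
      (tensorCoeff T T' 0 (Finsupp.single q' p' r'))) fun q' _ => ?_
    rw [tensorCoeff, map_zero, zero_mul, Finsupp.single_zero]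

theorem tensorBilin_smul (a : FreeR T) (a' : FreeR T') (m : FreeM T Q) (m' : FreeM T' Q') :
    tensorBilin T Q T' Q' (a • m) (a' • m') =
      tensorCoeff T T' a a' • tensorBilin T Q T' Q' m m' := by
  induction m using Finsupp.induction_linear with
  | zero => simp
  | add m n hm hn => simp only [smul_add, map_add, AddMonoidHom.add_apply, hm, hn]
  | single q p =>
    induction m' using Finsupp.induction_linear with
    | zero => simp
    | add m n hm hn => simp only [smul_add, map_add, hm, hn]
    | single q' p' =>
      rw [Finsupp.smul_single, Finsupp.smul_single, tensorBilin_single, tensorBilin_single,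
        Finsupp.smul_single, smul_eq_mul, smul_eq_mul, smul_eq_mul]
      simp only [tensorCoeff, map_mul]
      rw [mul_mul_mul_comm]

theorem counitM_tensorBilin (m : FreeM T Q) (m' : FreeM T' Q') :
    counitM _ _ (tensorBilin T Q T' Q' m m') =
      ExtTensor.mk T T' (counitM T Q m) (counitM T' Q' m') := by
  induction m using Finsupp.induction_linear with
  | zero =>
    rw [map_zero, map_zero, AddMonoidHom.zero_apply, map_zero]
    exact (TensorProduct.zero_tmul _ _).symm
  | add m n hm hn =>
    rw [map_add, map_add, AddMonoidHom.add_apply, map_add, hm, hn, ExtTensor.mk_add_left]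
  | single q p =>
    induction m' using Finsupp.induction_linear with
    | zero =>
      rw [map_zero, map_zero, map_zero]
      exact (TensorProduct.tmul_zero _ _).symm
    | add m n hm hn => rw [map_add, map_add, map_add, hm, hn, ExtTensor.mk_add_right]
    | single q' p' =>
      rw [tensorBilin_single, counitM, freeLift_single, counitR_tensorCoeff, id, counitM, counitM,
        freeLift_single, freeLift_single, ← ExtTensor.tmul_smul_mk]
      rfl

/-- The additive map underlying the section for a tensor product. -/
noncomputable def tensorModule (s : ResolutionSection T Q) (s' : ResolutionSection T' Q') :
    Q ⊗[ℤ] Q' →+ FreeM (T ⊗[ℤ] T') (ExtTensor T Q T' Q') :=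
  TensorProduct.liftAddHom (((tensorBilin T Q T' Q').comp s.module.toAddMonoidHom).compl₂
    s'.module.toAddMonoidHom) fun _ m n => by
      rw [map_zsmul, map_zsmul, AddMonoidHom.zsmul_apply]

theorem tensorModule_tmul (s : ResolutionSection T Q) (s' : ResolutionSection T' Q') (q : Q)
    (q' : Q') :
    tensorModule s s' (q ⊗ₜ[ℤ] q') = tensorBilin T Q T' Q' (s.module q) (s'.module q') :=
  rfl

/-- Sections of two resolutions induce a section for the tensor product. -/
noncomputable def tensor (s : ResolutionSection T Q) (s' : ResolutionSection T' Q') :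
    ResolutionSection (T ⊗[ℤ] T') (ExtTensor T Q T' Q') where
  ring := tensorRing s s'
  module :=
    { toFun := tensorModule s s'
      map_add' := fun x y => (tensorModule s s').map_add x y
      map_smul' := fun r x => ExtTensor.semilinear_aux (tensorRing s s') (tensorModule s s')
        (fun t t' q q' => by
          rw [tensorModule_tmul, tensorModule_tmul, s.module.map_smulₛₗ, s'.module.map_smulₛₗ,
            tensorBilin_smul, tensorRing_tmul]) r x }
  counitR_ring t := by
    induction t using TensorProduct.induction_on with
    | zero => rw [map_zero, map_zero]
    | add x y hx hy => rw [map_add, map_add, hx, hy]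
    | tmul t t' => rw [tensorRing_tmul, counitR_tensorCoeff, s.counitR_ring, s'.counitR_ring]
  counitM_module q := by
    change counitM _ _ (tensorModule s s' q) = q
    induction q using TensorProduct.induction_on with
    | zero => rw [map_zero]; exact map_zero _
    | add x y hx hy => rw [map_add]; exact (map_add _ _ _).trans (congrArg₂ _ hx hy)
    | tmul q q' =>
      rw [tensorModule_tmul, counitM_tensorBilin, s.counitM_module, s'.counitM_module]
      rfl

end Tensor

end ResolutionSection

namespace Witt

variable {G : Type v} [Group G] [TopologicalSpace G] {H : Subgroup G} [IsTopologicalGroup G]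
  [CompactSpace G] (c : WittChoice H)

theorem map_surjective {R M R' M' : Type*} [CommRing R] [AddCommGroup M] [Module R M]
    [CommRing R'] [AddCommGroup M'] [Module R' M'] (α : R →+* R') (f : M →ₛₗ[α] M')
    (hα : Function.Surjective α) (hf : Function.Surjective f) :
    Function.Surjective (map c α f) := by
  intro y
  obtain ⟨b, rfl⟩ := mk_surjective c y
  have hα' : Function.Surjective (freeRMap α) := MvPolynomial.rename_surjective _ hα
  have hf' : Function.Surjective (freeMMap α f) := fun m => by
    induction m using Finsupp.induction_linear with
    | zero => exact ⟨0, map_zero _⟩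
    | add a b ha hb =>
      obtain ⟨x, rfl⟩ := ha
      obtain ⟨y, rfl⟩ := hb
      exact ⟨x + y, _root_.map_add _ _ _⟩
    | single m t =>
      obtain ⟨m, rfl⟩ := hf m
      obtain ⟨t, rfl⟩ := hα' t
      exact ⟨Finsupp.single m t, by simp [freeMMap, freeLift_single]⟩
  obtain ⟨a, rfl⟩ := ghostImageMap_surjective c (freeRMap α) (freeMMap α f) hf' b
  exact ⟨mk c R M a, map_mk c α f a⟩

/-! ### Witt vectors respect presentations -/

section Coequaliser

/-- A surjection `D₀ → (R; N)` together with a pair of maps `D₁ ⇉ D₀` whose image is its kernel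
pair. -/
structure Presentation {S₁ Q₁ S₀ Q₀ R N : Type*} [CommRing S₁] [AddCommGroup Q₁] [Module S₁ Q₁]
    [CommRing S₀] [AddCommGroup Q₀] [Module S₀ Q₀] [CommRing R] [AddCommGroup N] [Module R N]
    {δ₀ δ₁ : S₁ →+* S₀} (d₀ : Q₁ →ₛₗ[δ₀] Q₀) (d₁ : Q₁ →ₛₗ[δ₁] Q₀) {δ : S₀ →+* R}
    (d : Q₀ →ₛₗ[δ] N) : Prop where
  ring_surjective : Function.Surjective δ
  surjective : Function.Surjective d
  ring_comp : ∀ z, δ (δ₀ z) = δ (δ₁ z)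
  comp : ∀ z, d (d₀ z) = d (d₁ z)
  ring_exact : ∀ x y, δ x = δ y → ∃ z, δ₀ z = x ∧ δ₁ z = y
  exact : ∀ x y, d x = d y → ∃ z, d₀ z = x ∧ d₁ z = y

variable {S₁ Q₁ S₀ Q₀ R N : Type*} [CommRing S₁] [AddCommGroup Q₁] [Module S₁ Q₁]
    [CommRing S₀] [AddCommGroup Q₀] [Module S₀ Q₀] [CommRing R] [AddCommGroup N] [Module R N]
    {δ₀ δ₁ : S₁ →+* S₀} {d₀ : Q₁ →ₛₗ[δ₀] Q₀} {d₁ : Q₁ →ₛₗ[δ₁] Q₀} {δ : S₀ →+* R}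
    {d : Q₀ →ₛₗ[δ] N}

/-- The map of free modules given by maps of underlying sets. -/
theorem ghostImageMap_freeMMap {A B C M N P : Type*} (α : A → B) (β : B → C) (γ : A → C)
    (h : ∀ a, β (α a) = γ a) (f : M → N) (g : N → P) (k : M → P) (h' : ∀ m, g (f m) = k m)
    (t : ghostImage c (FreeR A) (FreeM A M)) :
    ghostImageMap c (freeRMap β) (freeMMap β g) (ghostImageMap c (freeRMap α) (freeMMap α f) t) =
      ghostImageMap c (freeRMap γ) (freeMMap γ k) t :=
  Subtype.ext (funext fun _ => TPow.map_map (fun r => freeRMap_comp _ _ _ h r)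
    (fun m => freeMMap_comp _ _ _ h _ _ _ h' m) _)

theorem ghostImageMap_id {A M : Type*} (t : ghostImage c (FreeR A) (FreeM A M)) :
    ghostImageMap c (freeRMap id) (freeMMap id id) t = t :=
  Subtype.ext (funext fun _ => TPow.map_of_eq _ _ (fun r => MvPolynomial.rename_id_apply r)
    TPow.freeMMap_id _)

/-- Exactness lifts the two maps of sets jointly to the relations. No additivity is needed, because
the free pairs depend only on underlying sets. -/
theorem Presentation.mk_eq_of_comp_eq (p : Presentation d₀ d₁ d) {A B : Type*} (u u' : A → S₀)
    (w w' : B → Q₀) (hu : ∀ a, δ (u a) = δ (u' a)) (hw : ∀ b, d (w b) = d (w' b))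
    (t : ghostImage c (FreeR A) (FreeM A B)) :
    Witt.mk c S₀ Q₀ (ghostImageMap c (freeRMap u) (freeMMap u w) t) -
      Witt.mk c S₀ Q₀ (ghostImageMap c (freeRMap u') (freeMMap u' w') t) ∈
        (map c δ₀ d₀ - map c δ₁ d₁).range := by
  choose k hk hk' using fun a => p.ring_exact _ _ (hu a)
  choose l hl hl' using fun b => p.exact _ _ (hw b)
  refine ⟨Witt.mk c S₁ Q₁ (ghostImageMap c (freeRMap k) (freeMMap k l) t), ?_⟩
  rw [AddMonoidHom.sub_apply, map_mk, map_mk, ghostImageMap_freeMMap c k δ₀ u hk l d₀ w hl,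
    ghostImageMap_freeMMap c k δ₁ u' hk' l d₁ w' hl']

/-- Set-theoretic sections of the presentation already factor the defining quotient map through this
one. -/
theorem Presentation.isQuotientMap (p : Presentation d₀ d₁ d) :
    Topology.IsQuotientMap (map c δ d) := by
  let σ := Function.surjInv p.ring_surjective
  let τ := Function.surjInv p.surjective
  have h : (map c δ d) ∘ (fun a => Witt.mk c S₀ Q₀ (ghostImageMap c (freeRMap σ) (freeMMap σ τ) a)) =
      Witt.mk c R N := by
    funext a
    rw [Function.comp_apply, map_mk, ghostImageMap_freeMMap c σ δ id
      (Function.surjInv_eq p.ring_surjective) τ d id (Function.surjInv_eq p.surjective),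
      ghostImageMap_id]
  refine Topology.IsQuotientMap.of_comp ((isQuotientMap_mk c).continuous.comp
    (continuous_ghostImageMap c (freeRMap σ) (freeMMap σ τ))) (continuous_map c δ d) ?_
  exact h ▸ isQuotientMap_mk c

/-- Set-theoretic sections induce a homomorphism s from W(P(R; N)) to W(S₀; Q₀). It need not respect
the canonical relations of (R; N), but it does so up to the image of d₀ − d₁, and by continuity up
to its closure. Hence nothing beyond that closure is killed. -/
theorem Presentation.map_eq_zero (p : Presentation d₀ d₁ d) (x : Witt c S₀ Q₀) :
    map c δ d x = 0 ↔ x ∈ (map c δ₀ d₀ - map c δ₁ d₁).range.topologicalClosure := by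
  constructor
  · intro hx
    let σ := Function.surjInv p.ring_surjective
    have hσ : ∀ r, δ (σ r) = r := Function.surjInv_eq p.ring_surjective
    let τ := Function.surjInv p.surjective
    have hτ : ∀ m, d (τ m) = m := Function.surjInv_eq p.surjective
    let s : ghostImage c (FreeR R) (FreeM R N) →+ Witt c S₀ Q₀ :=
      (Witt.mk c S₀ Q₀).comp (ghostImageMap c (freeRMap σ) (freeMMap σ τ))
    have hs : Continuous s :=
      (isQuotientMap_mk c).continuous.comp (continuous_ghostImageMap c _ _)
    obtain ⟨b, rfl⟩ := mk_surjective c x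
    -- The class of b differs from s applied to the image of b by an element of the range of the
    -- pair.
    have h1 := p.mk_eq_of_comp_eq c id (σ ∘ δ) id (τ ∘ d) (fun a => (hσ _).symm)
      (fun m => (hτ _).symm) b
    rw [ghostImageMap_id, ← ghostImageMap_freeMMap c δ σ (σ ∘ δ) (fun _ => rfl) d τ (τ ∘ d)
      (fun _ => rfl)] at h1
    rw [map_mk, mk_eq_zero] at hx
    have h2 : (resolutionDiff c R N).range.topologicalClosure ≤
        (map c δ₀ d₀ - map c δ₁ d₁).range.topologicalClosure.comap s := by
      refine AddSubgroup.topologicalClosure_minimal _ ?_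
        ((AddSubgroup.isClosed_topologicalClosure _).preimage hs)
      rintro _ ⟨z, rfl⟩
      refine AddSubgroup.le_topologicalClosure _ ?_
      -- Evaluating after applying the section and applying it after evaluating agree once projected
      -- to (R; N).
      have h3 := p.mk_eq_of_comp_eq c (fun t => counitR S₀ (freeRMap σ t))
        (fun t => σ (counitR R t)) (fun t => counitM S₀ Q₀ (freeMMap σ τ t))
        (fun t => τ (counitM R N t)) (fun t => ?_) (fun t => ?_) z
      · convert h3 using 1
        change s (_ - _) = _
        rw [map_sub]
        congr 1
        · change Witt.mk c S₀ Q₀ _ = _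
          rw [← ghostImageMap_freeMMap c (freeRMap σ) (counitR S₀) _ (fun _ => rfl)
            (freeMMap σ τ) (counitM S₀ Q₀) _ (fun _ => rfl), ← Witt.mk_resolutionDiff c]
          congr 1
          exact Subtype.ext (GhostProd.map_comm (fun t => (counitR_map (freeRMap σ) t).symm)
            (fun t => (counitM_map (freeRMap σ) (freeMMap σ τ) t).symm) _)
        · change Witt.mk c S₀ Q₀ _ = _
          rw [ghostImageMap_freeMMap c _ _ _ (fun _ => rfl) _ _ _ (fun _ => rfl)]
      · rw [hσ, ← counitR_map δ, freeRMap_comp σ δ id hσ]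
        exact congrArg _ (MvPolynomial.rename_id_apply t)
      · rw [hτ, ← counitM_map δ d, freeMMap_comp σ δ id hσ τ d id hτ, TPow.freeMMap_id]
    have h4 := add_mem (AddSubgroup.le_topologicalClosure _ h1) (h2 hx)
    change _ - s _ + s _ ∈ _ at h4
    rwa [sub_add_cancel] at h4
  · intro hx
    have : (map c δ₀ d₀ - map c δ₁ d₁).range.topologicalClosure ≤ (map c δ d).ker := by
      refine AddSubgroup.topologicalClosure_minimal _ ?_
        (isClosed_singleton.preimage (continuous_map c _ _))
      rintro _ ⟨z, rfl⟩
      rw [AddMonoidHom.mem_ker, AddMonoidHom.sub_apply, _root_.map_sub, sub_eq_zero,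
        map_comm c p.ring_comp p.comp]
    exact this hx

end Coequaliser

end Witt

/-- The section of the resolution of a canonical free module. -/
noncomputable def ResolutionSection.canonical (R M : Type*) :
    ResolutionSection (FreeR R) (FreeM R M) :=
  ResolutionSection.free R Finsupp.basisSingleOne

namespace Witt

variable {G : Type*} [Group G] [TopologicalSpace G] {H : Subgroup G} (c : WittChoice H)
  {R M R' M' : Type*} [CommRing R] [AddCommGroup M] [Module R M] [CommRing R']
  [AddCommGroup M'] [Module R' M']

/-- The universal property of the coequaliser. -/
noncomputable def descend {Y : Type*} [AddCommGroup Y] [TopologicalSpace Y] [T2Space Y]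
    (f : ghostImage c (FreeR R) (FreeM R M) →+ Y) (hf : Continuous f)
    (h : ∀ z, f (ghostImageMap c (counitR (FreeR R)) (counitM (FreeR R) (FreeM R M)) z) =
      f (ghostImageMap c (freeRMap (counitR R)) (freeMMap (counitR R) (counitM R M)) z)) :
    Witt c R M →ₜ+ Y where
  toAddMonoidHom := QuotientAddGroup.lift _ f (by
    refine AddSubgroup.topologicalClosure_minimal (t := AddMonoidHom.ker f) _ ?_
      (isClosed_singleton.preimage hf)
    rintro _ ⟨z, rfl⟩
    rw [AddMonoidHom.mem_ker, resolutionDiff, AddMonoidHom.sub_apply, _root_.map_sub, h, sub_self])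
  continuous_toFun := continuous_of_mk c hf

end Witt

/-! ### Reduction to canonical free coefficients -/

section Uniqueness

variable {G : Type v} [Group G] [TopologicalSpace G] {H : Subgroup G} [IsTopologicalGroup G]
  [CompactSpace G] (c : WittChoice H) {R M : Type*} [CommRing R] [AddCommGroup M] [Module R M]

/-- Naturality and this surjection determine every transformation below by its values on canonical
free pairs, where ghosts are injective. -/
theorem Witt.exists_counit (x : Witt c R M) :
    ∃ y, Witt.map c (counitR R) (counitM R M) y = x :=
  Witt.map_surjective c _ _ TPow.counitR_surjective TPow.counitM_surjective x

end Uniqueness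

/-! ### The map q -/

section QuotMap

variable {G : Type v} [Group G] [TopologicalSpace G] {H : Subgroup G} [IsTopologicalGroup G]
  [CompactSpace G] (c : WittChoice H)

theorem continuous_ghostMap {R M : Type*} [CommRing R] [AddCommGroup M] [Module R M] :
    Continuous (ghostMap c R M) := by
  refine continuous_pi fun U => ?_
  unfold ghostMap
  split_ifs with h
  · refine continuous_finsetSum _ fun i _ => ?_
    exact (continuous_of_discreteTopology (f := fun t : TPow R M (G ⧸ i.1.1) =>
      TPow.twist i.2.1.out (mem_iff_conj_mem i.2.1.out U.1)
        (TPow.cosetIso (conj_le_of_fixed i.2.2.2) (c.sec i.1.1) (c.sec_spec i.1.1)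
          (TPow.power _ t)))).comp (continuous_apply i.1)
  · exact continuous_const

variable {R M : Type*} [CommRing R] [AddCommGroup M] [Module R M]

theorem map_counit_surjective (X : Type*) [Nonempty X] :
    Function.Surjective (TPow.map (counitR R) (counitM R M) X) :=
  TPow.map_surjective _ _ TPow.counitM_surjective

/-- Two lifts of the same tensors are the two images of one family at the second stage of the
resolution, by `TPow.exists_counit_pair`. So q does not depend on the chosen lifts. -/
theorem mk_ghostMap_eq (m m' : ∀ V : c.reps, TPow (FreeR R) (FreeM R M) (G ⧸ V.1))
    (h : ∀ V, TPow.map (counitR R) (counitM R M) _ (m V) =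
      TPow.map (counitR R) (counitM R M) _ (m' V)) :
    Witt.mk c R M ⟨ghostMap c _ _ m, ghostMap_mem c m⟩ =
      Witt.mk c R M ⟨ghostMap c _ _ m', ghostMap_mem c m'⟩ := by
  choose z hz hz' using fun V => TPow.exists_counit_pair _ _ (h V)
  have := Witt.mk_resolutionDiff c ⟨ghostMap c _ _ z, ghostMap_mem c z⟩
  convert this using 2 <;> refine Subtype.ext ?_ <;> rw [coe_ghostImageMap, map_ghostMap]
  · exact congrArg (ghostMap c _ _) (funext fun V => (hz V).symm)
  · exact congrArg (ghostMap c _ _) (funext fun V => (hz' V).symm)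

/-- The quotient map onto the Witt vectors. -/
noncomputable def Witt.quot (n : ∀ V : c.reps, TPow R M (G ⧸ V.1)) : Witt c R M :=
  Witt.mk c R M ⟨ghostMap c _ _ fun V => Function.surjInv (map_counit_surjective _) (n V),
    ghostMap_mem c _⟩

theorem Witt.quot_map (m : ∀ V : c.reps, TPow (FreeR R) (FreeM R M) (G ⧸ V.1)) :
    Witt.quot c (fun V => TPow.map (counitR R) (counitM R M) _ (m V)) =
      Witt.mk c R M ⟨ghostMap c _ _ m, ghostMap_mem c m⟩ :=
  mk_ghostMap_eq c _ _ fun _ => Function.surjInv_eq _ _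

theorem exists_lift_counit (n : ∀ V : c.reps, TPow R M (G ⧸ V.1)) :
    ∃ m : ∀ V : c.reps, TPow (FreeR R) (FreeM R M) (G ⧸ V.1),
      (fun V => TPow.map (counitR R) (counitM R M) _ (m V)) = n :=
  ⟨fun V => Function.surjInv (map_counit_surjective _) (n V),
    funext fun _ => Function.surjInv_eq _ _⟩

theorem Witt.map_quot {R' M' : Type*} [CommRing R'] [AddCommGroup M'] [Module R' M']
    (α : R →+* R') (f : M →ₛₗ[α] M') (n : ∀ V : c.reps, TPow R M (G ⧸ V.1)) :
    Witt.map c α f (Witt.quot c n) = Witt.quot c fun V => TPow.map α f _ (n V) := by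
  obtain ⟨m, rfl⟩ := exists_lift_counit c n
  have h : ∀ V : c.reps, TPow.map α f (G ⧸ V.1) (TPow.map (counitR R) (counitM R M) _ (m V)) =
      TPow.map (counitR R') (counitM R' M') _
        (TPow.map (freeRMap α) (freeMMap α f) _ (m V)) := fun V =>
    TPow.map_comm (fun r => (counitR_map α r).symm) (fun q => (counitM_map α f q).symm) _
  simp only [h]
  rw [Witt.quot_map, Witt.quot_map, Witt.map_mk]
  congr 1
  exact Subtype.ext (map_ghostMap c _ _ m)

theorem Witt.ghost_quot (n : ∀ V : c.reps, TPow R M (G ⧸ V.1)) :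
    Witt.ghost c R M (Witt.quot c n) = ghostMap c R M n := by
  obtain ⟨m, rfl⟩ := exists_lift_counit c n
  rw [Witt.quot_map, Witt.ghost_mk, map_ghostMap]

theorem Witt.continuous_quot : Continuous (Witt.quot c (R := R) (M := M)) := by
  refine (Witt.isQuotientMap_mk c).continuous.comp
    (((continuous_ghostMap c).comp (continuous_pi fun V => ?_)).subtype_mk _)
  exact (continuous_of_discreteTopology (f := fun t : TPow R M (G ⧸ V.1) =>
    Function.surjInv (map_counit_surjective (R := R) (M := M) _) t)).comp (continuous_apply V)

variable {c} in
theorem QuotMap.toFun_eq (q : QuotMap.{u} c) {R M : Type u} [CommRing R] [AddCommGroup M]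
    [Module R M] (n : ∀ V : c.reps, TPow R M (G ⧸ V.1)) : q.toFun R M n = Witt.quot c n := by
  obtain ⟨m, rfl⟩ := exists_lift_counit c n
  rw [← q.natural, ← Witt.map_quot]
  congr 1
  apply (ResolutionSection.canonical R M).ghost_injective c
  rw [q.ghost, Witt.ghost_quot]

theorem nonempty_unique_quotMap : Nonempty (Unique (QuotMap.{u} c)) := by
  refine ⟨⟨⟨⟨fun R M => Witt.quot c, fun R M => Witt.continuous_quot c, Witt.map_quot c,
    Witt.ghost_quot c⟩⟩, fun q => ?_⟩⟩
  have h := @QuotMap.toFun_eq _ _ _ _ _ _ _ q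
  obtain ⟨f, _, _, _⟩ := q
  congr
  funext R M _ _ _ n
  exact h n

end QuotMap

/-! ### Frobenius -/

section Frobenius

variable {G : Type v} [Group G] [TopologicalSpace G] {H K : Subgroup G} [IsTopologicalGroup G]
  [CompactSpace G] (hKH : K ≤ H) (c : WittChoice H) (c' : WittChoice K)

/-- The restriction of ghost components. -/
noncomputable def restrictImage (R M : Type*) [CommRing R] [AddCommGroup M] [Module R M] :
    ghostImage c R M →+ ghostImage c' R M :=
  ((GhostProd.restrict hKH R M).comp (ghostImage c R M).subtype).codRestrict _
    fun a => GhostProd.restrict_mem hKH c c' a.2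

variable {R M R' M' : Type*} [CommRing R] [AddCommGroup M] [Module R M] [CommRing R']
  [AddCommGroup M'] [Module R' M']

theorem continuous_restrictImage : Continuous (restrictImage hKH c c' R M) :=
  ((GhostProd.continuous_restrict hKH).comp continuous_subtype_val).subtype_mk _

/-- The Frobenius. -/
noncomputable def Witt.frobenius (R M : Type*) [CommRing R] [AddCommGroup M] [Module R M] :
    Witt c R M →ₜ+ Witt c' R M :=
  Witt.descend c ((Witt.mk c' R M).comp (restrictImage hKH c c' _ _))
    ((Witt.isQuotientMap_mk c').continuous.comp (continuous_restrictImage hKH c c'))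
    fun z => Witt.mk_resolutionDiff c' (restrictImage hKH c c' _ _ z)

theorem nonempty_unique_frobenius : Nonempty (Unique (Frobenius.{u} hKH c c')) := by
  have hghost : ∀ {R M : Type u} [CommRing R] [AddCommGroup M] [Module R M] (x : Witt c R M)
      (U : OpenSub K), Witt.ghost c' R M (Witt.frobenius hKH c c' R M x) U =
        Witt.ghost c R M x ⟨U.1, U.2.1, U.2.2.trans hKH⟩ := by
    intro R M _ _ _ x U
    obtain ⟨a, rfl⟩ := Witt.mk_surjective c x
    rfl
  refine ⟨⟨⟨⟨Witt.frobenius hKH c c', fun α f x => ?_, hghost⟩⟩, fun F => ?_⟩⟩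
  · obtain ⟨a, rfl⟩ := Witt.mk_surjective c x
    rfl
  · have h : ∀ (R M : Type u) [CommRing R] [AddCommGroup M] [Module R M] (x : Witt c R M),
        F.toFun R M x = Witt.frobenius hKH c c' R M x := by
      intro R M _ _ _ x
      obtain ⟨y, rfl⟩ := Witt.exists_counit c x
      rw [← F.natural]
      have : F.toFun _ _ y = Witt.frobenius hKH c c' _ _ y := by
        apply (ResolutionSection.canonical R M).ghost_injective c'
        funext U
        rw [F.ghost, hghost]
      rw [this]
      obtain ⟨a, rfl⟩ := Witt.mk_surjective c y
      rfl
    obtain ⟨f, _, _⟩ := F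
    congr
    funext R M _ _ _
    ext x
    exact h R M x

end Frobenius

/-! ### Verschiebung -/

section Verschiebung

variable {G : Type v} [Group G] [TopologicalSpace G] {H K : Subgroup G} [IsTopologicalGroup G]
  [CompactSpace G] (hKH : K ≤ H) (hK : IsOpen (K : Set G)) (c : WittChoice H) (c' : WittChoice K)

/-- The transfer of ghost components. -/
noncomputable def transferImage (R M : Type*) [CommRing R] [AddCommGroup M] [Module R M] :
    ghostImage c' R M →+ ghostImage c R M :=
  ((GhostProd.transfer H hK R M).comp (ghostImage c' R M).subtype).codRestrict _
    fun a => GhostProd.transfer_mem hKH hK c c' a.2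

variable {R M R' M' : Type*} [CommRing R] [AddCommGroup M] [Module R M] [CommRing R']
  [AddCommGroup M'] [Module R' M']

theorem continuous_transferImage : Continuous (transferImage hKH hK c c' R M) :=
  ((GhostProd.continuous_transfer hK).comp continuous_subtype_val).subtype_mk _

theorem ghostImageMap_transferImage (α : R →+* R') (f : M →ₛₗ[α] M') (a : ghostImage c' R M) :
    ghostImageMap c α f (transferImage hKH hK c c' R M a) =
      transferImage hKH hK c c' R' M' (ghostImageMap c' α f a) :=
  Subtype.ext (GhostProd.map_transfer hK α f a)

/-- The Verschiebung. -/
noncomputable def Witt.verschiebung (R M : Type*) [CommRing R] [AddCommGroup M] [Module R M] :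
    Witt c' R M →ₜ+ Witt c R M :=
  Witt.descend c' ((Witt.mk c R M).comp (transferImage hKH hK c c' _ _))
    ((Witt.isQuotientMap_mk c).continuous.comp (continuous_transferImage hKH hK c c'))
    fun z => by
      rw [AddMonoidHom.comp_apply, AddMonoidHom.comp_apply, ← ghostImageMap_transferImage,
        ← ghostImageMap_transferImage]
      exact Witt.mk_resolutionDiff c (transferImage hKH hK c c' _ _ z)

theorem Witt.verschiebung_mk (a : ghostImage c' (FreeR R) (FreeM R M)) :
    Witt.verschiebung hKH hK c c' R M (Witt.mk c' R M a) =
      Witt.mk c R M (transferImage hKH hK c c' _ _ a) := rfl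

theorem Witt.map_verschiebung (α : R →+* R') (f : M →ₛₗ[α] M') (x : Witt c' R M) :
    Witt.map c α f (Witt.verschiebung hKH hK c c' R M x) =
      Witt.verschiebung hKH hK c c' R' M' (Witt.map c' α f x) := by
  obtain ⟨a, rfl⟩ := Witt.mk_surjective c' x
  rw [Witt.verschiebung_mk, Witt.map_mk, Witt.map_mk, Witt.verschiebung_mk,
    ghostImageMap_transferImage]

include hKH hK in
theorem nonempty_unique_verschiebung : Nonempty (Unique (Verschiebung.{u} c c')) := by
  have hghost : ∀ {R M : Type u} [CommRing R] [AddCommGroup M] [Module R M] (x : Witt c' R M)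
      (W : OpenSub H), Witt.ghost c R M (Witt.verschiebung hKH hK c c' R M x) W =
        ∑ᶠ i : fixedCosets H W.1 K, TPow.twist i.1.out (mem_iff_conj_mem i.1.out W.1)
          (Witt.ghost c' R M x (W.conj i)) := by
    intro R M _ _ _ x W
    obtain ⟨a, rfl⟩ := Witt.mk_surjective c' x
    exact congrFun (GhostProd.map_transfer hK _ _ a.1) W
  refine ⟨⟨⟨⟨Witt.verschiebung hKH hK c c', Witt.map_verschiebung hKH hK c c', hghost⟩⟩,
    fun F => ?_⟩⟩
  have h : ∀ (R M : Type u) [CommRing R] [AddCommGroup M] [Module R M] (x : Witt c' R M),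
      F.toFun R M x = Witt.verschiebung hKH hK c c' R M x := by
    intro R M _ _ _ x
    obtain ⟨y, rfl⟩ := Witt.exists_counit c' x
    rw [← F.natural, ← Witt.map_verschiebung]
    congr 1
    apply (ResolutionSection.canonical R M).ghost_injective c
    funext U
    rw [F.ghost, hghost]
  obtain ⟨f, _, _⟩ := F
  congr
  funext R M _ _ _
  ext x
  exact h R M x

end Verschiebung

/-! ### The external product -/

section ExternalProduct

theorem ExtTensor.map_comm {R₁ M₁ R₂ M₂ R₃ M₃ R₄ M₄ S₁ N₁ S₂ N₂ S₃ N₃ S₄ N₄ : Type*}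
    [CommRing R₁] [AddCommGroup M₁] [Module R₁ M₁] [CommRing R₂] [AddCommGroup M₂] [Module R₂ M₂]
    [CommRing R₃] [AddCommGroup M₃] [Module R₃ M₃] [CommRing R₄] [AddCommGroup M₄] [Module R₄ M₄]
    [CommRing S₁] [AddCommGroup N₁] [Module S₁ N₁] [CommRing S₂] [AddCommGroup N₂] [Module S₂ N₂]
    [CommRing S₃] [AddCommGroup N₃] [Module S₃ N₃] [CommRing S₄] [AddCommGroup N₄] [Module S₄ N₄]
    {α₁ : R₁ →+* R₂} {α₂ : R₂ →+* R₄} {α₃ : R₁ →+* R₃} {α₄ : R₃ →+* R₄}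
    {β₁ : S₁ →+* S₂} {β₂ : S₂ →+* S₄} {β₃ : S₁ →+* S₃} {β₄ : S₃ →+* S₄}
    {f₁ : M₁ →ₛₗ[α₁] M₂} {f₂ : M₂ →ₛₗ[α₂] M₄} {f₃ : M₁ →ₛₗ[α₃] M₃} {f₄ : M₃ →ₛₗ[α₄] M₄}
    {g₁ : N₁ →ₛₗ[β₁] N₂} {g₂ : N₂ →ₛₗ[β₂] N₄} {g₃ : N₁ →ₛₗ[β₃] N₃} {g₄ : N₃ →ₛₗ[β₄] N₄}
    (hf : ∀ m, f₂ (f₁ m) = f₄ (f₃ m)) (hg : ∀ n, g₂ (g₁ n) = g₄ (g₃ n))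
    (t : ExtTensor R₁ M₁ S₁ N₁) :
    ExtTensor.map α₂ f₂ β₂ g₂ (ExtTensor.map α₁ f₁ β₁ g₁ t) =
      ExtTensor.map α₄ f₄ β₄ g₄ (ExtTensor.map α₃ f₃ β₃ g₃ t) := by
  induction t using TensorProduct.induction_on with
  | zero => exact rfl
  | add x y hx hy =>
    change ExtTensor.mapAux f₂ g₂ (ExtTensor.mapAux f₁ g₁ (x + y)) =
      ExtTensor.mapAux f₄ g₄ (ExtTensor.mapAux f₃ g₃ (x + y))
    simp only [_root_.map_add]
    exact congrArg₂ (· + ·) hx hy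
  | tmul m n => exact congrArg₂ (ExtTensor.mk R₄ S₄) (hf m) (hg n)

theorem tensorProduct_map_comm {R₁ R₂ R₃ R₄ S₁ S₂ S₃ S₄ : Type*}
    [CommRing R₁] [CommRing R₂] [CommRing R₃] [CommRing R₄]
    [CommRing S₁] [CommRing S₂] [CommRing S₃] [CommRing S₄]
    {α₁ : R₁ →+* R₂} {α₂ : R₂ →+* R₄} {α₃ : R₁ →+* R₃} {α₄ : R₃ →+* R₄}
    {β₁ : S₁ →+* S₂} {β₂ : S₂ →+* S₄} {β₃ : S₁ →+* S₃} {β₄ : S₃ →+* S₄}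
    (hα : ∀ r, α₂ (α₁ r) = α₄ (α₃ r)) (hβ : ∀ s, β₂ (β₁ s) = β₄ (β₃ s)) (t : R₁ ⊗[ℤ] S₁) :
    (Algebra.TensorProduct.map α₂.toIntAlgHom β₂.toIntAlgHom).toRingHom
        ((Algebra.TensorProduct.map α₁.toIntAlgHom β₁.toIntAlgHom).toRingHom t) =
      (Algebra.TensorProduct.map α₄.toIntAlgHom β₄.toIntAlgHom).toRingHom
        ((Algebra.TensorProduct.map α₃.toIntAlgHom β₃.toIntAlgHom).toRingHom t) := by
  induction t using TensorProduct.induction_on with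
  | zero => simp only [_root_.map_zero]
  | add x y hx hy => simp only [_root_.map_add, hx, hy]
  | tmul r s => exact congrArg₂ (fun a b => a ⊗ₜ[ℤ] b) (hα r) (hβ s)

variable {G : Type v} [Group G] [TopologicalSpace G] {H : Subgroup G} [IsTopologicalGroup G]
  [CompactSpace G] (c : WittChoice H)

/-- The shuffle of ghost components. -/
noncomputable def shuffleImage (R M R' M' : Type*) [CommRing R] [AddCommGroup M] [Module R M]
    [CommRing R'] [AddCommGroup M'] [Module R' M'] : ghostImage c R M →+ ghostImage c R' M' →+
      ghostImage c (R ⊗[ℤ] R') (ExtTensor R M R' M') :=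
  AddMonoidHom.mk' (fun a => AddMonoidHom.mk' (fun b =>
    ⟨GhostProd.shuffle H R M R' M' a b, GhostProd.shuffle_mem c a.2 b.2⟩)
      fun b b' => Subtype.ext (map_add (GhostProd.shuffle H R M R' M' a) _ _)) fun a a' =>
        AddMonoidHom.ext fun b => Subtype.ext (by
          change GhostProd.shuffle H R M R' M' (a + a' : GhostProd H R M) _ = _
          rw [map_add]
          rfl)

section
variable {R M R' M' S N S' N' : Type*} [CommRing R] [AddCommGroup M] [Module R M]
    [CommRing R'] [AddCommGroup M'] [Module R' M'] [CommRing S] [AddCommGroup N] [Module S N]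
    [CommRing S'] [AddCommGroup N'] [Module S' N']

theorem ghostImageMap_shuffleImage (α : R →+* S) (f : M →ₛₗ[α] N) (β : R' →+* S')
    (g : M' →ₛₗ[β] N') (a : ghostImage c R M) (b : ghostImage c R' M') :
    ghostImageMap c _ (ExtTensor.map α f β g) (shuffleImage c R M R' M' a b) =
      shuffleImage c S N S' N' (ghostImageMap c α f a) (ghostImageMap c β g b) :=
  Subtype.ext (GhostProd.map_shuffle α f β g a.1 b.1)

/-- The external product of ghost components for modules with a section of the resolution. -/
noncomputable def starImage {T Q T' Q' : Type*} [CommRing T] [AddCommGroup Q] [Module T Q]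
    [CommRing T'] [AddCommGroup Q'] [Module T' Q'] (s : ResolutionSection T Q)
    (s' : ResolutionSection T' Q') :
    ghostImage c T Q →+ ghostImage c T' Q' →+ Witt c (T ⊗[ℤ] T') (ExtTensor T Q T' Q') :=
  AddMonoidHom.mk' (fun a => ((s.tensor s').ofGhost c).comp (shuffleImage c T Q T' Q' a))
    fun a a' => by rw [map_add]; exact AddMonoidHom.comp_add _ _ _

theorem map_starImage {T Q T' Q' T₁ Q₁ T₁' Q₁' : Type*} [CommRing T] [AddCommGroup Q] [Module T Q]
    [CommRing T'] [AddCommGroup Q'] [Module T' Q'] [CommRing T₁] [AddCommGroup Q₁] [Module T₁ Q₁]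
    [CommRing T₁'] [AddCommGroup Q₁'] [Module T₁' Q₁'] (s : ResolutionSection T Q)
    (s' : ResolutionSection T' Q') (s₁ : ResolutionSection T₁ Q₁)
    (s₁' : ResolutionSection T₁' Q₁') (α : T →+* T₁) (f : Q →ₛₗ[α] Q₁) (β : T' →+* T₁')
    (g : Q' →ₛₗ[β] Q₁') (a : ghostImage c T Q) (b : ghostImage c T' Q') :
    Witt.map c _ (ExtTensor.map α f β g) (starImage c s s' a b) =
      starImage c s₁ s₁' (ghostImageMap c α f a) (ghostImageMap c β g b) := by
  change Witt.map c _ _ ((s.tensor s').ofGhost c _) = (s₁.tensor s₁').ofGhost c _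
  rw [ResolutionSection.map_ofGhost c (s.tensor s') (s₁.tensor s₁'), ghostImageMap_shuffleImage]

/-- The external product of Witt vectors, on representatives. -/
noncomputable def starPre (R M R' M' : Type*) [CommRing R] [AddCommGroup M] [Module R M]
    [CommRing R'] [AddCommGroup M'] [Module R' M'] (a : ghostImage c (FreeR R) (FreeM R M)) :
    ghostImage c (FreeR R') (FreeM R' M') →+ Witt c (R ⊗[ℤ] R') (ExtTensor R M R' M') :=
  (Witt.map c _ (ExtTensor.map (counitR R) (counitM R M) (counitR R') (counitM R' M'))).comp
    (starImage c (.canonical R M) (.canonical R' M') a)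

/-- The product is natural in maps between pairs with sections, and parallel maps agreeing after the
counit have the same effect. With the resolution pair in one variable and identities in the other,
this lets the product descend one variable at a time. -/
theorem starPre_eq {S₁ N₁ S₁' N₁' : Type*} [CommRing S₁] [AddCommGroup N₁] [Module S₁ N₁]
    [CommRing S₁'] [AddCommGroup N₁'] [Module S₁' N₁'] (s : ResolutionSection S₁ N₁)
    (s' : ResolutionSection S₁' N₁') {δ₀ δ₁ : S₁ →+* FreeR R} (d₀ : N₁ →ₛₗ[δ₀] FreeM R M)
    (d₁ : N₁ →ₛₗ[δ₁] FreeM R M) {δ₀' δ₁' : S₁' →+* FreeR R'} (d₀' : N₁' →ₛₗ[δ₀'] FreeM R' M')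
    (d₁' : N₁' →ₛₗ[δ₁'] FreeM R' M') (hδ : ∀ t, counitR R (δ₀ t) = counitR R (δ₁ t))
    (hd : ∀ t, counitM R M (d₀ t) = counitM R M (d₁ t))
    (hδ' : ∀ t, counitR R' (δ₀' t) = counitR R' (δ₁' t))
    (hd' : ∀ t, counitM R' M' (d₀' t) = counitM R' M' (d₁' t)) (a : ghostImage c S₁ N₁)
    (b : ghostImage c S₁' N₁') :
    starPre c R M R' M' (ghostImageMap c δ₀ d₀ a) (ghostImageMap c δ₀' d₀' b) =
      starPre c R M R' M' (ghostImageMap c δ₁ d₁ a) (ghostImageMap c δ₁' d₁' b) := by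
  change Witt.map c _ _ (starImage c _ _ _ _) = Witt.map c _ _ (starImage c _ _ _ _)
  rw [← map_starImage c s s', ← map_starImage c s s']
  exact Witt.map_comm c (tensorProduct_map_comm hδ hδ') (ExtTensor.map_comm hd hd') _

theorem continuous_starPre :
    Continuous fun p : ghostImage c (FreeR R) (FreeM R M) × ghostImage c (FreeR R') (FreeM R' M') =>
      starPre c R M R' M' p.1 p.2 := by
  refine (Witt.continuous_map c _ _).comp ((ResolutionSection.continuous_ofGhost c _).comp
    (Continuous.subtype_mk ?_ _))
  exact GhostProd.continuous_shuffle.comp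
    ((continuous_subtype_val.comp continuous_fst).prodMk (continuous_subtype_val.comp continuous_snd))

theorem ghostImageMap_of_eq {T Q : Type*} [CommRing T] [AddCommGroup Q] [Module T Q]
    (a : ghostImage c T Q) : ghostImageMap c (RingHom.id T) LinearMap.id a = a :=
  Subtype.ext (funext fun _ => TPow.map_of_eq _ _ (fun _ => rfl) (fun _ => rfl) _)

theorem continuous_starPre_right (a : ghostImage c (FreeR R) (FreeM R M)) :
    Continuous (starPre c R M R' M' a) :=
  Continuous.comp (f := fun b => (a, b)) (continuous_starPre c) (Continuous.prodMk_right a)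

theorem continuous_starPre_left (b : ghostImage c (FreeR R') (FreeM R' M')) :
    Continuous fun a => starPre c R M R' M' a b :=
  Continuous.comp (f := fun a => (a, b)) (continuous_starPre c) (Continuous.prodMk_left b)

/-- The external product with a fixed representative. -/
noncomputable def starLeft (R' M' : Type*) [CommRing R'] [AddCommGroup M'] [Module R' M']
    (a : ghostImage c (FreeR R) (FreeM R M)) :
    Witt c R' M' →ₜ+ Witt c (R ⊗[ℤ] R') (ExtTensor R M R' M') :=
  Witt.descend c (starPre c R M R' M' a)
    (continuous_starPre_right c a) fun z => by
      have h := starPre_eq c (.canonical R M) (.canonical (FreeR R') (FreeM R' M'))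
        (LinearMap.id (R := FreeR R) (M := FreeM R M)) LinearMap.id
        (counitM (FreeR R') (FreeM R' M')) (freeMMap (counitR R') (counitM R' M'))
        (fun _ => rfl) (fun _ => rfl) (fun t => (counitR_map (counitR R') t).symm)
        (fun t => (counitM_map (counitR R') (counitM R' M') t).symm) a z
      rwa [ghostImageMap_of_eq] at h

theorem starLeft_mk (a : ghostImage c (FreeR R) (FreeM R M))
    (b : ghostImage c (FreeR R') (FreeM R' M')) :
    starLeft c R' M' a (Witt.mk c R' M' b) = starPre c R M R' M' a b := rfl

theorem starLeft_add (a a' : ghostImage c (FreeR R) (FreeM R M)) (y : Witt c R' M') :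
    starLeft c R' M' (a + a') y = starLeft c R' M' a y + starLeft c R' M' a' y := by
  obtain ⟨b, rfl⟩ := Witt.mk_surjective c y
  rw [starLeft_mk, starLeft_mk, starLeft_mk]
  change Witt.map c _ _ (starImage c _ _ _ _) = _
  rw [map_add, AddMonoidHom.add_apply, map_add]
  rfl

/-- The external product with a fixed right factor. -/
noncomputable def starRight (R M : Type*) [CommRing R] [AddCommGroup M] [Module R M]
    (y : Witt c R' M') : Witt c R M →ₜ+ Witt c (R ⊗[ℤ] R') (ExtTensor R M R' M') :=
  Witt.descend c (AddMonoidHom.mk' (fun a => starLeft c R' M' a y) fun a a' =>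
    starLeft_add c a a' y) (by
      obtain ⟨b, rfl⟩ := Witt.mk_surjective c y
      exact continuous_starPre_left c b) fun z => by
      obtain ⟨b, rfl⟩ := Witt.mk_surjective c y
      have h := starPre_eq c (.canonical (FreeR R) (FreeM R M)) (.canonical R' M')
        (counitM (FreeR R) (FreeM R M)) (freeMMap (counitR R) (counitM R M))
        (LinearMap.id (R := FreeR R') (M := FreeM R' M')) LinearMap.id
        (fun t => (counitR_map (counitR R) t).symm)
        (fun t => (counitM_map (counitR R) (counitM R M) t).symm) (fun _ => rfl) (fun _ => rfl) z b
      rwa [ghostImageMap_of_eq] at h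

/-- The external product of Witt vectors. -/
noncomputable def Witt.star (R M R' M' : Type*) [CommRing R] [AddCommGroup M] [Module R M]
    [CommRing R'] [AddCommGroup M'] [Module R' M'] :
    Witt c R M →+ Witt c R' M' →+ Witt c (R ⊗[ℤ] R') (ExtTensor R M R' M') :=
  AddMonoidHom.mk' (fun x => AddMonoidHom.mk' (fun y => starRight c R M y x) fun y y' => by
    obtain ⟨a, rfl⟩ := Witt.mk_surjective c x
    exact map_add (starLeft c R' M' a) y y') fun x x' =>
      AddMonoidHom.ext fun y => map_add (starRight c R M y) x x'

theorem Witt.star_mk (a : ghostImage c (FreeR R) (FreeM R M))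
    (b : ghostImage c (FreeR R') (FreeM R' M')) :
    Witt.star c R M R' M' (Witt.mk c R M a) (Witt.mk c R' M' b) = starPre c R M R' M' a b := rfl

theorem Witt.map_star (α : R →+* S) (f : M →ₛₗ[α] N) (β : R' →+* S') (g : M' →ₛₗ[β] N')
    (x : Witt c R M) (y : Witt c R' M') :
    Witt.map c _ (ExtTensor.map α f β g) (Witt.star c R M R' M' x y) =
      Witt.star c S N S' N' (Witt.map c α f x) (Witt.map c β g y) := by
  obtain ⟨a, rfl⟩ := Witt.mk_surjective c x
  obtain ⟨b, rfl⟩ := Witt.mk_surjective c y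
  rw [Witt.map_mk, Witt.map_mk, Witt.star_mk, Witt.star_mk]
  change Witt.map c _ _ (Witt.map c _ _ (starImage c _ _ _ _)) =
    Witt.map c _ _ (starImage c _ _ _ _)
  rw [← map_starImage c (.canonical R M) (.canonical R' M')]
  exact Witt.map_comm c (tensorProduct_map_comm (fun t => (counitR_map α t).symm)
    fun t => (counitR_map β t).symm) (ExtTensor.map_comm (fun t => (counitM_map α f t).symm)
      fun t => (counitM_map β g t).symm) _

theorem Witt.ghost_star (x : Witt c R M) (y : Witt c R' M') :
    Witt.ghost c _ _ (Witt.star c R M R' M' x y) =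
      GhostProd.shuffle H R M R' M' (Witt.ghost c R M x) (Witt.ghost c R' M' y) := by
  obtain ⟨a, rfl⟩ := Witt.mk_surjective c x
  obtain ⟨b, rfl⟩ := Witt.mk_surjective c y
  rw [Witt.star_mk]
  change Witt.ghost c _ _ (Witt.map c _ _ (ResolutionSection.ofGhost c _ _)) = _
  rw [Witt.ghost_map, ResolutionSection.ghost_ofGhost]
  exact GhostProd.map_shuffle _ _ _ _ _ _

end

theorem nonempty_unique_externalProduct : Nonempty (Unique (ExternalProduct.{u} c)) := by
  refine ⟨⟨⟨⟨fun R M R' M' => Witt.star c R M R' M', Witt.map_star c,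
    fun x y U => congrFun (Witt.ghost_star c x y) U⟩⟩, fun s => ?_⟩⟩
  have h : ∀ (R M R' M' : Type u) [CommRing R] [AddCommGroup M] [Module R M] [CommRing R']
      [AddCommGroup M'] [Module R' M'] (x : Witt c R M) (y : Witt c R' M'),
      s.toFun R M R' M' x y = Witt.star c R M R' M' x y := by
    intro R M R' M' _ _ _ _ _ _ x y
    obtain ⟨x, rfl⟩ := Witt.exists_counit c x
    obtain ⟨y, rfl⟩ := Witt.exists_counit c y
    rw [← s.natural, ← Witt.map_star]
    congr 1
    -- A tensor product of canonical free pairs is not itself canonical, but it inherits a section,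
    -- so its ghost map is injective.
    apply ((ResolutionSection.canonical R M).tensor (.canonical R' M')).ghost_injective c
    rw [Witt.ghost_star]
    funext U
    rw [s.ghost]
    rfl
  obtain ⟨f, _, _⟩ := s
  congr
  funext R M R' M' _ _ _ _ _ _
  ext x y
  exact h R M R' M' x y

end ExternalProduct

/-- Two surjections with the same kernel that are quotient maps have isomorphic targets. -/
theorem exists_continuousAddEquiv {A B C : Type*} [AddCommGroup A] [AddCommGroup B] [AddCommGroup C]
    [TopologicalSpace A] [TopologicalSpace B] [TopologicalSpace C] (f : A →+ B) (g : A →+ C)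
    (hf : Topology.IsQuotientMap f) (hg : Topology.IsQuotientMap g)
    (h : ∀ a, f a = 0 ↔ g a = 0) : ∃ e : B ≃ₜ+ C, ∀ a, e (f a) = g a := by
  have h' : ∀ a b, f a = f b ↔ g a = g b := fun a b => by
    rw [← sub_eq_zero, ← map_sub, h, map_sub, sub_eq_zero]
  have hfs := Function.surjInv_eq hf.surjective
  have hgs := Function.surjInv_eq hg.surjective
  have h1 : ∀ a, g (Function.surjInv hf.surjective (f a)) = g a := fun a => (h' _ _).1 (hfs _)
  have h2 : ∀ a, f (Function.surjInv hg.surjective (g a)) = f a := fun a => (h' _ _).2 (hgs _)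
  refine ⟨{ toFun := fun b => g (Function.surjInv hf.surjective b)
            invFun := fun c => f (Function.surjInv hg.surjective c)
            left_inv := fun b => ?_
            right_inv := fun c => ?_
            map_add' := fun b b' => ?_
            continuous_toFun := hf.continuous_iff.2 ?_
            continuous_invFun := hg.continuous_iff.2 ?_ }, h1⟩
  · exact (h2 _).trans (hfs b)
  · exact (h1 _).trans (hgs c)
  · obtain ⟨a, rfl⟩ := hf.surjective b
    obtain ⟨a', rfl⟩ := hf.surjective b'
    rw [← map_add, h1, h1, h1, map_add]
  · exact hg.continuous.congr fun a => (h1 a).symm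
  · exact hf.continuous.congr fun a => (h2 a).symm

/-- Tensor powers of free modules over polynomial rings. -/
noncomputable def ResolutionSection.power (R M X : Type*) [Finite X] :
    ResolutionSection (FreeR R) (TPow (FreeR R) (FreeM R M) X) :=
  ResolutionSection.free R (Module.Basis.ofRepr (TPow.finsuppEquiv (FreeR R) M X))

/-! ### The isomorphism Θ -/

section Theta

variable {G : Type v} [Group G] [TopologicalSpace G] {H : Subgroup G} [IsTopologicalGroup G]
  [CompactSpace G] (hH : IsOpen (H : Set G)) (σ : G ⧸ H → G)
  (hσ : Function.RightInverse σ QuotientGroup.mk) (c : WittChoice H)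
  (c' : WittChoice (⊤ : Subgroup ↥H))

/-- The canonical presentation of a tensor power. -/
theorem Witt.presentation (R M X : Type*) [CommRing R] [AddCommGroup M] [Module R M] [Nonempty X] :
    Witt.Presentation
      (TPow.map (counitR (FreeR R)) (counitM (FreeR R) (FreeM R M)) X)
      (TPow.map (freeRMap (counitR R)) (freeMMap (counitR R) (counitM R M)) X)
      (TPow.map (counitR R) (counitM R M) X) where
  ring_surjective := TPow.counitR_surjective
  surjective := TPow.map_surjective _ _ TPow.counitM_surjective
  ring_comp z := (counitR_map (counitR R) z).symm
  comp z := TPow.map_comm (fun t => (counitR_map (counitR R) t).symm)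
    (fun t => (counitM_map (counitR R) (counitM R M) t).symm) z
  ring_exact _ _ h := TPow.exists_counitR_pair _ _ h
  exact _ _ h := TPow.exists_counit_pair _ _ h

/-- The isomorphism `Θ` on ghost components. -/
noncomputable def thetaImage (R M : Type*) [CommRing R] [AddCommGroup M] [Module R M] :
    ghostImage c' R (TPow R M (G ⧸ H)) ≃ₜ+ ghostImage c R M where
  toFun a := ⟨GhostProd.theta hH σ hσ R M a, (theta_mem_iff hH σ hσ c c').2 a.2⟩
  invFun a := ⟨(GhostProd.theta hH σ hσ R M).symm a, (theta_mem_iff hH σ hσ c c').1 (by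
    rw [ContinuousAddEquiv.apply_symm_apply]
    exact a.2)⟩
  left_inv a := Subtype.ext (ContinuousAddEquiv.symm_apply_apply _ _)
  right_inv a := Subtype.ext (ContinuousAddEquiv.apply_symm_apply _ _)
  map_add' a b := Subtype.ext (map_add _ _ _)
  continuous_toFun :=
    ((GhostProd.theta hH σ hσ R M).continuous.comp continuous_subtype_val).subtype_mk _
  continuous_invFun :=
    ((GhostProd.theta hH σ hσ R M).symm.continuous.comp continuous_subtype_val).subtype_mk _

variable {R M R' M' : Type*} [CommRing R] [AddCommGroup M] [Module R M] [CommRing R']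
  [AddCommGroup M'] [Module R' M']

theorem ghostImageMap_thetaImage (α : R →+* R') (f : M →ₛₗ[α] M')
    (a : ghostImage c' R (TPow R M (G ⧸ H))) :
    ghostImageMap c α f (thetaImage hH σ hσ c c' R M a) =
      thetaImage hH σ hσ c c' R' M' (ghostImageMap c' α (TPow.map α f _) a) :=
  Subtype.ext (GhostProd.map_theta hH σ hσ α f a.1)

/-- The Witt vectors with coefficients in a tensor power, as a quotient of ghost components. -/
noncomputable def powerQuot [Finite (G ⧸ H)] (R M : Type*) [CommRing R] [AddCommGroup M]
    [Module R M] :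
    ghostImage c' (FreeR R) (TPow (FreeR R) (FreeM R M) (G ⧸ H)) →+
      Witt c' R (TPow R M (G ⧸ H)) :=
  (Witt.map c' (counitR R) (TPow.map (counitR R) (counitM R M) _)).comp
    ((ResolutionSection.power R M (G ⧸ H)).ofGhost c')

theorem powerQuot_apply [Finite (G ⧸ H)]
    (a : ghostImage c' (FreeR R) (TPow (FreeR R) (FreeM R M) (G ⧸ H))) :
    powerQuot c' R M a = Witt.map c' (counitR R) (TPow.map (counitR R) (counitM R M) _)
      ((ResolutionSection.power R M (G ⧸ H)).ofGhost c' a) := rfl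

theorem powerQuot_surjective [CompactSpace ↥H] [Finite (G ⧸ H)] :
    Function.Surjective (powerQuot c' R M) := fun x => by
  obtain ⟨y, rfl⟩ := Witt.map_surjective c' (counitR R) (TPow.map (counitR R) (counitM R M) _)
    TPow.counitR_surjective (TPow.map_surjective _ _ TPow.counitM_surjective) x
  obtain ⟨a, rfl⟩ := ((ResolutionSection.power R M (G ⧸ H)).ghostEquiv c').symm.surjective y
  exact ⟨a, rfl⟩

theorem map_powerQuot [Finite (G ⧸ H)] (α : R →+* R') (f : M →ₛₗ[α] M')
    (a : ghostImage c' (FreeR R) (TPow (FreeR R) (FreeM R M) (G ⧸ H))) :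
    Witt.map c' α (TPow.map α f _) (powerQuot c' R M a) =
      powerQuot c' R' M' (ghostImageMap c' (freeRMap α) (TPow.map (freeRMap α) (freeMMap α f) _)
        a) := by
  rw [powerQuot_apply, powerQuot_apply, ← ResolutionSection.map_ofGhost c' (ResolutionSection.power R M (G ⧸ H))]
  exact Witt.map_comm c' (fun t => (counitR_map α t).symm) (fun t => TPow.map_comm
    (fun t => (counitR_map α t).symm) (fun t => (counitM_map α f t).symm) t) _

theorem ghost_powerQuot [Finite (G ⧸ H)]
    (a : ghostImage c' (FreeR R) (TPow (FreeR R) (FreeM R M) (G ⧸ H))) :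
    Witt.ghost c' _ _ (powerQuot c' R M a) =
      GhostProd.map _ (counitR R) (TPow.map (counitR R) (counitM R M) _) a.1 := by
  rw [powerQuot_apply, Witt.ghost_map, ResolutionSection.ghost_ofGhost]

/-- The left kernel comes from the presentation of M^{⊗ G/H} by tensor powers of the canonical
resolution, the right one from the definition of W_{H ≤ G}(R; M). Θ on ghost images carries one pair
of maps to the other, and being a homeomorphism it also matches the closures of their images. -/
theorem powerQuot_eq_zero [CompactSpace ↥H] [Finite (G ⧸ H)]
    (a : ghostImage c' (FreeR R) (TPow (FreeR R) (FreeM R M) (G ⧸ H))) :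
    powerQuot c' R M a = 0 ↔
      Witt.mk c R M (thetaImage hH σ hσ c c' _ _ a) = 0 := by
  let E₀ := (thetaImage hH σ hσ c c' (FreeR R) (FreeM R M)).symm.trans
    ((ResolutionSection.power R M (G ⧸ H)).ghostEquiv c').symm
  let E₁ := (thetaImage hH σ hσ c c' (FreeR (FreeR R)) (FreeM (FreeR R) (FreeM R M))).symm.trans
    ((ResolutionSection.power (FreeR R) (FreeM R M) (G ⧸ H)).ghostEquiv c').symm
  let D := Witt.map c' (counitR (FreeR R))
      (TPow.map (counitR (FreeR R)) (counitM (FreeR R) (FreeM R M)) (G ⧸ H)) -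
    Witt.map c' (freeRMap (counitR R))
      (TPow.map (freeRMap (counitR R)) (freeMMap (counitR R) (counitM R M)) (G ⧸ H))
  have hE : ∀ z, E₀ (resolutionDiff c R M z) = D (E₁ z) := fun z => by
    obtain ⟨z, rfl⟩ := (thetaImage hH σ hσ c c' _ _).surjective z
    have h1 : E₁ (thetaImage hH σ hσ c c' _ _ z) =
        (ResolutionSection.power (FreeR R) (FreeM R M) (G ⧸ H)).ofGhost c' z :=
      congrArg (ResolutionSection.ofGhost c' _) (ContinuousAddEquiv.symm_apply_apply _ z)
    have h0 : ∀ z, E₀ (thetaImage hH σ hσ c c' _ _ z) =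
        (ResolutionSection.power R M (G ⧸ H)).ofGhost c' z := fun z =>
      congrArg (ResolutionSection.ofGhost c' _) (ContinuousAddEquiv.symm_apply_apply _ z)
    rw [h1, resolutionDiff, AddMonoidHom.sub_apply, ghostImageMap_thetaImage,
      ghostImageMap_thetaImage, map_sub, h0, h0, AddMonoidHom.sub_apply,
      ResolutionSection.map_ofGhost c' _ (ResolutionSection.power R M (G ⧸ H)),
      ResolutionSection.map_ofGhost c' _ (ResolutionSection.power R M (G ⧸ H))]
  have hr : ((resolutionDiff c R M).range : Set _) = E₀.toHomeomorph ⁻¹' D.range := by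
    ext b
    constructor
    · rintro ⟨z, rfl⟩
      exact ⟨E₁ z, (hE z).symm⟩
    · rintro ⟨y, hy⟩
      obtain ⟨z, rfl⟩ := E₁.surjective y
      exact ⟨z, E₀.injective ((hE z).trans hy)⟩
  have hcl : ∀ b, b ∈ (resolutionDiff c R M).range.topologicalClosure ↔
      E₀ b ∈ D.range.topologicalClosure := fun b => by
    rw [← SetLike.mem_coe, ← SetLike.mem_coe, AddSubgroup.topologicalClosure_coe,
      AddSubgroup.topologicalClosure_coe, hr, ← E₀.toHomeomorph.preimage_closure]
    rfl
  rw [Witt.mk_eq_zero, hcl, powerQuot_apply]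
  refine ((Witt.presentation R M (G ⧸ H)).map_eq_zero c' _).trans (iff_of_eq ?_)
  congr 1
  exact congrArg (ResolutionSection.ofGhost c' _) (ContinuousAddEquiv.symm_apply_apply _ a).symm

/-- Both groups are topological quotients of the same ghost image by the same kernel. -/
theorem Witt.exists_theta [CompactSpace ↥H] [Finite (G ⧸ H)] (R M : Type*) [CommRing R]
    [AddCommGroup M] [Module R M] :
    ∃ e : Witt c' R (TPow R M (G ⧸ H)) ≃ₜ+ Witt c R M, ∀ a,
      e (powerQuot c' R M a) = Witt.mk c R M (thetaImage hH σ hσ c c' _ _ a) := by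
  refine exists_continuousAddEquiv (powerQuot c' R M) ((Witt.mk c R M).comp
    (thetaImage hH σ hσ c c' _ _).toAddMonoidHom) ?_ ?_ (powerQuot_eq_zero hH σ hσ c c')
  · exact ((Witt.presentation R M (G ⧸ H)).isQuotientMap c').comp
      ((ResolutionSection.power R M (G ⧸ H)).ghostEquiv c').symm.toHomeomorph.isQuotientMap
  · exact (Witt.isQuotientMap_mk c).comp
      (thetaImage hH σ hσ c c' _ _).toHomeomorph.isQuotientMap

include hH in
theorem nonempty_unique_theta : Nonempty (Unique (Theta.{u} σ hσ c c')) := by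
  have : CompactSpace ↥H := compactSpace_of_isOpen hH
  have : Finite (G ⧸ H) := OpenSub.finite_quotient (H := H) ⟨H, hH, le_rfl⟩
  choose θ hθ using fun (R M : Type u) [CommRing R] [AddCommGroup M] [Module R M] =>
    Witt.exists_theta hH σ hσ c c' R M
  have hnat : ∀ {R M R' M' : Type u} [CommRing R] [AddCommGroup M] [Module R M] [CommRing R']
      [AddCommGroup M'] [Module R' M'] (α : R →+* R') (f : M →ₛₗ[α] M')
      (x : Witt c' R (TPow R M (G ⧸ H))), Witt.map c α f (θ R M x) =
        θ R' M' (Witt.map c' α (TPow.map α f _) x) := by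
    intro R M R' M' _ _ _ _ _ _ α f x
    obtain ⟨a, rfl⟩ := powerQuot_surjective c' x
    rw [hθ, map_powerQuot, hθ, Witt.map_mk, ghostImageMap_thetaImage]
  have hghost : ∀ {R M : Type u} [CommRing R] [AddCommGroup M] [Module R M]
      (x : Witt c' R (TPow R M (G ⧸ H))) (U : OpenSub H), Witt.ghost c R M (θ R M x) U =
        TPow.cosetIso U.2.2 σ hσ (TPow.nest R M _ _ (Witt.ghost c' R _ x U.inside)) := by
    intro R M _ _ _ x U
    obtain ⟨a, rfl⟩ := powerQuot_surjective c' x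
    rw [hθ, ghost_powerQuot, Witt.ghost_mk]
    exact congrFun (GhostProd.map_theta hH σ hσ _ _ a.1) U
  refine ⟨⟨⟨⟨θ, hnat, hghost⟩⟩, fun Θ => ?_⟩⟩
  have h : ∀ (R M : Type u) [CommRing R] [AddCommGroup M] [Module R M]
      (x : Witt c' R (TPow R M (G ⧸ H))), Θ.toFun R M x = θ R M x := by
    intro R M _ _ _ x
    obtain ⟨y, rfl⟩ := Witt.map_surjective c' (counitR R) (TPow.map (counitR R) (counitM R M) _)
      TPow.counitR_surjective (TPow.map_surjective _ _ TPow.counitM_surjective) x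
    rw [← Θ.natural, ← hnat]
    congr 1
    apply (ResolutionSection.canonical R M).ghost_injective c
    funext U
    rw [Θ.ghost, hghost]
  obtain ⟨f, _, _⟩ := Θ
  congr
  funext R M _ _ _
  exact ContinuousAddEquiv.ext (h R M)

end Theta

/-! ### Rank-one coefficients: q on scalars is bijective -/

section RankOne

variable {G : Type v} [Group G] [TopologicalSpace G] {H : Subgroup G} [IsTopologicalGroup G]
  [CompactSpace G] (c : WittChoice H) {R R' : Type*} [CommRing R] [CommRing R']

/-- A sum over pairs whose terms depend only on the first entry. -/
theorem sum_sigma_eq_finsum {ι : Type*} {F : ι → Type*} [Fintype (Σ i, F i)] (g : ι → R) :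
    ∑ x : Σ i, F i, g x.1 = ∑ᶠ i, (Nat.card (F i) : R) * g i := by
  classical
  rw [finsum_eq_sum_of_support_subset (s := Finset.univ.image (Sigma.fst : (Σ i, F i) → ι))]
  · rw [Finset.sum_comp g Sigma.fst]
    refine Finset.sum_congr rfl fun i _ => ?_
    rw [nsmul_eq_mul]
    congr 2
    rw [← Nat.card_congr (Equiv.sigmaSubtype i), Nat.card_eq_fintype_card, Fintype.card_subtype]
  · intro i hi
    have : Nat.card (F i) ≠ 0 := fun h => hi (by simp [h])
    obtain ⟨x⟩ := (Nat.card_ne_zero.1 this).1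
    simpa using ⟨x⟩

/-- The ghost components of a family of scalars. -/
noncomputable def scalarGhost (S : ClassReps H) (U : Subgroup G) (a : S.reps → R) : R :=
  ∑ᶠ V : S.reps, (Nat.card (fixedCosets H U V.1) : R) * a V ^ (U.index / V.1.index)

/-- The fibre V/U^h has [G:U]/[G:V] elements, which becomes the exponent of the scalar. -/
theorem ghostTerm_smul_one (U : OpenSub H) (a : c.reps → R) (i : GhostIndex c U.1) :
    ghostTerm c R R U.1 (fun V => a V • TPow.tprod R fun _ => (1 : R)) i =
      a i.1 ^ (U.1.index / i.1.1.index) • TPow.tprod R fun _ => (1 : R) := by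
  have : Finite (G ⧸ U.1) := U.finite_quotient
  have hle := conjLE_out i.2.2.2
  have := finite_normFiber i.2.1.out hle
  have hcard : Nat.card (i.1.1 ⧸ (conjSubgroup i.2.1.out⁻¹ U.1).subgroupOf i.1.1) =
      U.1.index / i.1.1.index := by
    have h := Subgroup.relIndex_mul_index (conj_le_of_fixed i.2.2.2)
    rw [index_conjSubgroup] at h
    have h0 : i.1.1.index ≠ 0 := (c.openSub i.1).index_ne_zero
    rw [← h, Nat.mul_div_cancel _ (Nat.pos_of_ne_zero h0)]
    rfl
  rw [ghostTerm, TPow.twist, TPow.cosetIso, TPow.power, TPow.nest_smul_one, TPow.reindex_smul_one,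
    TPow.reindex_smul_one, hcard]

theorem ghostMap_smul_one (a : c.reps → R) (U : OpenSub H) :
    ghostMap c R R (fun V => a V • TPow.tprod R fun _ => (1 : R)) U =
      scalarGhost c.toClassReps U.1 a • TPow.tprod R fun _ => (1 : R) := by
  have : Finite (GhostIndex c U.1) := finite_ghostIndex c U
  have := Fintype.ofFinite (GhostIndex c U.1)
  rw [ghostMap_apply, scalarGhost, ← sum_sigma_eq_finsum, Finset.sum_smul]
  exact Finset.sum_congr rfl fun i _ => ghostTerm_smul_one c U a i

/-- Induction on the index: once the coordinates of smaller index agree, the component at V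
determines #N_H(V)/V times the coordinate, and this number is nonzero in R. Only components at the U
to which V is subconjugate are used. -/
theorem scalar_eq_of_ghost_eq [IsDomain R] [CharZero R] (a b : c.reps → R) (V : c.reps)
    (h : ∀ U : c.reps, Nonempty (fixedCosets H V.1 U.1) →
      scalarGhost c.toClassReps U.1 a = scalarGhost c.toClassReps U.1 b) : a V = b V := by
  induction hN : V.1.index using Nat.strong_induction_on generalizing V with
  | _ N ih =>
  subst hN
  have hrefl : Nonempty (fixedCosets H V.1 V.1) :=
    ⟨⟨_, mk_mem_fixedCosets H.one_mem (ConjLE.one le_rfl)⟩⟩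
  have h1 := ghostMap_sub_of_agree c (fun V => a V • TPow.tprod R fun _ => (1 : R))
    (fun V => b V • TPow.tprod R fun _ => (1 : R)) V fun W hW ⟨x⟩ => by
      -- Subconjugacy is transitive, so every component needed for W is among those available for V.
      rw [ih W.1.index hW W (fun U ⟨y⟩ => h U ⟨⟨_, mk_mem_fixedCosets
        (H.mul_mem (out_mem_of_mem_fixedCosets (c.le _ W.2) x.2)
          (out_mem_of_mem_fixedCosets (c.le _ U.2) y.2))
        ((conjLE_out x.2.2).mul (conjLE_out y.2.2))⟩⟩) rfl]
  have hfin : Finite (G ⧸ V.1) := (c.openSub V).finite_quotient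
  let _ := Fintype.ofFinite (fixedCosets H V.1 V.1)
  rw [ghostMap_smul_one, ghostMap_smul_one, h V hrefl, sub_self] at h1
  simp only [← sub_smul, TPow.twist, TPow.reindex_smul_one] at h1
  rw [Finset.sum_const, ← smul_assoc, nsmul_eq_mul] at h1
  have h2 := TPow.smul_one_injective ((zero_smul R _).trans h1)
  rcases mul_eq_zero.1 h2.symm with h3 | h3
  · rw [Nat.cast_eq_zero, Finset.card_eq_zero] at h3
    exact absurd h3 Finset.univ_nonempty.ne_empty
  · exact sub_eq_zero.1 h3

/-- The coefficient of a ghost component. -/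
noncomputable def Witt.coeff (c : WittChoice H) (R : Type*) [CommRing R] (U : OpenSub H) :
    Witt c R R →+ R :=
  have : Finite (G ⧸ U.1) := U.finite_quotient
  ((TPow.oneEquiv R (G ⧸ U.1)).symm.toLinearMap.toAddMonoidHom.comp
    (Pi.evalAddMonoidHom _ U)).comp (Witt.ghost c R R)

theorem Witt.ghost_eq_coeff (x : Witt c R R) (U : OpenSub H) :
    Witt.ghost c R R x U = Witt.coeff c R U x • TPow.tprod R fun _ => (1 : R) := by
  have : Finite (G ⧸ U.1) := U.finite_quotient
  rw [← TPow.oneEquiv_apply]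
  exact ((TPow.oneEquiv R (G ⧸ U.1)).apply_symm_apply _).symm

theorem Witt.coeff_eq_iff {x : Witt c R R} {U : OpenSub H} {r : R} :
    Witt.coeff c R U x = r ↔ Witt.ghost c R R x U = r • TPow.tprod R fun _ => (1 : R) := by
  have : Finite (G ⧸ U.1) := U.finite_quotient
  rw [Witt.ghost_eq_coeff]
  exact ⟨fun h => h ▸ rfl, TPow.smul_one_injective⟩

theorem ResolutionSection.coeff_ext (s : ResolutionSection R R) {x y : Witt c R R}
    (h : ∀ U, Witt.coeff c R U x = Witt.coeff c R U y) : x = y :=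
  s.ghost_injective c (funext fun U => by
    rw [Witt.ghost_eq_coeff, Witt.ghost_eq_coeff, h])

/-- The section of the canonical resolution of a polynomial ring as a module over itself. -/
noncomputable def ResolutionSection.self (A : Type*) : ResolutionSection (FreeR A) (FreeR A) :=
  ResolutionSection.free A (Module.Basis.singleton Unit (FreeR A))

/-- The map from families of scalars to Witt vectors. -/
noncomputable def Witt.scalar (a : c.reps → R) : Witt c R R :=
  Witt.quot c fun V => a V • TPow.tprod R fun _ => (1 : R)

theorem Witt.coeff_scalar (a : c.reps → R) (U : OpenSub H) :
    Witt.coeff c R U (Witt.scalar c a) = scalarGhost c.toClassReps U.1 a := by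
  rw [Witt.coeff_eq_iff, Witt.scalar, Witt.ghost_quot, ghostMap_smul_one]

theorem Witt.map_scalar (α : R →+* R') (a : c.reps → R) :
    Witt.map c α α.toSemilinearMap (Witt.scalar c a) = Witt.scalar c fun V => α (a V) := by
  rw [Witt.scalar, Witt.map_quot]
  simp only [TPow.map_smul_one α _ α.toSemilinearMap α.map_one]
  rfl

theorem ResolutionSection.scalar_surjective (s : ResolutionSection R R) :
    Function.Surjective (Witt.scalar c (R := R)) := fun x => by
  obtain ⟨n, hn⟩ := (mem_ghostImage c).1 (ResolutionSection.ghost_mem c x)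
  have : ∀ V : c.reps, ∃ r : R, n V = r • TPow.tprod R fun _ => (1 : R) := fun V =>
    have : Finite (G ⧸ V.1) := (c.openSub V).finite_quotient
    TPow.exists_smul_one (n V)
  choose a ha using this
  refine ⟨a, s.ghost_injective c ?_⟩
  rw [← hn, Witt.scalar, Witt.ghost_quot]
  exact congrArg _ (funext fun V => (ha V).symm)

theorem Witt.map_ring_surjective (α : R →+* R') (hα : Function.Surjective α) :
    Function.Surjective (Witt.map c α α.toSemilinearMap) :=
  Witt.map_surjective c _ _ hα hα

/-- Over a polynomial ring W is the image of the ghost map and every tensor is a scalar; the general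
case follows along the counit. -/
theorem Witt.scalar_surjective : Function.Surjective (Witt.scalar c (R := R)) := fun x => by
  obtain ⟨y, rfl⟩ := Witt.map_ring_surjective c (counitR R) TPow.counitR_surjective x
  obtain ⟨a, rfl⟩ := (ResolutionSection.self R).scalar_surjective c y
  exact ⟨_, (Witt.map_scalar c _ a).symm⟩

theorem counitR_presentation (R : Type*) [CommRing R] :
    Witt.Presentation (counitR (FreeR R)).toSemilinearMap (freeRMap (counitR R)).toSemilinearMap
      (counitR R).toSemilinearMap where
  ring_surjective := TPow.counitR_surjective
  surjective := TPow.counitR_surjective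
  ring_comp z := (counitR_map (counitR R) z).symm
  comp z := (counitR_map (counitR R) z).symm
  ring_exact _ _ h := TPow.exists_counitR_pair _ _ h
  exact _ _ h := TPow.exists_counitR_pair _ _ h

theorem exists_scalar_pair (a b : c.reps → FreeR R) (h : ∀ V, counitR R (a V) = counitR R (b V)) :
    ∃ z : c.reps → FreeR (FreeR R),
      (fun V => counitR (FreeR R) (z V)) = a ∧ (fun V => freeRMap (counitR R) (z V)) = b := by
  choose z hz hz' using fun V => TPow.exists_counitR_pair (a V) (b V) (h V)
  exact ⟨z, funext hz, funext hz'⟩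

theorem scalar_injective_of_domain [IsDomain R] [CharZero R] :
    Function.Injective (Witt.scalar c (R := R)) := fun a b h => funext fun V =>
  scalar_eq_of_ghost_eq c a b V fun U _ => by
    rw [← Witt.coeff_scalar c a (c.openSub U), ← Witt.coeff_scalar c b (c.openSub U), h]

/-- The families of scalars that differ by an element of the image of the resolution agree after
projection. -/
theorem counitR_eq_of_sub_mem_range {a b : c.reps → FreeR R}
    (h : Witt.scalar c a - Witt.scalar c b ∈
      (Witt.map c (counitR (FreeR R)) (counitR (FreeR R)).toSemilinearMap -
        Witt.map c (freeRMap (counitR R)) (freeRMap (counitR R)).toSemilinearMap).range) (V : c.reps) :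
    counitR R (a V) = counitR R (b V) := by
  obtain ⟨ζ, hζ⟩ := h
  rw [AddMonoidHom.sub_apply] at hζ
  obtain ⟨z, rfl⟩ := (ResolutionSection.self (FreeR R)).scalar_surjective c ζ
  -- w and t are lifts with the same value under both maps of the resolution, namely b and the
  -- second image of z. The combination w + z − t, formed in Witt vectors, is the vector of some k
  -- whose two images are a and b exactly.
  obtain ⟨w, hw, hw'⟩ := exists_scalar_pair c b b fun _ => rfl
  obtain ⟨t, ht, ht'⟩ := exists_scalar_pair c (fun V => freeRMap (counitR R) (z V))
    (fun V => freeRMap (counitR R) (z V)) fun _ => rfl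
  obtain ⟨k, hk⟩ := (ResolutionSection.self (FreeR R)).scalar_surjective c
    (Witt.scalar c w + Witt.scalar c z - Witt.scalar c t)
  have h0 := congrArg (Witt.map c (counitR (FreeR R)) (counitR (FreeR R)).toSemilinearMap) hk
  have h1 := congrArg
    (Witt.map c (freeRMap (counitR R)) (freeRMap (counitR R)).toSemilinearMap) hk
  rw [map_sub, map_add] at h0 h1
  simp only [Witt.map_scalar] at h0 h1 hζ
  rw [hw, ht, add_sub_assoc, hζ, add_sub_cancel] at h0
  rw [hw', ht', add_sub_cancel_right] at h1
  have e0 := congrFun (scalar_injective_of_domain c h0) V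
  have e1 := congrFun (scalar_injective_of_domain c h1) V
  rw [← e0, ← e1]
  exact (counitR_map (counitR R) (k V)).symm

/-- Lift a and b to a' and b' over the polynomial ring. The difference of their vectors is only in
the closure of the relations, but the coordinate at V depends on finitely many ghost components.
Approximating the difference there by an actual relation d reduces the claim to
`counitR_eq_of_sub_mem_range`. -/
theorem Witt.scalar_injective : Function.Injective (Witt.scalar c (R := R)) := by
  intro a b h
  choose a' ha' using fun V => TPow.counitR_surjective (a V)
  choose b' hb' using fun V => TPow.counitR_surjective (b V)
  obtain rfl : (fun V => counitR R (a' V)) = a := funext ha'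
  obtain rfl : (fun V => counitR R (b' V)) = b := funext hb'
  rw [← Witt.map_scalar, ← Witt.map_scalar, ← sub_eq_zero, ← map_sub,
    (counitR_presentation R).map_eq_zero c] at h
  funext V
  have hfin : Finite {U : c.reps // Nonempty (fixedCosets H V.1 U.1)} := by
    have := finite_ghostIndex c (c.openSub V)
    exact Finite.of_injective (β := GhostIndex c V.1) (fun U => ⟨U.1, U.2.some⟩)
      fun U U' hU => Subtype.ext (Sigma.mk.inj hU).1
  let N : Set (Witt c (FreeR R) (FreeR R)) := {x | ∀ U : {U : c.reps //
    Nonempty (fixedCosets H V.1 U.1)}, Witt.ghost c _ _ x (c.openSub U.1) =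
      Witt.ghost c _ _ (Witt.scalar c a' - Witt.scalar c b') (c.openSub U.1)}
  have hN : IsOpen N := by
    have : N = ⋂ U : {U : c.reps // Nonempty (fixedCosets H V.1 U.1)},
        (fun x => Witt.ghost c _ _ x (c.openSub U.1)) ⁻¹'
          {Witt.ghost c _ _ (Witt.scalar c a' - Witt.scalar c b') (c.openSub U.1)} := by
      ext x
      simp [N]
    rw [this]
    exact isOpen_iInter_of_finite fun U => (isOpen_discrete _).preimage
      ((continuous_apply _).comp (Witt.continuous_ghost c))
  obtain ⟨d, hdN, hd⟩ := mem_closure_iff.1 h N hN fun _ => rfl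
  -- The family e differs from b' by a true relation and agrees with a' at V.
  obtain ⟨e, he⟩ := (ResolutionSection.self R).scalar_surjective c (d + Witt.scalar c b')
  have h1 : a' V = e V := scalar_eq_of_ghost_eq c a' e V fun U hU => by
    have h2 : Witt.coeff c _ (c.openSub U) d =
        Witt.coeff c _ (c.openSub U) (Witt.scalar c a' - Witt.scalar c b') :=
      (Witt.coeff_eq_iff c).2 ((hdN ⟨U, hU⟩).trans (Witt.ghost_eq_coeff c _ _))
    rw [← Witt.coeff_scalar c a' (c.openSub U), ← Witt.coeff_scalar c e (c.openSub U), he,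
      map_add, h2, map_sub, sub_add_cancel]
  rw [h1]
  exact counitR_eq_of_sub_mem_range c (by rwa [he, add_sub_cancel_right]) V

theorem Witt.scalar_bijective : Function.Bijective (Witt.scalar c (R := R)) :=
  ⟨Witt.scalar_injective c, Witt.scalar_surjective c⟩

end RankOne

/-! ### The ring structure on W(R; R) -/

section WittRing

variable {G : Type v} [Group G] [TopologicalSpace G] {H : Subgroup G} [IsTopologicalGroup G]
  [CompactSpace G] {c : WittChoice H} (q : QuotMap.{u} c) (s : ExternalProduct.{u} c)
  {R R' : Type u} [CommRing R] [CommRing R']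

theorem QuotMap.ringMap_eq (a : c.reps → R) : q.ringMap R a = Witt.scalar c a := q.toFun_eq _

theorem QuotMap.ringMap_bijective : Function.Bijective (q.ringMap R) := by
  rw [show q.ringMap R = Witt.scalar c from funext q.ringMap_eq]
  exact Witt.scalar_bijective c

theorem QuotMap.coeff_ringMap (a : c.reps → R) (U : OpenSub H) :
    Witt.coeff c R U (q.ringMap R a) = scalarGhost c.toClassReps U.1 a := by
  rw [q.ringMap_eq, Witt.coeff_scalar]

theorem QuotMap.map_ringMap (α : R →+* R') (a : c.reps → R) :
    Witt.map c α α.toSemilinearMap (q.ringMap R a) = q.ringMap R' fun V => α (a V) := by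
  rw [q.ringMap_eq, q.ringMap_eq, Witt.map_scalar]

/-- The internal product of Witt vectors. -/
noncomputable def ExternalProduct.mul (x y : Witt c R R) : Witt c R R :=
  Witt.map c (Algebra.TensorProduct.lmul' (S := R) ℤ).toRingHom (ExtTensor.mul' R)
    (s.toFun R R R R x y)

theorem ExternalProduct.mul_add (x y z : Witt c R R) :
    s.mul x (y + z) = s.mul x y + s.mul x z := by
  rw [ExternalProduct.mul, map_add, map_add]
  rfl

/-- In rank one the shuffle followed by the multiplication of R is the product of the two scalars.
-/
theorem ExternalProduct.coeff_mul (x y : Witt c R R) (U : OpenSub H) :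
    Witt.coeff c R U (s.mul x y) = Witt.coeff c R U x * Witt.coeff c R U y := by
  rw [Witt.coeff_eq_iff, ExternalProduct.mul, Witt.ghost_map]
  change TPow.map _ _ _ (Witt.ghost c _ _ (s.toFun R R R R x y) U) = _
  rw [s.ghost, Witt.ghost_eq_coeff, Witt.ghost_eq_coeff, TPow.shuffle_tprod, map_smulₛₗ,
    TPow.map_tprod]
  change (Witt.coeff c R U x * Witt.coeff c R U y) • TPow.tprod R (fun _ => (1 * 1 : R)) = _
  rw [mul_one]

theorem ExternalProduct.map_mul (α : R →+* R') (x y : Witt c R R) :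
    Witt.map c α α.toSemilinearMap (s.mul x y) =
      s.mul (Witt.map c α α.toSemilinearMap x) (Witt.map c α α.toSemilinearMap y) := by
  rw [ExternalProduct.mul, ExternalProduct.mul, ← s.natural]
  refine Witt.map_comm c (fun t => ?_) (fun t => ?_) _
  · induction t using TensorProduct.induction_on with
    | zero => simp only [map_zero]
    | add x y hx hy => simp only [map_add, hx, hy]
    | tmul a b => exact α.map_mul a b
  · change α (LinearMap.mul' ℤ R t) = LinearMap.mul' ℤ R' (ExtTensor.mapAux _ _ t)
    induction t using TensorProduct.induction_on with
    | zero => simp only [map_zero]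
    | add x y hx hy => simp only [map_add, hx, hy]
    | tmul a b => exact α.map_mul a b

namespace WittRing

variable (R) in
/-- The ghost components of the ring of Witt vectors. -/
noncomputable def coeff (U : OpenSub H) : WittRing q s R →+ R := Witt.coeff c R U

/-- Functoriality of the ring of Witt vectors. -/
noncomputable def map (α : R →+* R') : WittRing q s R →+ WittRing q s R' :=
  Witt.map c α α.toSemilinearMap

theorem coeff_mul (x y : WittRing q s R) (U : OpenSub H) :
    coeff q s R U (x * y) = coeff q s R U x * coeff q s R U y :=
  s.coeff_mul x y U

theorem map_mul (α : R →+* R') (x y : WittRing q s R) :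
    map q s α (x * y) = map q s α x * map q s α y :=
  s.map_mul α x y

theorem map_surjective (α : R →+* R') (hα : Function.Surjective α) :
    Function.Surjective (map q s α) := Witt.map_ring_surjective c α hα

theorem coeff_ext {A : Type u} {x y : WittRing q s (FreeR A)}
    (h : ∀ U, coeff q s _ U x = coeff q s _ U y) : x = y :=
  (ResolutionSection.self A).coeff_ext c h

theorem map_one (α : R →+* R') : map q s α 1 = 1 := by
  classical
  refine (q.natural _ _ _).trans (congrArg (q.toFun R' R') (funext fun V => ?_))
  split_ifs
  · rw [TPow.map_tprod]
    exact congrArg _ (funext fun _ => α.map_one)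
  · exact _root_.map_zero _

theorem coeff_one (hH : IsOpen (H : Set G)) (U : OpenSub H) : coeff q s R U 1 = 1 := by
  classical
  obtain ⟨V, ⟨hV, h, hh, hHV⟩, -⟩ := c.existsUnique H hH le_rfl
  -- H is conjugate only to itself under H, so it is its own representative and the unit has exactly
  -- one nonzero coordinate.
  have hVH : V = H := by
    refine le_antisymm (c.le _ hV) fun x hx => ?_
    have : h * x * h⁻¹ ∈ H := H.mul_mem (H.mul_mem hh hx) (H.inv_mem hh)
    rw [hHV, mem_conjSubgroup] at this
    simpa [mul_assoc] using this
  subst hVH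
  have h1 : (1 : WittRing q s R) = q.ringMap R fun W => if W.1 = V then 1 else 0 := by
    refine congrArg (q.toFun R R) (funext fun W => ?_)
    dsimp only
    split_ifs
    · rw [one_smul]
    · rw [zero_smul]
  rw [h1]
  refine (q.coeff_ringMap _ U).trans ?_
  rw [scalarGhost, finsum_eq_single _ (⟨V, hV⟩ : c.reps)]
  · have : Nat.card (fixedCosets V U.1 V) = 1 := by
      rw [Nat.card_eq_one_iff_unique]
      refine ⟨⟨fun x y => ?_⟩, ⟨⟨_, mk_mem_fixedCosets V.one_mem (ConjLE.one U.2.2)⟩⟩⟩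
      obtain ⟨_, ⟨a, ha, rfl⟩, -⟩ := x
      obtain ⟨_, ⟨b, hb, rfl⟩, -⟩ := y
      exact Subtype.ext (QuotientGroup.eq.2 (V.mul_mem (V.inv_mem ha) hb))
    rw [this]
    simp
  · intro W hW
    rw [if_neg fun h => hW (Subtype.ext h)]
    by_cases hc : Nat.card (fixedCosets V U.1 W.1) = 0
    · simp [hc]
    · obtain ⟨x⟩ := (Nat.card_ne_zero.1 hc).1
      -- The exponent must be positive, since 0 to the power 0 would contribute.
      have hdvd := (conjLE_out x.2.2).index_dvd
      have h0 := U.index_ne_zero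
      rw [zero_pow, mul_zero]
      exact (Nat.div_pos (Nat.le_of_dvd (Nat.pos_of_ne_zero h0) hdvd) (Nat.pos_of_dvd_of_pos hdvd
        (Nat.pos_of_ne_zero h0))).ne'

/-- The ring of Witt vectors is a commutative ring. -/
noncomputable abbrev commRing (hH : IsOpen (H : Set G)) (R : Type u) [CommRing R] :
    CommRing (WittRing q s R) :=
  -- Associativity, commutativity and the unit law hold over polynomial rings because ghost
  -- components are jointly injective there; they pass to R along this surjection.
  have hsurj := map_surjective q s (counitR R) TPow.counitR_surjective
  have hdist : ∀ x y z : WittRing q s R, x * (y + z) = x * y + x * z := s.mul_add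
  have hcomm : ∀ x y : WittRing q s R, x * y = y * x := fun x y => by
    obtain ⟨x, rfl⟩ := hsurj x
    obtain ⟨y, rfl⟩ := hsurj y
    rw [← map_mul, ← map_mul]
    exact congrArg _ (coeff_ext q s fun U => by rw [coeff_mul, coeff_mul, mul_comm])
  have hone : ∀ x : WittRing q s R, 1 * x = x := fun x => by
    obtain ⟨x, rfl⟩ := hsurj x
    rw [← map_one q s (counitR R), ← map_mul]
    exact congrArg _ (coeff_ext q s fun U => by rw [coeff_mul, coeff_one q s hH, one_mul])
  have hzero : ∀ x : WittRing q s R, x * 0 = 0 := fun x => by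
    have := hdist x 0 0
    rwa [add_zero, left_eq_add] at this
  { (inferInstance : AddCommGroup (WittRing q s R)),
    (inferInstance : Mul (WittRing q s R)), (inferInstance : One (WittRing q s R)) with
    left_distrib := hdist
    right_distrib := fun x y z => by rw [hcomm, hdist, hcomm z, hcomm z]
    zero_mul := fun x => by rw [hcomm, hzero]
    mul_zero := hzero
    mul_assoc := fun x y z => by
      obtain ⟨x, rfl⟩ := hsurj x
      obtain ⟨y, rfl⟩ := hsurj y
      obtain ⟨z, rfl⟩ := hsurj z
      rw [← map_mul, ← map_mul, ← map_mul, ← map_mul]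
      exact congrArg _ (coeff_ext q s fun U => by simp only [coeff_mul, mul_assoc])
    one_mul := hone
    mul_one := fun x => by rw [hcomm, hone]
    mul_comm := hcomm }

end WittRing

end WittRing

/-! ### The Dress–Siebeneicher ring structure -/

section DressSiebeneicher

variable {G : Type v} [Group G] [TopologicalSpace G] [IsTopologicalGroup G] [CompactSpace G]
  (c : WittChoice (⊤ : Subgroup G))

theorem DSWitt.ext_ghost {R : Type*} [CommRing R] [IsDomain R] [CharZero R]
    {a b : DSWitt c.toClassReps R} (h : ∀ U : OpenSub (⊤ : Subgroup G),
      DSWitt.ghost c.toClassReps U.1 a = DSWitt.ghost c.toClassReps U.1 b) : a = b :=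
  funext fun V => scalar_eq_of_ghost_eq c a b V fun U _ => h (c.openSub U)

theorem DSWitt.exists_map_counit {R : Type u} [CommRing R] (a : DSWitt c.toClassReps R) :
    ∃ a', DSWitt.map c.toClassReps (counitR R) a' = a := by
  choose a' ha' using fun V => TPow.counitR_surjective (a V)
  exact ⟨a', funext ha'⟩

variable {c}

/-- Over polynomial rings the ghost components are jointly injective and determine sums and
products. Over R the operations are forced by the surjection from ℤ[R]. -/
theorem DressSiebeneicher.eq (D D' : DressSiebeneicher.{u} c.toClassReps) : D = D' := by
  have hfree : ∀ R : Type u, D.ring (FreeR R) = D'.ring (FreeR R) := fun R => by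
    apply CommRing.ext <;> refine funext fun a => funext fun b => DSWitt.ext_ghost c fun U => ?_ <;>
      obtain ⟨φ, hφ⟩ := D.ghost_ring (FreeR R) U.1 U.2.1 <;>
      obtain ⟨φ', hφ'⟩ := D'.ghost_ring (FreeR R) U.1 U.2.1
    · have h1 := φ.map_add a b
      have h2 := φ'.map_add a b
      rw [hφ, hφ, hφ] at h1
      rw [hφ', hφ', hφ'] at h2
      exact h1.trans h2.symm
    · have h1 := φ.map_mul a b
      have h2 := φ'.map_mul a b
      rw [hφ, hφ, hφ] at h1
      rw [hφ', hφ', hφ'] at h2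
      exact h1.trans h2.symm
  have h : ∀ (R : Type u) [CommRing R], D.ring R = D'.ring R := fun R _ => by
    obtain ⟨F, hF⟩ := D.map_ring (counitR R)
    obtain ⟨F', hF'⟩ := D'.map_ring (counitR R)
    apply CommRing.ext <;> refine funext fun a => funext fun b => ?_ <;>
      obtain ⟨a, rfl⟩ := DSWitt.exists_map_counit c a <;>
      obtain ⟨b, rfl⟩ := DSWitt.exists_map_counit c b
    · have h1 := F.map_add a b
      have h2 := F'.map_add a b
      rw [hF, hF, hF] at h1
      rw [hF', hF', hF', ← hfree] at h2
      exact h1.symm.trans h2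
    · have h1 := F.map_mul a b
      have h2 := F'.map_mul a b
      rw [hF, hF, hF] at h1
      rw [hF', hF', hF', ← hfree] at h2
      exact h1.symm.trans h2
  obtain ⟨r, _, _⟩ := D
  congr
  funext R _
  exact h R

/-- The structure is transported along the bijection with W_G(R; R), whose ghost coefficients are
the polynomials φ_U. Existence and the isomorphism thus come together, and by uniqueness the
isomorphism holds for any such structure. -/
theorem exists_dressSiebeneicher (q : QuotMap.{u} c) (s : ExternalProduct.{u} c) :
    ∃ D : DressSiebeneicher.{u} c.toClassReps, ∀ (R : Type u) [CommRing R], letI := D.ring R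
      ∃ e : DSWitt c.toClassReps R ≃+* WittRing q s R,
          (∀ a, e a = q.ringMap R a) ∧ e 1 = 1 := by
  let inst : ∀ (R : Type u) [CommRing R], CommRing (WittRing q s R) :=
    fun R _ => WittRing.commRing q s isOpen_univ R
  let E : ∀ (R : Type u) [CommRing R], DSWitt c.toClassReps R ≃ WittRing q s R := fun R _ =>
    Equiv.ofBijective (q.ringMap R) q.ringMap_bijective
  let ring : ∀ (R : Type u) [CommRing R], CommRing (DSWitt c.toClassReps R) := fun R _ =>
    (E R).commRing
  let e : ∀ (R : Type u) [CommRing R], letI := ring R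
      DSWitt c.toClassReps R ≃+* WittRing q s R := fun R _ => (E R).ringEquiv
  refine ⟨⟨ring, fun {R R'} _ _ α => ?_, fun R _ U hU => ?_⟩, fun R _ => ?_⟩
  · let _ := ring R
    let _ := ring R'
    let F : WittRing q s R →+* WittRing q s R' :=
      { WittRing.map q s α with
        map_one' := WittRing.map_one q s α
        map_mul' := WittRing.map_mul q s α }
    refine ⟨((e R').symm.toRingHom.comp F).comp (e R).toRingHom, fun a => ?_⟩
    refine (e R').symm_apply_eq.2 ?_
    exact q.map_ringMap α a
  · let _ := ring R
    let F : WittRing q s R →+* R :=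
      { WittRing.coeff q s R ⟨U, hU, le_top⟩ with
        map_one' := WittRing.coeff_one q s isOpen_univ _
        map_mul' := fun x y => WittRing.coeff_mul q s x y _ }
    exact ⟨F.comp (e R).toRingHom, fun a => q.coeff_ringMap a ⟨U, hU, le_top⟩⟩
  · let _ := ring R
    exact ⟨e R, fun a => rfl, map_one (e R)⟩

end DressSiebeneicher

/-! ### The isomorphism δ⁻¹ -/

section Delta

variable {G : Type v} [Group G] [TopologicalSpace G] {H : Subgroup G} [IsTopologicalGroup G]
  [CompactSpace G] [CompactSpace ↥H] {σ : G ⧸ H → G}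
  {hσ : Function.RightInverse σ QuotientGroup.mk} {c : WittChoice H}
  {c' : WittChoice (⊤ : Subgroup ↥H)} (Θ : Theta.{u} σ hσ c c') {R R' : Type u} [CommRing R]
  [CommRing R']

theorem Theta.deltaInv_bijective [Finite (G ⧸ H)] : Function.Bijective (Θ.deltaInv R) := by
  refine (Θ.toFun R R).bijective.comp ?_
  have h : ∀ r : R, LinearMap.toSpanSingleton R (TPow R R (G ⧸ H)) (TPow.tprod R fun _ => 1) r =
      TPow.oneEquiv R (G ⧸ H) r := fun r => (TPow.oneEquiv_apply r).symm
  refine Function.bijective_iff_has_inverse.2 ⟨Witt.map c' (RingHom.id R)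
    (TPow.oneEquiv R (G ⧸ H)).symm.toLinearMap, fun x => ?_, fun x => ?_⟩
  · rw [Witt.map_map c' (γ := RingHom.id R) (k := LinearMap.id) (fun _ => rfl) fun m => ?_]
    · exact Witt.map_of_eq c' _ _ (fun _ => rfl) (fun _ => rfl) x
    · rw [h]
      exact LinearEquiv.symm_apply_apply _ m
  · rw [Witt.map_map c' (γ := RingHom.id R) (k := LinearMap.id) (fun _ => rfl) fun m => ?_]
    · exact Witt.map_of_eq c' _ _ (fun _ => rfl) (fun _ => rfl) x
    · rw [h]
      exact LinearEquiv.apply_symm_apply _ m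

theorem Theta.map_deltaInv (α : R →+* R') (x : Witt c' R R) :
    Witt.map c α α.toSemilinearMap (Θ.deltaInv R x) =
      Θ.deltaInv R' (Witt.map c' α α.toSemilinearMap x) := by
  rw [Theta.deltaInv, Theta.deltaInv, Θ.natural]
  have hm : ∀ r : R, TPow.map α α.toSemilinearMap (G ⧸ H) (LinearMap.toSpanSingleton R
      (TPow R R (G ⧸ H)) (TPow.tprod R fun _ => 1) r) = LinearMap.toSpanSingleton R'
      (TPow R' R' (G ⧸ H)) (TPow.tprod R' fun _ => 1) (α.toSemilinearMap r) := fun r => by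
    rw [LinearMap.toSpanSingleton_apply, LinearMap.toSpanSingleton_apply]
    exact TPow.map_smul_one α r α.toSemilinearMap α.map_one
  exact congrArg (Θ.toFun R' R') (Witt.map_comm c' (α₁ := RingHom.id R) (β₁ := α) (α₂ := α)
    (β₂ := RingHom.id R') (fun _ => rfl) hm x)

theorem Theta.coeff_deltaInv (x : Witt c' R R) (U : OpenSub H) :
    Witt.coeff c R U (Θ.deltaInv R x) = Witt.coeff c' R U.inside x := by
  have : Finite (↥H ⧸ U.1.subgroupOf H) := U.inside.finite_quotient
  have key : ∀ r : R, TPow.cosetIso U.2.2 σ hσ (TPow.nest R R _ _ (TPow.map (RingHom.id R)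
      (LinearMap.toSpanSingleton R (TPow R R (G ⧸ H)) (TPow.tprod R fun _ => 1))
      (↥H ⧸ U.1.subgroupOf H) (r • TPow.tprod R fun _ => (1 : R)))) =
        r • TPow.tprod R fun _ => (1 : R) := fun r => by
    rw [map_smulₛₗ, TPow.map_tprod]
    simp only [LinearMap.toSpanSingleton_apply, one_smul]
    rw [map_smulₛₗ, TPow.nest_tprod]
    exact TPow.reindex_smul_one _ _
  rw [Witt.coeff_eq_iff, Theta.deltaInv, Θ.ghost, Witt.ghost_map, ← key]
  exact congrArg (fun t => TPow.cosetIso U.2.2 σ hσ (TPow.nest R R _ _ (TPow.map (RingHom.id R)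
      (LinearMap.toSpanSingleton R (TPow R R (G ⧸ H)) (TPow.tprod R fun _ => 1))
      (↥H ⧸ U.1.subgroupOf H) t))) (Witt.ghost_eq_coeff c' x U.inside)

end Delta

/-! ### Frobenius and Verschiebung in ghost coefficients -/

section Operators

variable {G : Type v} [Group G] [TopologicalSpace G] {H K : Subgroup G} [IsTopologicalGroup G]
  [CompactSpace G] {c : WittChoice H} {c' : WittChoice K} {R : Type u} [CommRing R]

theorem Frobenius.coeff {hKH : K ≤ H} (F : Frobenius.{u} hKH c c') (x : Witt c R R)
    (U : OpenSub K) :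
    Witt.coeff c' R U (F.toFun R R x) = Witt.coeff c R (U.incl hKH) x := by
  rw [Witt.coeff_eq_iff, F.ghost]
  exact Witt.ghost_eq_coeff c x _

theorem Verschiebung.coeff (V : Verschiebung.{u} c c') (hK : IsOpen (K : Set G)) (x : Witt c' R R)
    (W : OpenSub H) : Witt.coeff c R W (V.toFun R R x) =
      ∑ᶠ i : fixedCosets H W.1 K, Witt.coeff c' R (W.conj i) x := by
  have := finite_fixedCosets (H := H) hK W.1
  have := Fintype.ofFinite (fixedCosets H W.1 K)
  rw [Witt.coeff_eq_iff, V.ghost, finsum_eq_sum_of_fintype, finsum_eq_sum_of_fintype,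
    Finset.sum_smul]
  refine Finset.sum_congr rfl fun i _ => ?_
  rw [Witt.ghost_eq_coeff]
  exact TPow.reindex_smul_one _ _

end Operators

/-! ### Comparison of Frobenius and Verschiebung -/

section DressSiebeneicher

variable {G : Type v} [Group G] [TopologicalSpace G] {H : Subgroup G} [IsTopologicalGroup G]
  [CompactSpace G] [CompactSpace ↥H] {c : WittChoice (⊤ : Subgroup G)} {cH : WittChoice H}
  {cH' : WittChoice (⊤ : Subgroup ↥H)} {σ : G ⧸ H → G}
  {hσ : Function.RightInverse σ QuotientGroup.mk} (q : QuotMap.{u} c) (q' : QuotMap.{u} cH')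
  (F : Frobenius.{u} (le_top : H ≤ ⊤) c cH) (V : Verschiebung.{u} c cH)
  (Θ : Theta.{u} σ hσ cH cH')

/-- The map from the Dress–Siebeneicher Witt vectors to the Witt vectors with coefficients. -/
noncomputable def QuotMap.ds (R : Type u) [CommRing R] (a : DSWitt c.toClassReps R) : Witt c R R :=
  q.ringMap R a

/-- The composite of `δ⁻¹` and `e_H`. -/
noncomputable def Theta.scalar (R : Type u) [CommRing R] (b : DSWitt cH'.toClassReps R) :
    Witt cH R R :=
  Θ.deltaInv R (q'.ringMap R b)

variable {R R' : Type u} [CommRing R] [CommRing R']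

theorem QuotMap.ds_bijective : Function.Bijective (q.ds R) := q.ringMap_bijective

theorem QuotMap.map_ds (α : R →+* R') (a : DSWitt c.toClassReps R) :
    Witt.map c α α.toSemilinearMap (q.ds R a) = q.ds R' (DSWitt.map c.toClassReps α a) :=
  q.map_ringMap α a

theorem QuotMap.coeff_ds (a : DSWitt c.toClassReps R) (U : OpenSub (⊤ : Subgroup G)) :
    Witt.coeff c R U (q.ds R a) = DSWitt.ghost c.toClassReps U.1 a :=
  q.coeff_ringMap a U

theorem Theta.scalar_bijective [Finite (G ⧸ H)] : Function.Bijective (Θ.scalar q' R) :=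
  Θ.deltaInv_bijective.comp q'.ringMap_bijective

theorem Theta.map_scalar (α : R →+* R') (b : DSWitt cH'.toClassReps R) :
    Witt.map cH α α.toSemilinearMap (Θ.scalar q' R b) =
      Θ.scalar q' R' (DSWitt.map cH'.toClassReps α b) :=
  (Θ.map_deltaInv α _).trans (congrArg _ (q'.map_ringMap α b))

theorem Theta.coeff_scalar (b : DSWitt cH'.toClassReps R) (U : OpenSub H) :
    Witt.coeff cH R U (Θ.scalar q' R b) = DSWitt.ghost cH'.toClassReps U.inside.1 b :=
  (Θ.coeff_deltaInv _ U).trans (q'.coeff_ringMap b U.inside)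

/-- Over ℤ[R] both sides have the same ghost coefficients and are therefore equal; naturality along
the counit gives the identity over R. -/
theorem DSFrobenius.compat (f : DSFrobenius.{u} H c.toClassReps cH'.toClassReps)
    (a : DSWitt c.toClassReps R) :
    F.toFun R R (q.ds R a) = Θ.scalar q' R (f.toFun R a) := by
  obtain ⟨a, rfl⟩ := DSWitt.exists_map_counit c a
  have h : F.toFun _ _ (q.ds (FreeR R) a) = Θ.scalar q' (FreeR R) (f.toFun (FreeR R) a) :=
    (ResolutionSection.self R).coeff_ext cH fun U => by
      rw [F.coeff, q.coeff_ds, Θ.coeff_scalar, f.ghost]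
  have h' := congrArg (Witt.map cH (counitR R) (counitR R).toSemilinearMap) h
  rw [F.natural, q.map_ds, Θ.map_scalar, f.natural] at h'
  exact h'

theorem DSVerschiebung.compat (hH : IsOpen (H : Set G))
    (v : DSVerschiebung.{u} H c.toClassReps cH'.toClassReps) (b : DSWitt cH'.toClassReps R) :
    V.toFun R R (Θ.scalar q' R b) = q.ds R (v.toFun R b) := by
  obtain ⟨b, rfl⟩ := DSWitt.exists_map_counit cH' b
  have h : V.toFun _ _ (Θ.scalar q' (FreeR R) b) = q.ds (FreeR R) (v.toFun (FreeR R) b) :=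
    (ResolutionSection.self R).coeff_ext c fun W => by
      rw [V.coeff hH, q.coeff_ds]
      refine Eq.trans ?_ (v.ghost b W).symm
      exact finsum_congr fun i => Θ.coeff_scalar q' b _
  have h' := congrArg (Witt.map c (counitR R) (counitR R).toSemilinearMap) h
  rw [V.natural, q.map_ds, Θ.map_scalar] at h'
  exact h'.trans (congrArg _ (v.natural _ b))

include q q' F Θ in
-- As e_G and δ⁻¹ ∘ e_H are bijective, the compatibility square defines the map, and by
-- `DSFrobenius.compat` every candidate fits into that square.
theorem nonempty_unique_dsFrobenius (hH : IsOpen (H : Set G)) :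
    Nonempty (Unique (DSFrobenius.{u} H c.toClassReps cH'.toClassReps)) := by
  have : Finite (G ⧸ H) := OpenSub.finite_quotient (H := H) ⟨H, hH, le_rfl⟩
  choose f hf using fun (R : Type u) [CommRing R] (a : DSWitt c.toClassReps R) =>
    (Θ.scalar_bijective q' (R := R)).surjective (F.toFun R R (q.ds R a))
  refine ⟨⟨⟨⟨f, fun {R R'} _ _ α a => ?_, fun {R} _ a U => ?_⟩⟩, fun f₁ => ?_⟩⟩
  · apply (Θ.scalar_bijective q' (R := R')).injective
    rw [← Θ.map_scalar, hf, hf, F.natural, q.map_ds]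
  · rw [← Θ.coeff_scalar q', hf, F.coeff, q.coeff_ds]
  · have h : ∀ (R : Type u) [CommRing R] (a : DSWitt c.toClassReps R), f₁.toFun R a = f R a :=
      fun R _ a => (Θ.scalar_bijective q' (R := R)).injective
        ((f₁.compat q q' F Θ a).symm.trans (hf R a).symm)
    obtain ⟨g, _, _⟩ := f₁
    congr
    funext R _ a
    exact h R a

include q q' V Θ in
theorem nonempty_unique_dsVerschiebung (hH : IsOpen (H : Set G)) :
    Nonempty (Unique (DSVerschiebung.{u} H c.toClassReps cH'.toClassReps)) := by
  choose g hg using fun (R : Type u) [CommRing R] (b : DSWitt cH'.toClassReps R) =>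
    (q.ds_bijective (R := R)).surjective (V.toFun R R (Θ.scalar q' R b))
  refine ⟨⟨⟨⟨g, fun {R R'} _ _ α a => ?_, fun {R} _ b W => ?_⟩⟩, fun v => ?_⟩⟩
  · apply (q.ds_bijective (R := R')).injective
    rw [hg, ← Θ.map_scalar, ← V.natural, ← hg, q.map_ds]
  · refine (q.coeff_ds _ W).symm.trans ?_
    rw [hg, V.coeff hH]
    exact finsum_congr fun i => Θ.coeff_scalar q' b _
  · have h : ∀ (R : Type u) [CommRing R] (b : DSWitt cH'.toClassReps R), v.toFun R b = g R b :=
      fun R _ b => (q.ds_bijective (R := R)).injective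
        ((v.compat q q' V Θ hH b).symm.trans (hg R b).symm)
    obtain ⟨g', _, _⟩ := v
    congr
    funext R _ b
    exact h R b

end DressSiebeneicher

/-! ### Group sets determined by numbers of fixed points -/

section GSets

open MulAction

variable {Γ : Type*} [Group Γ] {X Y : Type*} [MulAction Γ X] [MulAction Γ Y]

theorem Subgroup.index_lt_index_of_lt {V W : Subgroup Γ} (h : V < W) (hV : V.index ≠ 0) :
    W.index < V.index :=
  lt_of_le_of_ne (Nat.le_of_dvd (Nat.pos_of_ne_zero hV) (Subgroup.index_dvd_of_le h.le)) fun he =>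
    h.ne (Subgroup.eq_of_le_of_index_eq h.le he hV)

/-- The points with stabilizer `W` as a fibre of the stabilizer map on points with stabilizer
strictly larger than `V`. -/
def stabilizerFiber (X : Type*) [MulAction Γ X] (V : Subgroup Γ) (W : {W : Subgroup Γ // V < W}) :
    {x : {x : X // V < stabilizer Γ x} //
      (⟨stabilizer Γ x.1, x.2⟩ : {W : Subgroup Γ // V < W}) = W} ≃
        {x : X | stabilizer Γ x = W.1} where
  toFun x := ⟨x.1.1, congrArg Subtype.val x.2⟩
  invFun x := ⟨⟨x.1, lt_of_lt_of_eq W.2 x.2.symm⟩, Subtype.ext x.2⟩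
  left_inv _ := rfl
  right_inv _ := rfl

theorem ncard_le_stabilizer {V : Subgroup Γ} (h : {x : X | V ≤ stabilizer Γ x}.Finite) :
    {x : X | V ≤ stabilizer Γ x}.ncard =
      {x : X | stabilizer Γ x = V}.ncard + {x : X | V < stabilizer Γ x}.ncard := by
  have h1 : Disjoint {x : X | stabilizer Γ x = V} {x : X | V < stabilizer Γ x} :=
    Set.disjoint_left.2 fun x (hx : _ = _) (hx' : V < _) => hx'.ne hx.symm
  rw [← Set.ncard_union_eq h1 (h.subset fun x (hx : _ = _) => hx.ge)
    (h.subset fun x (hx : V < _) => hx.le)]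
  congr 1
  ext x
  exact (le_iff_eq_or_lt (a := V) (b := stabilizer Γ x)).trans (or_congr_left eq_comm)

/-- The numbers of points with given stabilizers are determined by the numbers of fixed points. -/
theorem ncard_stabilizer_eq {p : Subgroup Γ → Prop} (hp : ∀ V W, V ≤ W → p V → p W)
    (hi : ∀ V, p V → V.index ≠ 0) (hX : ∀ V, p V → {x : X | V ≤ stabilizer Γ x}.Finite)
    (hY : ∀ V, p V → {y : Y | V ≤ stabilizer Γ y}.Finite)
    (h : ∀ V, p V → {x : X | V ≤ stabilizer Γ x}.ncard = {y : Y | V ≤ stabilizer Γ y}.ncard)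
    (V : Subgroup Γ) (hV : p V) :
    {x : X | stabilizer Γ x = V}.ncard = {y : Y | stabilizer Γ y = V}.ncard := by
  induction hn : V.index using Nat.strong_induction_on generalizing V with
  | _ n ih =>
    have e : ∀ W : {W : Subgroup Γ // V < W},
        Nonempty ({x : X | stabilizer Γ x = W.1} ≃ {y : Y | stabilizer Γ y = W.1}) := fun W => by
      have hW := hp _ _ W.2.le hV
      have : Finite {x : X | stabilizer Γ x = W.1} := (hX _ hW).subset fun x hx => hx.ge
      have : Finite {y : Y | stabilizer Γ y = W.1} := (hY _ hW).subset fun x hx => hx.ge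
      exact Finite.card_eq.1
        (ih _ (hn ▸ Subgroup.index_lt_index_of_lt W.2 (hi _ hV)) W.1 hW rfl)
    -- The points fixed by more than V are fibred over their stabilisers W > V, of smaller index,
    -- and the fibres match by induction.
    have h1 : {x : X | V < stabilizer Γ x}.ncard = {y : Y | V < stabilizer Γ y}.ncard :=
      Nat.card_congr ((Equiv.sigmaFiberEquiv fun x : {x : X // V < stabilizer Γ x} =>
          (⟨stabilizer Γ x.1, x.2⟩ : {W : Subgroup Γ // V < W})).symm.trans
        ((Equiv.sigmaCongrRight fun W => (stabilizerFiber X V W).trans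
          ((e W).some.trans (stabilizerFiber Y V W).symm)).trans
        (Equiv.sigmaFiberEquiv fun y : {y : Y // V < stabilizer Γ y} =>
          (⟨stabilizer Γ y.1, y.2⟩ : {W : Subgroup Γ // V < W}))))
    have h2 := h V hV
    rw [ncard_le_stabilizer (hX V hV), ncard_le_stabilizer (hY V hV), h1] at h2
    exact Nat.add_right_cancel h2

/-- Two sets with the same finite numbers of points with given stabilizers are isomorphic. -/
theorem exists_equiv_of_ncard_stabilizer_eq
    (hX : ∀ x : X, {x' : X | stabilizer Γ x' = stabilizer Γ x}.Finite)
    (hY : ∀ y : Y, {y' : Y | stabilizer Γ y' = stabilizer Γ y}.Finite)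
    (hXY : ∀ x : X, {x' : X | stabilizer Γ x' = stabilizer Γ x}.ncard =
      {y : Y | stabilizer Γ y = stabilizer Γ x}.ncard)
    (hYX : ∀ y : Y, {x : X | stabilizer Γ x = stabilizer Γ y}.ncard =
      {y' : Y | stabilizer Γ y' = stabilizer Γ y}.ncard) :
    ∃ e : X ≃ Y, ∀ (g : Γ) x, e (g • x) = g • e x := by
  have hfin : ∀ y : Y, {x : X | stabilizer Γ x = stabilizer Γ y}.Finite := fun y =>
    Set.finite_of_ncard_ne_zero (hYX y ▸ Set.ncard_ne_zero_of_mem (Set.mem_ofPred.2 rfl) (hY y))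
  -- A maximal partial equivariant bijection, encoded as its graph.
  obtain ⟨P, hP⟩ := zorn_subset {P : Set (X × Y) | (∀ p ∈ P, ∀ g : Γ, g • p ∈ P) ∧
      ∀ p ∈ P, ∀ p' ∈ P, p.1 = p'.1 ↔ p.2 = p'.2} fun c hc hchain => by
    refine ⟨⋃₀ c, ⟨?_, ?_⟩, fun s hs => Set.subset_sUnion_of_mem hs⟩
    · rintro p ⟨s, hs, hp⟩ g
      exact ⟨s, hs, (hc hs).1 p hp g⟩
    · rintro p ⟨s, hs, hp⟩ p' ⟨s', hs', hp'⟩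
      rcases hchain.total hs hs' with h | h
      · exact (hc hs').2 p (h hp) p' hp'
      · exact (hc hs).2 p hp p' (h hp')
  have hinv := hP.prop.1
  have hfun := hP.prop.2
  have hstab : ∀ p ∈ P, stabilizer Γ p.1 = stabilizer Γ p.2 := fun p hp => by
    ext g
    exact hfun _ (hinv p hp g) p hp
  have htot : ∀ x, ∃ y, (x, y) ∈ P := by
    intro x
    by_contra! hx
    -- If every y with the stabiliser of x were already matched, these y would inject into the
    -- points of X with that stabiliser other than x, against equality of the finite numbers.
    have hy : ∃ y, stabilizer Γ y = stabilizer Γ x ∧ ∀ x', (x', y) ∉ P := by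
      by_contra! hy
      have : Nonempty X := ⟨x⟩
      choose! f hf using hy
      have h1 : {y : Y | stabilizer Γ y = stabilizer Γ x}.ncard ≤
          ({x' : X | stabilizer Γ x' = stabilizer Γ x} \ {x}).ncard := by
        refine Set.ncard_le_ncard_of_injOn f (fun y hy => ⟨?_, ?_⟩) (fun y hy y' hy' hyy => ?_)
          ((hX x).subset Set.sdiff_subset)
        · exact (hstab _ (hf y hy)).trans hy
        · rintro rfl
          exact hx _ (hf y hy)
        · exact (hfun _ (hf y hy) _ (hf y' hy')).1 hyy
      rw [← hXY x] at h1
      exact absurd h1 (not_le.2 (Set.ncard_sdiff_singleton_lt_of_mem rfl (hX x)))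
    obtain ⟨y, hy, hyP⟩ := hy
    have hsmul' : ∀ (g g' : Γ), g • x = g' • x ↔ g • y = g' • y := fun g g' => by
      have h1 : g • x = g' • x ↔ g'⁻¹ * g ∈ stabilizer Γ x := by
        rw [mem_stabilizer_iff, mul_smul, inv_smul_eq_iff]
      have h2 : g • y = g' • y ↔ g'⁻¹ * g ∈ stabilizer Γ y := by
        rw [mem_stabilizer_iff, mul_smul, inv_smul_eq_iff]
      rw [h1, h2, hy]
    have h1 : ∀ p ∈ P, ∀ g : Γ, p.1 ≠ g • x := fun p hp g h => hx (g⁻¹ • p.2) <| by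
      have := hinv p hp g⁻¹
      rwa [show g⁻¹ • p = (x, g⁻¹ • p.2) from Prod.ext (inv_smul_eq_iff.2 h) rfl] at this
    have h2 : ∀ p ∈ P, ∀ g : Γ, p.2 ≠ g • y := fun p hp g h => hyP (g⁻¹ • p.1) <| by
      have := hinv p hp g⁻¹
      rwa [show g⁻¹ • p = (g⁻¹ • p.1, y) from Prod.ext rfl (inv_smul_eq_iff.2 h)] at this
    -- Since x and y have equal stabilisers, gx ↦ gy is a well-defined bijection of orbits and
    -- extends P, contradicting maximality.
    have hmem : P ∪ {p | ∃ g : Γ, p = (g • x, g • y)} ∈ {P : Set (X × Y) |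
        (∀ p ∈ P, ∀ g : Γ, g • p ∈ P) ∧ ∀ p ∈ P, ∀ p' ∈ P, p.1 = p'.1 ↔ p.2 = p'.2} := by
      refine ⟨?_, ?_⟩
      · rintro p (hp | ⟨k, rfl⟩) g
        · exact Or.inl (hinv p hp g)
        · exact Or.inr ⟨g * k, Prod.ext (mul_smul g k x).symm (mul_smul g k y).symm⟩
      · rintro p (hp | ⟨k, rfl⟩) p' (hp' | ⟨k', rfl⟩)
        · exact hfun p hp p' hp'
        · exact iff_of_false (h1 p hp k') (h2 p hp k')
        · exact iff_of_false (fun h => h1 p' hp' k h.symm) fun h => h2 p' hp' k h.symm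
        · exact hsmul' k k'
    exact hx y (hP.le_of_ge hmem Set.subset_union_left
      (Or.inr ⟨1, Prod.ext (one_smul Γ x).symm (one_smul Γ y).symm⟩))
  choose f hf using htot
  have hinj : Function.Injective f := fun x x' h => (hfun _ (hf x) _ (hf x')).2 h
  have hsurj : Function.Surjective f := fun y => by
    have h1 : f '' {x : X | stabilizer Γ x = stabilizer Γ y} =
        {y' : Y | stabilizer Γ y' = stabilizer Γ y} := by
      refine Set.eq_of_subset_of_ncard_le ?_ ?_ (hY y)
      · rintro _ ⟨x, hx, rfl⟩
        exact (hstab _ (hf x)).symm.trans hx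
      · rw [Set.ncard_image_of_injective _ hinj, hYX]
    obtain ⟨x, -, hx⟩ := h1.ge (show y ∈ {y' : Y | stabilizer Γ y' = stabilizer Γ y} from rfl)
    exact ⟨x, hx⟩
  exact ⟨Equiv.ofBijective f ⟨hinj, hsurj⟩, fun g x =>
    (hfun _ (hf (g • x)) _ (hinv _ (hf x) g)).1 rfl⟩

end GSets

/-! ### Integer ghost vectors and tables of marks -/

section Marks

attribute [local instance] OpenSub.finite_quotient Fintype.ofFinite

variable {G : Type v} [Group G] [TopologicalSpace G] {H : Subgroup G} [IsTopologicalGroup G]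
  [CompactSpace G]

/-- The multiples of the label with values in a point. -/
noncomputable def LabelGroup.ofInt (U : Subgroup G) : ℤ →+ LabelGroup Unit U :=
  Finsupp.singleAddHom fun _ => ()

theorem LabelGroup.ofInt_injective (U : Subgroup G) : Function.Injective (LabelGroup.ofInt U) :=
  Finsupp.single_injective _

theorem LabelGroup.ofInt_surjective (U : Subgroup G) : Function.Surjective (LabelGroup.ofInt U) :=
  fun x => ⟨x fun _ => (), Finsupp.ext fun _ => Finsupp.single_eq_same⟩

theorem LabelGroup.tr_ofInt (D : Subgroup G) (U : OpenSub H) (k : ℤ) :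
    LabelGroup.tr D U (LabelGroup.ofInt U.1 k) =
      LabelGroup.ofInt U.1 (Fintype.card (fixedCosets D U.1 U.1) • k) := by
  rw [LabelGroup.tr_apply, map_nsmul, ← Finset.card_univ, ← Finset.sum_const]
  exact Finset.sum_congr rfl fun x _ => LabelGroup.res_single (conjLE_out x.2.2) (fun _ => ()) k

theorem labelSum_unit {X : Type*} [MulAction H X] (U : OpenSub H)
    (h : Finite (fixedPts H X U.1)) :
    labelSum (fun (_ : X) (_ : G) => ()) U =
      LabelGroup.ofInt U.1 (fixedPts H X U.1).ncard := by
  rw [labelSum, dif_pos h, Finset.sum_const, Finset.card_univ, ← Nat.card_eq_fintype_card,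
    Nat.card_coe_set_eq]
  exact (Finsupp.smul_single _ _ _).trans (by simp [LabelGroup.ofInt])

theorem LabelGroup.eval_ofInt (U : OpenSub H) (k : ℤ) :
    LabelGroup.eval ℤ (fun _ : Unit => (1 : ℤ)) U (LabelGroup.ofInt U.1 k) =
      k • TPow.tprod ℤ fun _ => (1 : ℤ) := by
  rw [← LabelGroup.eval_single (R := ℤ) (fun _ : Unit => (1 : ℤ)) U fun _ => (), ← map_zsmul]
  congr 1
  exact (Finsupp.smul_single_one _ _).symm

/-- Viewing ℤ as the free module on one generator makes the ghost coefficients labels with B a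
point, to which `range_ghostMap_int` applies. -/
theorem ofInt_coeff_mem_congruences (c : WittChoice H) (x : Witt c ℤ ℤ) :
    (fun U : OpenSub H => LabelGroup.ofInt U.1 (Witt.coeff c ℤ U x)) ∈ congruences H Unit := by
  let L : ℤ →ₗ[ℤ] (Unit →₀ ℤ) := Finsupp.lsingle ()
  have h := ResolutionSection.ghost_mem c (Witt.map c (RingHom.id ℤ) L x)
  rw [mem_ghostImage] at h
  change _ ∈ Set.range _ at h
  rw [range_ghostMap_int c, Set.mem_ofPred_eq] at h
  convert h using 1
  funext U
  rw [GhostProd.labels_apply, Witt.ghost_map]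
  change _ = TPow.finsuppEquiv ℤ Unit (G ⧸ U.1) (TPow.map _ L _ (Witt.ghost c ℤ ℤ x U))
  rw [Witt.ghost_eq_coeff, map_smulₛₗ, TPow.map_tprod, map_smul]
  have := TPow.finsuppEquiv_tprod (R := ℤ) fun _ : G ⧸ U.1 => ()
  refine Eq.trans ?_ (congrArg _ this.symm)
  exact (Finsupp.smul_single_one _ _).symm

theorem exists_coeff_eq (c : WittChoice H) {a : OpenSub H → ℤ}
    (ha : (fun U : OpenSub H => LabelGroup.ofInt U.1 (a U)) ∈ congruences H Unit) :
    ∃ x : Witt c ℤ ℤ, ∀ U, Witt.coeff c ℤ U x = a U := by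
  refine ⟨ResolutionSection.int.ofGhost c
    ⟨_, eval_mem_ghostImage (R := ℤ) c (fun _ : Unit => (1 : ℤ)) ha⟩, fun U => ?_⟩
  rw [Witt.coeff_eq_iff, ResolutionSection.ghost_ofGhost]
  exact LabelGroup.eval_ofInt U (a U)

theorem AFSet.ofInt_ncard_mem_congruences (X : AFSet ↥H) :
    (fun U : OpenSub H => LabelGroup.ofInt U.1 (X.fixed U.inside.1).ncard) ∈
      congruences H Unit := by
  have hfin : ∀ U : OpenSub H, Finite (fixedPts H X.carrier U.1) := fun U =>
    (X.finite_fixed U.inside.1 U.inside.2.1).to_subtype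
  convert labelSum_mem_congruences (lam := fun (_ : X.carrier) (_ : G) => ())
    (fun _ _ _ => rfl) hfin using 1
  funext U
  exact (labelSum_unit U (hfin U)).symm

/-- The disjoint union of `k V` copies of `H/V`, for all distinguished subgroups `V`. -/
theorem exists_afSet (hH : IsOpen (H : Set G)) (c : WittChoice H) (k : c.reps → ℕ) :
    ∃ X : AFSet ↥H, ∀ (U : OpenSub H) [Fintype (GhostIndex c U.1)],
      (X.fixed U.inside.1).ncard = ∑ i : GhostIndex c U.1, k i.1 := by
  -- Functions with values in a point carry no information, so the coinduced set is H/V itself.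
  let E : ∀ U : OpenSub H, (Σ i : GhostIndex c U.1, Fin (k i.1)) ≃
      fixedPts H (Σ p : (Σ V : c.reps, Fin (k V)), CosetFun H p.1.1 Unit) U.1 := fun U =>
    (show (Σ i : GhostIndex c U.1, Fin (k i.1)) ≃
        Σ p : (Σ V : c.reps, Fin (k V)), fixedCosets H U.1 p.1.1 from
      { toFun := fun t => ⟨⟨t.1.1, t.2⟩, t.1.2⟩
        invFun := fun t => ⟨⟨t.1.1, t.2⟩, t.1.2⟩
        left_inv := fun _ => rfl
        right_inv := fun _ => rfl }).trans
    ((Equiv.sigmaCongrRight fun p => (Equiv.sigmaUnique _ _).symm.trans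
      (CosetFun.fixedEquiv U.2.2)).trans (sigmaFixedPts U.1))
  have hfin : ∀ U : OpenSub H,
      Finite (fixedPts H (Σ p : (Σ V : c.reps, Fin (k V)), CosetFun H p.1.1 Unit) U.1) :=
    fun U => have := finite_ghostIndex c U; Finite.of_equiv _ (E U)
  refine ⟨⟨Σ p : (Σ V : c.reps, Fin (k V)), CosetFun H p.1.1 Unit, ?_, fun U hU => ?_⟩, ?_⟩
  · rintro ⟨p, y⟩
    obtain ⟨h, hh, hy⟩ := y.2.1
    have h1 : (MulAction.stabilizer ↥H (⟨p, y⟩ : Σ p : (Σ V : c.reps, Fin (k V)),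
        CosetFun H p.1.1 Unit) : Set ↥H) = (fun g : ↥H => h⁻¹ * (g : G) * h) ⁻¹' p.1.1 := by
      ext g
      rw [SetLike.mem_coe, MulAction.mem_stabilizer_iff, Set.mem_preimage, SetLike.mem_coe]
      have h2 : g • (⟨p, y⟩ : Σ p : (Σ V : c.reps, Fin (k V)), CosetFun H p.1.1 Unit) = ⟨p, y⟩ ↔
          (g : G) • y.1.1 = y.1.1 :=
        ⟨fun h => congrArg (fun z => z.1.1) (eq_of_heq (Sigma.mk.inj h).2), fun h =>
          Sigma.ext rfl (heq_of_eq (Subtype.ext (Prod.ext h (funext fun _ => rfl))))⟩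
      rw [h2, ← hy, MulAction.Quotient.smul_mk, eq_comm, QuotientGroup.eq, smul_eq_mul, mul_assoc]
    rw [h1]
    exact (c.isOpen _ p.1.2).preimage (by fun_prop)
  · have h1 := hfin (OpenSub.outside hH ⟨U, hU, le_top⟩)
    have h2 : (OpenSub.outside hH ⟨U, hU, le_top⟩).1.subgroupOf H = U :=
      congrArg Subtype.val (OpenSub.inside_outside hH ⟨U, hU, le_top⟩)
    refine Set.Finite.subset (s := fixedPts H _ (OpenSub.outside hH ⟨U, hU, le_top⟩).1) h1
      fun x hx g hg => hx g ?_
    rw [← h2]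
    exact hg
  · intro U _
    refine (Nat.card_congr (E U)).symm.trans ?_
    rw [Nat.card_sigma]
    simp

/-- The triangular argument is reused with a linear map in place of the ghost map: integers t(V) are
sent to the marks of the virtual set with t(V) copies of H/V. It has the same diagonal, so it also
reaches every integer family satisfying the congruences. Positive and negative parts give X and Y.
-/
theorem exists_afSet_sub_eq (hH : IsOpen (H : Set G)) (c : WittChoice H) {a : OpenSub H → ℤ}
    (ha : (fun U : OpenSub H => LabelGroup.ofInt U.1 (a U)) ∈ congruences H Unit) :
    ∃ X Y : AFSet ↥H, ∀ U : OpenSub H,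
      a U = (X.fixed U.inside.1).ncard - (Y.fixed U.inside.1).ncard := by
  have := finite_ghostIndex c
  let t : (∀ V : c.reps, LabelGroup Unit V.1) → c.reps → ℤ := fun n V => n V fun _ => ()
  have ht : ∀ n V, n V = LabelGroup.ofInt V.1 (t n V) := fun n V => by
    obtain ⟨k, hk⟩ := LabelGroup.ofInt_surjective V.1 (n V)
    rw [← hk]
    congr 1
    change k = n V _
    rw [← hk]
    exact Finsupp.single_eq_same.symm
  let ω : (∀ V : c.reps, LabelGroup Unit V.1) → ∀ U : OpenSub H, LabelGroup Unit U.1 :=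
    fun n U => LabelGroup.ofInt U.1 (∑ i : GhostIndex c U.1, t n i.1)
  have hω : ∀ n, ∃ X Y : AFSet ↥H, ∀ U : OpenSub H, ∑ i : GhostIndex c U.1, t n i.1 =
      (X.fixed U.inside.1).ncard - (Y.fixed U.inside.1).ncard := fun n => by
    obtain ⟨X, hX⟩ := exists_afSet hH c fun V => (t n V).toNat
    obtain ⟨Y, hY⟩ := exists_afSet hH c fun V => (-t n V).toNat
    refine ⟨X, Y, fun U => ?_⟩
    rw [hX, hY, Nat.cast_sum, Nat.cast_sum, ← Finset.sum_sub_distrib]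
    exact Finset.sum_congr rfl fun i _ => (Int.toNat_sub_toNat_neg _).symm
  obtain ⟨n, hn⟩ := exists_eq_of_triangular c.toClassReps ω (fun n => by
      obtain ⟨X, Y, hXY⟩ := hω n
      convert sub_mem X.ofInt_ncard_mem_congruences Y.ofInt_ncard_mem_congruences using 1
      funext U
      rw [Pi.sub_apply, ← map_sub, ← hXY]) (fun n n' U h => by
      have h1 : ∀ V : c.reps, V ≠ U → Nonempty (fixedCosets H U.1 V.1) → t n V = t n' V :=
        fun V hV ⟨x⟩ => by simp only [t, h V (GhostIndex.index_lt c x hV)]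
      have h2 : n U - n' U = LabelGroup.ofInt U.1 (t n U - t n' U) := by
        rw [map_sub, ← ht, ← ht]
      refine Eq.trans ?_ (Eq.trans (LabelGroup.tr_ofInt H (c.openSub U) (t n U - t n' U)).symm
        (congrArg _ h2.symm))
      rw [← map_sub, ← Finset.sum_sub_distrib]
      congr 1
      have : Finite (G ⧸ U.1) := (c.openSub U).finite_quotient
      refine (Fintype.sum_of_injective (fun x : fixedCosets H U.1 U.1 =>
        (⟨U, x⟩ : GhostIndex c (c.openSub U).1)) (fun x x' hx => eq_of_heq (Sigma.mk.inj hx).2)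
        (fun _ => t n U - t n' U) (fun i => t n i.1 - t n' i.1) (fun i hi => ?_) fun x => rfl).symm.trans ?_
      · obtain ⟨V, x⟩ := i
        refine sub_eq_zero.2 (h1 V (fun hVU => hi ?_) ⟨x⟩)
        subst hVU
        exact ⟨x, rfl⟩
      · rw [Finset.sum_const, Finset.card_univ]) ha
  obtain ⟨X, Y, hXY⟩ := hω n
  refine ⟨X, Y, fun U => ?_⟩
  rw [← hXY]
  exact (LabelGroup.ofInt_injective U.1 (congrFun hn U)).symm

end Marks

/-! ### The completed Burnside ring -/

section Burnside

variable {G : Type v} [Group G] [TopologicalSpace G] {H : Subgroup G}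

theorem AFSet.ncard_fixed_congr {Γ : Type v} [Group Γ] [TopologicalSpace Γ] {X Y : AFSet Γ}
    (h : X ≈ Y) (U : Subgroup Γ) : (X.fixed U).ncard = (Y.fixed U).ncard := by
  obtain ⟨e, he⟩ := h
  refine Nat.card_congr (e.subtypeEquiv fun x => forall₂_congr fun g _ => ?_)
  rw [← he, e.apply_eq_iff_eq]

/-- The numbers of fixed points of almost finite sets. -/
noncomputable def AFClass.marks (H : Subgroup G) : AFClass ↥H →* (OpenSub H → ℤ) where
  toFun := Quotient.lift (fun X U => ((X.fixed U.inside.1).ncard : ℤ)) fun _ _ h =>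
    funext fun U => by rw [AFSet.ncard_fixed_congr h]
  map_one' := funext fun U => by
    have : (AFSet.point ↥H).fixed U.inside.1 = Set.univ :=
      Set.eq_univ_of_forall fun _ _ _ => rfl
    change (((AFSet.point ↥H).fixed U.inside.1).ncard : ℤ) = 1
    rw [this, Set.ncard_univ]
    exact congrArg _ (Nat.card_unique (α := PUnit))
  map_mul' := by
    rintro ⟨X⟩ ⟨Y⟩
    funext U
    have : (X.prod Y).fixed U.inside.1 = X.fixed U.inside.1 ×ˢ Y.fixed U.inside.1 := by
      ext p
      exact ⟨fun h => ⟨fun g hg => congrArg Prod.fst (h g hg), fun g hg =>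
        congrArg Prod.snd (h g hg)⟩, fun h g hg => Prod.ext (h.1 g hg) (h.2 g hg)⟩
    exact (congrArg (fun s => (Set.ncard s : ℤ)) this).trans
      ((congrArg _ Set.ncard_prod).trans (Nat.cast_mul _ _))

theorem AFClass.marks_add (a b : AFClass ↥H) :
    AFClass.marks H (a + b) = AFClass.marks H a + AFClass.marks H b := by
  obtain ⟨X⟩ := a
  obtain ⟨Y⟩ := b
  funext U
  have : (X.sum Y).fixed U.inside.1 =
      Sum.inl '' X.fixed U.inside.1 ∪ Sum.inr '' Y.fixed U.inside.1 := by
    ext p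
    constructor
    · intro h
      rcases p with x | y
      · exact Or.inl ⟨x, fun g hg => Sum.inl_injective (h g hg), rfl⟩
      · exact Or.inr ⟨y, fun g hg => Sum.inr_injective (h g hg), rfl⟩
    · rintro (⟨x, hx, rfl⟩ | ⟨y, hy, rfl⟩) g hg
      · exact congrArg Sum.inl (hx g hg)
      · exact congrArg Sum.inr (hy g hg)
  have h1 : Disjoint (Sum.inl '' X.fixed U.inside.1 : Set (X.carrier ⊕ Y.carrier))
      (Sum.inr '' Y.fixed U.inside.1) := by
    rw [Set.disjoint_left]
    rintro _ ⟨x, -, rfl⟩ ⟨y, -, h⟩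
    cases h
  refine (congrArg (fun s => (Set.ncard s : ℤ)) this).trans
    ((congrArg _ ((Set.ncard_union_eq h1 ((X.finite_fixed _ U.inside.2.1).image _)
      ((Y.finite_fixed _ U.inside.2.1).image _)).trans ?_)).trans (Nat.cast_add _ _))
  rw [Set.ncard_image_of_injective _ Sum.inl_injective,
    Set.ncard_image_of_injective _ Sum.inr_injective]

/-- The homomorphism from the completed Burnside ring given by the numbers of fixed points. -/
noncomputable def BurnsideRing.marks (H : Subgroup G) : BurnsideRing ↥H →+* (OpenSub H → ℤ) :=
  Ideal.Quotient.lift _ (FreeAbelianGroup.liftMonoid (AFClass.marks H)) fun a ha => by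
    refine (Ideal.span_le (I := RingHom.ker (FreeAbelianGroup.liftMonoid (AFClass.marks H)))).2
      ?_ ha
    rintro _ ⟨a, b, rfl⟩
    simp [RingHom.mem_ker, AFClass.marks_add]

theorem BurnsideRing.marks_of (X : AFSet ↥H) (U : OpenSub H) :
    BurnsideRing.marks H (BurnsideRing.of X) U = (X.fixed U.inside.1).ncard := by
  exact congrFun (FreeAbelianGroup.lift_apply_of (AFClass.marks H) (AFClass.mk X)) U

theorem BurnsideRing.of_sum {Γ : Type v} [Group Γ] [TopologicalSpace Γ] (X Y : AFSet Γ) :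
    BurnsideRing.of (X.sum Y) = BurnsideRing.of X + BurnsideRing.of Y := by
  rw [← sub_eq_zero, ← sub_sub]
  exact Ideal.Quotient.eq_zero_iff_mem.2 (Ideal.subset_span ⟨AFClass.mk X, AFClass.mk Y, rfl⟩)

theorem BurnsideRing.exists_eq_sub {Γ : Type v} [Group Γ] [TopologicalSpace Γ]
    (b : BurnsideRing Γ) : ∃ X Y : AFSet Γ, b = BurnsideRing.of X - BurnsideRing.of Y := by
  obtain ⟨b, rfl⟩ := Ideal.Quotient.mk_surjective b
  induction b using FreeAbelianGroup.induction_on with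
  | zero => exact ⟨AFSet.point Γ, AFSet.point Γ, by rw [map_zero, sub_self]⟩
  | of a =>
    obtain ⟨X⟩ := a
    refine ⟨X.sum (AFSet.point Γ), AFSet.point Γ, ?_⟩
    rw [BurnsideRing.of_sum, add_sub_cancel_right]
    rfl
  | neg a h =>
    obtain ⟨X, Y, h⟩ := h
    exact ⟨Y, X, by rw [map_neg, h, neg_sub]⟩
  | add a b ha hb =>
    obtain ⟨X, Y, ha⟩ := ha
    obtain ⟨X', Y', hb⟩ := hb
    exact ⟨X.sum X', Y.sum Y', by
      rw [map_add, ha, hb, BurnsideRing.of_sum, BurnsideRing.of_sum, add_sub_add_comm]⟩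

variable [IsTopologicalGroup G] [CompactSpace G]

/-- Fixed-point numbers determine the numbers of points with each open stabiliser by induction on
the index, and those numbers determine the set. Finiteness at every open subgroup replaces
finiteness of the sets. -/
theorem AFSet.equiv_of_ncard_fixed_eq (hH : IsOpen (H : Set G)) {X Y : AFSet ↥H}
    (h : ∀ U : OpenSub H, (X.fixed U.inside.1).ncard = (Y.fixed U.inside.1).ncard) : X ≈ Y := by
  have := compactSpace_of_isOpen hH
  have hs := ncard_stabilizer_eq (X := X.carrier) (Y := Y.carrier)
    (p := fun V : Subgroup ↥H => IsOpen (V : Set ↥H)) (fun V W hVW hV => Subgroup.isOpen_mono hVW hV)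
    (fun V hV => OpenSub.index_ne_zero (H := ⊤) ⟨V, hV, le_top⟩) X.finite_fixed Y.finite_fixed
    fun V hV => by
      have := h (OpenSub.outside hH ⟨V, hV, le_top⟩)
      rwa [OpenSub.inside_outside] at this
  exact exists_equiv_of_ncard_stabilizer_eq
    (fun x => (X.finite_fixed _ (X.isOpen_stabilizer x)).subset fun x' (hx : _ = _) => hx.ge)
    (fun y => (Y.finite_fixed _ (Y.isOpen_stabilizer y)).subset fun y' (hy : _ = _) => hy.ge)
    (fun x => hs _ (X.isOpen_stabilizer x)) fun y => hs _ (Y.isOpen_stabilizer y)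

theorem BurnsideRing.marks_injective (hH : IsOpen (H : Set G)) :
    Function.Injective (BurnsideRing.marks H) := by
  rw [injective_iff_map_eq_zero]
  intro b hb
  obtain ⟨X, Y, rfl⟩ := BurnsideRing.exists_eq_sub b
  rw [map_sub, sub_eq_zero] at hb
  have h : X ≈ Y := AFSet.equiv_of_ncard_fixed_eq hH fun U => by
    have := congrFun hb U
    rw [BurnsideRing.marks_of, BurnsideRing.marks_of] at this
    exact_mod_cast this
  rw [sub_eq_zero, BurnsideRing.of, BurnsideRing.of, AFClass.mk, AFClass.mk, Quotient.sound h]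

theorem exists_ringEquiv_of_range_eq {A B C : Type*} [Mul A] [Add A] [Mul B] [Add B] [Mul C]
    [Add C] (f : A → C) (g : B → C) (hf : Function.Injective f) (hg : Function.Injective g)
    (h : Set.range f = Set.range g) (hfm : ∀ x y, f (x * y) = f x * f y)
    (hfa : ∀ x y, f (x + y) = f x + f y) (hgm : ∀ x y, g (x * y) = g x * g y)
    (hga : ∀ x y, g (x + y) = g x + g y) : ∃ e : A ≃+* B, ∀ a, g (e a) = f a := by
  have h1 : ∀ a, ∃ b, g b = f a := fun a => h.le ⟨a, rfl⟩
  choose e he using h1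
  refine ⟨{ Equiv.ofBijective e ⟨fun a a' haa => hf ?_, fun b => ?_⟩ with
    map_mul' := fun a a' => hg ?_, map_add' := fun a a' => hg ?_ }, he⟩
  · rw [← he, ← he, haa]
  · obtain ⟨a, ha⟩ := h.ge ⟨b, rfl⟩
    exact ⟨a, hg ((he a).trans ha)⟩
  · change g (e (a * a')) = g (e a * e a')
    rw [he, hgm, he, he, hfm]
  · change g (e (a + a')) = g (e a + e a')
    rw [he, hga, he, he, hfa]

/-- Marks and ghost coefficients embed the two rings in the same product of copies of ℤ,
multiplicatively and additively. Both ranges consist of the families satisfying the congruences, so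
the rings are identified by matching values. -/
theorem exists_burnsideRing_ringEquiv (hH : IsOpen (H : Set G)) {c : WittChoice H}
    (q : QuotMap.{0} c) (s : ExternalProduct.{0} c) :
    ∃ β : BurnsideRing ↥H ≃+* WittRing q s ℤ, β 1 = 1 ∧
      ∀ (X : AFSet ↥H) (U : OpenSub H), Witt.ghost c ℤ ℤ (β (BurnsideRing.of X)) U =
        Nat.card (X.fixed U.inside.1) • TPow.tprod ℤ (fun _ => 1) := by
  have hinj : Function.Injective fun (x : WittRing q s ℤ) U => WittRing.coeff q s ℤ U x :=
    fun x y h => ResolutionSection.int.coeff_ext c (congrFun h)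
  obtain ⟨β, hβ⟩ := exists_ringEquiv_of_range_eq (BurnsideRing.marks H)
    (fun (x : WittRing q s ℤ) U => WittRing.coeff q s ℤ U x) (BurnsideRing.marks_injective hH)
    hinj (by
      refine Set.Subset.antisymm ?_ ?_
      · rintro _ ⟨b, rfl⟩
        obtain ⟨X, Y, rfl⟩ := BurnsideRing.exists_eq_sub b
        obtain ⟨x, hx⟩ := exists_coeff_eq c X.ofInt_ncard_mem_congruences
        obtain ⟨y, hy⟩ := exists_coeff_eq c Y.ofInt_ncard_mem_congruences
        refine ⟨x - y, funext fun U => ?_⟩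
        rw [map_sub, Pi.sub_apply, BurnsideRing.marks_of, BurnsideRing.marks_of, ← hx, ← hy]
        exact map_sub (Witt.coeff c ℤ U) x y
      · rintro _ ⟨x, rfl⟩
        obtain ⟨X, Y, h⟩ := exists_afSet_sub_eq hH c (ofInt_coeff_mem_congruences c x)
        refine ⟨BurnsideRing.of X - BurnsideRing.of Y, funext fun U => ?_⟩
        rw [map_sub, Pi.sub_apply, BurnsideRing.marks_of, BurnsideRing.marks_of]
        exact (h U).symm)
    (map_mul _) (map_add _) (fun x y => funext (WittRing.coeff_mul q s x y)) fun x y =>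
      funext fun U => map_add (WittRing.coeff q s ℤ U) x y
  refine ⟨β, hinj ?_, fun X U => ?_⟩
  · refine (hβ 1).trans ((map_one _).trans ?_)
    exact funext fun U => (WittRing.coeff_one q s hH U).symm
  · refine (Witt.ghost_eq_coeff c _ U).trans ?_
    have : Witt.coeff c ℤ U (β (BurnsideRing.of X)) = Nat.card (X.fixed U.inside.1) :=
      (congrFun (hβ (BurnsideRing.of X)) U).trans (BurnsideRing.marks_of X U)
    rw [this]
    exact Nat.cast_smul_eq_nsmul ℤ _ _

end Burnside

theorem mainTheorem9 (G : Type v) [Group G] [TopologicalSpace G] [IsTopologicalGroup G]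
    [CompactSpace G] [T2Space G] [TotallyDisconnectedSpace G] :
    -- the bijection `W_G(R) ≅ W_G(R; R)` is an isomorphism of rings
    (∀ c : WittChoice (⊤ : Subgroup G),
      Nonempty (Unique (QuotMap.{u} c)) ∧
      Nonempty (Unique (ExternalProduct.{u} c)) ∧
      Nonempty (Unique (DressSiebeneicher.{u} c.toClassReps)) ∧
      ∀ (q : QuotMap.{u} c) (s : ExternalProduct.{u} c)
        (D : DressSiebeneicher.{u} c.toClassReps) (R : Type u) [CommRing R],
        letI := D.ring R
        ∃ e : DSWitt c.toClassReps R ≃+* WittRing q s R,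
          (∀ a, e a = q.ringMap R a) ∧ e 1 = 1) ∧
    -- it respects the Frobenius and Verschiebung operators
    (∀ H : Subgroup G, IsOpen (H : Set G) →
      ∀ (c : WittChoice (⊤ : Subgroup G)) (cH : WittChoice H)
        (cH' : WittChoice (⊤ : Subgroup ↥H)) (σ : G ⧸ H → G)
        (hσ : Function.RightInverse σ QuotientGroup.mk),
      Nonempty (Unique (Frobenius.{u} (le_top : H ≤ ⊤) c cH)) ∧
      Nonempty (Unique (Verschiebung.{u} c cH)) ∧
      Nonempty (Unique (Theta.{u} σ hσ cH cH')) ∧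
      Nonempty (Unique (DSFrobenius.{u} H c.toClassReps cH'.toClassReps)) ∧
      Nonempty (Unique (DSVerschiebung.{u} H c.toClassReps cH'.toClassReps)) ∧
      ∀ (q : QuotMap.{u} c) (q' : QuotMap.{u} cH') (F : Frobenius.{u} (le_top : H ≤ ⊤) c cH)
        (V : Verschiebung.{u} c cH) (Θ : Theta.{u} σ hσ cH cH')
        (f : DSFrobenius.{u} H c.toClassReps cH'.toClassReps)
        (v : DSVerschiebung.{u} H c.toClassReps cH'.toClassReps) (R : Type u) [CommRing R],
        Function.Bijective (Θ.deltaInv R) ∧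
        (∀ a, F.toFun R R (q.ringMap R a) = Θ.deltaInv R (q'.ringMap R (f.toFun R a))) ∧
        ∀ b, V.toFun R R (Θ.deltaInv R (q'.ringMap R b)) = q.ringMap R (v.toFun R b)) ∧
    -- the case of integer coefficients
    (∀ H : Subgroup G, IsOpen (H : Set G) → ∀ c : WittChoice H,
      Nonempty (Unique (QuotMap.{0} c)) ∧
      Nonempty (Unique (ExternalProduct.{0} c)) ∧
      ∀ (q : QuotMap.{0} c) (s : ExternalProduct.{0} c),
        ∃ β : BurnsideRing ↥H ≃+* WittRing q s ℤ, β 1 = 1 ∧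
          ∀ (X : AFSet ↥H) (U : OpenSub H),
            Witt.ghost c ℤ ℤ (β (BurnsideRing.of X)) U =
              Nat.card (X.fixed U.inside.1) • TPow.tprod ℤ (fun _ => 1)) := by
  refine ⟨fun c => ⟨nonempty_unique_quotMap c, nonempty_unique_externalProduct c, ?_, ?_⟩,
    fun H hH c cH cH' σ hσ => ?_, fun H hH c => ⟨nonempty_unique_quotMap c,
      nonempty_unique_externalProduct c, fun q s => exists_burnsideRing_ringEquiv hH q s⟩⟩
  · obtain ⟨q⟩ := nonempty_unique_quotMap.{u} c
    obtain ⟨s⟩ := nonempty_unique_externalProduct.{u} c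
    obtain ⟨D, -⟩ := exists_dressSiebeneicher q.default s.default
    exact ⟨⟨⟨D⟩, fun D' => DressSiebeneicher.eq D' D⟩⟩
  · intro q s D
    obtain ⟨D', hD'⟩ := exists_dressSiebeneicher q s
    -- The given structure is the transported one, for which the isomorphism is built in.
    obtain rfl := DressSiebeneicher.eq D D'
    exact hD'
  · have : CompactSpace ↥H := compactSpace_of_isOpen hH
    have : Finite (G ⧸ H) := OpenSub.finite_quotient (H := H) ⟨H, hH, le_rfl⟩
    have hF := nonempty_unique_frobenius.{u} (le_top : H ≤ ⊤) c cH
    have hV := nonempty_unique_verschiebung.{u} (le_top : H ≤ ⊤) hH c cH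
    have hΘ := nonempty_unique_theta.{u} hH σ hσ cH cH'
    obtain ⟨q⟩ := nonempty_unique_quotMap.{u} c
    obtain ⟨q'⟩ := nonempty_unique_quotMap.{u} cH'
    obtain ⟨F⟩ := id hF
    obtain ⟨V⟩ := id hV
    obtain ⟨Θ⟩ := id hΘ
    exact ⟨hF, hV, hΘ, nonempty_unique_dsFrobenius q.default q'.default F.default Θ.default hH,
      nonempty_unique_dsVerschiebung q.default q'.default V.default Θ.default hH,
      fun q q' F V Θ f v R _ => ⟨Θ.deltaInv_bijective,
        fun a => DSFrobenius.compat q q' F Θ f a,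
        fun b => DSVerschiebung.compat q q' V Θ hH v b⟩⟩
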